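/- **Conventions.** Identify the unit circle $\mathbb S^1$ with $\mathbb R/\mathbb Z$ and let $\sigma(x)=3x$. For $a\neq b$ let $(a,b)$ be the positively oriented open arc from $a$ to $b$; for a closed set $A\subset\mathbb S^1$, $\mathrm{CH}(A)$ is its convex hull in $\mathbb C$, a *hole* of $A$ is a component $(a,b)$ of $\mathbb S^1\setminus A$, and $\overline{ab}$ is then an *edge* of $\mathrm{CH}(A)$. A *cubic invariant lamination* is an equivalence relation $\sim$ on $\mathbb S^1$ with closed graph and finite classes, such that: if $t_1\sim t_2$, $t_3\sim t_4$, $t_2\not\sim t_3$, then the open segments $t_1t_2$ and $t_3t_4$ are disjoint; the image $\sigma(g)$ of a class $g$ is a class; the preimage $\sigma^{-1}(g)$ of a class $g$ is a union of at most three classes; and for each class $g$ the map $\sigma:g\to\sigma(g)$ extends to an orientation preserving covering map of $\mathbb S^1$ under which $g$ is the full preimage of $\sigma(g)$ (equivalently, $\sigma(g)$ is a point or $(\sigma(a),\sigma(b))$ is a hole of $\sigma(g)$ for every hole $(a,b)$ of $g$). It is *empty* if all its classes are points. Its *leaves* are the points of $\mathbb S^1$ and the edges of the convex hulls of its classes;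 its *gaps* are the closures of the components of the open unit disk minus the union of all leaves. The *basis* of a gap or leaf $G$ is $G'=G\cap\mathbb S^1$. A gap or leaf $G$ is *periodic* of (minimal) period $n\ge1$ if $n$ is the least positive integer with $\sigma^n(G')=G'$. It is then *rotational* if either $G'$ is finite and $\sigma^n$ has no fixed point in $G'$, or $G'$ is infinite and $G$ is a Siegel gap, i.e. a monotone degree one map $\psi$ from the boundary of $G$ onto $\mathbb S^1$ which collapses every edge of $G$ to a point semiconjugates $\sigma^n$ to an irrational rotation. An *invariant quadratic gap* is $U=\mathrm{CH}(U')$ with non-empty interior, where $U'\subset\mathbb S^1$ is closed, $\sigma(U')=U'$, for every hole $(a,b)$ of $U'$ either $\sigma(a)=\sigma(b)$ or $(\sigma(a),\sigma(b))$ is a hole of $U'$, and a monotone degree one map from the boundary of $U$ onto $\mathbb S^1$ which collapses every edge of $U$ semiconjugates $\sigma$ to $x\mapsto 2x$. A *major* of $U$ is an edge $M=\overline{ab}$ whose hole $(a,b)$ has length at least $\frac13$. The gap $U$ is of *regular critical type* if $\sigma(a)=\sigma(b)$ and $\sigma^n(a)\in(b,a)$ for all $n\ge1$; it is of *periodic type*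 if $M$ is periodic, of minimal period $k$ say, and then its *vassal* $V$ is the convex hull of the set of all $x$ whose $\sigma^k$-orbit is contained in $[a,b-\frac13]\cup[a+\frac13,b]$. The *canonical lamination* $\sim_U$ of $U$ is defined for these two types: $x\sim_U y$ if and only if $x=y$, or there is $N\ge0$ such that $\sigma^N(x)$ and $\sigma^N(y)$ are the two endpoints of an edge of $U$ (or of an edge of $V$, if $U$ is of periodic type) while for all $0\le i<N$ the chord $\overline{\sigma^i(x)\sigma^i(y)}$ is disjoint from $U$ (from $U\cup V$, if $U$ is of periodic type). **Lemma.** Let $\sim$ be a cubic invariant lamination that has no periodic rotational gaps and no periodic rotational leaves. Then either $\sim$ is empty, or there is an invariant quadratic gap $U$, of regular critical or of periodic type, such that $\sim$ coincides with the canonical lamination $\sim_U$ of $U$. -/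

import Mathlib

/-- The angle-tripling map on the circle `ℝ/ℤ`, i.e. `z ↦ z ^ 3` in the multiplicative notation. -/
noncomputable def sig (x : UnitAddCircle) : UnitAddCircle := 3 • x

/-- The point `exp (2 π i x)` of the plane that corresponds to the angle `x`. -/
noncomputable def pt (x : UnitAddCircle) : ℂ := (AddCircle.toCircle x : Circle)

/-- The convex hull, in the plane, of a set of angles. -/
noncomputable def hull (A : Set UnitAddCircle) : Set ℂ := convexHull ℝ (pt '' A)

/-- The chord joining two angles (a point if they coincide). -/
noncomputable def chord (a b : UnitAddCircle) : Set ℂ := segment ℝ (pt a) (pt b)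

/-- Length, in `[0, 1)`, of the positively oriented arc from `a` to `b`. -/
noncomputable def arcLen (a b : UnitAddCircle) : ℝ := (AddCircle.equivIco 1 0 (b - a) : ℝ)

/-- The positively oriented open arc `(a, b)` is a hole (complementary component) of the
closed set `A`; meant for sets with at least two points. -/
def IsHole (A : Set UnitAddCircle) (a b : UnitAddCircle) : Prop :=
  a ∈ A ∧ b ∈ A ∧ a ≠ b ∧ Disjoint (Set.cIoo a b) A

/-- `a` and `b` are the two endpoints of an edge of the convex hull of `A`. -/
def IsEdge (A : Set UnitAddCircle) (a b : UnitAddCircle) : Prop :=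
  IsHole A a b ∨ IsHole A b a

/-- Laminations as equivalence relations on the circle. -/
structure IsLamination (r : Setoid UnitAddCircle) : Prop where
  closed_graph : IsClosed {p : UnitAddCircle × UnitAddCircle | r p.1 p.2}
  unlinked : ∀ t₁ t₂ t₃ t₄ : UnitAddCircle, r t₁ t₂ → r t₃ t₄ → ¬ r t₂ t₃ →
    Disjoint (openSegment ℝ (pt t₁) (pt t₂)) (openSegment ℝ (pt t₃) (pt t₄))
  totally_disconnected : ∀ g ∈ r.classes, IsTotallyDisconnected g

/-- Cubic invariant laminations. The condition `covering` says that `sig : g → sig '' g` extends to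
an orientation preserving covering map of the circle under which `g` is the full preimage of
`sig '' g`, in its standard form through holes. -/
structure IsCubicInvariantLamination (r : Setoid UnitAddCircle) : Prop
    extends IsLamination r where
  forward : ∀ g ∈ r.classes, sig '' g ∈ r.classes
  backward : ∀ g ∈ r.classes,
    (∀ h ∈ r.classes, (h ∩ sig ⁻¹' g).Nonempty → h ⊆ sig ⁻¹' g) ∧
    {h | h ∈ r.classes ∧ (h ∩ sig ⁻¹' g).Nonempty}.encard ≤ 3
  covering : ∀ g ∈ r.classes, (sig '' g).Subsingleton ∨
    ∀ a b, IsHole g a b → IsHole (sig '' g) (sig a) (sig b)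
  finite_classes : ∀ g ∈ r.classes, g.Finite

/-- The chord `ab` is a (possibly degenerate) leaf: a point, or an edge of the convex hull of a
class. -/
def IsLeaf (r : Setoid UnitAddCircle) (a b : UnitAddCircle) : Prop :=
  a = b ∨ ∃ g ∈ r.classes, IsEdge g a b

/-- The union of all leaves. -/
def leafUnion (r : Setoid UnitAddCircle) : Set ℂ :=
  {z | ∃ a b, IsLeaf r a b ∧ z ∈ chord a b}

/-- Gaps: closures of the components of the open unit disk minus the union of all leaves. -/
def IsGap (r : Setoid UnitAddCircle) (G : Set ℂ) : Prop :=
  ∃ z ∈ Metric.ball (0 : ℂ) 1 \ leafUnion r,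
    G = closure (connectedComponentIn (Metric.ball (0 : ℂ) 1 \ leafUnion r) z)

/-- The basis of a set in the closed disk: its trace on the circle. -/
def basis (G : Set ℂ) : Set UnitAddCircle := {x | pt x ∈ G}

/-- `A` is periodic under `sig`, of minimal period `n`. -/
def HasMinPeriod (A : Set UnitAddCircle) (n : ℕ) : Prop :=
  0 < n ∧ sig^[n] '' A = A ∧ ∀ m, 0 < m → m < n → sig^[m] '' A ≠ A

/-- `ψ` is a monotone circle map of degree one that collapses every hole of `A`. The boundary of
the convex hull of `A` is identified with the circle by sending edges to closed holes. -/
def IsCollapse (A : Set UnitAddCircle) (ψ : UnitAddCircle → UnitAddCircle) : Prop :=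
  (∃ Ψ : ℝ → ℝ, Continuous Ψ ∧ Monotone Ψ ∧ (∀ t, Ψ (t + 1) = Ψ t + 1) ∧
    ∀ t : ℝ, ψ (t : UnitAddCircle) = (Ψ t : UnitAddCircle)) ∧
  ∀ a b, IsHole A a b → ∀ x ∈ Set.cIcc a b, ψ x = ψ a

/-- The `n`-th iterate of `sig` on `A` is modelled by an irrational rotation. -/
def IsSiegel (A : Set UnitAddCircle) (n : ℕ) : Prop :=
  ∃ (ψ : UnitAddCircle → UnitAddCircle) (θ : ℝ), IsCollapse A ψ ∧ Irrational θ ∧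
    ∀ x ∈ A, ψ (sig^[n] x) = ψ x + (θ : UnitAddCircle)

/-- A periodic rotational gap or leaf, in terms of its basis `A`: finite without refixed points, or
Siegel. -/
def IsPeriodicRotational (A : Set UnitAddCircle) : Prop :=
  A.Nonempty ∧ ∃ n, HasMinPeriod A n ∧
    ((A.Finite ∧ ∀ x ∈ A, sig^[n] x ≠ x) ∨ (A.Infinite ∧ IsSiegel A n))

/-- The lamination has a periodic rotational gap or a periodic rotational leaf. -/
def HasPeriodicRotationalGapOrLeaf (r : Setoid UnitAddCircle) : Prop :=
  (∃ G, IsGap r G ∧ IsPeriodicRotational (basis G)) ∨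
  ∃ a b, IsLeaf r a b ∧ IsPeriodicRotational {a, b}

/-- `A` is the basis of a (stand alone) invariant gap for `sig`. -/
structure IsInvariantGap (A : Set UnitAddCircle) : Prop where
  closed : IsClosed A
  interior_nonempty : (interior (hull A)).Nonempty
  invariant : sig '' A = A
  holes : ∀ a b, IsHole A a b → sig a = sig b ∨ IsHole A (sig a) (sig b)

/-- `A` is the basis of an invariant quadratic gap: the collapse of the edges semiconjugates `sig`
on the boundary of the gap to angle doubling. -/
structure IsInvariantQuadraticGap (A : Set UnitAddCircle) : Prop extends IsInvariantGap A where
  degree_two : ∃ ψ, IsCollapse A ψ ∧ ∀ x ∈ A, ψ (sig x) = 2 • ψ x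

/-- The edge `ab` of the gap with basis `A`, with the hole `(a, b)` behind it, is a major. -/
def IsMajor (A : Set UnitAddCircle) (a b : UnitAddCircle) : Prop :=
  IsHole A a b ∧ 1 / 3 ≤ arcLen a b

/-- The major `ab` is critical, and all its images lie in the open arc from `b` to `a`
(regular critical type). -/
def IsRegularCriticalMajor (A : Set UnitAddCircle) (a b : UnitAddCircle) : Prop :=
  IsMajor A a b ∧ sig a = sig b ∧ ∀ n, 0 < n → sig^[n] a ∈ Set.cIoo b a

/-- The major `ab` is periodic of period `k` (periodic type). -/
def IsPeriodicMajor (A : Set UnitAddCircle) (a b : UnitAddCircle) (k : ℕ) : Prop :=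
  IsMajor A a b ∧ HasMinPeriod {a, b} k

/-- The basis of the vassal gap of the gap with periodic major `ab` of period `k`: all points whose
orbits under the `k`-th iterate stay in `[a, b - 1/3] ∪ [a + 1/3, b]`. -/
def vassalBasis (a b : UnitAddCircle) (k : ℕ) : Set UnitAddCircle :=
  {x | ∀ j : ℕ, (sig^[k])^[j] x ∈
    Set.cIcc a (b - ((1 / 3 : ℝ) : UnitAddCircle)) ∪
      Set.cIcc (a + ((1 / 3 : ℝ) : UnitAddCircle)) b}

/-- The relation generated by the edges of the gaps with bases in `S` and by their iterated
pullbacks outside of these gaps. -/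
def pullbackRel (S : Set (Set UnitAddCircle)) (x y : UnitAddCircle) : Prop :=
  x = y ∨ ∃ N : ℕ, (∃ A ∈ S, IsEdge A (sig^[N] x) (sig^[N] y)) ∧
    ∀ i < N, ∀ A ∈ S, Disjoint (chord (sig^[i] x) (sig^[i] y)) (hull A)

/-- `r` is the canonical lamination of the invariant quadratic gap with basis `A`, which is of
regular critical type or of periodic type. -/
def IsCanonicalLamination (A : Set UnitAddCircle) (r : Setoid UnitAddCircle) : Prop :=
  (∃ a b, IsRegularCriticalMajor A a b ∧ ∀ x y, r x y ↔ pullbackRel {A} x y) ∨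
  ∃ a b k, IsPeriodicMajor A a b k ∧ ∀ x y, r x y ↔ pullbackRel {A, vassalBasis a b k} x y

/-! The argument runs on the universal cover. A lamination becomes a closed periodic relation on the
line (`Lam`), tripling becomes t ↦ 3t, and the absence of finite rotational classes becomes
`nopoly`: a class that returns to itself is fixed pointwise.

The engine is a rotation argument. Let F be a lift of an iterate of tripling on a part of the
circle, with displacement in (0, 1). A leaf is not linked with its image, so exactly one of its two
arcs is moved off itself by F. Removing all these arcs leaves the `core`. If the complement of the
domain of F consists of at most two such arcs per period, then F is monotone of degree one, the core
is invariant, and its complementary arcs are leaf arcs. A rational rotation number would make all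
points of the core periodic; the core would then be discrete, neighbours would be related, and one
class would be mapped to itself without fixed points. Hence the rotation number is irrational and
the core is the basis of a Siegel gap, which is excluded (`RotSys.false`).

The engine is used twice. Applied to tripling off its fixed points 0 and 1/2, it shows that arcs
moved off themselves cannot surround both of them; so, seen from one of the two, every leaf arc that
avoids it is moved off itself (`Lam.glam_or`). Unless a leaf joins the two fixed points, compactness
then gives a longest leaf arc (a, b), and comparison with leaves of the same image shows that its
length is in [1/3, 1/2). No leaf properly surrounds its image. Hence either the length is 1/3 and
the orbit of a never returns to [a, b], or the image grows until it enters [a, b] and then has to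
coincide with it, so that the major is periodic. A leaf joining the fixed points is itself a major
of period one. The second use, for the first return map to [a, b - 1/3] ∪ [a + 1/3, b], shows that
only the major and one middle leaf join the two branches (`Major.straddle`).

The gap U consists of the points whose orbits avoid (a, b); its holes are the iterated preimages of
(a, b), and they are cut off by leaves. The holes of the vassal gap V inside (a, b) come in the same
way from the middle leaf. A leaf is an edge of U or V or lies in a hole of each gap involved. In the
latter case tripling multiplies its length by three, so an edge is reached after finitely many
steps; conversely, inside such holes related images have only one possible pullback. This identifies
the relation with the canonical one (`Major.rel_iff_of_crit`, `Major.rel_iff_of_per`). -/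

/-! ### Laminations lifted to the line -/

/-- A lamination of the circle lifted to the line: a closed periodic equivalence relation without
crossings, invariant under tripling, in which a class is mapped to itself by an iterate of the
tripling only if its points are fixed. -/
structure Lam (R : ℝ → ℝ → Prop) : Prop where
  refl : ∀ t, R t t
  symm : ∀ {s t}, R s t → R t s
  trans : ∀ {s t u}, R s t → R t u → R s u
  per : ∀ (t : ℝ) (n : ℤ), R t (t + n)
  cross : ∀ {s u t v : ℝ}, s < u → u < t → t < v → v < s + 1 → R s t → R u v → R s u
  closed : IsClosed {p : ℝ × ℝ | R p.1 p.2}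
  fwd : ∀ {s t}, R s t → R (3 * s) (3 * t)
  back : ∀ {s t}, R (3 * s) t → ∃ w, R s w ∧ ∃ n : ℤ, 3 * w = t + n
  nopoly : ∀ (s : ℝ) (k : ℕ), R s (3 ^ k * s) → ∃ n : ℤ, 3 ^ k * s = s + n
  -- Here (s, u) is a hole of the class of s. Either the image class is a point, or the image of the
  -- hole is a hole once its right end is moved by n into the period that starts at 3 * s.
  cov : ∀ {s u : ℝ}, s < u → u < s + 1 → R s u → (∀ w, s < w → w < u → ¬ R s w) →
    (∀ w, R s w → ∃ n : ℤ, 3 * w = 3 * s + n) ∨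
    ∃ n : ℤ, 3 * s < 3 * u - n ∧ 3 * u - n < 3 * s + 1 ∧
      ∀ w, 3 * s < w → w < 3 * u - n → ¬ R (3 * s) w

namespace Lam

variable {R : ℝ → ℝ → Prop}

theorem shift (h : Lam R) {s t : ℝ} (hst : R s t) (m n : ℤ) : R (s + m) (t + n) :=
  h.trans (h.symm (h.per s m)) (h.trans hst (h.per t n))

theorem shift_right (h : Lam R) {s t : ℝ} (hst : R s t) (n : ℤ) : R s (t + n) :=
  h.trans hst (h.per t n)

theorem add_one (h : Lam R) {s t : ℝ} (hst : R s t) : R s (t + 1) := by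
  simpa using h.shift_right hst 1

theorem sub_one (h : Lam R) {s t : ℝ} (hst : R s t) : R s (t - 1) := by
  simpa [sub_eq_add_neg] using h.shift_right hst (-1)

theorem of_shift (h : Lam R) {s t : ℝ} (n : ℤ) (hst : R s (t + n)) : R s t :=
  h.trans hst (h.symm (h.per t n))

/-- Orientation reversal; statements at right endpoints are obtained from those at left endpoints
through it. -/
theorem reflect (h : Lam R) : Lam fun s t => R (-s) (-t) where
  refl t := h.refl _
  symm hst := h.symm hst
  trans hst htu := h.trans hst htu
  per t n := by
    have := h.per (-t) (-n)
    convert this using 1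
    push_cast; ring
  cross {s u t v} h1 h2 h3 h4 hst huv := by
    have hvu : R (-v) (-u) := h.symm huv
    have hts : R (-t) (-s) := h.symm hst
    have := h.cross (by linarith) (by linarith) (by linarith) (by linarith) hvu hts
    exact h.trans hst (h.trans (h.symm this) hvu)
  closed := h.closed.preimage (by fun_prop : Continuous fun p : ℝ × ℝ => (-p.1, -p.2))
  fwd {s t} hst := by
    have := h.fwd hst
    simpa only [mul_neg] using this
  back {s t} hst := by
    have hst' : R (3 * -s) (-t) := by simpa only [mul_neg] using hst
    obtain ⟨w, hw, n, hn⟩ := h.back hst'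
    refine ⟨-w, by simpa using hw, -n, ?_⟩
    push_cast; linarith
  nopoly s k hs := by
    have hs' : R (-s) (3 ^ k * -s) := by simpa only [mul_neg] using hs
    obtain ⟨n, hn⟩ := h.nopoly _ k hs'
    refine ⟨-n, ?_⟩
    push_cast; linarith
  cov {s u} h1 h2 hsu hole := by
    have h3 : ∀ w, -u < w → w < -s → ¬ R (-u) w := fun w hw1 hw2 hw =>
      hole (-w) (by linarith) (by linarith) (by simpa using h.trans hsu hw)
    rcases h.cov (by linarith) (by linarith) (h.symm hsu) h3 with h4 | ⟨n, hn1, hn2, hn3⟩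
    · left
      intro w hw
      obtain ⟨n, hn⟩ := h4 (-w) (h.trans (h.symm hsu) hw)
      obtain ⟨m, hm⟩ := h4 (-s) (h.symm hsu)
      refine ⟨m - n, ?_⟩
      push_cast; linarith
    · right
      refine ⟨n, by linarith, by linarith, fun w hw1 hw2 hw => ?_⟩
      refine hn3 (-w - n) (by linarith) (by linarith) ?_
      have h5 : R (3 * -u) (3 * -s) := h.fwd (h.symm hsu)
      have h6 : R (3 * -s) (-w) := by simpa only [mul_neg] using hw
      have := h.shift_right (h.trans h5 h6) (-n)
      convert this using 1
      push_cast; ring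

/-- The position of the image of an unlinked pair: outside of the arc, or inside of it. -/
theorem dich (h : Lam R) {s u x y : ℝ} (hsu : s < u) (hus : u < s + 1) (hR : R s u)
    (hx1 : s < x) (hx2 : x < s + 1) (hy1 : u < y) (hy2 : y < u + 1) (hxy : R x y)
    (hn : ¬ R s x) : (u < x ∧ y < s + 1) ∨ (x < u ∧ s + 1 < y) := by
  have hxu : x ≠ u := by rintro rfl; exact hn hR
  have hys : y ≠ s + 1 := by
    rintro rfl
    exact hn (h.symm (by simpa using h.sub_one hxy))
  rcases lt_or_gt_of_ne hxu with h1 | h1 <;> rcases lt_or_gt_of_ne hys with h2 | h2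
  · exact absurd (h.cross hx1 h1 hy1 h2 hR hxy) hn
  · exact Or.inr ⟨h1, h2⟩
  · exact Or.inl ⟨h1, h2⟩
  -- Now y - 1 lies in (s, u) and x lies beyond u, so it is the translated pair that crosses the
  -- leaf.
  · have h3 : R (y - 1) x := h.symm (h.sub_one hxy)
    have h4 := h.cross (s := s) (u := y - 1) (t := u) (v := x) (by linarith) (by linarith) h1 hx2 hR h3
    exact absurd (h.trans h4 h3) hn

theorem fwd_pow (h : Lam R) {s t : ℝ} (hst : R s t) (k : ℕ) : R (3 ^ k * s) (3 ^ k * t) := by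
  induction k with
  | zero => simpa using hst
  | succ k ih => simpa only [pow_succ', mul_assoc] using h.fwd ih

theorem back_pow (h : Lam R) (k : ℕ) {s t : ℝ} (hst : R (3 ^ k * s) t) :
    ∃ w, R s w ∧ ∃ n : ℤ, 3 ^ k * w = t + n := by
  induction k generalizing t with
  | zero => exact ⟨t, by simpa using hst, 0, by simp⟩
  | succ k ih =>
    rw [pow_succ', mul_assoc] at hst
    obtain ⟨w, hw, n, hn⟩ := h.back hst
    obtain ⟨v, hv, m, hm⟩ := ih hw
    refine ⟨v, hv, 3 * m + n, ?_⟩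
    rw [pow_succ', mul_assoc, hm]
    push_cast; linarith

/-- A singleton class (modulo one) is mapped to a singleton class. -/
theorem singleton_pow (h : Lam R) {s : ℝ} (hs : ∀ w, R s w → ∃ n : ℤ, w = s + n) (k : ℕ) :
    ∀ w, R (3 ^ k * s) w → ∃ n : ℤ, w = 3 ^ k * s + n := by
  intro w hw
  obtain ⟨v, hv, n, hn⟩ := h.back_pow k hw
  obtain ⟨m, rfl⟩ := hs v hv
  refine ⟨3 ^ k * m - n, ?_⟩
  push_cast; linarith

/-- Iteration of `cov`. In the degenerate case the image class is a single point modulo one by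
`back`, and `singleton_pow` keeps it so. -/
theorem cov_pow (h : Lam R) (k : ℕ) {s u : ℝ} (hsu : s < u) (hus : u < s + 1) (hR : R s u)
    (hole : ∀ w, s < w → w < u → ¬ R s w) :
    (∀ w, R (3 ^ k * s) w → ∃ n : ℤ, w = 3 ^ k * s + n) ∨
    ∃ n : ℤ, 3 ^ k * s < 3 ^ k * u - n ∧ 3 ^ k * u - n < 3 ^ k * s + 1 ∧
      ∀ w, 3 ^ k * s < w → w < 3 ^ k * u - n → ¬ R (3 ^ k * s) w := by
  induction k with
  | zero => right; exact ⟨0, by simpa using hsu, by simpa using hus, by simpa using hole⟩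
  | succ k ih =>
    rcases ih with h1 | ⟨n, h1, h2, h3⟩
    · left
      have := h.singleton_pow h1 1
      simpa only [pow_succ', mul_assoc, pow_zero, one_mul] using this
    · have h4 : R (3 ^ k * s) (3 ^ k * u - n) := by
        simpa [sub_eq_add_neg] using h.shift_right (h.fwd_pow hR k) (-n)
      rcases h.cov h1 h2 h4 h3 with h5 | ⟨m, h5, h6, h7⟩
      · left
        intro w hw
        rw [pow_succ', mul_assoc] at hw ⊢
        obtain ⟨v, hv, j, hj⟩ := h.back hw
        obtain ⟨i, hi⟩ := h5 v hv
        refine ⟨i - j, ?_⟩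
        push_cast; linarith
      · right
        refine ⟨3 * n + m, ?_, ?_, ?_⟩ <;> rw [pow_succ', mul_assoc] <;> push_cast
        · rw [mul_assoc]; linarith
        · rw [mul_assoc]; linarith
        · rw [mul_assoc]
          intro w hw1 hw2
          exact h7 w hw1 (by linarith)

end Lam

/-! ### Partial circle maps without fixed points and the arcs they move off themselves -/

/-- A leaf arc `(s, u)` with endpoints in `D` whose endpoints are mapped outside of its closure by
the partial circle map with lift `F`. -/
def Memb (R : ℝ → ℝ → Prop) (D : Set ℝ) (F : ℝ → ℝ) (s u : ℝ) : Prop :=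
  s ∈ D ∧ u ∈ D ∧ s < u ∧ u < s + 1 ∧ R s u ∧ u < F s ∧ F u < s + 1

/-- A partial lift `F` of `t ↦ 3 ^ k t` on a set `D`, without fixed points modulo one. -/
structure PreSys (R : ℝ → ℝ → Prop) (k : ℕ) (D : Set ℝ) (F : ℝ → ℝ) : Prop where
  lam : Lam R
  per : ∀ {t} (n : ℤ), t ∈ D → t + n ∈ D
  map_add_int : ∀ t (n : ℤ), F (t + n) = F t + n
  disp : ∀ {t}, t ∈ D → t < F t ∧ F t < t + 1
  cong : ∀ {t}, t ∈ D → ∃ n : ℤ, F t = 3 ^ k * t + n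
  aff : ∀ {s t}, s ≤ t → Set.Icc s t ⊆ D → F t - F s = 3 ^ k * (t - s)

/-- A partial lift `F` of `t ↦ 3 ^ k t`, defined on the complement `D` of at most two leaf arcs
(modulo one) and without fixed points there. -/
structure RotSys (R : ℝ → ℝ → Prop) (k : ℕ) (D : Set ℝ) (F : ℝ → ℝ) (G : ℝ → ℝ → Prop) : Prop
    extends PreSys R k D F where
  closed : IsClosed D
  gap_per : ∀ {e f} (n : ℤ), G e f → G (e + n) (f + n)
  gap : ∀ {e f}, G e f → e < f ∧ e ∈ D ∧ f ∈ D ∧ ∀ t, e < t → t < f → t ∉ D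
  cover : ∀ {t}, t ∉ D → ∃ e f, G e f ∧ e < t ∧ t < f
  memb : ∀ {e f}, G e f → Memb R D F e f
  sep : ∃ δ > 0, ∀ e f, G e f → δ ≤ f - e
  -- At most two gaps fit into one period; this is needed only for the monotonicity across gaps.
  two : ∀ {e₁ f₁ e₂ f₂ e₃ f₃}, G e₁ f₁ → G e₂ f₂ → G e₃ f₃ → f₁ ≤ e₂ → f₂ ≤ e₃ → ¬ f₃ ≤ e₁ + 1
  -- Two arcs moved off themselves never cover the whole circle.
  nest : ∀ {s u p q}, Memb R D F s u → Memb R D F q (p + 1) → s < p → p < q → ¬ q < u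
  gap_ex : ∃ e f, G e f

/-- The points that lie in no leaf arc that is mapped off itself. -/
def core (R : ℝ → ℝ → Prop) (D : Set ℝ) (F : ℝ → ℝ) : Set ℝ :=
  {t | ∀ s u, Memb R D F s u → ¬ (s < t ∧ t < u)}

namespace PreSys

variable {R : ℝ → ℝ → Prop} {k : ℕ} {D : Set ℝ} {F : ℝ → ℝ}

theorem map_add_one (S : PreSys R k D F) (t : ℝ) : F (t + 1) = F t + 1 := by
  simpa using S.map_add_int t 1

theorem map_sub_one (S : PreSys R k D F) (t : ℝ) : F (t - 1) = F t - 1 := by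
  have := S.map_add_one (t - 1)
  rw [sub_add_cancel] at this
  linarith

theorem add_one_mem (S : PreSys R k D F) {t : ℝ} (ht : t ∈ D) : t + 1 ∈ D := by
  simpa using S.per 1 ht

theorem sub_one_mem (S : PreSys R k D F) {t : ℝ} (ht : t ∈ D) : t - 1 ∈ D := by
  simpa [sub_eq_add_neg] using S.per (-1) ht

theorem map_rel (S : PreSys R k D F) {s t : ℝ} (hs : s ∈ D) (ht : t ∈ D) (h : R s t) :
    R (F s) (F t) := by
  obtain ⟨m, hm⟩ := S.cong hs
  obtain ⟨n, hn⟩ := S.cong ht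
  rw [hm, hn]
  exact S.lam.shift (S.lam.fwd_pow h k) m n

/-- By `nopoly` the point would be fixed modulo one, whereas its displacement lies strictly between
0 and 1. -/
theorem not_rel_map (S : PreSys R k D F) {s : ℝ} (hs : s ∈ D) : ¬ R s (F s) := by
  intro h
  obtain ⟨m, hm⟩ := S.cong hs
  rw [hm] at h
  obtain ⟨n, hn⟩ := S.lam.nopoly s k (S.lam.of_shift m h)
  have h1 := S.disp hs
  rw [hm, hn] at h1
  have h2 : (0 : ℝ) < ((n + m : ℤ) : ℝ) := by push_cast; linarith
  have h3 : ((n + m : ℤ) : ℝ) < 1 := by push_cast; linarith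
  have h4 : 0 < n + m := by exact_mod_cast h2
  have h5 : n + m < 1 := by exact_mod_cast h3
  omega

theorem memb_shift (S : PreSys R k D F) {s u : ℝ} (n : ℤ) (h : Memb R D F s u) :
    Memb R D F (s + n) (u + n) := by
  obtain ⟨h1, h2, h3, h4, h5, h6, h7⟩ := h
  refine ⟨S.per n h1, S.per n h2, by linarith, by linarith, S.lam.shift h5 n n, ?_, ?_⟩
  · rw [S.map_add_int]; linarith
  · rw [S.map_add_int]; linarith

/-- Of the two arcs of a leaf exactly one is mapped off itself. -/
theorem memb_or (S : PreSys R k D F) {s u : ℝ} (hs : s ∈ D) (hu : u ∈ D) (h1 : s < u)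
    (h2 : u < s + 1) (hR : R s u) : Memb R D F s u ∨ Memb R D F u (s + 1) := by
  have a := S.disp hs
  have b := S.disp hu
  rcases S.lam.dich h1 h2 hR a.1 a.2 b.1 b.2 (S.map_rel hs hu hR) (S.not_rel_map hs) with h | h
  · exact Or.inl ⟨hs, hu, h1, h2, hR, h.1, h.2⟩
  · refine Or.inr ⟨hu, S.add_one_mem hs, h2, by linarith, S.lam.add_one (S.lam.symm hR), h.2, ?_⟩
    rw [S.map_add_one]; linarith

theorem memb_excl {s u : ℝ} (h : Memb R D F s u)
    (h' : Memb R D F u (s + 1)) : False := by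
  have a := h.2.2.2.2.2.2
  have b := h'.2.2.2.2.2.1
  linarith

/-- The three arcs cut out by three points of one class are not all mapped off themselves. -/
theorem not_three (S : PreSys R k D F) {s u q : ℝ} (h1 : Memb R D F s u) (h2 : Memb R D F u q)
    (h3 : Memb R D F q (s + 1)) : False := by
  obtain ⟨a1, a2, a3, a4, a5, a6, a7⟩ := h1
  obtain ⟨b1, b2, b3, b4, b5, b6, b7⟩ := h2
  obtain ⟨c1, c2, c3, c4, c5, c6, c7⟩ := h3
  rw [S.map_add_one] at c7
  -- u < F s < q < F u: the image of the leaf s u crosses the leaf u q, which puts F s into the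
  -- class of s.
  have := S.lam.cross (s := u) (u := F s) (t := q) (v := F u) a6 (by linarith) b6 (by linarith) b5
    (S.map_rel a1 a2 a5)
  exact S.not_rel_map a1 (S.lam.trans a5 this)

/-- Overlapping arcs that are mapped off themselves have a union of the same kind. -/
theorem memb_union (S : PreSys R k D F)
    (hnest : ∀ {s u p q}, Memb R D F s u → Memb R D F q (p + 1) → s < p → p < q → ¬ q < u)
    {s u p q : ℝ} (h : Memb R D F s u) (h' : Memb R D F p q)
    (h1 : s < p) (h2 : p < u) (h3 : u < q) : Memb R D F s q := by
  obtain ⟨a1, a2, a3, a4, a5, a6, a7⟩ := h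
  obtain ⟨b1, b2, b3, b4, b5, b6, b7⟩ := h'
  rcases lt_trichotomy q (s + 1) with h4 | h4 | h4
  · have h5 : R s p := S.lam.cross h1 h2 h3 h4 a5 b5
    have h6 : R s q := S.lam.trans h5 b5
    -- If instead (q, s + 1) is moved off itself, then (u, q) would complete a triple excluded by
    -- `not_three`, and (q, u + 1) is impossible because F q < p + 1 < u + 1.
    rcases S.memb_or a1 b2 (by linarith) h4 h6 with h7 | h7
    · exact h7
    · rcases S.memb_or a2 b2 h3 (by linarith) (S.lam.trans (S.lam.symm a5) h6) with h8 | h8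
      · exact (S.not_three ⟨a1, a2, a3, a4, a5, a6, a7⟩ h8 h7).elim
      · have := h8.2.2.2.2.2.1
        linarith
  · subst h4
    rw [S.map_add_one] at b7
    linarith
  -- Here q > s + 1, so the two arcs cover the circle, which is the excluded configuration.
  · have h5 : Memb R D F p ((q - 1) + 1) := by
      rw [sub_add_cancel]; exact ⟨b1, b2, b3, b4, b5, b6, b7⟩
    exact (hnest ⟨a1, a2, a3, a4, a5, a6, a7⟩ h5 (by linarith) (by linarith) h2).elim

end PreSys

namespace RotSys

variable {R : ℝ → ℝ → Prop} {k : ℕ} {D : Set ℝ} {F : ℝ → ℝ} {G : ℝ → ℝ → Prop}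

theorem core_subset (S : RotSys R k D F G) : core R D F ⊆ D := by
  intro t ht
  by_contra h
  obtain ⟨e, f, h1, h2, h3⟩ := S.cover h
  exact ht e f (S.memb h1) ⟨h2, h3⟩

theorem core_per (S : RotSys R k D F G) {t : ℝ} (n : ℤ) (ht : t ∈ core R D F) :
    t + n ∈ core R D F := by
  rintro s u h ⟨h1, h2⟩
  have := S.memb_shift (-n) h
  refine ht _ _ this ⟨?_, ?_⟩ <;> push_cast <;> linarith

theorem core_closed : IsClosed (core R D F) := by
  have : core R D F = ⋂ (s : ℝ) (u : ℝ) (_ : Memb R D F s u), (Set.Ioo s u)ᶜ := by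
    ext t
    simp [core]
  rw [this]
  exact isClosed_iInter fun s => isClosed_iInter fun u => isClosed_iInter fun _ =>
    isOpen_Ioo.isClosed_compl

/-- No gap fits between two points of D closer than δ. Hence F is affine at small scale, which
yields both its continuity and its expansion. -/
theorem icc_subset (S : RotSys R k D F G) {δ : ℝ} (hδ : ∀ e f, G e f → δ ≤ f - e) {s t : ℝ}
    (hs : s ∈ D) (ht : t ∈ D) (h : t - s < δ) : Set.Icc s t ⊆ D := by
  intro x hx
  by_contra hxD
  obtain ⟨e, f, h1, h2, h3⟩ := S.cover hxD
  obtain ⟨g1, g2, g3, g4⟩ := S.gap h1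
  have h4 : s ≤ e := by
    by_contra h5
    exact g4 s (not_le.1 h5) (by linarith [hx.1]) hs
  have h5 : f ≤ t := by
    by_contra h5
    exact g4 t (by linarith [hx.2]) (not_le.1 h5) ht
  linarith [hδ e f h1]

theorem continuousOn (S : RotSys R k D F G) : ContinuousOn F D := by
  obtain ⟨δ, hδ, hs⟩ := S.sep
  rw [Metric.continuousOn_iff]
  intro x hx ε hε
  refine ⟨min δ (ε / 3 ^ k), by positivity, fun y hy hxy => ?_⟩
  rw [Real.dist_eq] at hxy ⊢
  have h1 : |y - x| < δ := lt_of_lt_of_le hxy (min_le_left _ _)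
  have h2 : |y - x| < ε / 3 ^ k := lt_of_lt_of_le hxy (min_le_right _ _)
  have h3 : F y - F x = 3 ^ k * (y - x) := by
    rcases le_total x y with h | h
    · exact S.aff h (S.icc_subset hs hx hy (by linarith [le_abs_self (y - x)]))
    · have := S.aff h (S.icc_subset hs hy hx (by linarith [neg_abs_le (y - x)]))
      linarith
  rw [h3, abs_mul, abs_of_pos (by positivity : (0 : ℝ) < 3 ^ k)]
  rw [lt_div_iff₀ (by positivity)] at h2
  linarith

/-- The arcs around a fixed point t are directed, so their endpoints can be optimised
simultaneously. -/
theorem memb_sup (S : RotSys R k D F G) {s u p q t : ℝ} (h : Memb R D F s u) (h' : Memb R D F p q)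
    (h1 : s < t) (h2 : t < u) (h3 : p < t) (h4 : t < q) : Memb R D F (min s p) (max u q) := by
  rcases le_or_gt s p with a | a <;> rcases le_or_gt u q with b | b
  · rw [min_eq_left a, max_eq_right b]
    rcases eq_or_lt_of_le a with rfl | a
    · exact h'
    rcases eq_or_lt_of_le b with rfl | b
    · exact h
    exact S.memb_union S.nest h h' a (by linarith) b
  · rwa [min_eq_left a, max_eq_left b.le]
  · rwa [min_eq_right a.le, max_eq_right b]
  · rw [min_eq_right a.le, max_eq_left b.le]
    exact S.memb_union S.nest h' h a (by linarith) b

/-- Every point outside of the core lies in an arc with endpoints in the core. -/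
theorem exists_hole (S : RotSys R k D F G) {t : ℝ} (ht : t ∉ core R D F) :
    ∃ s u, Memb R D F s u ∧ s < t ∧ t < u ∧ s ∈ core R D F ∧ u ∈ core R D F := by
  simp only [core, Set.mem_ofPred_eq, not_forall, not_not] at ht
  obtain ⟨s₀, u₀, h₀, hs₀, hu₀⟩ := ht
  set A : Set ℝ := {s | ∃ u, Memb R D F s u ∧ s < t ∧ t < u} with hA
  set B : Set ℝ := {u | ∃ s, Memb R D F s u ∧ s < t ∧ t < u} with hB
  have hA0 : s₀ ∈ A := ⟨u₀, h₀, hs₀, hu₀⟩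
  have hB0 : u₀ ∈ B := ⟨s₀, h₀, hs₀, hu₀⟩
  have hAb : BddBelow A := ⟨t - 1, by
    rintro s ⟨u, h, h1, h2⟩
    linarith [h.2.2.2.1]⟩
  have hBb : BddAbove B := ⟨t + 1, by
    rintro u ⟨s, h, h1, h2⟩
    linarith [h.2.2.2.1]⟩
  set α := sInf A
  set β := sSup B
  -- By directedness one sequence of arcs approaches the infimum of the left endpoints and the
  -- supremum of the right endpoints at once.
  have hex : ∀ n : ℕ, ∃ p : ℝ × ℝ, Memb R D F p.1 p.2 ∧ p.1 < t ∧ t < p.2 ∧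
      α ≤ p.1 ∧ p.1 ≤ α + 1 / (n + 1) ∧ β - 1 / (n + 1) ≤ p.2 ∧ p.2 ≤ β := by
    intro n
    have hn : (0 : ℝ) < 1 / (n + 1) := by positivity
    obtain ⟨s, ⟨u', h1, h2, h3⟩, hs⟩ := exists_lt_of_csInf_lt ⟨s₀, hA0⟩
      (show sInf A < α + 1 / (n + 1) by simp only [α]; linarith)
    obtain ⟨u, ⟨s', h4, h5, h6⟩, hu⟩ := exists_lt_of_lt_csSup ⟨u₀, hB0⟩
      (show β - 1 / (n + 1) < sSup B by simp only [β]; linarith)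
    have h7 := S.memb_sup h1 h4 h2 h3 h5 h6
    have h8 : min s s' < t := lt_of_le_of_lt (min_le_left _ _) h2
    have h9 : t < max u' u := lt_of_lt_of_le h3 (le_max_left _ _)
    refine ⟨(min s s', max u' u), h7, h8, h9, csInf_le hAb ⟨_, h7, h8, h9⟩, ?_, ?_,
      le_csSup hBb ⟨_, h7, h8, h9⟩⟩
    · exact (min_le_left _ _).trans hs.le
    · exact hu.le.trans (le_max_right _ _)
  choose p hp1 hp2 hp3 hp4 hp5 hp6 hp7 using hex
  have hz : Filter.Tendsto (fun n : ℕ => (1 : ℝ) / (n + 1)) Filter.atTop (nhds 0) :=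
    tendsto_one_div_add_atTop_nhds_zero_nat
  have ta : Filter.Tendsto (fun n => (p n).1) Filter.atTop (nhds α) :=
    tendsto_of_tendsto_of_tendsto_of_le_of_le tendsto_const_nhds
      (by simpa using hz.const_add α) hp4 hp5
  have tb : Filter.Tendsto (fun n => (p n).2) Filter.atTop (nhds β) :=
    tendsto_of_tendsto_of_tendsto_of_le_of_le (by simpa using hz.const_sub β)
      tendsto_const_nhds hp6 hp7
  have hαD : α ∈ D := S.closed.mem_of_tendsto ta (.of_forall fun n => (hp1 n).1)
  have hβD : β ∈ D := S.closed.mem_of_tendsto tb (.of_forall fun n => (hp1 n).2.1)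
  have hR : R α β := S.lam.closed.mem_of_tendsto (ta.prodMk_nhds tb)
    (.of_forall fun n => (hp1 n).2.2.2.2.1)
  have fa : Filter.Tendsto (fun n => F (p n).1) Filter.atTop (nhds (F α)) :=
    (S.continuousOn α hαD).tendsto.comp
      (tendsto_nhdsWithin_iff.2 ⟨ta, .of_forall fun n => (hp1 n).1⟩)
  have fb : Filter.Tendsto (fun n => F (p n).2) Filter.atTop (nhds (F β)) :=
    (S.continuousOn β hβD).tendsto.comp
      (tendsto_nhdsWithin_iff.2 ⟨tb, .of_forall fun n => (hp1 n).2.1⟩)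
  have i1 : β ≤ F α := le_of_tendsto_of_tendsto' tb fa fun n => (hp1 n).2.2.2.2.2.1.le
  have i2 : F β ≤ α + 1 :=
    le_of_tendsto_of_tendsto' fb (ta.add_const 1) fun n => (hp1 n).2.2.2.2.2.2.le
  have i3 : α < t := lt_of_le_of_lt (csInf_le hAb hA0) hs₀
  have i4 : t < β := lt_of_lt_of_le hu₀ (le_csSup hBb hB0)
  -- In the limit the inequalities are only weak. The alternative in `memb_or` restores strictness:
  -- it would need α + 1 < F β.
  have hM : Memb R D F α β := by
    rcases S.memb_or hαD hβD (by linarith) (by linarith [(S.disp hαD).2]) hR with h | h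
    · exact h
    · linarith [h.2.2.2.2.2.1]
  refine ⟨α, β, hM, i3, i4, ?_, ?_⟩
  -- An arc around α overlaps (α, β); the union is an arc around t with a left endpoint below the
  -- infimum. The same applies to β.
  · rintro p q h ⟨h1, h2⟩
    have h3 := S.memb_sup (t := (α + min q β) / 2) h hM (by
      have : α ≤ min q β := le_min h2.le (by linarith)
      linarith) (by
      have : min q β ≤ q := min_le_left _ _
      linarith) (by
      have : α < min q β := lt_min h2 (by linarith)
      linarith) (by
      have : min q β ≤ β := min_le_right _ _
      linarith)
    have h4 : p ∈ A := ⟨_, by rwa [min_eq_left h1.le] at h3, by linarith,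
      lt_of_lt_of_le i4 (le_max_right _ _)⟩
    linarith [csInf_le hAb h4]
  · rintro p q h ⟨h1, h2⟩
    have h3 := S.memb_sup (t := (β + max p α) / 2) h hM (by
      have : p ≤ max p α := le_max_left _ _
      linarith) (by
      have : max p α ≤ β := max_le h1.le (by linarith)
      linarith) (by
      have : α ≤ max p α := le_max_right _ _
      linarith) (by
      have : max p α < β := max_lt h1 (by linarith)
      linarith)
    have h4 : q ∈ B := ⟨_, by rwa [max_eq_left h2.le] at h3,
      lt_of_le_of_lt (min_le_right _ _) i3, by linarith⟩
    linarith [le_csSup hBb h4]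

end RotSys


/-! ### Enlarging the gaps to holes of the core; monotonicity across gaps -/

/-- A rotation system all of whose gaps have their endpoints in the core. -/
structure MaxSys (R : ℝ → ℝ → Prop) (k : ℕ) (D : Set ℝ) (F : ℝ → ℝ) (G : ℝ → ℝ → Prop) : Prop
    extends RotSys R k D F G where
  gap_core : ∀ {e f}, G e f → e ∈ core R D F ∧ f ∈ core R D F

/-- A complementary arc of the core. -/
def CoreHole (R : ℝ → ℝ → Prop) (D : Set ℝ) (F : ℝ → ℝ) (s u : ℝ) : Prop :=
  Memb R D F s u ∧ s ∈ core R D F ∧ u ∈ core R D F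

theorem Memb.mono {R : ℝ → ℝ → Prop} {D D' : Set ℝ} {F : ℝ → ℝ} {s u : ℝ} (h : Memb R D F s u)
    (hs : s ∈ D') (hu : u ∈ D') : Memb R D' F s u :=
  ⟨hs, hu, h.2.2⟩

/-- Enlarging the gaps to complementary arcs of the core. -/
theorem RotSys.exists_maxSys {R : ℝ → ℝ → Prop} {k : ℕ} {D : Set ℝ} {F : ℝ → ℝ}
    {G : ℝ → ℝ → Prop} (S : RotSys R k D F G) :
    ∃ D₁ ⊆ D, ∃ G₁ : ℝ → ℝ → Prop, MaxSys R k D₁ F G₁ := by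
  -- Each new gap contains an old one and inherits from it the lower bound on the length and the
  -- bound on the number per period.
  set G₁ : ℝ → ℝ → Prop := fun s u => CoreHole R D F s u ∧ ∃ e f, G e f ∧ s ≤ e ∧ f ≤ u with hG₁
  set D₁ : Set ℝ := {t | t ∈ D ∧ ∀ s u, G₁ s u → ¬ (s < t ∧ t < u)} with hD₁
  have hsub : D₁ ⊆ D := fun t ht => ht.1
  have hcore : core R D F ⊆ D₁ := fun t ht => ⟨S.core_subset ht, fun s u h => ht s u h.1.1⟩
  have hmemb : ∀ {s u}, Memb R D₁ F s u → Memb R D F s u := fun h =>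
    h.mono (hsub h.1) (hsub h.2.1)
  have hcore' : core R D F ⊆ core R D₁ F := fun t ht s u h => ht s u (hmemb h)
  have hG : ∀ e f, G e f → ∃ s u, G₁ s u ∧ s ≤ e ∧ f ≤ u := by
    intro e f h
    obtain ⟨h1, -⟩ := S.gap h
    have h2 : (e + f) / 2 ∉ core R D F := fun hc =>
      hc e f (S.memb h) ⟨by linarith, by linarith⟩
    obtain ⟨s, u, h3, h4, h5, h6, h7⟩ := S.exists_hole h2
    have h8 : s ≤ e := by
      by_contra h9
      exact h6 e f (S.memb h) ⟨not_le.1 h9, by linarith⟩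
    have h9 : f ≤ u := by
      by_contra h9
      exact h7 e f (S.memb h) ⟨by linarith, not_le.1 h9⟩
    exact ⟨s, u, ⟨⟨h3, h6, h7⟩, e, f, h, h8, h9⟩, h8, h9⟩
  have hGper : ∀ {s u} (n : ℤ), G₁ s u → G₁ (s + n) (u + n) := by
    rintro s u n ⟨⟨h1, h2, h3⟩, e, f, h4, h5, h6⟩
    exact ⟨⟨S.memb_shift n h1, S.core_per n h2, S.core_per n h3⟩, e + n, f + n, S.gap_per n h4,
      by linarith, by linarith⟩
  refine ⟨D₁, hsub, G₁, ?_⟩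
  refine
    { lam := S.lam
      closed := ?_
      per := ?_
      map_add_int := S.map_add_int
      disp := fun ht => S.disp ht.1
      cong := fun ht => S.cong ht.1
      aff := fun h h' => S.aff h (h'.trans hsub)
      gap_per := hGper
      gap := ?_
      cover := ?_
      memb := ?_
      sep := ?_
      two := ?_
      nest := fun h h' => S.nest (hmemb h) (hmemb h')
      gap_core := fun h => ⟨hcore' h.1.2.1, hcore' h.1.2.2⟩
      gap_ex := ?_ }
  · rintro t n ⟨h1, h2⟩
    refine ⟨S.per n h1, fun s u h => ?_⟩
    rintro ⟨h3, h4⟩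
    have := hGper (-n) h
    refine h2 _ _ this ⟨?_, ?_⟩ <;> push_cast <;> linarith
  · have : D₁ = D ∩ ⋂ (s : ℝ) (u : ℝ) (_ : G₁ s u), (Set.Ioo s u)ᶜ := by
      ext t
      simp [hD₁]
    rw [this]
    exact S.closed.inter (isClosed_iInter fun s => isClosed_iInter fun u => isClosed_iInter fun _ =>
      isOpen_Ioo.isClosed_compl)
  · rintro e f h
    exact ⟨h.1.1.2.2.1, hcore h.1.2.1, hcore h.1.2.2, fun t h1 h2 ht => ht.2 e f h ⟨h1, h2⟩⟩
  · intro t ht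
    by_cases h : t ∈ D
    · have h2 : ¬ ∀ s u, G₁ s u → ¬ (s < t ∧ t < u) := fun h' => ht ⟨h, h'⟩
      simp only [not_forall, not_not] at h2
      obtain ⟨s, u, h3, h4⟩ := h2
      exact ⟨s, u, h3, h4⟩
    · obtain ⟨e, f, h1, h2, h3⟩ := S.cover h
      obtain ⟨s, u, h4, h5, h6⟩ := hG e f h1
      exact ⟨s, u, h4, by linarith, by linarith⟩
  · intro e f h
    exact h.1.1.mono (hcore h.1.2.1) (hcore h.1.2.2)
  · obtain ⟨δ, hδ, h⟩ := S.sep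
    refine ⟨δ, hδ, ?_⟩
    rintro s u ⟨-, e, f, h1, h2, h3⟩
    linarith [h e f h1]
  · rintro e₁ f₁ e₂ f₂ e₃ f₃ ⟨-, a, b, h1, h2, h3⟩ ⟨-, a', b', h1', h2', h3'⟩
      ⟨-, a'', b'', h1'', h2'', h3''⟩ h4 h5 h6
    exact S.two h1 h1' h1'' (by linarith) (by linarith) (by linarith)
  · obtain ⟨e, f, h⟩ := S.gap_ex
    obtain ⟨s, u, h1, -⟩ := hG e f h
    exact ⟨s, u, h1⟩

namespace MaxSys

variable {R : ℝ → ℝ → Prop} {k : ℕ} {D : Set ℝ} {F : ℝ → ℝ} {G : ℝ → ℝ → Prop}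

theorem gap_hole (S : MaxSys R k D F G) {e f : ℝ} (h : G e f) : CoreHole R D F e f :=
  ⟨S.memb h, S.gap_core h⟩

theorem core_add_one (S : MaxSys R k D F G) {t : ℝ} (ht : t ∈ core R D F) :
    t + 1 ∈ core R D F := by
  simpa using S.core_per 1 ht

theorem hole_shift (S : MaxSys R k D F G) {s u : ℝ} (n : ℤ) (h : CoreHole R D F s u) :
    CoreHole R D F (s + n) (u + n) :=
  ⟨S.memb_shift n h.1, S.core_per n h.2.1, S.core_per n h.2.2⟩

/-- A third point q of the class outside of the arc leads to `not_three`: since u and s lie in the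
core, neither (s, q) nor (q, u + 1) is moved off itself, hence (q, s + 1) and (u, q) are, together
with (s, u). -/
theorem not_rel_of_hole_aux (S : MaxSys R k D F G) {s u q : ℝ} (h : CoreHole R D F s u)
    (hq : q ∈ D) (h1 : u < q) (h2 : q < s + 1) : ¬ R s q := by
  intro hR
  obtain ⟨hM, hs, hu⟩ := h
  obtain ⟨a1, a2, a3, a4, a5, a6, a7⟩ := hM
  have h3 : Memb R D F q (s + 1) := by
    rcases S.memb_or a1 hq (by linarith) h2 hR with h | h
    · exact (hu _ _ h ⟨a3, h1⟩).elim
    · exact h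
  have h4 : Memb R D F u q := by
    rcases S.memb_or a2 hq h1 (by linarith) (S.lam.trans (S.lam.symm a5) hR) with h | h
    · exact h
    · exact (S.core_add_one hs _ _ h ⟨h2, by linarith⟩).elim
  exact S.not_three ⟨a1, a2, a3, a4, a5, a6, a7⟩ h4 h3

/-- The class of the endpoints of a complementary arc of the core lies in the closed arc. -/
theorem not_rel_of_hole (S : MaxSys R k D F G) {s u q : ℝ} (h : CoreHole R D F s u)
    (h1 : u < q) (h2 : q < s + 1) : ¬ R s q := by
  intro hR
  by_cases hq : q ∈ D
  · exact S.not_rel_of_hole_aux h hq h1 h2 hR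
  obtain ⟨e, f, h3, h4, h5⟩ := S.cover hq
  obtain ⟨g1, g2, g3, g4⟩ := S.gap h3
  have hue : u ≤ e := by
    by_contra h6
    exact h.2.2 e f (S.memb h3) ⟨not_le.1 h6, by linarith⟩
  have hfs : f ≤ s + 1 := by
    by_contra h6
    exact S.core_add_one h.2.1 e f (S.memb h3) ⟨by linarith, not_le.1 h6⟩
  have hsu := h.1.2.2.1
  have hef : R e f := (S.memb h3).2.2.2.2.1
  -- The point q lies in the gap (e, f) and s outside of it, so the leaf s q crosses the leaf e f or
  -- they share an endpoint. An endpoint of the gap, which lies in D, can now replace q.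
  have hse : R s e := by
    rcases eq_or_lt_of_le hfs with h6 | h6
    · exact S.lam.symm (by simpa [h6] using S.lam.sub_one hef)
    · have := S.lam.cross h4 h5 h6 (by linarith) hef (S.lam.add_one (S.lam.symm hR))
      exact S.lam.trans hR (S.lam.symm this)
  rcases eq_or_lt_of_le hue with h6 | h6
  · subst h6
    rcases eq_or_lt_of_le hfs with h7 | h7
    · subst h7
      exact PreSys.memb_excl h.1 (S.memb h3)
    · exact S.not_rel_of_hole_aux h g3 g1 h7 (S.lam.trans hse hef)
  · exact S.not_rel_of_hole_aux h g2 h6 (by linarith) hse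

/-- A point of `D` related to a point inside of a gap is an endpoint of the gap. -/
theorem eq_of_rel_gap (S : MaxSys R k D F G) {e f v w : ℝ} (h : G e f) (h1 : e < v) (h2 : v < f)
    (h3 : f ≤ w) (h4 : w ≤ e + 1) (hR : R v w) : w = f ∨ w = e + 1 := by
  by_contra h5
  simp only [not_or] at h5
  have h6 : f < w := lt_of_le_of_ne h3 (Ne.symm h5.1)
  have h7 : w < e + 1 := lt_of_le_of_ne h4 h5.2
  have hef : R e f := (S.memb h).2.2.2.2.1
  have := S.lam.cross h1 h2 h6 h7 hef hR
  exact S.not_rel_of_hole (S.gap_hole h) h6 h7 (S.lam.trans this hR)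

/-- Suppose that F reverses the gap (s, u), with both images in the closed hole [p, q]. As F is
affine on [q, s + 1], it takes the value p + 1 at some w there, and the class of w has a further
point v over q. Every position of v is impossible: it contradicts the affine form of F, the
description of the class of a hole, or the fact that s is in the core. -/
theorem gap_mono_aux (S : MaxSys R k D F G) {s u p q : ℝ} (h : G s u) (hlt : F u < F s)
    (hpq : CoreHole R D F p q) (h1 : u ≤ p) (h2 : p ≤ F u) (h3 : F s ≤ q) (h4 : q ≤ s + 1)
    (hD : Set.Icc q (s + 1) ⊆ D) : False := by
  obtain ⟨g1, g2, g3, g4⟩ := S.gap h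
  obtain ⟨a1, a2, a3, a4, a5, a6, a7⟩ := hpq.1
  have hl : (0 : ℝ) < 3 ^ k := by positivity
  have haff : ∀ {x y}, q ≤ x → x ≤ y → y ≤ s + 1 → F y - F x = 3 ^ k * (y - x) :=
    fun hx hxy hy => S.aff hxy fun z hz => hD ⟨hx.trans hz.1, hz.2.trans hy⟩
  have e1 := haff le_rfl h4 le_rfl
  rw [S.map_add_one] at e1
  -- The solution of F w = p + 1; it lies in (q, s + 1) because F q < p + 1 < F s + 1.
  set w := q + (p + 1 - F q) / 3 ^ k with hw
  have hw1 : q < w := by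
    have : 0 < (p + 1 - F q) / 3 ^ k := div_pos (by linarith) hl
    linarith
  have hw2 : w < s + 1 := by
    have : (p + 1 - F q) / 3 ^ k < s + 1 - q := by
      rw [div_lt_iff₀ hl]; linarith
    linarith
  have hFw : F w = p + 1 := by
    have e2 := haff le_rfl hw1.le hw2.le
    have e3 : (3 : ℝ) ^ k * (w - q) = p + 1 - F q := by
      rw [hw]; field_simp; ring
    linarith
  have hwD : w ∈ D := hD ⟨hw1.le, hw2.le⟩
  obtain ⟨n, hn⟩ := S.cong hwD
  have hR1 : R (3 ^ k * w) q := by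
    have h5 : R (F w) q := by
      rw [hFw]
      exact S.lam.symm (S.lam.add_one (S.lam.symm a5))
    rw [hn] at h5
    exact S.lam.symm (S.lam.of_shift n (S.lam.symm h5))
  -- The class of w is mapped onto the class of p, which contains q. The chosen point over q is then
  -- translated into [w - 1, w).
  obtain ⟨v₀, hv₀, m, hm⟩ := S.lam.back_pow k hR1
  obtain ⟨v, hvw, hv1, hv2, j, hj⟩ : ∃ v, R w v ∧ w - 1 ≤ v ∧ v < w ∧ ∃ j : ℤ, 3 ^ k * v = q + j := by
    refine ⟨v₀ + (-⌊v₀ - (w - 1)⌋ : ℤ), S.lam.shift_right hv₀ _, ?_, ?_, ?_⟩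
    · have := Int.floor_le (v₀ - (w - 1)); push_cast; linarith
    · have := Int.lt_floor_add_one (v₀ - (w - 1)); push_cast; linarith
    · refine ⟨m - 3 ^ k * ⌊v₀ - (w - 1)⌋, ?_⟩
      push_cast; linarith
  -- values of `F` at preimages of `q`
  have hFv : ∀ {x : ℝ}, x ∈ D → (∃ j : ℤ, 3 ^ k * x = q + j) → ∃ i : ℤ, F x = q + i := by
    rintro x hx ⟨j, hj⟩
    obtain ⟨i, hi⟩ := S.cong hx
    exact ⟨j + i, by rw [hi, hj]; push_cast; ring⟩
  have hsw : ¬ R s w := S.not_rel_of_hole (S.gap_hole h) (by linarith) hw2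
  have hpw : ¬ R p w := S.not_rel_of_hole hpq hw1 (by linarith)
  -- A gap around v would have w as an endpoint modulo one, but D contains an interval on either
  -- side of w.
  have hvD : v ∈ D := by
    by_contra hvD
    obtain ⟨e, f, b1, b2, b3⟩ := S.cover hvD
    obtain ⟨c1, c2, c3, c4⟩ := S.gap b1
    have hf : f ≤ w := by
      by_contra h5
      exact c4 w (by linarith) (not_le.1 h5) hwD
    have he : w ≤ e + 1 := by
      by_contra h5
      exact c4 (w - 1) (by linarith) (by linarith) (S.sub_one_mem hwD)
    rcases S.eq_of_rel_gap b1 b2 b3 hf he (S.lam.symm hvw) with h5 | h5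
    · have : max ((e + f) / 2) ((q + w) / 2) ∈ D := hD ⟨by
        have := le_max_right ((e + f) / 2) ((q + w) / 2); linarith,
        max_le (by linarith) (by linarith)⟩
      exact c4 _ (lt_of_lt_of_le (by linarith) (le_max_left _ _))
        (max_lt (by linarith) (by linarith)) this
    · have h6 : min ((e + f) / 2 + 1) ((w + s + 1) / 2) ∈ D := hD
        ⟨le_min (by linarith) (by linarith), (min_le_right _ _).trans (by linarith)⟩
      have h7 := S.sub_one_mem h6
      refine c4 _ ?_ ?_ h7
      · have : e + 1 < min ((e + f) / 2 + 1) ((w + s + 1) / 2) :=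
          lt_min (by linarith) (by linarith)
        linarith
      · have := min_le_left ((e + f) / 2 + 1) ((w + s + 1) / 2)
        linarith
  rcases lt_or_ge v p with c1 | c1
  · rcases le_or_gt u v with c2 | c2
    · -- a larger arc around the gap
      obtain ⟨i, hi⟩ := hFv hvD ⟨j, hj⟩
      have d := S.disp hvD
      have hi0 : i = 0 := by
        have i1 : (i : ℝ) < 1 := by linarith
        have i2 : (-1 : ℝ) < i := by linarith
        have i1' : i < 1 := by exact_mod_cast i1
        have i2' : -1 < i := by exact_mod_cast i2
        omega
      subst hi0
      have : Memb R D F w (v + 1) := by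
        refine ⟨hwD, S.add_one_mem hvD, by linarith, by linarith, S.lam.add_one hvw, by linarith, ?_⟩
        rw [S.map_add_one, hi]; push_cast; linarith
      exact S.core_add_one (S.gap_core h).1 _ _ this ⟨hw2, by linarith⟩
    · rcases le_or_gt v s with c3 | c3
      · -- `v + 1` in `[w, s + 1]`
        have hv' : v + 1 ∈ D := S.add_one_mem hvD
        obtain ⟨i, hi⟩ := hFv hv' ⟨j + 3 ^ k, by push_cast; linarith⟩
        have d := S.disp hv'
        have e2 := haff (x := v + 1) (y := s + 1) (by linarith) (by linarith) le_rfl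
        rw [S.map_add_one s] at e2
        have hi0 : (1 : ℝ) ≤ i := by
          have i2 : (0 : ℝ) < i := by linarith
          have i2' : 0 < i := by exact_mod_cast i2
          exact_mod_cast i2'
        have h6 : (3 : ℝ) ^ k * (s + 1 - (v + 1)) ≤ 0 := by linarith
        have h7 : s + 1 - (v + 1) ≤ 0 := by
          by_contra h8
          have := mul_pos hl (not_le.1 h8)
          linarith
        have h8 : v = s := by linarith
        exact hsw (S.lam.symm (h8 ▸ hvw))
      · exact g4 v c3 c2 hvD
  · rcases le_or_gt v q with c2 | c2
    · have : R p v := by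
        rcases eq_or_lt_of_le c1 with c3 | c3
        · rw [← c3]; exact S.lam.refl _
        rcases eq_or_lt_of_le c2 with c4 | c4
        · rw [c4]; exact a5
        exact S.lam.cross c3 c4 hw1 (by linarith) a5 (S.lam.symm hvw)
      exact hpw (S.lam.trans this (S.lam.symm hvw))
    · obtain ⟨i, hi⟩ := hFv hvD ⟨j, hj⟩
      have d := S.disp hvD
      have e2 := haff c2.le hv2.le hw2.le
      have h6 := mul_pos hl (sub_pos.2 hv2)
      have i1 : (0 : ℝ) < i := by linarith
      have i2 : (i : ℝ) < 1 := by linarith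
      have i1' : 0 < i := by exact_mod_cast i1
      have i2' : i < 1 := by exact_mod_cast i2
      omega

theorem memb_reflect (S : MaxSys R k D F G) {s u : ℝ} :
    Memb (fun s t => R (-s) (-t)) {t | -t ∈ D} (fun t => 1 - F (-t)) s u ↔
      Memb R D F (-u) (-s) := by
  constructor
  · rintro ⟨h1, h2, h3, h4, h5, h6, h7⟩
    exact ⟨h2, h1, by linarith, by linarith, S.lam.symm h5, by linarith, by linarith⟩
  · rintro ⟨h1, h2, h3, h4, h5, h6, h7⟩
    exact ⟨h2, h1, by linarith, by linarith, S.lam.symm h5, by linarith, by linarith⟩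

theorem core_reflect (S : MaxSys R k D F G) {t : ℝ} :
    t ∈ core (fun s t => R (-s) (-t)) {t | -t ∈ D} (fun t => 1 - F (-t)) ↔
      -t ∈ core R D F := by
  constructor
  · intro h s u hM hh
    refine h (-u) (-s) (S.memb_reflect.2 (by simpa using hM)) ⟨by linarith [hh.2], by linarith [hh.1]⟩
  · intro h s u hM hh
    exact h _ _ (S.memb_reflect.1 hM) ⟨by linarith [hh.2], by linarith [hh.1]⟩

/-- Orientation reversal. The summand 1 in the conjugated lift brings the displacement back from
(-1, 0) to (0, 1). -/
theorem reflect (S : MaxSys R k D F G) : MaxSys (fun s t => R (-s) (-t)) k {t | -t ∈ D}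
    (fun t => 1 - F (-t)) (fun e f => G (-f) (-e)) where
  lam := S.lam.reflect
  closed := S.closed.preimage continuous_neg
  per {t} n ht := by
    have := S.per (-n) ht
    change -(t + n) ∈ D
    convert this using 1
    push_cast; ring
  map_add_int t n := by
    have := S.map_add_int (-t) (-n)
    push_cast at this
    rw [neg_add, this]; ring
  disp {t} ht := by
    have := S.disp ht
    constructor <;> linarith
  cong {t} ht := by
    obtain ⟨n, hn⟩ := S.cong ht
    exact ⟨1 - n, by rw [hn]; push_cast; ring⟩
  aff {s t} h h' := by
    have := S.aff (s := -t) (t := -s) (by linarith) (fun x hx => by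
      have := h' (show -x ∈ Set.Icc s t from ⟨by linarith [hx.2], by linarith [hx.1]⟩)
      simpa using this)
    linarith
  gap_per {e f} n h := by
    have := S.gap_per (-n) h
    push_cast at this
    simpa only [neg_add] using this
  gap {e f} h := by
    obtain ⟨h1, h2, h3, h4⟩ := S.gap h
    exact ⟨by linarith, h3, h2, fun t ht1 ht2 => h4 (-t) (by linarith) (by linarith)⟩
  cover {t} ht := by
    obtain ⟨e, f, h1, h2, h3⟩ := S.cover ht
    exact ⟨-f, -e, by simpa using h1, by linarith, by linarith⟩
  memb h := S.memb_reflect.2 (S.memb h)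
  sep := by
    obtain ⟨δ, h1, h2⟩ := S.sep
    exact ⟨δ, h1, fun e f h => by linarith [h2 _ _ h]⟩
  two {e₁ f₁ e₂ f₂ e₃ f₃} h1 h2 h3 h4 h5 h6 :=
    S.two h3 h2 h1 (by linarith) (by linarith) (by linarith)
  nest {s u p q} h1 h2 h3 h4 h5 := by
    have h1' := S.memb_reflect.1 h1
    have h2' := S.memb_shift 1 (S.memb_reflect.1 h2)
    refine S.nest (p := -q) (q := -p) h1' ?_ (by linarith) (by linarith) (by linarith)
    convert h2' using 1 <;> (try push_cast) <;> ring
  gap_core h := by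
    have := S.gap_core h
    exact ⟨S.core_reflect.2 this.2, S.core_reflect.2 this.1⟩
  gap_ex := by
    obtain ⟨e, f, h⟩ := S.gap_ex
    exact ⟨-f, -e, by simpa using h⟩

/-- The lift is monotone across gaps. -/
theorem gap_mono (S : MaxSys R k D F G) {s u : ℝ} (h : G s u) : F s ≤ F u := by
  by_contra hlt
  rw [not_le] at hlt
  obtain ⟨a1, a2, a3, a4, a5, a6, a7⟩ := S.memb h
  have hRF : R (F u) (F s) := S.lam.symm (S.map_rel a1 a2 a5)
  have dU := S.disp a2
  have dS := S.disp a1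
  have hcs := S.core_add_one (S.gap_core h).1
  have hcu := (S.gap_core h).2
  -- The closed interval between the reversed images lies in a closed hole of the core. If both
  -- images are in D, their leaf has an arc moved off itself, and the arc containing s + 1 is not an
  -- option. If one image is in a gap, that gap contains the other one in its closure.
  obtain ⟨p, q, hpq, h1, h2⟩ : ∃ p q, CoreHole R D F p q ∧ p ≤ F u ∧ F s ≤ q := by
    have key : ∀ e f, G e f → ∀ x y, u < x → x < s + 1 → u < y → y < s + 1 → R x y → e < x → x < f →
        e ≤ y ∧ y ≤ f := by
      intro e f hef x y hx1 hx2 hy1 hy2 hxy hex hxf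
      have hue : u ≤ e := by
        by_contra h6
        exact hcu e f (S.memb hef) ⟨not_le.1 h6, by linarith⟩
      have hfs : f ≤ s + 1 := by
        by_contra h6
        exact hcs e f (S.memb hef) ⟨by linarith, not_le.1 h6⟩
      by_contra hc
      rw [not_and_or, not_le, not_le] at hc
      rcases hc with hc | hc
      · rcases S.eq_of_rel_gap hef hex hxf (w := y + 1) (by linarith) (by linarith)
          (S.lam.add_one hxy) with h5 | h5 <;> linarith
      · rcases S.eq_of_rel_gap hef hex hxf (w := y) (by linarith) (by linarith)
          hxy with h5 | h5 <;> linarith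
    by_cases hu : F u ∈ D
    · by_cases hs : F s ∈ D
      · rcases S.memb_or hu hs hlt (by linarith) hRF with hM | hM
        · have h2 : (F u + F s) / 2 ∉ core R D F := fun hc =>
            hc _ _ hM ⟨by linarith, by linarith⟩
          obtain ⟨p, q, h3, h4, h5, h6, h7⟩ := S.exists_hole h2
          refine ⟨p, q, ⟨h3, h6, h7⟩, ?_, ?_⟩
          · by_contra h8
            exact h6 _ _ hM ⟨not_le.1 h8, by linarith⟩
          · by_contra h8
            exact h7 _ _ hM ⟨by linarith, not_le.1 h8⟩
        · exact (hcs _ _ hM ⟨by linarith, by linarith⟩).elim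
      · obtain ⟨e, f, h1, h2, h3⟩ := S.cover hs
        have := key e f h1 (F s) (F u) (by linarith) (by linarith) (by linarith) (by linarith)
          (S.lam.symm hRF) h2 h3
        exact ⟨e, f, S.gap_hole h1, this.1, h3.le⟩
    · obtain ⟨e, f, h1, h2, h3⟩ := S.cover hu
      have := key e f h1 (F u) (F s) (by linarith) (by linarith) (by linarith) (by linarith)
        hRF h2 h3
      exact ⟨e, f, S.gap_hole h1, h2.le, this.2⟩
  have hup : u ≤ p := by
    by_contra h6
    exact hcu p q hpq.1 ⟨not_le.1 h6, by linarith⟩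
  have hqs : q ≤ s + 1 := by
    by_contra h6
    exact hcs p q hpq.1 ⟨by linarith, not_le.1 h6⟩
  by_cases hD : Set.Icc q (s + 1) ⊆ D
  · exact S.gap_mono_aux h hlt hpq hup h1 h2 hqs hD
  -- A gap in [u, p], one in [q, s + 1] and (s, u) itself would be three in one period. So one of
  -- the two intervals is free of gaps, and reflection exchanges them.
  have hD' : Set.Icc u p ⊆ D := by
    rw [Set.not_subset] at hD
    obtain ⟨x, hx, hxD⟩ := hD
    obtain ⟨e, f, b1, b2, b3⟩ := S.cover hxD
    have hqe : q ≤ e := by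
      by_contra h6
      exact hpq.2.2 _ _ (S.memb b1) ⟨not_le.1 h6, by linarith [hx.1]⟩
    have hfs : f ≤ s + 1 := by
      by_contra h6
      exact hcs _ _ (S.memb b1) ⟨by linarith [hx.2], not_le.1 h6⟩
    intro y hy
    by_contra hyD
    obtain ⟨e', f', c1, c2, c3⟩ := S.cover hyD
    have hue : u ≤ e' := by
      by_contra h6
      exact hcu _ _ (S.memb c1) ⟨not_le.1 h6, by linarith [hy.1]⟩
    have hfp : f' ≤ p := by
      by_contra h6
      exact hpq.2.1 _ _ (S.memb c1) ⟨by linarith [hy.2], not_le.1 h6⟩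
    have := hpq.1.2.2.1
    exact S.two h c1 b1 hue (by linarith) hfs
  have hM : CoreHole (fun s t => R (-s) (-t)) {t | -t ∈ D} (fun t => 1 - F (-t))
      (1 - q) (1 - p) := by
    have hq' := S.hole_shift (-1) hpq
    have hq1 : Memb R D F (-(1 - p)) (-(1 - q)) := by
      convert hq'.1 using 1 <;> push_cast <;> ring
    refine ⟨S.memb_reflect.2 hq1, S.core_reflect.2 ?_, S.core_reflect.2 ?_⟩
    · convert hq'.2.2 using 1; push_cast; ring
    · convert hq'.2.1 using 1; push_cast; ring
  have hG : G (- -s) (- -u) := by simpa using h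
  refine S.reflect.gap_mono_aux (s := -u) (u := -s) (p := 1 - q) (q := 1 - p) hG ?_ hM
    (by linarith) ?_ ?_ (by linarith) ?_
  · simp only [neg_neg]; linarith
  · simp only [neg_neg]; linarith
  · simp only [neg_neg]; linarith
  · intro x hx
    change -x ∈ D
    have : -x + 1 ∈ D := hD' ⟨by linarith [hx.2], by linarith [hx.1]⟩
    simpa using S.sub_one_mem this

end MaxSys


/-! ### Monotonicity of the lift and invariance of the core -/

namespace MaxSys

variable {R : ℝ → ℝ → Prop} {k : ℕ} {D : Set ℝ} {F : ℝ → ℝ} {G : ℝ → ℝ → Prop}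

theorem right_cases (S : MaxSys R k D F G) {t : ℝ} (ht : t ∈ D) :
    (∃ f, G t f) ∨ ∃ ε > 0, Set.Icc t (t + ε) ⊆ D := by
  obtain ⟨δ, hδ, hs⟩ := S.sep
  by_cases h : ∃ f, G t f
  · exact Or.inl h
  right
  by_cases h' : ∃ e f, G e f ∧ t < e ∧ e < t + δ
  · obtain ⟨e, f, h1, h2, h3⟩ := h'
    refine ⟨e - t, by linarith, ?_⟩
    rw [add_sub_cancel]
    exact S.icc_subset hs ht (S.gap h1).2.1 (by linarith)
  · refine ⟨δ / 2, by linarith, fun x hx => ?_⟩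
    by_contra hxD
    obtain ⟨e, f, h1, h2, h3⟩ := S.cover hxD
    obtain ⟨g1, g2, g3, g4⟩ := S.gap h1
    rcases lt_trichotomy t e with h4 | h4 | h4
    · exact h' ⟨e, f, h1, h4, by linarith [hx.2]⟩
    · exact h ⟨f, h4 ▸ h1⟩
    · exact g4 t h4 (by linarith [hx.1]) ht

/-- A continuity argument: the greatest m in D ∩ [s, t] with F s ≤ F m is t, since from any smaller
m one proceeds across a gap by `gap_mono` or along an affine piece. -/
theorem mono (S : MaxSys R k D F G) {s t : ℝ} (hs : s ∈ D) (ht : t ∈ D) (hst : s ≤ t) :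
    F s ≤ F t := by
  have hcl : IsClosed ((D ∩ Set.Icc s t) ∩ F ⁻¹' Set.Ici (F s)) :=
    (S.continuousOn.mono Set.inter_subset_left).preimage_isClosed_of_isClosed
      (S.closed.inter isClosed_Icc) isClosed_Ici
  have hcp : IsCompact ((D ∩ Set.Icc s t) ∩ F ⁻¹' Set.Ici (F s)) :=
    isCompact_Icc.of_isClosed_subset hcl fun x hx => hx.1.2
  obtain ⟨m, ⟨⟨hm1, hm2⟩, hm3⟩, hm⟩ := hcp.exists_isGreatest
    ⟨s, ⟨hs, le_rfl, hst⟩, le_refl (F s)⟩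
  have hm3 : F s ≤ F m := hm3
  rcases eq_or_lt_of_le hm2.2 with h | h
  · rwa [← h]
  exfalso
  rcases S.right_cases hm1 with ⟨f, hf⟩ | ⟨ε, h1, h2⟩
  · obtain ⟨g1, g2, g3, g4⟩ := S.gap hf
    have hft : f ≤ t := by
      by_contra h5
      exact g4 t h (not_le.1 h5) ht
    have : f ≤ m := hm ⟨⟨g3, by linarith [hm2.1], hft⟩, hm3.trans (S.gap_mono hf)⟩
    linarith
  · have h3 : m < min (m + ε) t := lt_min (by linarith) h
    have h4 : Set.Icc m (min (m + ε) t) ⊆ D := fun x hx =>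
      h2 ⟨hx.1, hx.2.trans (min_le_left _ _)⟩
    have h5 := S.aff h3.le h4
    have h6 : (0 : ℝ) ≤ 3 ^ k * (min (m + ε) t - m) := by
      have := sub_pos.2 h3; positivity
    have h7 : min (m + ε) t ≤ m := hm ⟨⟨h4 ⟨h3.le, le_rfl⟩, by linarith [hm2.1], min_le_right _ _⟩,
      show F s ≤ F (min (m + ε) t) by linarith⟩
    linarith

theorem lt_of_map_lt (S : MaxSys R k D F G) {s t : ℝ} (hs : s ∈ D) (ht : t ∈ D) (h : F s < F t) :
    s < t := by
  by_contra h'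
  linarith [S.mono ht hs (not_lt.1 h')]

theorem gap_of_map_eq_aux (S : MaxSys R k D F G) {s t : ℝ} (hs : s ∈ D) (ht : t ∈ D) (hst : s < t)
    (h : F s = F t) : ∃ f, G s f ∧ f ≤ t := by
  rcases S.right_cases hs with ⟨f, hf⟩ | ⟨ε, h1, h2⟩
  · refine ⟨f, hf, ?_⟩
    by_contra h5
    exact (S.gap hf).2.2.2 t hst (not_le.1 h5) ht
  · have h3 : s < min (s + ε) t := lt_min (by linarith) hst
    have h4 : Set.Icc s (min (s + ε) t) ⊆ D := fun x hx =>
      h2 ⟨hx.1, hx.2.trans (min_le_left _ _)⟩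
    have h5 := S.aff h3.le h4
    have h6 : (0 : ℝ) < 3 ^ k * (min (s + ε) t - s) := by
      have := sub_pos.2 h3; positivity
    have h7 := S.mono (h4 ⟨h3.le, le_rfl⟩) ht (min_le_right _ _)
    linarith

/-- The lift identifies only endpoints of gaps. -/
theorem gap_of_map_eq (S : MaxSys R k D F G) {s t : ℝ} (hs : s ∈ D) (ht : t ∈ D) (hst : s < t)
    (h : F s = F t) : G s t := by
  obtain ⟨f, hf, hft⟩ := S.gap_of_map_eq_aux hs ht hst h
  obtain ⟨g1, g2, g3, g4⟩ := S.gap hf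
  rcases eq_or_lt_of_le hft with h1 | h1
  · rwa [← h1]
  exfalso
  -- If f < t, then a second gap starts at f, and its other end is a third point of the class of s
  -- outside of the hole (s, f).
  have h2 : F f = F t := le_antisymm (S.mono g3 ht hft) (by rw [← h]; exact S.gap_mono hf)
  obtain ⟨f', hf', hft'⟩ := S.gap_of_map_eq_aux g3 ht h1 h2
  have h3 := S.disp hs
  have h4 := S.disp ht
  exact S.not_rel_of_hole (S.gap_hole hf) (S.gap hf').1 (by linarith)
    (S.lam.trans (S.memb hf).2.2.2.2.1 (S.memb hf').2.2.2.2.1)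

/-- This is the covering condition for the complementary arc (f, e + 1), which is a hole of its
class by `not_rel_of_hole`. -/
theorem gap_cov (S : MaxSys R k D F G) {e f : ℝ} (h : G e f) :
    (∀ w, R (F f) w → ∃ n : ℤ, w = F f + n) ∨
      (F e < F f ∧ ∀ w, F f < w → w < F e + 1 → ¬ R (F f) w) := by
  obtain ⟨a1, a2, a3, a4, a5, a6, a7⟩ := S.memb h
  obtain ⟨m, hm⟩ := S.cong a2
  obtain ⟨m', hm'⟩ := S.cong a1
  have hfe : R f (e + 1) := S.lam.add_one (S.lam.symm a5)
  have hole : ∀ w, f < w → w < e + 1 → ¬ R f w := fun w h1 h2 h3 =>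
    S.not_rel_of_hole (S.gap_hole h) h1 h2 (S.lam.trans a5 h3)
  have hback : ∀ w, R (F f) w → R (3 ^ k * f) (w - m) := fun w hw => by
    rw [hm] at hw
    have := S.lam.shift hw (-m) (-m)
    convert this using 1 <;> push_cast <;> ring
  rcases S.lam.cov_pow k (by linarith) (by linarith) hfe hole with h1 | ⟨n, h1, h2, h3⟩
  · left
    intro w hw
    obtain ⟨n, hn⟩ := h1 _ (hback w hw)
    exact ⟨n, by rw [hm]; linarith⟩
  · right
    have i1 := S.mono a1 a2 a3.le
    have i2 := S.mono a2 (S.add_one_mem a1) a4.le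
    rw [S.map_add_one] at i2
    -- The right end of the image hole is F e + j. Monotonicity of F at e ≤ f ≤ e + 1 leaves only j
    -- = 1.
    obtain ⟨j, hj⟩ : ∃ j : ℤ, 3 ^ k * (e + 1) - n + m = F e + j :=
      ⟨3 ^ k - n + m - m', by rw [hm']; push_cast; ring⟩
    have j1 : (0 : ℝ) < j := by linarith
    have j2 : (j : ℝ) < 2 := by linarith
    have j1' : 0 < j := by exact_mod_cast j1
    have j2' : j < 2 := by exact_mod_cast j2
    have j3 : j = 1 := by omega
    subst j3
    push_cast at hj
    refine ⟨by linarith, fun w hw1 hw2 hw => h3 (w - m) (by linarith) (by linarith) (hback w hw)⟩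

theorem single_of_map_eq (S : MaxSys R k D F G) {e f : ℝ} (h : G e f) (h' : F e = F f) :
    ∀ w, R (F f) w → ∃ n : ℤ, w = F f + n := by
  rcases S.gap_cov h with h1 | h1
  · exact h1
  · linarith [h1.1]

/-- The point p is moved beyond q by less than a full turn, so no integer translate of F p lies in
[p, q]. -/
theorem not_maps_into (S : MaxSys R k D F G) {p q : ℝ} (h : CoreHole R D F p q) (y : ℝ)
    (hy : ∀ t ∈ D, y ≤ t → t < y + 1 → p ≤ F t ∧ F t ≤ q) : False := by
  obtain ⟨a1, a2, a3, a4, a5, a6, a7⟩ := h.1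
  have hd := S.disp a1
  have h1 := hy (p + (-⌊p - y⌋ : ℤ)) (S.per _ a1)
    (by have := Int.floor_le (p - y); push_cast; linarith)
    (by have := Int.lt_floor_add_one (p - y); push_cast; linarith)
  rw [S.map_add_int] at h1
  generalize -⌊p - y⌋ = n at h1
  have n1 : (n : ℝ) < 0 := by linarith [h1.2]
  have n1' : n < 0 := by exact_mod_cast n1
  have n2 : (-1 : ℝ) < n := by linarith [h1.1]
  have n2' : -1 < n := by exact_mod_cast n2
  omega

/-- The core is invariant. -/
theorem map_core (S : MaxSys R k D F G) {x : ℝ} (hx : x ∈ core R D F) : F x ∈ core R D F := by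
  by_contra hFx
  obtain ⟨p, q, hM, hp, hq, hpc, hqc⟩ := S.exists_hole hFx
  have hole : CoreHole R D F p q := ⟨hM, hpc, hqc⟩
  obtain ⟨a1, a2, a3, a4, a5, a6, a7⟩ := hM
  have hxD := S.core_subset hx
  have hcl : IsClosed ((D ∩ Set.Icc (x - 1) x) ∩ F ⁻¹' Set.Iic p) :=
    (S.continuousOn.mono Set.inter_subset_left).preimage_isClosed_of_isClosed
      (S.closed.inter isClosed_Icc) isClosed_Iic
  have hcp : IsCompact ((D ∩ Set.Icc (x - 1) x) ∩ F ⁻¹' Set.Iic p) :=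
    isCompact_Icc.of_isClosed_subset hcl fun x hx => hx.1.2
  -- The last point before x whose image has not passed p. The aim is a leaf arc from v over x to a
  -- point above q.
  obtain ⟨v, ⟨⟨hv1, hv2⟩, hv3⟩, hv⟩ := hcp.exists_isGreatest
    ⟨x - 1, ⟨S.sub_one_mem hxD, le_rfl, by linarith⟩, show F (x - 1) ≤ p by
      rw [S.map_sub_one]; linarith⟩
  have hv3 : F v ≤ p := hv3
  have hvx : v < x := lt_of_le_of_ne hv2.2 (by rintro rfl; linarith)
  have hgt : ∀ t ∈ D, v < t → t ≤ x → p < F t := by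
    intro t ht h1 h2
    by_contra h3
    have : t ≤ v := hv ⟨⟨ht, by linarith [hv2.1], h2⟩, not_lt.1 h3⟩
    linarith
  by_cases hR : ∃ f, G v f
  · obtain ⟨f, hf⟩ := hR
    obtain ⟨g1, g2, g3, g4⟩ := S.gap hf
    have hfx : f ≤ x := by
      by_contra h5
      exact g4 x hvx (not_le.1 h5) hxD
    have h1 := hgt f g3 g1 hfx
    have h2 := S.mono g3 hxD hfx
    have hrel : R (F v) (F f) := S.map_rel g2 g3 (S.memb hf).2.2.2.2.1
    rcases eq_or_lt_of_le hv3 with h3 | h3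
    · rcases S.gap_cov hf with h4 | ⟨h4, h5⟩
      · obtain ⟨n, hn⟩ := h4 _ (S.lam.symm hrel)
        rw [h3] at hn
        have n1 : (n : ℝ) < 0 := by linarith
        have n1' : n < 0 := by exact_mod_cast n1
        have n2 : (-1 : ℝ) < n := by linarith
        have n2' : -1 < n := by exact_mod_cast n2
        omega
      · rw [h3] at h5 hrel
        exact h5 q (by linarith) a4 (S.lam.trans (S.lam.symm hrel) a5)
    · rcases lt_or_ge (q - 1) (F v) with h4 | h4
      · have h5 := S.lam.cross h3 h1 (by linarith) (by linarith) hrel a5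
        exact S.not_rel_of_hole hole (q := F v + 1) (by linarith) (by linarith)
          (S.lam.add_one (S.lam.symm h5))
      -- The images of f and of v + 1 bound all images of D in between, and both lie in [p, q].
      · refine S.not_maps_into hole f fun t ht ht1 ht2 => ?_
        have h5 := S.mono g3 ht ht1
        have h6 : t - 1 ≤ v := by
          by_contra h7
          exact g4 (t - 1) (not_le.1 h7) (by linarith) (S.sub_one_mem ht)
        have h7 := S.mono (S.sub_one_mem ht) g2 h6
        rw [S.map_sub_one] at h7
        constructor <;> linarith
  obtain ⟨ε, hε, hI⟩ := (S.right_cases hv1).resolve_left hR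
  have hFv : F v = p := by
    by_contra hne
    have hlt : F v < p := lt_of_le_of_ne hv3 hne
    set η := min (min ε (x - v)) ((p - F v) / 3 ^ k) with hη
    have hη0 : 0 < η := lt_min (lt_min hε (by linarith)) (div_pos (by linarith) (by positivity))
    have hη1 : η ≤ ε := (min_le_left _ _).trans (min_le_left _ _)
    have hη2 : η ≤ x - v := (min_le_left _ _).trans (min_le_right _ _)
    have hη3 : η * 3 ^ k ≤ p - F v := by
      rw [← le_div_iff₀ (by positivity)]; exact min_le_right _ _
    have h1 : Set.Icc v (v + η) ⊆ D := fun y hy => hI ⟨hy.1, by linarith [hy.2]⟩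
    have h2 := S.aff (by linarith) h1
    have h3 := hgt (v + η) (h1 ⟨by linarith, le_rfl⟩) (by linarith) (by linarith)
    have h4 : (3 : ℝ) ^ k * (v + η - v) = η * 3 ^ k := by ring
    linarith
  by_cases hL : ∃ e, G e v
  · obtain ⟨e, he⟩ := hL
    obtain ⟨g1, g2, g3, g4⟩ := S.gap he
    rcases S.gap_cov he with h4 | ⟨h4, h5⟩
    · rw [hFv] at h4
      obtain ⟨n, hn⟩ := h4 _ a5
      have n1 : (n : ℝ) < 1 := by linarith
      have n1' : n < 1 := by exact_mod_cast n1
      have n2 : (0 : ℝ) < n := by linarith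
      have n2' : 0 < n := by exact_mod_cast n2
      omega
    · rw [hFv] at h5 h4
      have h6 : F e + 1 ≤ q := by
        by_contra h7
        exact h5 q a3 (not_le.1 h7) a5
      refine S.not_maps_into hole v fun t ht ht1 ht2 => ?_
      have h7 := S.mono g3 ht ht1
      have h8 : t - 1 ≤ e := by
        by_contra h7
        exact g4 (t - 1) (not_le.1 h7) (by linarith) (S.sub_one_mem ht)
      have h9 := S.mono (S.sub_one_mem ht) g2 h8
      rw [S.map_sub_one] at h9
      constructor <;> linarith
  obtain ⟨m, hm⟩ := S.cong hv1
  -- Since F v = p is related to q, the class of v contains a point over q.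
  have hR1 : R (3 ^ k * v) q := by
    have h1 := a5
    rw [← hFv, hm] at h1
    exact S.lam.symm (S.lam.of_shift m (S.lam.symm h1))
  obtain ⟨w₀, hw₀, n, hn⟩ := S.lam.back_pow k hR1
  -- A gap around w₀ would begin or end at v modulo one, and both cases have been excluded.
  have hw₀D : w₀ ∈ D := by
    by_contra hwD
    obtain ⟨e, f, h1, h2, h3⟩ := S.cover hwD
    obtain ⟨g1, g2, g3, g4⟩ := S.gap h1
    set j := ⌈f - v⌉
    have hj1 := Int.le_ceil (f - v)
    have hj2 := Int.ceil_lt_add_one (f - v)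
    have hj3 : v + j ≤ e + 1 := by
      by_contra h5
      refine g4 (v + j - 1) (by linarith) (by linarith) ?_
      exact S.sub_one_mem (S.per j hv1)
    rcases S.eq_of_rel_gap h1 h2 h3 (w := v + j) (by linarith) hj3
      (S.lam.shift_right (S.lam.symm hw₀) j) with h5 | h5
    · refine hL ⟨e + (-j : ℤ), ?_⟩
      have := S.gap_per (-j) h1
      rw [← h5] at this
      simpa using this
    · refine hR ⟨f + (1 - j : ℤ), ?_⟩
      have := S.gap_per (1 - j) h1
      have h6 : e + ((1 - j : ℤ) : ℝ) = v := by push_cast; linarith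
      rwa [h6] at this
  obtain ⟨w, hwD, hvw, hw1, hw2, j, hj⟩ : ∃ w ∈ D, R v w ∧ v ≤ w ∧ w < v + 1 ∧
      ∃ j : ℤ, F w = q + j := by
    refine ⟨w₀ + (-⌊w₀ - v⌋ : ℤ), S.per _ hw₀D, S.lam.shift_right hw₀ _, ?_, ?_, ?_⟩
    · have := Int.floor_le (w₀ - v); push_cast; linarith
    · have := Int.lt_floor_add_one (w₀ - v); push_cast; linarith
    · obtain ⟨i, hi⟩ := S.cong hw₀D
      refine ⟨n + i - ⌊w₀ - v⌋, ?_⟩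
      rw [S.map_add_int, hi, hn]
      push_cast; ring
  have i1 := S.mono hv1 hwD hw1
  have i2 := S.mono hwD (S.add_one_mem hv1) hw2.le
  rw [S.map_add_one] at i2
  have hj0 : j = 0 := by
    have n1 : (j : ℝ) < 1 := by linarith
    have n1' : j < 1 := by exact_mod_cast n1
    have n2 : (-1 : ℝ) < j := by linarith
    have n2' : -1 < j := by exact_mod_cast n2
    omega
  subst hj0
  have hFw : F w = q := by simpa using hj
  have hxw : x < w := S.lt_of_map_lt hxD hwD (by linarith)
  -- The arc (v, w) contains the core point x and cannot be moved off itself. The other arc cannot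
  -- either: it would give p < w, hence F p ≤ F w = q, against q < F p.
  rcases S.memb_or hv1 hwD (by linarith) hw2 hvw with h | h
  · exact hx _ _ h ⟨hvx, hxw⟩
  · have h1 := (S.disp hv1).1
    have h2 := h.2.2.2.2.2.2
    rw [S.map_add_one] at h2
    have h3 := S.mono a1 hwD (by linarith)
    linarith

end MaxSys


/-! ### Semiconjugacy to an irrational rotation -/

/-- Multiples of an irrational number come close to integers. -/
theorem Irrational.exists_small_step {τ : ℝ} (hτ : Irrational τ) {ε : ℝ} (hε : 0 < ε) :
    ∃ n : ℕ, 0 < n ∧ ∃ m : ℤ, n * τ - m ≠ 0 ∧ |n * τ - m| < ε := by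
  obtain ⟨N, hN⟩ := exists_nat_one_div_lt hε
  obtain ⟨n, h1, h2, h3⟩ := Real.exists_nat_abs_mul_sub_round_le τ (n := N + 1) (by omega)
  refine ⟨n, h1, round (n * τ), ?_, lt_of_le_of_lt h3 (lt_of_le_of_lt ?_ hN)⟩
  · intro h
    have := (hτ.natCast_mul h1.ne').ne_int (round (n * τ))
    exact this (by linarith)
  · push_cast
    gcongr
    linarith

/-- A monotone degree one circle map with irrational translation number is semiconjugate to the
translation. -/
theorem CircleDeg1Lift.exists_semiconj (f : CircleDeg1Lift) (hτ : Irrational f.translationNumber) :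
    ∃ Ψ : ℝ → ℝ, Continuous Ψ ∧ Monotone Ψ ∧ (∀ t, Ψ (t + 1) = Ψ t + 1) ∧
      ∀ t, Ψ (f t) = Ψ t + f.translationNumber := by
  set τ := f.translationNumber with hτd
  have hub : ∀ (n : ℕ) x, f^[n] x - n * τ ≤ x + 1 := fun n x => by
    have := (f ^ n).map_lt_add_translationNumber_add_one x
    rw [translationNumber_pow, coe_pow] at this
    linarith
  have hlb : ∀ (n : ℕ) x, x - 1 ≤ f^[n] x - n * τ := fun n x => by
    have h1 := (f ^ n).translationNumber_le_ceil_sub x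
    rw [translationNumber_pow, coe_pow] at h1
    have h2 := Int.ceil_lt_add_one (f^[n] x - x)
    linarith
  set u : ℝ → ℕ → ℝ := fun x n => f^[n] x - n * τ with hu
  have hb : ∀ x, Filter.IsBoundedUnder (· ≤ ·) Filter.atTop (u x) := fun x =>
    Filter.isBoundedUnder_of ⟨x + 1, fun n => hub n x⟩
  have hb' : ∀ x, Filter.IsCoboundedUnder (· ≤ ·) Filter.atTop (u x) := fun x =>
    Filter.IsBoundedUnder.isCoboundedUnder_le (Filter.isBoundedUnder_of ⟨x - 1, fun n => hlb n x⟩)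
  -- The deviation of the nth iterate from n * τ is bounded. Its limsup conjugates f to the
  -- translation by τ, because a shift of the index only adds τ.
  set Ψ : ℝ → ℝ := fun x => Filter.limsup (u x) Filter.atTop with hΨ
  have hmono : Monotone Ψ := fun x y hxy =>
    Filter.limsup_le_limsup (.of_forall fun n => by
      have := f.monotone.iterate n hxy
      simp only [hu]; linarith) (hb' x) (hb y)
  have hit : ∀ n x, f^[n] (x + 1) = f^[n] x + 1 := fun n x => by
    rw [← coe_pow]; exact (f ^ n).map_add_one x
  have hdeg : ∀ t, Ψ (t + 1) = Ψ t + 1 := fun t => by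
    have h1 : u (t + 1) = fun n => u t n + 1 := by
      funext n
      simp only [hu, hit]; ring
    simp only [hΨ, h1]
    exact limsup_add_const _ _ _ (hb t) (hb' t)
  have hconj : ∀ t, Ψ (f t) = Ψ t + τ := fun t => by
    have h1 : u (f t) = fun n => u t (n + 1) + τ := by
      funext n
      simp only [hu, Function.iterate_succ_apply]
      push_cast; ring
    have h2 : Filter.limsup (fun n => u t (n + 1)) Filter.atTop = Ψ t :=
      Filter.limsup_nat_add (u t) 1
    rw [← h2]
    simp only [hΨ, h1]
    refine limsup_add_const Filter.atTop (fun n => u t (n + 1)) τ ?_ ?_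
    · exact Filter.isBoundedUnder_of ⟨t + 1, fun n => hub _ t⟩
    · exact Filter.IsBoundedUnder.isCoboundedUnder_le
        (Filter.isBoundedUnder_of ⟨t - 1, fun n => hlb _ t⟩)
  have hdegz : ∀ t (n : ℤ), Ψ (t + n) = Ψ t + n := fun t n => by
    let g : CircleDeg1Lift := ⟨⟨Ψ, hmono⟩, hdeg⟩
    exact g.map_add_int t n
  have hconjn : ∀ (n : ℕ) t, Ψ (f^[n] t) = Ψ t + n * τ := fun n t => by
    induction n with
    | zero => simp
    | succ n ih => rw [Function.iterate_succ_apply', hconj, ih]; push_cast; ring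
  refine ⟨Ψ, hmono.continuous_of_denseRange ?_, hmono, hdeg, hconj⟩
  rw [DenseRange, dense_iff_exists_between]
  intro a b hab
  -- A monotone function with dense range is continuous. The range contains Ψ 0 + i + j * r for a
  -- nonzero step r shorter than b - a, with i an arbitrary integer and j a natural number.
  obtain ⟨n, hn, m, hm0, hm⟩ := hτ.exists_small_step (sub_pos.2 hab)
  set r := n * τ - m with hr
  have hstep : ∀ (j : ℕ) (i : ℤ), Ψ (f^[n * j] 0 - (m * j : ℤ) + i) = Ψ 0 + i + j * r := by
    intro j i
    have := hdegz (f^[n * j] 0) (-(m * j) + i)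
    rw [hconjn] at this
    push_cast at this ⊢
    rw [sub_eq_add_neg, add_assoc, this, hr]
    ring
  rcases lt_or_gt_of_ne hm0 with h | h
  · rw [abs_of_neg h] at hm
    set i : ℤ := ⌈b - Ψ 0⌉
    have hi : b ≤ Ψ 0 + i := by have := Int.le_ceil (b - Ψ 0); linarith
    set j : ℕ := ⌊(Ψ 0 + i - b) / (-r)⌋₊ with hj
    have j1 : (j : ℝ) * (-r) ≤ Ψ 0 + i - b := by
      rw [← le_div_iff₀ (by linarith)]
      exact Nat.floor_le (div_nonneg (by linarith) (by linarith))
    have j2 : Ψ 0 + i - b < (j + 1) * (-r) := by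
      rw [← div_lt_iff₀ (by linarith)]
      exact Nat.lt_floor_add_one _
    refine ⟨_, ⟨_, hstep (j + 1) i⟩, ?_, ?_⟩ <;> push_cast <;> linarith
  · rw [abs_of_pos h] at hm
    set i : ℤ := ⌊a - Ψ 0⌋
    have hi : Ψ 0 + i ≤ a := by have := Int.floor_le (a - Ψ 0); linarith
    set j : ℕ := ⌊(a - (Ψ 0 + i)) / r⌋₊ with hj
    have j1 : (j : ℝ) * r ≤ a - (Ψ 0 + i) := by
      rw [← le_div_iff₀ (by linarith)]
      exact Nat.floor_le (div_nonneg (by linarith) (by linarith))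
    have j2 : a - (Ψ 0 + i) < (j + 1) * r := by
      rw [← div_lt_iff₀ (by linarith)]
      exact Nat.lt_floor_add_one _
    refine ⟨_, ⟨_, hstep (j + 1) i⟩, ?_, ?_⟩ <;> push_cast <;> linarith

/-! ### The rotation number of the core is irrational -/

namespace MaxSys

variable {R : ℝ → ℝ → Prop} {k : ℕ} {D : Set ℝ} {F : ℝ → ℝ} {G : ℝ → ℝ → Prop}

theorem core_sub_one (S : MaxSys R k D F G) {t : ℝ} (ht : t ∈ core R D F) :
    t - 1 ∈ core R D F := by
  simpa [sub_eq_add_neg] using S.core_per (-1) ht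

theorem core_nonempty (S : MaxSys R k D F G) : (core R D F).Nonempty := by
  obtain ⟨e, f, h⟩ := S.gap_ex
  exact ⟨e, (S.gap_core h).1⟩

theorem pos (S : MaxSys R k D F G) : 0 < k := by
  rcases Nat.eq_zero_or_pos k with h | h
  · subst h
    obtain ⟨x, hx⟩ := S.core_nonempty
    obtain ⟨n, hn⟩ := S.cong (S.core_subset hx)
    have h1 := S.disp (S.core_subset hx)
    simp only [pow_zero, one_mul] at hn
    rw [hn] at h1
    have n1 : (n : ℝ) < 1 := by linarith
    have n1' : n < 1 := by exact_mod_cast n1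
    have n2 : (0 : ℝ) < n := by linarith
    have n2' : 0 < n := by exact_mod_cast n2
    omega
  · exact h

/-- The restriction of the lift to the core extends to a monotone map of degree one. -/
theorem exists_lift (S : MaxSys R k D F G) :
    ∃ f : CircleDeg1Lift, ∀ t ∈ core R D F, f t = F t := by
  obtain ⟨x, hx⟩ := S.core_nonempty
  set O := core R D F with hO
  have hne : ∀ t, (F '' (O ∩ Set.Iic t)).Nonempty := fun t =>
    ⟨_, x + (-⌈x - t⌉ : ℤ), ⟨S.core_per _ hx, by
      have := Int.le_ceil (x - t)
      simp only [Set.mem_Iic]; push_cast; linarith⟩, rfl⟩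
  have hbd : ∀ t, BddAbove (F '' (O ∩ Set.Iic t)) := fun t => ⟨F (x + (⌈t - x⌉ : ℤ)), by
    rintro _ ⟨y, ⟨hy1, hy2⟩, rfl⟩
    refine S.mono (S.core_subset hy1) (S.per _ (S.core_subset hx)) ?_
    have := Int.le_ceil (t - x)
    simp only [Set.mem_Iic] at hy2
    linarith⟩
  -- The extension takes at t the value of F at the last point of the core up to t.
  refine ⟨⟨⟨fun t => sSup (F '' (O ∩ Set.Iic t)), fun s t hst => ?_⟩, fun t => ?_⟩, fun t ht => ?_⟩
  · exact csSup_le_csSup (hbd t) (hne s) (Set.image_mono fun y hy => ⟨hy.1, hy.2.trans hst⟩)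
  · change sSup (F '' (O ∩ Set.Iic (t + 1))) = sSup (F '' (O ∩ Set.Iic t)) + 1
    apply le_antisymm
    · refine csSup_le (hne _) ?_
      rintro _ ⟨y, ⟨hy1, hy2⟩, rfl⟩
      simp only [Set.mem_Iic] at hy2
      have := le_csSup (hbd t) ⟨y - 1, ⟨S.core_sub_one hy1, by simp only [Set.mem_Iic]; linarith⟩, rfl⟩
      rw [S.map_sub_one] at this
      linarith
    · rw [← le_sub_iff_add_le]
      refine csSup_le (hne _) ?_
      rintro _ ⟨y, ⟨hy1, hy2⟩, rfl⟩
      simp only [Set.mem_Iic] at hy2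
      have := le_csSup (hbd (t + 1))
        ⟨y + 1, ⟨S.core_add_one hy1, by simp only [Set.mem_Iic]; linarith⟩, rfl⟩
      rw [S.map_add_one] at this
      linarith
  · change sSup (F '' (O ∩ Set.Iic t)) = F t
    apply le_antisymm
    · refine csSup_le (hne _) ?_
      rintro _ ⟨y, ⟨hy1, hy2⟩, rfl⟩
      exact S.mono (S.core_subset hy1) (S.core_subset ht) hy2
    · exact le_csSup (hbd t) ⟨t, ⟨ht, le_refl t⟩, rfl⟩

theorem iter_core (S : MaxSys R k D F G) (n : ℕ) {t : ℝ} (ht : t ∈ core R D F) :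
    F^[n] t ∈ core R D F := by
  induction n with
  | zero => exact ht
  | succ n ih => rw [Function.iterate_succ_apply']; exact S.map_core ih

theorem iter_eq (S : MaxSys R k D F G) {f : CircleDeg1Lift} (hf : ∀ t ∈ core R D F, f t = F t)
    (n : ℕ) {t : ℝ} (ht : t ∈ core R D F) : f^[n] t = F^[n] t := by
  induction n with
  | zero => rfl
  | succ n ih =>
    rw [Function.iterate_succ_apply', Function.iterate_succ_apply', ih, hf _ (S.iter_core n ht)]

theorem iter_add_int (S : MaxSys R k D F G) (n : ℕ) (t : ℝ) (m : ℤ) :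
    F^[n] (t + m) = F^[n] t + m := by
  induction n with
  | zero => rfl
  | succ n ih =>
    rw [Function.iterate_succ_apply', Function.iterate_succ_apply', ih, S.map_add_int]

theorem iter_mono (S : MaxSys R k D F G) (n : ℕ) {s t : ℝ} (hs : s ∈ core R D F)
    (ht : t ∈ core R D F) (h : s ≤ t) : F^[n] s ≤ F^[n] t := by
  induction n with
  | zero => exact h
  | succ n ih =>
    rw [Function.iterate_succ_apply', Function.iterate_succ_apply']
    exact S.mono (S.core_subset (S.iter_core n hs)) (S.core_subset (S.iter_core n ht)) ih

theorem iter_rel (S : MaxSys R k D F G) (n : ℕ) {s t : ℝ} (hs : s ∈ core R D F)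
    (ht : t ∈ core R D F) (h : R s t) : R (F^[n] s) (F^[n] t) := by
  induction n with
  | zero => exact h
  | succ n ih =>
    rw [Function.iterate_succ_apply', Function.iterate_succ_apply']
    exact S.map_rel (S.core_subset (S.iter_core n hs)) (S.core_subset (S.iter_core n ht)) ih

theorem iter_cong (S : MaxSys R k D F G) (n : ℕ) {t : ℝ} (ht : t ∈ core R D F) :
    ∃ m : ℤ, F^[n] t = 3 ^ (k * n) * t + m := by
  induction n with
  | zero => exact ⟨0, by simp⟩
  | succ n ih =>
    obtain ⟨m, hm⟩ := ih
    obtain ⟨j, hj⟩ := S.cong (S.core_subset (S.iter_core n ht))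
    refine ⟨3 ^ k * m + j, ?_⟩
    rw [Function.iterate_succ_apply', hj, hm, Nat.mul_succ, pow_add]
    push_cast; ring

theorem iter_single (S : MaxSys R k D F G) (n : ℕ) {t : ℝ} (ht : t ∈ core R D F)
    (h : ∀ w, R t w → ∃ n : ℤ, w = t + n) : ∀ w, R (F^[n] t) w → ∃ m : ℤ, w = F^[n] t + m := by
  intro w hw
  obtain ⟨m, hm⟩ := S.iter_cong n ht
  rw [hm] at hw ⊢
  obtain ⟨j, hj⟩ := S.lam.singleton_pow h (k * n) (w - m) (by
    have := S.lam.shift hw (-m) (-m)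
    convert this using 1 <;> push_cast <;> ring)
  exact ⟨j, by linarith⟩

theorem not_gap_of_single (S : MaxSys R k D F G) {t e f : ℝ}
    (h : ∀ w, R t w → ∃ n : ℤ, w = t + n) (hG : G e f) (hte : t = e ∨ t = f) : False := by
  obtain ⟨a1, a2, a3, a4, a5, a6, a7⟩ := S.memb hG
  rcases hte with rfl | rfl
  · obtain ⟨n, hn⟩ := h _ a5
    have n1 : (n : ℝ) < 1 := by linarith
    have n1' : n < 1 := by exact_mod_cast n1
    have n2 : (0 : ℝ) < n := by linarith
    have n2' : 0 < n := by exact_mod_cast n2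
    omega
  · obtain ⟨n, hn⟩ := h _ (S.lam.symm a5)
    have n1 : (n : ℝ) < 0 := by linarith
    have n1' : n < 0 := by exact_mod_cast n1
    have n2 : (-1 : ℝ) < n := by linarith
    have n2' : -1 < n := by exact_mod_cast n2
    omega

/-- Expansion of small distances in the core. -/
theorem iter_sub (S : MaxSys R k D F G) {δ : ℝ} (hδ : ∀ e f, G e f → δ ≤ f - e) {s t : ℝ}
    (hs : s ∈ core R D F) (ht : t ∈ core R D F) (hst : s ≤ t) (n : ℕ)
    (h : 3 ^ (k * n) * (t - s) < δ) : F^[n] t - F^[n] s = 3 ^ (k * n) * (t - s) := by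
  induction n with
  | zero => simp
  | succ n ih =>
    have h1 : (3 : ℝ) ^ (k * (n + 1)) = 3 ^ k * 3 ^ (k * n) := by
      rw [Nat.mul_succ, pow_add, mul_comm]
    have h2 : (1 : ℝ) ≤ 3 ^ k := one_le_pow₀ (by norm_num)
    have h3 : (0 : ℝ) ≤ 3 ^ (k * n) * (t - s) := mul_nonneg (by positivity) (by linarith)
    have h4 : 3 ^ (k * n) * (t - s) < δ := by
      rw [h1, mul_assoc] at h
      nlinarith
    have h5 := ih h4
    rw [Function.iterate_succ_apply', Function.iterate_succ_apply',
      S.aff (S.iter_mono n hs ht hst) (S.icc_subset hδ (S.core_subset (S.iter_core n hs))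
        (S.core_subset (S.iter_core n ht)) (by linarith)), h5, h1, mul_assoc]

/-- Two points of the core with a common image become the endpoints of a gap. -/
theorem exists_gap_of_iter_eq (S : MaxSys R k D F G) {s t : ℝ}
    (hs : s ∈ core R D F) (ht : t ∈ core R D F) (hst : s < t) {n : ℕ} (h : F^[n] s = F^[n] t) :
    ∃ i < n, G (F^[i] s) (F^[i] t) ∧ F^[i + 1] s = F^[i + 1] t := by
  classical
  have hex : ∃ n, F^[n] s = F^[n] t := ⟨n, h⟩
  obtain ⟨j, hj⟩ : ∃ j, Nat.find hex = j + 1 := by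
    refine Nat.exists_eq_succ_of_ne_zero fun h0 => ?_
    have := Nat.find_spec hex
    rw [h0] at this
    exact hst.ne this
  have h1 : F^[j + 1] s = F^[j + 1] t := hj ▸ Nat.find_spec hex
  have h2 : F^[j] s ≠ F^[j] t := Nat.find_min hex (by omega)
  have h3 := S.iter_mono j hs ht hst.le
  refine ⟨j, by have := Nat.find_min' hex h; omega, ?_, h1⟩
  rw [Function.iterate_succ_apply', Function.iterate_succ_apply'] at h1
  exact S.gap_of_map_eq (S.core_subset (S.iter_core j hs)) (S.core_subset (S.iter_core j ht))
    (lt_of_le_of_ne h3 h2) h1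

/-- A point of the core with the same image as a periodic point is that periodic point. -/
theorem eq_of_iter_eq (S : MaxSys R k D F G) {x z : ℝ} (hx : x ∈ core R D F)
    (hz : z ∈ core R D F) {n : ℕ} {m : ℤ} (hn : F^[n] z = z + m) (h : F^[n] x = F^[n] z) :
    x = z := by
  by_contra hne
  obtain ⟨i, hi, e, f, hG, hG', hzef⟩ : ∃ i < n, ∃ e f, G e f ∧ F e = F f ∧
      (F^[i] z = e ∨ F^[i] z = f) := by
    rcases lt_or_gt_of_ne hne with h1 | h1
    · obtain ⟨i, h2, h3, h4⟩ := S.exists_gap_of_iter_eq hx hz h1 h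
      rw [Function.iterate_succ_apply', Function.iterate_succ_apply'] at h4
      exact ⟨i, h2, _, _, h3, h4, Or.inr rfl⟩
    · obtain ⟨i, h2, h3, h4⟩ := S.exists_gap_of_iter_eq hz hx h1 h.symm
      rw [Function.iterate_succ_apply', Function.iterate_succ_apply'] at h4
      exact ⟨i, h2, _, _, h3, h4, Or.inl rfl⟩
  -- The orbits of x and z merge at a gap with F e = F f, whose image has a one-point class by the
  -- covering condition. The class stays a point along the orbit of z, yet that orbit returns to an
  -- endpoint of the gap, where the class has two points.
  have h1 := S.single_of_map_eq hG hG'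
  have h2 : F f = F^[i + 1] z := by
    rw [Function.iterate_succ_apply']
    rcases hzef with h2 | h2
    · rw [h2, hG']
    · rw [h2]
  rw [h2] at h1
  have h3 := S.iter_single (n - 1) (S.iter_core (i + 1) hz) h1
  rw [← Function.iterate_add_apply, show n - 1 + (i + 1) = i + n by omega,
    Function.iterate_add_apply, hn, S.iter_add_int] at h3
  refine S.not_gap_of_single (t := F^[i] z) (fun w hw => ?_) hG hzef
  obtain ⟨j, hj⟩ := h3 w (S.lam.symm (S.lam.shift_right (S.lam.symm hw) m))
  exact ⟨m + j, by rw [hj]; push_cast; ring⟩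

/-- If the translation number is rational then all points of the core are periodic. -/
theorem periodic_of_rational (S : MaxSys R k D F G) {f : CircleDeg1Lift}
    (hf : ∀ t ∈ core R D F, f t = F t) {q : ℕ} {m : ℤ}
    (hτ : q * f.translationNumber = m) {x : ℝ} (hx : x ∈ core R D F) : F^[q] x = x + m := by
  obtain ⟨δ, hδ, hs⟩ := S.sep
  set H : ℝ → ℝ := fun t => F^[q] t - m with hH
  have hHc : ∀ {t}, t ∈ core R D F → H t ∈ core R D F := fun ht => by
    have := S.core_per (-m) (S.iter_core q ht)
    simpa [hH, sub_eq_add_neg] using this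
  have hHm : ∀ {s t}, s ∈ core R D F → t ∈ core R D F → s ≤ t → H s ≤ H t := fun hs ht h => by
    have := S.iter_mono q hs ht h
    simp only [hH]; linarith
  have hHn : ∀ n, H^[n] x ∈ core R D F ∧ H^[n] x = F^[q * n] x - n * m := fun n => by
    induction n with
    | zero => simpa using hx
    | succ n ih =>
      rw [Function.iterate_succ_apply']
      refine ⟨hHc ih.1, ?_⟩
      simp only [hH]
      have h1 := S.iter_add_int q (F^[q * n] x) (-(n * m))
      push_cast at h1
      rw [ih.2, sub_eq_add_neg (F^[q * n] x), h1, ← Function.iterate_add_apply,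
        show q + q * n = q * (n + 1) by ring]
      push_cast; ring
  have hbd : ∀ n, |H^[n] x - x| ≤ 1 := fun n => by
    rw [(hHn n).2, ← S.iter_eq hf _ hx, ← CircleDeg1Lift.coe_pow, abs_le]
    have h1 := (f ^ (q * n)).map_lt_add_translationNumber_add_one x
    have h2 := (f ^ (q * n)).translationNumber_le_ceil_sub x
    have h3 := Int.ceil_lt_add_one ((f ^ (q * n)) x - x)
    rw [CircleDeg1Lift.translationNumber_pow] at h1 h2
    have h4 : ((q * n : ℕ) : ℝ) * f.translationNumber = n * m := by
      push_cast; rw [← hτ]; ring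
    rw [h4] at h1 h2
    constructor <;> linarith
  have hmon : Monotone (fun n => H^[n] x) ∨ Antitone (fun n => H^[n] x) := by
    rcases le_total x (H x) with h | h
    · left
      refine monotone_nat_of_le_succ fun n => ?_
      induction n with
      | zero => exact h
      | succ n ih =>
        have := hHm (hHn n).1 (hHn (n + 1)).1 ih
        simpa only [Function.iterate_succ_apply'] using this
    · right
      refine antitone_nat_of_succ_le fun n => ?_
      induction n with
      | zero => exact h
      | succ n ih =>
        have := hHm (hHn (n + 1)).1 (hHn n).1 ih
        simpa only [Function.iterate_succ_apply'] using this
  obtain ⟨z, hz⟩ : ∃ z, Filter.Tendsto (fun n => H^[n] x) Filter.atTop (nhds z) := by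
    rcases hmon with h | h
    · exact ⟨_, tendsto_atTop_ciSup h ⟨x + 1, by
        rintro _ ⟨n, rfl⟩; have := (abs_le.1 (hbd n)).2; dsimp only; linarith⟩⟩
    · exact ⟨_, tendsto_atTop_ciInf h ⟨x - 1, by
        rintro _ ⟨n, rfl⟩; have := (abs_le.1 (hbd n)).1; dsimp only; linarith⟩⟩
  have hzc : z ∈ core R D F := RotSys.core_closed.mem_of_tendsto hz (.of_forall fun n => (hHn n).1)
  have hq : 0 < q ∨ q = 0 := by omega
  rcases hq with hq | hq
  swap
  · subst hq
    have : (m : ℝ) = 0 := by rw [← hτ]; simp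
    simp [this]
  -- expansion near the limit
  set c : ℝ := 3 ^ (k * q) with hc
  have hc1 : (3 : ℝ) ≤ c := by
    have : 1 ≤ k * q := Nat.mul_pos S.pos hq
    calc (3 : ℝ) = 3 ^ 1 := by norm_num
      _ ≤ c := pow_le_pow_right₀ (by norm_num) this
  have hexp : ∀ {s t}, s ∈ core R D F → t ∈ core R D F → c * |t - s| < δ →
      H t - H s = c * (t - s) := by
    intro s t hs' ht' h
    simp only [hH]
    rcases le_total s t with h1 | h1
    · rw [abs_of_nonneg (by linarith)] at h
      have := S.iter_sub hs hs' ht' h1 q h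
      linarith
    · rw [abs_of_nonpos (by linarith)] at h
      have := S.iter_sub hs ht' hs' h1 q (by linarith)
      linarith
  have hsm : ∀ᶠ n in Filter.atTop, c * |H^[n] x - z| < δ := by
    have h1 : Filter.Tendsto (fun n => c * |H^[n] x - z|) Filter.atTop (nhds (c * |z - z|)) :=
      ((hz.sub_const z).abs).const_mul c
    rw [sub_self, abs_zero, mul_zero] at h1
    exact h1.eventually_lt_const hδ
  obtain ⟨N, hN⟩ := Filter.eventually_atTop.1 hsm
  have hsucc : Filter.Tendsto (fun n => H^[n + 1] x) Filter.atTop (nhds z) :=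
    hz.comp (Filter.tendsto_add_atTop_nat 1)
  have hHz : H z = z := by
    have h2 : Filter.Tendsto (fun n => H z + c * (H^[n] x - z)) Filter.atTop
        (nhds (H z + c * (z - z))) := ((hz.sub_const z).const_mul c).const_add _
    rw [sub_self, mul_zero, add_zero] at h2
    refine tendsto_nhds_unique (h2.congr' ?_) hsucc
    filter_upwards [hsm] with n hn
    have := hexp hzc (hHn n).1 hn
    rw [Function.iterate_succ_apply']; linarith
  -- Near z distances are multiplied by c ≥ 3, so an orbit can converge to z only by landing on it.
  have hzN : H^[N] x = z := by
    by_contra hne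
    have hpos : 0 < |H^[N] x - z| := abs_pos.2 (sub_ne_zero.2 hne)
    have hgrow : ∀ n, |H^[N + n] x - z| = c ^ n * |H^[N] x - z| := fun n => by
      induction n with
      | zero => simp
      | succ n ih =>
        have := hexp hzc (hHn (N + n)).1 (hN (N + n) (by omega))
        rw [hHz] at this
        rw [← add_assoc, Function.iterate_succ_apply', this, abs_mul, ih, pow_succ,
          abs_of_pos (by linarith)]
        ring
    have h1 : Filter.Tendsto (fun n => c ^ n * |H^[N] x - z|) Filter.atTop Filter.atTop :=
      (tendsto_pow_atTop_atTop_of_one_lt (by linarith)).atTop_mul_const hpos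
    obtain ⟨n, hn⟩ := (h1.eventually_ge_atTop δ).exists
    have h2 := hN (N + n) (by omega)
    rw [hgrow n] at h2
    nlinarith
  -- A fixed point of H has no other preimage in the core, so landing on z means starting there.
  have hback : ∀ {y}, y ∈ core R D F → H y = z → y = z := by
    intro y hy h
    have h1 : F^[q] z = z + m := by
      have : F^[q] z - m = z := hHz
      linarith
    refine S.eq_of_iter_eq hy hzc h1 ?_
    have : F^[q] y - m = z := h
    linarith
  have hall : ∀ n, H^[n] x = z → x = z := by
    intro n
    induction n with
    | zero => exact id
    | succ n ih =>
      intro h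
      rw [Function.iterate_succ_apply'] at h
      exact ih (hback (hHn n).1 h)
  have hxz := hall N hzN
  have : F^[q] z - m = z := hHz
  rw [hxz]; linarith

/-- The translation number is irrational. -/
theorem irrational (S : MaxSys R k D F G) {f : CircleDeg1Lift}
    (hf : ∀ t ∈ core R D F, f t = F t) : Irrational f.translationNumber := by
  rintro ⟨r, hr⟩
  have hτ : (r.den : ℝ) * f.translationNumber = r.num := by
    rw [← hr]
    exact_mod_cast Rat.den_mul_eq_num r
  have hper := fun x (hx : x ∈ core R D F) => S.periodic_of_rational hf hτ hx
  obtain ⟨δ, hδ, hs⟩ := S.sep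
  set c : ℝ := 3 ^ (k * r.den) with hc
  have hc1 : (3 : ℝ) ≤ c := by
    have : 1 ≤ k * r.den := Nat.mul_pos S.pos r.den_pos
    calc (3 : ℝ) = 3 ^ 1 := by norm_num
      _ ≤ c := pow_le_pow_right₀ (by norm_num) this
  -- The return is the identity up to translation and at the same time expands small distances by c.
  -- Hence distinct points of the core are at least δ / c apart.
  have hsep : ∀ s ∈ core R D F, ∀ t ∈ core R D F, s < t → δ / c ≤ t - s := by
    intro s hs' t ht' hst
    by_contra hlt
    rw [not_le, lt_div_iff₀ (by linarith)] at hlt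
    have h1 := S.iter_sub hs hs' ht' hst.le r.den (by rw [← hc]; linarith)
    rw [hper s hs', hper t ht', ← hc] at h1
    nlinarith
  set η := δ / c with hη
  have hη0 : 0 < η := div_pos hδ (by linarith)
  -- Neighbours in the discrete core are the two ends of a hole and therefore related. Stepping from
  -- hole to hole relates any two points, in particular x and F x.
  have hrel : ∀ n : ℕ, ∀ s ∈ core R D F, ∀ t ∈ core R D F, s ≤ t → t - s ≤ n * η → R s t := by
    intro n
    induction n with
    | zero =>
      intro s hs' t ht' h1 h2
      have : s = t := by simp at h2; linarith
      rw [this]; exact S.lam.refl _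
    | succ n ih =>
      intro s hs' t ht' h1 h2
      rcases eq_or_lt_of_le h1 with h3 | h3
      · rw [h3]; exact S.lam.refl _
      have h4 : t - η / 2 ∉ core R D F := fun h => by
        have := hsep _ h t ht' (by linarith)
        linarith
      obtain ⟨p, u, hM, h5, h6, h7, h8⟩ := S.exists_hole h4
      have hut : u = t := by
        rcases lt_trichotomy u t with h9 | h9 | h9
        · have := hsep u h8 t ht' h9; linarith
        · exact h9
        · exact (ht' p u hM ⟨by linarith, h9⟩).elim
      rw [hut] at hM
      have hsp : s ≤ p := by
        by_contra h9
        exact hs' p t hM ⟨not_le.1 h9, h3⟩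
      have h9 := hsep p h7 t ht' (by linarith)
      exact S.lam.trans (ih s hs' p h7 hsp (by push_cast at h2; linarith)) hM.2.2.2.2.1
  obtain ⟨x, hx⟩ := S.core_nonempty
  obtain ⟨n, hn⟩ := exists_nat_ge ((F x - x) / η)
  rw [div_le_iff₀ hη0] at hn
  exact S.not_rel_map (S.core_subset hx)
    (hrel n x hx (F x) (S.map_core hx) (S.disp (S.core_subset hx)).1.le hn)

end MaxSys


/-! ### From a rotation system to a Siegel gap -/

/-- The lifted form of a Siegel gap: a closed set `O` whose complementary arcs are leaf arcs, on
which `t ↦ 3 ^ k t` is modelled by an irrational rotation. -/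
structure SiegelData (R : ℝ → ℝ → Prop) (k : ℕ) (O : Set ℝ) (Ψ : ℝ → ℝ) (θ : ℝ) : Prop where
  closed : IsClosed O
  per : ∀ {t} (n : ℤ), t ∈ O → t + n ∈ O
  nonempty : O.Nonempty
  continuous : Continuous Ψ
  monotone : Monotone Ψ
  deg : ∀ t, Ψ (t + 1) = Ψ t + 1
  irrational : Irrational θ
  hole : ∀ {t}, t ∉ O → ∃ s u, s ∈ O ∧ u ∈ O ∧ s < t ∧ t < u ∧ u < s + 1 ∧ R s u ∧ Ψ s = Ψ u ∧
    ∀ x, s < x → x < u → x ∉ O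
  cls : ∀ {x y}, x ∈ O → y ∈ O → x < y → y < x + 1 → R x y →
    (∀ t, x < t → t < y → t ∉ O) ∨ ∀ t, y < t → t < x + 1 → t ∉ O
  map : ∀ {t}, t ∈ O → 3 ^ k * t ∈ O ∧ ∃ n : ℤ, Ψ (3 ^ k * t) = Ψ t + θ + n
  surj : ∀ {t}, t ∈ O → ∃ s ∈ O, ∃ n : ℤ, 3 ^ k * s = t + n

/-- There are no Siegel gaps. -/
def NoSiegel (R : ℝ → ℝ → Prop) : Prop :=
  -- The last premise makes k the minimal period of O.
  ∀ k O Ψ θ, 0 < k → SiegelData R k O Ψ θ → (∀ m, 0 < m → m < k → ∃ t ∈ O, 3 ^ m * t ∉ O) → False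

namespace MaxSys

variable {R : ℝ → ℝ → Prop} {k : ℕ} {D : Set ℝ} {F : ℝ → ℝ} {G : ℝ → ℝ → Prop} {Ψ : ℝ → ℝ} {τ : ℝ}

theorem semi_iter (S : MaxSys R k D F G) (hF : ∀ t ∈ core R D F, Ψ (F t) = Ψ t + τ) (n : ℕ) {t : ℝ}
    (ht : t ∈ core R D F) : Ψ (F^[n] t) = Ψ t + n * τ := by
  induction n with
  | zero => simp
  | succ n ih =>
    rw [Function.iterate_succ_apply', hF _ (S.iter_core n ht), ih]
    push_cast; ring

/-- Related points of the core have the same projection modulo one. -/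
theorem semi_rel (S : MaxSys R k D F G) (hm : Monotone Ψ) (hd : ∀ t (n : ℤ), Ψ (t + n) = Ψ t + n)
    (hτ : Irrational τ) (hF : ∀ t ∈ core R D F, Ψ (F t) = Ψ t + τ) {x y : ℝ}
    (hx : x ∈ core R D F) (hy : y ∈ core R D F) (h1 : x < y) (h2 : y < x + 1) (hR : R x y) :
    Ψ y = Ψ x ∨ Ψ y = Ψ x + 1 := by
  by_contra hc
  simp only [not_or] at hc
  have hd1 : Ψ (x + 1) = Ψ x + 1 := by simpa using hd x 1
  have hlt : ∀ {s t}, Ψ s < Ψ t → s < t := fun h => by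
    by_contra h'
    exact absurd (hm (not_lt.1 h')) (not_le.2 h)
  have h3 : Ψ x < Ψ y := lt_of_le_of_ne (hm h1.le) (Ne.symm hc.1)
  have h4 : Ψ y < Ψ x + 1 := lt_of_le_of_ne (hd1 ▸ hm h2.le) hc.2
  -- Suppose that the leaf x y projects to a proper chord. An iterate that rotates by a sufficiently
  -- small nonzero amount carries it to a chord linked with it, so x is related to its own image; by
  -- `nopoly` this image is x modulo one, and n * τ would be an integer.
  obtain ⟨n, hn, m, hm0, hms⟩ := hτ.exists_small_step
    (lt_min (sub_pos.2 h3) (sub_pos.2 h4))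
  have h5 : |n * τ - m| < Ψ y - Ψ x := lt_of_lt_of_le hms (min_le_left _ _)
  have h6 : |n * τ - m| < Ψ x + 1 - Ψ y := lt_of_lt_of_le hms (min_le_right _ _)
  set x' := F^[n] x + (-m : ℤ) with hx'
  set y' := F^[n] y + (-m : ℤ) with hy'
  have ex : Ψ x' = Ψ x + (n * τ - m) := by
    rw [hx', hd, S.semi_iter hF n hx]; push_cast; ring
  have ey : Ψ y' = Ψ y + (n * τ - m) := by
    rw [hy', hd, S.semi_iter hF n hy]; push_cast; ring
  have hR' : R x' y' := S.lam.shift (S.iter_rel n hx hy hR) _ _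
  have hxx : R x x' := by
    rcases lt_or_gt_of_ne hm0 with h | h
    · rw [abs_of_neg h] at h5 h6
      refine S.lam.symm (S.lam.cross (s := x') (u := x) (t := y') (v := y) (hlt ?_) (hlt ?_)
        (hlt ?_) (hlt ?_) hR' hR)
      · linarith
      · linarith
      · linarith
      · have := hd x' 1
        push_cast at this
        linarith
    · rw [abs_of_pos h] at h5 h6
      refine S.lam.cross (s := x) (u := x') (t := y) (v := y') (hlt ?_) (hlt ?_)
        (hlt ?_) (hlt ?_) hR hR'
      · linarith
      · linarith
      · linarith
      · rw [hd1]; linarith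
  obtain ⟨j, hj⟩ := S.iter_cong n hx
  have h7 : R x (3 ^ (k * n) * x) := by
    have := S.lam.of_shift _ hxx
    rw [hj] at this
    exact S.lam.of_shift _ this
  obtain ⟨i, hi⟩ := S.lam.nopoly x (k * n) h7
  have h8 : Ψ (F^[n] x) = Ψ x + (i + j : ℤ) := by
    rw [← hd, hj, hi]; congr 1; push_cast; ring
  rw [S.semi_iter hF n hx] at h8
  exact (hτ.natCast_mul hn.ne').ne_int (i + j) (by linarith)

/-- Two points of the core with the same projection become the endpoints of a gap. -/
theorem semi_fiber (S : MaxSys R k D F G) (hm : Monotone Ψ) (hd : ∀ t (n : ℤ), Ψ (t + n) = Ψ t + n)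
    (hτ : Irrational τ) (hF : ∀ t ∈ core R D F, Ψ (F t) = Ψ t + τ) {x y : ℝ}
    (hx : x ∈ core R D F) (hy : y ∈ core R D F) (h1 : x < y) (h2 : Ψ x = Ψ y) :
    ∃ i, G (F^[i] x) (F^[i] y) ∧ F^[i + 1] x = F^[i + 1] y := by
  by_cases hex : ∃ n, F^[n] x = F^[n] y
  · obtain ⟨n, hn⟩ := hex
    obtain ⟨i, -, h⟩ := S.exists_gap_of_iter_eq hx hy h1 hn
    exact ⟨i, h⟩
  exfalso
  have hne : ∀ n, F^[n] x < F^[n] y := fun n =>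
    lt_of_le_of_ne (S.iter_mono n hx hy h1.le) fun h => hex ⟨n, h⟩
  obtain ⟨δ, hδ, hs⟩ := S.sep
  -- As long as the two orbits stay closer than δ their distance grows by the factor 3 ^ k. It
  -- therefore exceeds δ infinitely often.
  have hinf : {n | δ ≤ F^[n] y - F^[n] x}.Infinite := by
    rw [Set.infinite_iff_exists_gt]
    intro N
    by_contra hc
    have hlt : ∀ n, N < n → F^[n] y - F^[n] x < δ := fun n hn => by
      by_contra h
      exact hc ⟨n, not_lt.1 h, hn⟩
    have hgrow : ∀ n, F^[N + 1 + n] y - F^[N + 1 + n] x =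
        (3 ^ k) ^ n * (F^[N + 1] y - F^[N + 1] x) := fun n => by
      induction n with
      | zero => simp
      | succ n ih =>
        rw [← add_assoc, Function.iterate_succ_apply', Function.iterate_succ_apply',
          S.aff (hne _).le (S.icc_subset hs (S.core_subset (S.iter_core _ hx))
            (S.core_subset (S.iter_core _ hy)) (hlt _ (by omega))), ih, pow_succ']
        ring
    have hk : (1 : ℝ) < 3 ^ k := one_lt_pow₀ (by norm_num) S.pos.ne'
    have h3 : Filter.Tendsto (fun n => ((3 : ℝ) ^ k) ^ n * (F^[N + 1] y - F^[N + 1] x))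
        Filter.atTop Filter.atTop :=
      (tendsto_pow_atTop_atTop_of_one_lt hk).atTop_mul_const (sub_pos.2 (hne _))
    obtain ⟨n, hn⟩ := (h3.eventually_ge_atTop δ).exists
    have h4 := hlt (N + 1 + n) (by omega)
    rw [hgrow] at h4
    linarith
  obtain ⟨M, hM⟩ := exists_nat_one_div_lt hδ
  have hM0 : (0 : ℝ) < M + 1 := by positivity
  rw [div_lt_iff₀ hM0] at hM
  have hmaps : Set.MapsTo (fun n => ⌊Int.fract (F^[n] x) * (M + 1)⌋)
      {n | δ ≤ F^[n] y - F^[n] x} (Set.Icc 0 (M + 1 : ℤ)) := by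
    intro n _
    have f1 := Int.fract_nonneg (F^[n] x)
    have f2 := Int.fract_lt_one (F^[n] x)
    refine ⟨Int.floor_nonneg.2 (by positivity), ?_⟩
    rw [Int.floor_le_iff]
    push_cast
    nlinarith
  -- The intervals between the two orbits project to distinct points modulo one, so the long ones do
  -- not overlap modulo one. The pigeonhole principle contradicts their infinite number.
  have key : ∀ i j : ℕ, i ≠ j → δ ≤ F^[i] y - F^[i] x →
      ∀ n : ℤ, F^[i] x ≤ F^[j] x + n → F^[j] x + n < F^[i] x + δ → False := by
    intro i j hij hi n h3 h4
    have e1 : Ψ (F^[j] x + n) = Ψ (F^[i] x) := by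
      apply le_antisymm
      · have := hm (show F^[j] x + n ≤ F^[i] y by linarith)
        rwa [S.semi_iter hF i hy, ← h2, ← S.semi_iter hF i hx] at this
      · exact hm h3
    rw [hd, S.semi_iter hF i hx, S.semi_iter hF j hx] at e1
    have h5 : ((i : ℤ) - j : ℤ) ≠ 0 := by omega
    exact (hτ.intCast_mul h5).ne_int n (by push_cast; linarith)
  obtain ⟨i, hi, j, hj, hij, heq⟩ := hinf.exists_ne_map_eq_of_mapsTo hmaps (Set.finite_Icc _ _)
  have habs := Int.abs_sub_lt_one_of_floor_eq_floor heq
  rw [← sub_mul, abs_mul, abs_of_pos hM0] at habs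
  have habs' : |Int.fract (F^[i] x) - Int.fract (F^[j] x)| < δ := by
    by_contra h
    nlinarith [not_lt.1 h]
  rw [abs_lt] at habs'
  have fi := Int.self_sub_floor (F^[i] x)
  have fj := Int.self_sub_floor (F^[j] x)
  rcases le_total (Int.fract (F^[i] x)) (Int.fract (F^[j] x)) with h | h
  · exact key i j hij hi (⌊F^[i] x⌋ - ⌊F^[j] x⌋) (by push_cast; linarith) (by push_cast; linarith)
  · exact key j i hij.symm hj (⌊F^[j] x⌋ - ⌊F^[i] x⌋) (by push_cast; linarith)
      (by push_cast; linarith)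

/-- By `semi_fiber` each of the pairs x y and y z becomes a gap and is then identified. If this
happens at different times, the first identification makes the class of the image of y a point for
ever, so it cannot be the end of a later gap. At the same time there would be two adjacent gaps in
one class. -/
theorem semi_not_three (S : MaxSys R k D F G) (hm : Monotone Ψ)
    (hd : ∀ t (n : ℤ), Ψ (t + n) = Ψ t + n)
    (hτ : Irrational τ) (hF : ∀ t ∈ core R D F, Ψ (F t) = Ψ t + τ) {x y z : ℝ}
    (hx : x ∈ core R D F) (hy : y ∈ core R D F) (hz : z ∈ core R D F) (h1 : x < y) (h2 : y < z)
    (h3 : Ψ x = Ψ z) : False := by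
  have h4 : Ψ x = Ψ y := le_antisymm (hm h1.le) (h3 ▸ hm h2.le)
  obtain ⟨i, hi1, hi2⟩ := S.semi_fiber hm hd hτ hF hx hy h1 h4
  obtain ⟨j, hj1, hj2⟩ := S.semi_fiber hm hd hτ hF hy hz h2 (h4.symm.trans h3)
  have hi3 : F (F^[i] x) = F (F^[i] y) := by
    rw [Function.iterate_succ_apply', Function.iterate_succ_apply'] at hi2; exact hi2
  have hj3 : F (F^[j] y) = F (F^[j] z) := by
    rw [Function.iterate_succ_apply', Function.iterate_succ_apply'] at hj2; exact hj2
  rcases lt_trichotomy i j with h | h | h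
  · have h5 := S.single_of_map_eq hi1 hi3
    rw [← Function.iterate_succ_apply' F] at h5
    have h6 := S.iter_single (j - (i + 1)) (S.iter_core (i + 1) hy) h5
    rw [← Function.iterate_add_apply, show j - (i + 1) + (i + 1) = j by omega] at h6
    exact S.not_gap_of_single h6 hj1 (Or.inl rfl)
  · subst h
    have h5 := S.semi_iter hF i hx
    have h6 := S.semi_iter hF i hz
    have h7 : F^[i] z < F^[i] x + 1 := by
      by_contra h8
      have := hm (not_lt.1 h8)
      have e := hd (F^[i] x) 1
      push_cast at e
      linarith
    exact S.not_rel_of_hole (S.gap_hole hi1) (S.gap hj1).1 h7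
      (S.lam.trans (S.memb hi1).2.2.2.2.1 (S.memb hj1).2.2.2.2.1)
  · have h5 := S.single_of_map_eq hj1 hj3
    rw [← hj3, ← Function.iterate_succ_apply' F] at h5
    have h6 := S.iter_single (i - (j + 1)) (S.iter_core (j + 1) hy) h5
    rw [← Function.iterate_add_apply, show i - (j + 1) + (j + 1) = i by omega] at h6
    exact S.not_gap_of_single h6 hi1 (Or.inr rfl)

/-- By `semi_rel` the alternative is Ψ u = Ψ s + 1. As F s lies between u and s + 1, it would force
τ = 1. -/
theorem semi_hole (S : MaxSys R k D F G) (hm : Monotone Ψ)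
    (hd : ∀ t (n : ℤ), Ψ (t + n) = Ψ t + n)
    (hτ : Irrational τ) (hF : ∀ t ∈ core R D F, Ψ (F t) = Ψ t + τ) {s u : ℝ}
    (h : CoreHole R D F s u) : Ψ s = Ψ u := by
  obtain ⟨⟨a1, a2, a3, a4, a5, a6, a7⟩, hs, hu⟩ := h
  rcases S.semi_rel hm hd hτ hF hs hu a3 a4 a5 with h1 | h1
  · exact h1.symm
  · exfalso
    have h2 := hm a6.le
    have h3 := hm (S.disp a1).2.le
    have h4 := hd s 1
    push_cast at h4
    rw [hF s hs] at h2 h3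
    exact hτ.ne_int 1 (by push_cast; linarith)

/-- The values Ψ (F s) on the core exhaust the line. If t were missed, compactness gives a
neighbourhood of t without image points, on which Ψ is constant. The fibre of t then contains t, an
image point F s on one side and a point of the core on the other, against `semi_not_three`. -/
theorem semi_surj (S : MaxSys R k D F G) (hc : Continuous Ψ) (hm : Monotone Ψ)
    (hd : ∀ t (n : ℤ), Ψ (t + n) = Ψ t + n)
    (hτ : Irrational τ) (hF : ∀ t ∈ core R D F, Ψ (F t) = Ψ t + τ) {t : ℝ}
    (ht : t ∈ core R D F) : ∃ s ∈ core R D F, F s = t := by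
  have hsurj : Function.Surjective Ψ := by
    intro y
    have h1 : Ψ (0 + (⌊y - Ψ 0⌋ : ℤ)) ≤ y := by
      rw [hd]; have := Int.floor_le (y - Ψ 0); linarith
    have h2 : y ≤ Ψ (0 + (⌈y - Ψ 0⌉ : ℤ)) := by
      rw [hd]; have := Int.le_ceil (y - Ψ 0); linarith
    exact mem_range_of_exists_le_of_exists_ge hc ⟨_, h1⟩ ⟨_, h2⟩
  have hcore : ∀ y, ∃ s ∈ core R D F, Ψ (F s) = y := by
    intro y
    obtain ⟨x, hx⟩ := hsurj (y - τ)
    by_cases hxc : x ∈ core R D F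
    · exact ⟨x, hxc, by rw [hF x hxc]; linarith⟩
    · obtain ⟨s, u, h1, h2, h3, h4, h5⟩ := S.exists_hole hxc
      have h6 := S.semi_hole hm hd hτ hF ⟨h1, h4, h5⟩
      refine ⟨s, h4, ?_⟩
      rw [hF s h4]
      have := hm h2.le
      have := hm h3.le
      linarith
  by_contra hne
  have hK : IsCompact (F '' (core R D F ∩ Set.Icc (t - 2) (t + 1))) := by
    refine IsCompact.image_of_continuousOn ?_
      (S.continuousOn.mono fun x hx => S.core_subset hx.1)
    exact isCompact_Icc.of_isClosed_subset (RotSys.core_closed.inter isClosed_Icc) fun x hx => hx.2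
  have htK : t ∈ (F '' (core R D F ∩ Set.Icc (t - 2) (t + 1)))ᶜ := by
    rintro ⟨s, hs, h⟩
    exact hne ⟨s, hs.1, h⟩
  obtain ⟨η, hη, hball⟩ := Metric.isOpen_iff.1 hK.isClosed.isOpen_compl t htK
  have hfree : ∀ s ∈ core R D F, |F s - t| < min η 1 → False := by
    intro s hs h
    have h1 := lt_of_lt_of_le h (min_le_left _ _)
    have h2 := lt_of_lt_of_le h (min_le_right _ _)
    rw [abs_lt] at h2
    have h3 := S.disp (S.core_subset hs)
    exact hball (Metric.mem_ball.2 (by rwa [Real.dist_eq])) ⟨s, ⟨hs, by linarith, by linarith⟩, rfl⟩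
  set ε := min η 1 with hε
  have hε0 : 0 < ε := lt_min hη one_pos
  have hconst : Ψ (t - ε / 2) = Ψ (t + ε / 2) := by
    refine le_antisymm (hm (by linarith)) ?_
    by_contra h
    rw [not_le] at h
    obtain ⟨s, hs, h1⟩ := hcore ((Ψ (t - ε / 2) + Ψ (t + ε / 2)) / 2)
    have h2 : t - ε / 2 < F s := by
      by_contra h3
      have := hm (not_lt.1 h3)
      linarith
    have h3 : F s < t + ε / 2 := by
      by_contra h3
      have := hm (not_lt.1 h3)
      linarith
    exact hfree s hs (abs_lt.2 ⟨by linarith, by linarith⟩)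
  have e1 : Ψ (t - ε / 2) = Ψ t := le_antisymm (hm (by linarith)) (hconst ▸ hm (by linarith))
  have e2 : Ψ (t + ε / 2) = Ψ t := hconst ▸ e1
  obtain ⟨s, hs, h1⟩ := hcore (Ψ t)
  have hFs := S.map_core hs
  have h2 : ε ≤ |F s - t| := by
    by_contra h
    exact hfree s hs (not_le.1 h)
  rcases le_abs.1 h2 with h3 | h3
  · obtain ⟨a, ha, ha1, ha2⟩ : ∃ a ∈ core R D F, a < t ∧ Ψ a = Ψ t := by
      by_cases hc : t - ε / 2 ∈ core R D F
      · exact ⟨_, hc, by linarith, e1⟩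
      · obtain ⟨a, b, h4, h5, h6, h7, h8⟩ := S.exists_hole hc
        have h9 := S.semi_hole hm hd hτ hF ⟨h4, h7, h8⟩
        refine ⟨a, h7, by linarith, ?_⟩
        have := hm h5.le
        have := hm h6.le
        linarith
    exact S.semi_not_three hm hd hτ hF ha ht hFs ha1 (by linarith) (by rw [ha2, h1])
  · obtain ⟨a, ha, ha1, ha2⟩ : ∃ a ∈ core R D F, t < a ∧ Ψ a = Ψ t := by
      by_cases hc : t + ε / 2 ∈ core R D F
      · exact ⟨_, hc, by linarith, e2⟩
      · obtain ⟨a, b, h4, h5, h6, h7, h8⟩ := S.exists_hole hc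
        have h9 := S.semi_hole hm hd hτ hF ⟨h4, h7, h8⟩
        refine ⟨b, h8, by linarith, ?_⟩
        have := hm h5.le
        have := hm h6.le
        linarith
    exact S.semi_not_three hm hd hτ hF hFs ht ha (by linarith) ha1 (by rw [ha2, h1])

theorem siegelData (S : MaxSys R k D F G) :
    ∃ Ψ θ, SiegelData R k (core R D F) Ψ θ := by
  obtain ⟨f, hf⟩ := S.exists_lift
  have hτ := S.irrational hf
  obtain ⟨Ψ, hc, hm, hd1, hconj⟩ := f.exists_semiconj hτ
  set τ := f.translationNumber
  have hd : ∀ t (n : ℤ), Ψ (t + n) = Ψ t + n := fun t n => by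
    let g : CircleDeg1Lift := ⟨⟨Ψ, hm⟩, hd1⟩
    exact g.map_add_int t n
  have hF : ∀ t ∈ core R D F, Ψ (F t) = Ψ t + τ := fun t ht => by rw [← hf t ht, hconj]
  refine ⟨Ψ, τ,
    { closed := RotSys.core_closed
      per := fun n ht => S.core_per n ht
      nonempty := S.core_nonempty
      continuous := hc
      monotone := hm
      deg := hd1
      irrational := hτ
      hole := ?_
      cls := ?_
      map := ?_
      surj := ?_ }⟩
  · intro t ht
    obtain ⟨s, u, h1, h2, h3, h4, h5⟩ := S.exists_hole ht
    exact ⟨s, u, h4, h5, h2, h3, h1.2.2.2.1, h1.2.2.2.2.1, S.semi_hole hm hd hτ hF ⟨h1, h4, h5⟩,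
      fun x h6 h7 hx => hx s u h1 ⟨h6, h7⟩⟩
  · intro x y hx hy h1 h2 hR
    rcases S.semi_rel hm hd hτ hF hx hy h1 h2 hR with h | h
    · exact Or.inl fun t h3 h4 ht => S.semi_not_three hm hd hτ hF hx ht hy h3 h4 h.symm
    · exact Or.inr fun t h3 h4 ht => S.semi_not_three hm hd hτ hF hy ht (S.core_add_one hx) h3 h4
        (by rw [hd1, h])
  · intro t ht
    obtain ⟨n, hn⟩ := S.cong (S.core_subset ht)
    have h1 : 3 ^ k * t = F t + (-n : ℤ) := by rw [hn]; push_cast; ring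
    rw [h1]
    exact ⟨S.core_per _ (S.map_core ht), -n, by rw [hd, hF t ht]⟩
  · intro t ht
    obtain ⟨s, hs, h⟩ := S.semi_surj hc hm hd hτ hF ht
    obtain ⟨n, hn⟩ := S.cong (S.core_subset hs)
    exact ⟨s, hs, -n, by rw [← h, hn]; push_cast; ring⟩

end MaxSys

/-- Without Siegel gaps there are no rotation systems. -/
theorem RotSys.false {R : ℝ → ℝ → Prop} {k : ℕ} {D : Set ℝ} {F : ℝ → ℝ} {G : ℝ → ℝ → Prop}
    (S : RotSys R k D F G) (hR : NoSiegel R)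
    (hper : ∀ m, 0 < m → m < k → ∀ t ∈ D, 3 ^ m * t ∉ D) : False := by
  obtain ⟨D₁, hD, G₁, S₁⟩ := S.exists_maxSys
  obtain ⟨Ψ, θ, h⟩ := S₁.siegelData
  refine hR k _ Ψ θ S₁.pos h fun m h1 h2 => ?_
  obtain ⟨x, hx⟩ := S₁.core_nonempty
  exact ⟨x, hx, fun hx' => hper m h1 h2 x (hD (S₁.core_subset hx)) (hD (S₁.core_subset hx'))⟩


/-! ### Leaf arcs around the two fixed points of tripling -/

theorem Int.cast_between_false {n : ℤ} (m : ℤ) (h1 : (m : ℝ) < n) (h2 : (n : ℝ) < m + 1) : False := by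
  have h1' : m < n := by exact_mod_cast h1
  have h2' : n < m + 1 := by exact_mod_cast h2
  omega

/-- A rotation system from a family of disjoint arcs that are mapped off themselves. -/
theorem PreSys.rotSys {R : ℝ → ℝ → Prop} {k : ℕ} {E : Set ℝ} {F : ℝ → ℝ} {G : ℝ → ℝ → Prop}
    (P : PreSys R k E F) (gper : ∀ {e f} (n : ℤ), G e f → G (e + n) (f + n))
    (gm : ∀ {e f}, G e f → Memb R E F e f)
    (disj : ∀ {e f e' f'}, G e f → G e' f' → e < f' → e' < f → e = e' ∧ f = f')
    (cov : ∀ {t}, t ∉ E → ∃ e f, G e f ∧ e < t ∧ t < f)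
    (sep : ∃ δ > 0, ∀ e f, G e f → δ ≤ f - e)
    (two : ∀ {e₁ f₁ e₂ f₂ e₃ f₃}, G e₁ f₁ → G e₂ f₂ → G e₃ f₃ → f₁ ≤ e₂ → f₂ ≤ e₃ → ¬ f₃ ≤ e₁ + 1)
    (nest : ∀ {s u p q}, (∀ e f, G e f → ∀ x ∈ ({s, u, p, q} : Set ℝ), ¬ (e < x ∧ x < f)) →
      Memb R E F s u → Memb R E F q (p + 1) → s < p → p < q → ¬ q < u)
    (ex : ∃ e f, G e f) : RotSys R k {t | ∀ e f, G e f → ¬ (e < t ∧ t < f)} F G := by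
  set D : Set ℝ := {t | ∀ e f, G e f → ¬ (e < t ∧ t < f)} with hD
  have hDE : D ⊆ E := fun t ht => by
    by_contra h
    obtain ⟨e, f, h1, h2⟩ := cov h
    exact ht e f h1 h2
  have hDper : ∀ {t} (n : ℤ), t ∈ D → t + n ∈ D := fun {t} n ht e f h h' => by
    refine ht _ _ (gper (-n) h) ⟨?_, ?_⟩ <;> push_cast <;> linarith [h'.1, h'.2]
  have hl : ∀ {e f}, G e f → e ∈ D := fun h e' f' h' hh => by
    have h1 := (gm h).2.2.1
    have := (disj h h' hh.2 (by linarith [hh.1])).1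
    linarith [hh.1]
  have hr : ∀ {e f}, G e f → f ∈ D := fun h e' f' h' hh => by
    have h1 := (gm h).2.2.1
    have := (disj h h' (by linarith [hh.2]) hh.1).2
    linarith [hh.2]
  refine
    { lam := P.lam
      per := hDper
      map_add_int := P.map_add_int
      disp := fun ht => P.disp (hDE ht)
      cong := fun ht => P.cong (hDE ht)
      aff := fun h h' => P.aff h (h'.trans hDE)
      closed := ?_
      gap_per := gper
      gap := fun h => ⟨(gm h).2.2.1, hl h, hr h, fun t h1 h2 ht => ht _ _ h ⟨h1, h2⟩⟩
      cover := ?_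
      memb := fun h => (gm h).mono (hl h) (hr h)
      sep := sep
      two := two
      nest := ?_
      gap_ex := ex }
  · have : D = ⋂ (s : ℝ) (u : ℝ) (_ : G s u), (Set.Ioo s u)ᶜ := by
      ext t
      simp [hD]
    rw [this]
    exact isClosed_iInter fun s => isClosed_iInter fun u => isClosed_iInter fun _ =>
      isOpen_Ioo.isClosed_compl
  · intro t ht
    simp only [hD, Set.mem_ofPred_eq, not_forall, not_not] at ht
    obtain ⟨e, f, h, h'⟩ := ht
    exact ⟨e, f, h, h'⟩
  · intro s u p q h1 h2
    refine nest ?_ (h1.mono (hDE h1.1) (hDE h1.2.1)) (h2.mono (hDE h2.1) (hDE h2.2.1))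
    intro e f hG x hx
    have hp : p ∈ D := by
      have := hDper (-1) h2.2.1
      simpa using this
    simp only [Set.mem_insert_iff, Set.mem_singleton_iff] at hx
    rcases hx with rfl | rfl | rfl | rfl
    · exact h1.1 e f hG
    · exact h1.2.1 e f hG
    · exact hp e f hG
    · exact h2.1 e f hG

/-- The numbers that are not half-integers. -/
def offHalf : Set ℝ := {t | ∀ n : ℤ, 2 * t ≠ n}

/-- The lift of the tripling map with displacement in `[0, 1)`. -/
noncomputable def dbl (t : ℝ) : ℝ := t + Int.fract (2 * t)

theorem dbl_add_int (t : ℝ) (n : ℤ) : dbl (t + n) = dbl t + n := by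
  have : Int.fract (2 * (t + n)) = Int.fract (2 * t) := by
    rw [mul_add, show (2 : ℝ) * n = ((2 * n : ℤ) : ℝ) by push_cast; ring, Int.fract_add_intCast]
  rw [dbl, dbl, this]; ring

theorem floor_eq_of_Icc_subset_offHalf {s t : ℝ} (hst : s ≤ t) (h : Set.Icc s t ⊆ offHalf) :
    ⌊2 * t⌋ = ⌊2 * s⌋ := by
  refine le_antisymm ?_ (Int.floor_le_floor (by linarith))
  by_contra hlt
  rw [not_le] at hlt
  have h1 : 2 * s < ⌊2 * t⌋ := Int.floor_lt.1 hlt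
  have h2 := Int.floor_le (2 * t)
  exact h (show (⌊2 * t⌋ : ℝ) / 2 ∈ Set.Icc s t from ⟨by linarith, by linarith⟩) ⌊2 * t⌋ (by ring)

/-- The half-integers are the fixed points of tripling modulo one; off them the displacement of
`dbl` is positive and less than one. -/
theorem Lam.preSys {R : ℝ → ℝ → Prop} (h : Lam R) : PreSys R 1 offHalf dbl where
  lam := h
  per {t} n ht m hm := ht (m - 2 * n) (by push_cast; linarith)
  map_add_int := dbl_add_int
  disp {t} ht := by
    have h1 : 0 < Int.fract (2 * t) := Int.fract_pos.2 (ht _)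
    have h2 := Int.fract_lt_one (2 * t)
    constructor <;> rw [dbl] <;> linarith
  cong {t} _ := ⟨-⌊2 * t⌋, by rw [dbl, Int.fract]; push_cast; ring⟩
  aff {s t} hst hD := by
    have := floor_eq_of_Icc_subset_offHalf hst hD
    rw [dbl, dbl, Int.fract, Int.fract, this]; ring

namespace Lam

variable {R : ℝ → ℝ → Prop}

/-- The class of a half-integer consists of half-integers. -/
theorem half_class (h : Lam R) {x y : ℝ} (hx : x ∉ offHalf) (hR : R x y) : y ∉ offHalf := by
  simp only [offHalf, ne_eq, Set.mem_ofPred_eq, not_forall, not_not] at hx ⊢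
  obtain ⟨n, hn⟩ := hx
  have h1 : R y (3 ^ 1 * y) := by
    have h2 := h.fwd hR
    rw [show 3 * x = x + n by linarith] at h2
    rw [pow_one]
    exact h.trans (h.symm hR) (h.trans (h.per x n) h2)
  obtain ⟨m, hm⟩ := h.nopoly y 1 h1
  exact ⟨m, by linarith⟩

/-- The image order is reversed both from s to p and from q to u. Since `dbl` is increasing on
intervals free of half-integers, each of these two intervals contains one. -/
theorem half_of_nest (h : Lam R) {s u p q : ℝ} (h1 : Memb R offHalf dbl s u)
    (h2 : Memb R offHalf dbl q (p + 1)) (h3 : s < p) (h4 : p < q) (h5 : q < u) :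
    ∃ m n : ℤ, s < m / 2 ∧ (m : ℝ) / 2 < p ∧ q < n / 2 ∧ (n : ℝ) / 2 < u := by
  have hE : ∀ {x y}, x < y → x ∈ offHalf → y ∈ offHalf → dbl y ≤ dbl x →
      ∃ m : ℤ, x < m / 2 ∧ (m : ℝ) / 2 < y := by
    intro x y hxy hx hy hd
    by_contra hc
    have hsub : Set.Icc x y ⊆ offHalf := by
      intro z hz n hn
      rcases eq_or_lt_of_le hz.1 with h6 | h6
      · rw [← h6] at hn; exact hx n hn
      rcases eq_or_lt_of_le hz.2 with h7 | h7
      · rw [h7] at hn; exact hy n hn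
      exact hc ⟨n, by linarith, by linarith⟩
    have := h.preSys.aff hxy.le hsub
    linarith
  have hp : p ∈ offHalf := by simpa using h.preSys.per (-1) h2.2.1
  have e1 := h1.2.2.2.2.2
  have e2 := h2.2.2.2.2.2
  rw [show dbl (p + 1) = dbl p + 1 by simpa using dbl_add_int p 1] at e2
  obtain ⟨m, hm⟩ := hE h3 h1.1 hp (by linarith)
  obtain ⟨n, hn⟩ := hE h5 h2.1 h1.2.1 (by linarith)
  exact ⟨m, n, hm.1, hm.2, hn.1, hn.2⟩

/-- Two consecutive half-integers represent both fixed points, so the translates of the arc cover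
everything off the domain of `dbl` and form a rotation system. The nesting condition holds since two
different translates of the arc do not fit into an arc shorter than one. -/
theorem not_two_half (h : Lam R) (hS : NoSiegel R) {s u : ℝ} (hM : Memb R offHalf dbl s u) {m : ℤ}
    (h1 : s < m / 2) (h2 : ((m : ℝ) + 1) / 2 < u) : False := by
  have hus := hM.2.2.2.1
  have hsu := hM.2.2.1
  have S := h.preSys.rotSys (G := fun e f => ∃ n : ℤ, e = s + n ∧ f = u + n) ?_ ?_ ?_ ?_ ?_ ?_ ?_
    ⟨s, u, 0, by simp⟩
  · exact S.false hS (fun m hm hm' => by omega)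
  · rintro e f j ⟨n, rfl, rfl⟩
    exact ⟨n + j, by push_cast; ring, by push_cast; ring⟩
  · rintro e f ⟨n, rfl, rfl⟩
    exact h.preSys.memb_shift n hM
  · rintro e f e' f' ⟨n, rfl, rfl⟩ ⟨n', rfl, rfl⟩ h3 h4
    have h5 : (n : ℝ) < n' + 1 := by linarith
    have h6 : (n' : ℝ) < n + 1 := by linarith
    have h5' : n < n' + 1 := by exact_mod_cast h5
    have h6' : n' < n + 1 := by exact_mod_cast h6
    have : n = n' := by omega
    subst this
    exact ⟨rfl, rfl⟩
  · intro t ht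
    simp only [offHalf, ne_eq, Set.mem_ofPred_eq, not_forall, not_not] at ht
    obtain ⟨j, hj⟩ := ht
    obtain ⟨i, hi | hi⟩ : ∃ i : ℤ, j = m + 2 * i ∨ j = m + 1 + 2 * i :=
      ⟨(j - m) / 2, by omega⟩
    · subst hi
      push_cast at hj
      exact ⟨_, _, ⟨i, rfl, rfl⟩, by linarith, by linarith⟩
    · subst hi
      push_cast at hj
      exact ⟨_, _, ⟨i, rfl, rfl⟩, by linarith, by linarith⟩
  · refine ⟨u - s, by linarith, ?_⟩
    rintro e f ⟨n, rfl, rfl⟩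
    linarith
  · rintro e₁ f₁ e₂ f₂ e₃ f₃ ⟨n, rfl, rfl⟩ ⟨n', rfl, rfl⟩ ⟨n'', rfl, rfl⟩ h3 h4 h5
    have h6 : (n : ℝ) < n' := by linarith
    have h7 : (n' : ℝ) < n'' := by linarith
    have h8 : (n'' : ℝ) < n + 1 := by linarith
    have h6' : n < n' := by exact_mod_cast h6
    have h7' : n' < n'' := by exact_mod_cast h7
    have h8' : n'' < n + 1 := by exact_mod_cast h8
    omega
  · intro s' u' p q hD h3 h4 h5 h6 h7
    obtain ⟨i, j, i1, i2, j1, j2⟩ := h.half_of_nest h3 h4 h5 h6 h7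
    have hcov : ∀ i : ℤ, ∃ n : ℤ, s + n < (i : ℝ) / 2 ∧ (i : ℝ) / 2 < u + n := by
      intro j
      obtain ⟨i, hi | hi⟩ : ∃ i : ℤ, j = m + 2 * i ∨ j = m + 1 + 2 * i :=
        ⟨(j - m) / 2, by omega⟩
      · subst hi; push_cast
        exact ⟨i, by linarith, by linarith⟩
      · subst hi; push_cast
        exact ⟨i, by linarith, by linarith⟩
    obtain ⟨n, hn1, hn2⟩ := hcov i
    obtain ⟨n', hn1', hn2'⟩ := hcov j
    have d1 := hD _ _ ⟨n, rfl, rfl⟩ s' (by simp)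
    have d2 := hD _ _ ⟨n, rfl, rfl⟩ p (by simp)
    have d3 := hD _ _ ⟨n', rfl, rfl⟩ q (by simp)
    have d4 := hD _ _ ⟨n', rfl, rfl⟩ u' (by simp)
    have c1 : s' ≤ s + n := by by_contra hc; exact d1 ⟨not_le.1 hc, by linarith⟩
    have c2 : u + n ≤ p := by by_contra hc; exact d2 ⟨by linarith, not_le.1 hc⟩
    have c3 : q ≤ s + n' := by by_contra hc; exact d3 ⟨not_le.1 hc, by linarith⟩
    have c4 : u + n' ≤ u' := by by_contra hc; exact d4 ⟨by linarith, not_le.1 hc⟩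
    have c5 := h3.2.2.2.1
    exact Int.cast_between_false (n := n') n (by linarith) (by linarith)

theorem nest_false (h : Lam R) (hS : NoSiegel R) {s u p q : ℝ} (h1 : Memb R offHalf dbl s u)
    (h2 : Memb R offHalf dbl q (p + 1)) (h3 : s < p) (h4 : p < q) : ¬ q < u := by
  intro h5
  obtain ⟨m, n, m1, m2, n1, n2⟩ := h.half_of_nest h1 h2 h3 h4 h5
  have h6 : (m : ℝ) < n := by linarith
  have h6' : m + 1 ≤ n := by exact_mod_cast h6
  have h7 : (m : ℝ) + 1 ≤ n := by exact_mod_cast h6'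
  exact h.not_two_half hS h1 m1 (by linarith)

/-- If the arcs overlapped, their union would contain both fixed points, against `not_two_half`.
Being disjoint, their translates are the gaps of a rotation system. -/
theorem not_both_half (h : Lam R) (hS : NoSiegel R) {s₀ u₀ s₁ u₁ : ℝ}
    (hM₀ : Memb R offHalf dbl s₀ u₀) (hM₁ : Memb R offHalf dbl s₁ u₁) (h₀ : s₀ < 0) (h₀' : 0 < u₀)
    (h₁ : s₁ < 1 / 2) (h₁' : 1 / 2 < u₁) : False := by
  have P := h.preSys
  have a3 : ¬ s₀ < -1 / 2 := fun hc =>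
    h.not_two_half hS hM₀ (m := -1) (by push_cast; linarith) (by push_cast; linarith)
  have a4 : ¬ 1 / 2 < u₀ := fun hc =>
    h.not_two_half hS hM₀ (m := 0) (by push_cast; linarith) (by push_cast; linarith)
  have b3 : ¬ s₁ < 0 := fun hc =>
    h.not_two_half hS hM₁ (m := 0) (by push_cast; linarith) (by push_cast; linarith)
  have b4 : ¬ 1 < u₁ := fun hc =>
    h.not_two_half hS hM₁ (m := 1) (by push_cast; linarith) (by push_cast; linarith)
  have o1 : u₀ ≤ s₁ := by
    by_contra hc
    have := P.memb_union (h.nest_false hS) hM₀ hM₁ (by linarith) (not_le.1 hc) (by linarith)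
    exact h.not_two_half hS this (m := 0) (by push_cast; linarith) (by push_cast; linarith)
  have hM₀' : Memb R offHalf dbl (s₀ + 1) (u₀ + 1) := by simpa using P.memb_shift 1 hM₀
  have o2 : u₁ ≤ s₀ + 1 := by
    by_contra hc
    have := P.memb_union (h.nest_false hS) hM₁ hM₀' (by linarith) (not_le.1 hc) (by linarith)
    exact h.not_two_half hS this (m := 1) (by push_cast; linarith) (by push_cast; linarith)
  have S := P.rotSys (G := fun e f => ∃ n : ℤ, (e = s₀ + n ∧ f = u₀ + n) ∨ (e = s₁ + n ∧ f = u₁ + n))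
    ?_ ?_ ?_ ?_ ?_ ?_ ?_ ⟨s₀, u₀, 0, by simp⟩
  · exact S.false hS (fun m hm hm' => by omega)
  · rintro e f j ⟨n, ⟨rfl, rfl⟩ | ⟨rfl, rfl⟩⟩
    · exact ⟨n + j, Or.inl ⟨by push_cast; ring, by push_cast; ring⟩⟩
    · exact ⟨n + j, Or.inr ⟨by push_cast; ring, by push_cast; ring⟩⟩
  · rintro e f ⟨n, ⟨rfl, rfl⟩ | ⟨rfl, rfl⟩⟩
    · exact P.memb_shift n hM₀
    · exact P.memb_shift n hM₁
  · have key : ∀ n n' : ℤ, (n : ℝ) < n' + 1 → (n' : ℝ) < n + 1 → n = n' := by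
      intro n n' h5 h6
      have h5' : n < n' + 1 := by exact_mod_cast h5
      have h6' : n' < n + 1 := by exact_mod_cast h6
      omega
    rintro e f e' f' ⟨n, ⟨rfl, rfl⟩ | ⟨rfl, rfl⟩⟩ ⟨n', ⟨rfl, rfl⟩ | ⟨rfl, rfl⟩⟩ h3 h4
    · have := key n n' (by linarith) (by linarith)
      subst this; exact ⟨rfl, rfl⟩
    · exfalso
      rcases le_or_gt n n' with hn | hn
      · have : (n : ℝ) ≤ n' := by exact_mod_cast hn
        linarith
      · have : (n' : ℝ) + 1 ≤ n := by exact_mod_cast hn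
        linarith
    · exfalso
      rcases le_or_gt n' n with hn | hn
      · have : (n' : ℝ) ≤ n := by exact_mod_cast hn
        linarith
      · have : (n : ℝ) + 1 ≤ n' := by exact_mod_cast hn
        linarith
    · have := key n n' (by linarith) (by linarith)
      subst this; exact ⟨rfl, rfl⟩
  · intro t ht
    simp only [offHalf, ne_eq, Set.mem_ofPred_eq, not_forall, not_not] at ht
    obtain ⟨j, hj⟩ := ht
    obtain ⟨i, hi | hi⟩ : ∃ i : ℤ, j = 2 * i ∨ j = 1 + 2 * i := ⟨j / 2, by omega⟩
    · subst hi
      push_cast at hj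
      exact ⟨_, _, ⟨i, Or.inl ⟨rfl, rfl⟩⟩, by linarith, by linarith⟩
    · subst hi
      push_cast at hj
      exact ⟨_, _, ⟨i, Or.inr ⟨rfl, rfl⟩⟩, by linarith, by linarith⟩
  · refine ⟨min (u₀ - s₀) (u₁ - s₁), lt_min (by linarith) (by linarith), ?_⟩
    rintro e f ⟨n, ⟨rfl, rfl⟩ | ⟨rfl, rfl⟩⟩
    · have := min_le_left (u₀ - s₀) (u₁ - s₁); linarith
    · have := min_le_right (u₀ - s₀) (u₁ - s₁); linarith
  · have key : ∀ e f, (∃ n : ℤ, (e = s₀ + n ∧ f = u₀ + n) ∨ (e = s₁ + n ∧ f = u₁ + n)) →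
        ∃ i : ℤ, e < (i : ℝ) / 2 ∧ (i : ℝ) / 2 < f := by
      rintro e f ⟨n, ⟨rfl, rfl⟩ | ⟨rfl, rfl⟩⟩
      · exact ⟨2 * n, by push_cast; linarith, by push_cast; linarith⟩
      · exact ⟨2 * n + 1, by push_cast; linarith, by push_cast; linarith⟩
    intro e₁ f₁ e₂ f₂ e₃ f₃ g1 g2 g3 h3 h4 h5
    obtain ⟨i, i1, i2⟩ := key _ _ g1
    obtain ⟨j, j1, j2⟩ := key _ _ g2
    obtain ⟨l, l1, l2⟩ := key _ _ g3
    have h6 : (i : ℝ) < j := by linarith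
    have h7 : (j : ℝ) < l := by linarith
    have h8 : (l : ℝ) < i + 2 := by linarith
    have h6' : i < j := by exact_mod_cast h6
    have h7' : j < l := by exact_mod_cast h7
    have h8' : l < i + 2 := by exact_mod_cast h8
    omega
  · intro s' u' p q _ h3 h4
    exact h.nest_false hS h3 h4

/-- The relation seen from the other fixed point of the tripling map. -/
theorem half_shift (h : Lam R) : Lam fun s t => R (s + 1 / 2) (t + 1 / 2) where
  refl t := h.refl _
  symm hst := h.symm hst
  trans hst htu := h.trans hst htu
  per t n := by
    have := h.per (t + 1 / 2) n
    rwa [add_right_comm] at this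
  cross {s u t v} h1 h2 h3 h4 hst huv :=
    h.cross (by linarith) (by linarith) (by linarith) (by linarith) hst huv
  closed := h.closed.preimage (by fun_prop : Continuous fun p : ℝ × ℝ => (p.1 + 1 / 2, p.2 + 1 / 2))
  fwd {s t} hst := by
    have := h.shift (h.fwd hst) (-1) (-1)
    convert this using 1 <;> push_cast <;> ring
  back {s t} hst := by
    have h1 := h.shift hst 1 1
    obtain ⟨w, hw, n, hn⟩ := h.back (s := s + 1 / 2) (t := t + 1 / 2 + (1 : ℤ)) (by
      convert h1 using 1; push_cast; ring)
    refine ⟨w - 1 / 2, by simpa using hw, n, ?_⟩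
    push_cast at hn
    linarith
  nopoly s k hs := by
    obtain ⟨j, hj⟩ : ∃ j : ℤ, (3 : ℝ) ^ k * (1 / 2) = 1 / 2 + j := by
      induction k with
      | zero => exact ⟨0, by simp⟩
      | succ k ih =>
        have : ∀ k : ℕ, ∃ j : ℤ, (3 : ℝ) ^ k * (1 / 2) = 1 / 2 + j := by
          intro k
          induction k with
          | zero => exact ⟨0, by simp⟩
          | succ k ih =>
            obtain ⟨j, hj⟩ := ih
            exact ⟨3 * j + 1, by rw [pow_succ', mul_assoc, hj]; push_cast; ring⟩
        exact this (k + 1)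
    obtain ⟨n, hn⟩ := h.nopoly (s + 1 / 2) k (by
      have := h.shift_right hs j
      convert this using 1
      rw [mul_add, hj]; ring)
    refine ⟨n - j, ?_⟩
    push_cast; linarith
  cov {s u} h1 h2 hsu hole := by
    have h3 : ∀ w, s + 1 / 2 < w → w < u + 1 / 2 → ¬ R (s + 1 / 2) w := fun w hw1 hw2 hw =>
      hole (w - 1 / 2) (by linarith) (by linarith) (by simpa using hw)
    rcases h.cov (by linarith) (by linarith) hsu h3 with h4 | ⟨n, hn1, hn2, hn3⟩
    · left
      intro w hw
      obtain ⟨n, hn⟩ := h4 _ hw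
      exact ⟨n, by linarith⟩
    · right
      refine ⟨n, by linarith, by linarith, fun w hw1 hw2 hw => ?_⟩
      refine hn3 (w + 3 / 2) (by linarith) (by linarith) ?_
      have := h.shift hw 1 1
      convert this using 1 <;> push_cast <;> ring

end Lam

/-- A lamination in which all leaf arcs in `(0, 1)` are mapped off themselves. -/
structure GLam (R : ℝ → ℝ → Prop) : Prop extends Lam R where
  bound : ∀ {s u}, 0 < s → s < u → u < 1 → s ≠ 1 / 2 → u ≠ 1 / 2 → R s u →
    u < dbl s ∧ dbl u < s + 1

/-- Seen from one of the two fixed points, all leaf arcs in `(0, 1)` are mapped off themselves. -/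
theorem Lam.glam_or {R : ℝ → ℝ → Prop} (h : Lam R) (hS : NoSiegel R) :
    GLam R ∨ GLam fun s t => R (s + 1 / 2) (t + 1 / 2) := by
  have hE : ∀ {x : ℝ}, 0 < x → x < 1 → x ≠ 1 / 2 → x ∈ offHalf := by
    intro x h1 h2 h3 n hn
    have n1 : (0 : ℝ) < n := by linarith
    have n2 : (n : ℝ) < 2 := by linarith
    have n1' : 0 < n := by exact_mod_cast n1
    have n2' : n < 2 := by exact_mod_cast n2
    have : n = 1 := by omega
    subst this
    exact h3 (by push_cast at hn; linarith)
  have hd1 : ∀ t, dbl (t + 1) = dbl t + 1 := fun t => by simpa using dbl_add_int t 1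
  -- The base point is 1/2 if some arc moved off itself surrounds 0, and 0 otherwise. A leaf arc in
  -- (0, 1) that is not moved off itself has a complementary arc that is, and this one surrounds the
  -- base point; in the first case it would do so together with an arc around 0.
  by_cases h0 : ∃ s u, Memb R offHalf dbl s u ∧ s < 0 ∧ 0 < u
  · obtain ⟨s₀, u₀, hM₀, h1, h2⟩ := h0
    right
    refine { h.half_shift with bound := ?_ }
    intro s u hs hsu hu hs' hu' hR
    have hP := h.half_shift.preSys
    rcases hP.memb_or (hE hs (by linarith) hs') (hE (by linarith) hu hu') hsu (by linarith) hR with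
      h3 | h3
    · exact h3.2.2.2.2.2
    · exfalso
      have hdh : ∀ t, dbl (t + 1 / 2) = dbl t + 1 / 2 := fun t => by
        rw [dbl, dbl, mul_add, mul_one_div_cancel two_ne_zero, Int.fract_add_one]; ring
      have hoff : ∀ {t}, t ∈ offHalf → t - 1 / 2 ∈ offHalf := fun {t} ht n hn =>
        ht (n + 1) (by push_cast; linarith)
      have h4 := h3.2.2.2.2.2
      have h5 : Memb R offHalf dbl (u - 1 / 2) (s + 1 / 2) := by
        refine ⟨hoff h3.1, ?_, by linarith, by linarith, ?_, ?_, ?_⟩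
        · have := hoff h3.2.1
          rwa [show s + 1 - 1 / 2 = s + 1 / 2 by ring] at this
        · have := h.shift h3.2.2.2.2.1 (-1) (-1)
          convert this using 1 <;> push_cast <;> ring
        · have := hdh (u - 1 / 2)
          rw [sub_add_cancel] at this
          linarith
        · rw [hdh]; linarith [hd1 s]
      exact h.not_both_half hS hM₀ h5 h1 h2 (by linarith) (by linarith)
  · left
    refine { h with bound := ?_ }
    intro s u hs hsu hu hs' hu' hR
    have hP := h.preSys
    rcases hP.memb_or (hE hs (by linarith) hs') (hE (by linarith) hu hu') hsu (by linarith) hR with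
      h3 | h3
    · exact h3.2.2.2.2.2
    · exfalso
      have := hP.memb_shift (-1) h3
      exact h0 ⟨_, _, this, by push_cast; linarith, by push_cast; linarith⟩


/-! ### Explicit bounds for leaf arcs that avoid the base point -/

theorem dbl_lo {t : ℝ} (h0 : 0 ≤ t) (h1 : t < 1 / 2) : dbl t = 3 * t := by
  rw [dbl, Int.fract_eq_self.2 ⟨by linarith, by linarith⟩]; ring

theorem dbl_hi {t : ℝ} (h0 : 1 / 2 ≤ t) (h1 : t < 1) : dbl t = 3 * t - 1 := by
  have := dbl_add_int (t - 1 / 2) 0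
  have h2 : dbl t = dbl (t - 1 / 2) + 1 / 2 := by
    rw [dbl, dbl, show 2 * t = 2 * (t - 1 / 2) + 1 by ring, Int.fract_add_one]; ring
  rw [h2, dbl_lo (by linarith) (by linarith)]; ring

theorem mem_offHalf {x : ℝ} (h1 : 0 < x) (h2 : x < 1) (h3 : x ≠ 1 / 2) : x ∈ offHalf := by
  intro n hn
  have n1 : (0 : ℝ) < n := by linarith
  have n2 : (n : ℝ) < 2 := by linarith
  have n1' : 0 < n := by exact_mod_cast n1
  have n2' : n < 2 := by exact_mod_cast n2
  have : n = 1 := by omega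
  subst this
  exact h3 (by push_cast at hn; linarith)

theorem not_mem_offHalf (n : ℤ) {x : ℝ} (h : 2 * x = n) : x ∉ offHalf := fun hx => hx n h

/-- The three preimages. -/
theorem Lam.back3 {R : ℝ → ℝ → Prop} (h : Lam R) {x y : ℝ} (m : ℤ) (hR : R (3 * x) (3 * y + m)) :
    R x y ∨ R x (y + 1 / 3) ∨ R x (y + 2 / 3) := by
  obtain ⟨w, hw, n, hn⟩ := h.back hR
  obtain ⟨i, hi⟩ : ∃ i : ℤ, m + n = 3 * i ∨ m + n = 3 * i + 1 ∨ m + n = 3 * i + 2 :=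
    ⟨(m + n) / 3, by omega⟩
  have hmn : 3 * w = 3 * y + ((m + n : ℤ) : ℝ) := by push_cast; linarith
  rcases hi with hi | hi | hi <;> rw [hi] at hmn <;> push_cast at hmn
  · left
    refine h.of_shift i ?_
    convert hw using 1; linarith
  · right; left
    refine h.of_shift i ?_
    convert hw using 1; linarith
  · right; right
    refine h.of_shift i ?_
    convert hw using 1; linarith

namespace GLam

variable {R : ℝ → ℝ → Prop}

/-- This and the three following lemmas make `bound` explicit on either side of 1/2. Where the other
endpoint is unrestricted, it is not 1/2 because classes of half-integers consist of half-integers.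
-/
theorem bd_left (h : GLam R) {s u : ℝ} (hs : 0 < s) (hsu : s < u) (hu : u < 1) (hR : R s u)
    (hs' : s < 1 / 2) : u < 3 * s := by
  have h1 : u ∈ offHalf := by
    by_contra hc
    exact h.half_class hc (h.symm hR) (mem_offHalf hs (by linarith) (by linarith))
  have := (h.bound hs hsu hu (by linarith) (fun hc => h1 1 (by rw [hc]; norm_num)) hR).1
  rwa [dbl_lo hs.le hs'] at this

theorem bd_left' (h : GLam R) {s u : ℝ} (hs' : 1 / 2 < s) (hsu : s < u) (hu : u < 1)
    (hR : R s u) : u < 3 * s - 1 := by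
  have := (h.bound (by linarith) hsu hu (by linarith) (by linarith) hR).1
  rwa [dbl_hi hs'.le (by linarith)] at this

theorem bd_right (h : GLam R) {s u : ℝ} (hs : 0 < s) (hsu : s < u) (hu : u < 1 / 2)
    (hR : R s u) : 3 * u < s + 1 := by
  have := (h.bound hs hsu (by linarith) (by linarith) (by linarith) hR).2
  rwa [dbl_lo (by linarith) hu] at this

theorem bd_right' (h : GLam R) {s u : ℝ} (hs : 0 < s) (hsu : s < u) (hu : u < 1) (hR : R s u)
    (hu' : 1 / 2 < u) : 3 * u < s + 2 := by
  have h1 : s ∈ offHalf := by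
    by_contra hc
    exact h.half_class hc hR (mem_offHalf (by linarith) hu (by linarith))
  have := (h.bound hs hsu hu (fun hc => h1 1 (by rw [hc]; norm_num)) (by linarith) hR).2
  rw [dbl_hi hu'.le hu] at this
  linarith

/-- For an arc across 1/2 the bounds u < 3 * s and 3 * u < s + 2 add up to 4 * (u - s) < 2. -/
theorem len (h : GLam R) {s u : ℝ} (hs : 0 < s) (hsu : s < u) (hu : u < 1) (hR : R s u) :
    u - s < 1 / 2 := by
  rcases lt_trichotomy s (1 / 2) with h1 | h1 | h1
  · rcases le_or_gt u (1 / 2) with h2 | h2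
    · linarith
    · linarith [h.bd_left hs hsu hu hR h1, h.bd_right' hs hsu hu hR h2]
  · linarith
  · linarith

theorem reflect (h : GLam R) : GLam fun s t => R (-s) (-t) where
  toLam := h.toLam.reflect
  bound {s u} hs hsu hu hs' hu' hR := by
    have hR' : R (1 - u) (1 - s) := by
      have := h.shift (h.symm hR) 1 1
      convert this using 1 <;> push_cast <;> ring
    have h1 := h.bound (by linarith) (by linarith) (by linarith) (fun hc => hu' (by linarith))
      (fun hc => hs' (by linarith)) hR'
    have hd : ∀ {t}, 0 < t → t < 1 → t ≠ 1 / 2 → dbl (1 - t) = 2 - dbl t := by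
      intro t h0 h1 h2
      rcases lt_or_gt_of_ne h2 with h3 | h3
      · rw [dbl_lo h0.le h3, dbl_hi (by linarith) (by linarith)]; ring
      · rw [dbl_hi h3.le h1, dbl_lo (by linarith) (by linarith)]; ring
    rw [hd hs (by linarith) hs', hd (by linarith) hu hu'] at h1
    constructor <;> linarith

/-- The point u - 1/3 has the same image as u modulo one, so it is related to s, s + 1/3 or s + 2/3.
But 3 * u < s + 1 puts all three beyond 3 * (u - 1/3), against `bd_left`. -/
theorem not_third_inside (h : GLam R) {s u : ℝ} (hs : 0 < s) (h1 : s < 1 / 3) (h2 : 1 / 3 < u)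
    (hu : u < 1 / 2) (hR : R s u) : False := by
  have h3 := h.bd_right hs (by linarith) hu hR
  rcases h.back3 (x := u - 1 / 3) (y := s) (-1) (by
    have := h.shift (h.fwd (h.symm hR)) (-1) (-1)
    convert this using 1; push_cast; ring) with h4 | h4 | h4
  · linarith [h.bd_left (by linarith) (by linarith) (by linarith) (h.trans h4 hR) (by linarith)]
  · linarith [h.bd_left (by linarith) (by linarith) (by linarith) h4 (by linarith)]
  · linarith [h.bd_left (by linarith) (by linarith) (by linarith) h4 (by linarith)]

theorem trip_left (h : GLam R) {x y : ℝ} (hx : 0 < x) (hy : y < 1 / 2) (hR : R x y) :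
    3 * y ≤ 1 ∨ 1 ≤ 3 * x := by
  by_contra hc
  simp only [not_or, not_le] at hc
  exact h.not_third_inside hx (by linarith) (by linarith) hy hR

theorem trip_right (h : GLam R) {x y : ℝ} (hx : 1 / 2 < x) (hy : y < 1)
    (hR : R x y) : 3 * y ≤ 2 ∨ 2 ≤ 3 * x := by
  have hR' : R (-(1 - y)) (-(1 - x)) := by
    have := h.shift (h.symm hR) (-1) (-1)
    convert this using 1 <;> push_cast <;> ring
  rcases h.reflect.trip_left (x := 1 - y) (y := 1 - x) (by linarith) (by linarith) hR'
    with h1 | h1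
  · right; linarith
  · left; linarith

end GLam

/-! ### The longest leaf arc -/

/-- A longest leaf arc in `(0, 1)`, in the absence of a leaf joining the two fixed points. -/
structure Long (R : ℝ → ℝ → Prop) (a b : ℝ) : Prop extends GLam R where
  nohalf : ¬ R 0 (1 / 2)
  pos : 0 < a
  lt : a < b
  lt_one : b < 1
  rel : R a b
  long : ∀ {s u}, 0 < s → s < u → u < 1 → R s u → u - s ≤ b - a

namespace Long

variable {R : ℝ → ℝ → Prop} {a b : ℝ}

/-- The class of the base point is trivial: it consists of half-integers, and `nohalf` excludes the
other fixed point. -/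
theorem int_free (h : Long R a b) {s u : ℝ} (hR : R s u) (hu : ∃ n : ℤ, u = n) : ∃ n : ℤ, s = n := by
  obtain ⟨n, rfl⟩ := hu
  have h1 : s ∉ offHalf := h.half_class (not_mem_offHalf (2 * n) (by push_cast; ring)) (h.symm hR)
  simp only [offHalf, ne_eq, Set.mem_ofPred_eq, not_forall, not_not] at h1
  obtain ⟨m, hm⟩ := h1
  obtain ⟨i, hi | hi⟩ : ∃ i : ℤ, m = 2 * i ∨ m = 2 * i + 1 := ⟨m / 2, by omega⟩
  · subst hi; push_cast at hm
    exact ⟨i, by linarith⟩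
  · subst hi; push_cast at hm
    refine (h.nohalf ?_).elim
    have := h.shift (h.symm hR) (-n) (-i)
    convert this using 1
    · push_cast; ring
    · push_cast; linarith

theorem half_free (h : Long R a b) {s u : ℝ} (hR : R s u) (hs : 0 < s) (hs' : s < 1)
    (hu : ∃ n : ℤ, u = n + 1 / 2) : s = 1 / 2 := by
  obtain ⟨n, rfl⟩ := hu
  by_contra hc
  exact h.half_class (not_mem_offHalf (2 * n + 1) (by push_cast; ring)) (h.symm hR)
    (mem_offHalf hs hs' hc)

theorem no_int (h : Long R a b) {s u : ℝ} (hR : R s u) (m : ℤ) (hs : m < s) (hs' : s < m + 1)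
    (n : ℤ) : u ≠ n := by
  intro hu
  obtain ⟨j, rfl⟩ := h.int_free hR ⟨n, hu⟩
  exact Int.cast_between_false m hs hs'

theorem ne_half (h : Long R a b) {s u : ℝ} (hs : 0 < s) (hsu : s < u) (hu : u < 1) (hR : R s u) :
    s ≠ 1 / 2 ∧ u ≠ 1 / 2 := by
  constructor
  · rintro rfl
    have := h.half_free (h.symm hR) (by linarith) hu ⟨0, by norm_num⟩
    linarith
  · rintro rfl
    have := h.half_free hR hs (by linarith) ⟨0, by norm_num⟩
    linarith

theorem reflect (h : Long R a b) : Long (fun s t => R (-s) (-t)) (1 - b) (1 - a) where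
  toGLam := h.toGLam.reflect
  nohalf hc := h.nohalf (by
    have := h.shift_right hc 1
    convert this using 1
    · simp
    · push_cast; ring)
  pos := by linarith [h.lt_one]
  lt := by linarith [h.lt]
  lt_one := by linarith [h.pos]
  rel := by
    have := h.shift (h.symm h.rel) (-1) (-1)
    convert this using 1 <;> push_cast <;> ring
  long {s u} hs hsu hu hR := by
    have hR' : R (1 - u) (1 - s) := by
      have := h.shift (h.symm hR) 1 1
      convert this using 1 <;> push_cast <;> ring
    linarith [h.long (by linarith) (by linarith) (by linarith) hR']

/-- A leaf arc in `(0, 1)` that does not straddle `1 / 2` is tripled. -/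
theorem step_left (h : Long R a b) {x y : ℝ} (hx : 0 < x) (hxy : x < y) (hy : y < 1 / 2)
    (hR : R x y) : ∃ m : ℤ, 0 < 3 * x + m ∧ 3 * y + m < 1 := by
  have hf := h.fwd hR
  rcases h.trip_left hx hy hR with h1 | h1
  · refine ⟨0, by push_cast; linarith, ?_⟩
    rcases eq_or_lt_of_le h1 with h2 | h2
    · refine (h.no_int hf 0 (by push_cast; linarith) (by push_cast; linarith) 1 ?_).elim
      push_cast; linarith
    · push_cast; linarith
  · refine ⟨-1, ?_, by push_cast; linarith⟩
    rcases eq_or_lt_of_le h1 with h2 | h2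
    · refine (h.no_int (h.symm hf) 1 (by push_cast; linarith) (by push_cast; linarith) 1 ?_).elim
      push_cast; linarith
    · push_cast; linarith

theorem step_right (h : Long R a b) {x y : ℝ} (hx : 1 / 2 < x) (hxy : x < y) (hy : y < 1)
    (hR : R x y) : ∃ m : ℤ, 0 < 3 * x + m ∧ 3 * y + m < 1 := by
  have hR' : R (-(1 - y)) (-(1 - x)) := by
    have := h.shift (h.symm hR) (-1) (-1)
    convert this using 1 <;> push_cast <;> ring
  obtain ⟨m, h1, h2⟩ := h.reflect.step_left (x := 1 - y) (y := 1 - x) (by linarith) (by linarith)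
    (by linarith) hR'
  exact ⟨-m - 2, by push_cast; linarith, by push_cast; linarith⟩

theorem fwd_shift (h : Long R a b) {x y : ℝ} (hR : R x y) (m : ℤ) : R (3 * x + m) (3 * y + m) :=
  h.shift (h.fwd hR) m m

/-- An arc on the left of 1/2 would be tripled to a longer arc in (0, 1). -/
theorem half_lt (h : Long R a b) : 1 / 2 < b := by
  by_contra hc
  have h1 := (h.ne_half h.pos h.lt h.lt_one h.rel).2
  obtain ⟨m, h2, h3⟩ := h.step_left h.pos h.lt (lt_of_le_of_ne (not_lt.1 hc) h1) h.rel
  linarith [h.long h2 (by linarith [h.lt]) h3 (h.fwd_shift h.rel m), h.lt]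

theorem lt_half (h : Long R a b) : a < 1 / 2 := by
  linarith [h.reflect.half_lt]

theorem lt_three (h : Long R a b) : b < 3 * a := h.bd_left h.pos h.lt h.lt_one h.rel h.lt_half

theorem three_lt (h : Long R a b) : 3 * b < a + 2 := h.bd_right' h.pos h.lt h.lt_one h.rel h.half_lt

theorem length_lt (h : Long R a b) : b - a < 1 / 2 := h.len h.pos h.lt h.lt_one h.rel

/-- If the arc were shorter than 1/3, the leaf with the same image attached to b - 1/3 (for a ≤ 1/3)
or to a + 1/3 (otherwise) would give a longer arc in (0, 1), whichever of the three preimages is its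
other end. -/
theorem third_le (h : Long R a b) : 1 / 3 ≤ b - a := by
  by_contra hc
  rw [not_le] at hc
  have h1 := h.half_lt
  have h2 := h.lt_half
  have h3 := h.pos
  have h4 := h.lt_one
  have h5 := h.lt
  have h6 := h.lt_three
  have h7 := h.three_lt
  rcases le_or_gt a (1 / 3) with h8 | h8
  · rcases h.back3 (x := b - 1 / 3) (y := a) (-1) (by
      have := h.shift (h.fwd (h.symm h.rel)) (-1) (-1)
      convert this using 1; push_cast; ring) with h9 | h9 | h9
    · linarith [h.long (by linarith) (by linarith) (by linarith) (h.trans h9 h.rel)]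
    · linarith [h.long (by linarith) (by linarith) (by linarith) h9]
    · rcases eq_or_lt_of_le h8 with h10 | h10
      · refine h.no_int h9 0 (by push_cast; linarith) (by push_cast; linarith) 1 ?_
        push_cast; linarith
      · linarith [h.long (by linarith) (by linarith) (by linarith) h9]
  · have h9 : 2 / 3 < b := by
      by_contra hb
      rcases eq_or_lt_of_le (not_lt.1 hb) with hb | hb
      · refine h.no_int (h.fwd h.rel) 1 (by push_cast; linarith) (by push_cast; linarith) 2 ?_
        push_cast; linarith
      · have := h.fwd_shift h.rel (-1)
        push_cast at this
        linarith [h.long (by linarith) (by linarith) (by linarith) this]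
    rcases h.back3 (x := a + 1 / 3) (y := b) 1 (by
      have := h.shift (h.fwd h.rel) 1 1
      convert this using 1; push_cast; ring) with h10 | h10 | h10
    · linarith [h.long (by linarith) (by linarith) (by linarith)
        (h.trans h.rel (h.symm h10))]
    · have := h.symm (h.sub_one h10)
      linarith [h.long (by linarith) (by linarith) (by linarith) this]
    · have := h.symm (h.sub_one h10)
      linarith [h.long (by linarith) (by linarith) (by linarith) this]

theorem class_in (h : Long R a b) {w : ℝ} (h0 : 0 < w) (h1 : w < 1) (hR : R a w) : a ≤ w ∧ w ≤ b := by
  have h3 := h.pos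
  have h4 := h.lt_one
  have h5 := h.lt
  constructor
  · by_contra hc
    linarith [h.long h0 (by linarith) h4 (h.trans (h.symm hR) h.rel)]
  · by_contra hc
    linarith [h.long h3 (by linarith) h1 hR]

/-- The class of a point outside of `[a, b]` is outside of `[a, b]`. -/
theorem out (h : Long R a b) {t w : ℝ} (ht0 : 0 < t) (ht1 : t < 1) (ht : t < a ∨ b < t)
    (hR : R t w) : w < a ∨ b < w := by
  by_contra hc
  simp only [not_or, not_lt] at hc
  have h3 := h.pos
  have h4 := h.lt_one
  have h5 := h.lt
  have hat : R a t := by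
    rcases eq_or_lt_of_le hc.1 with h6 | h6
    · rw [h6]; exact h.symm hR
    rcases eq_or_lt_of_le hc.2 with h7 | h7
    · rw [h7] at hR; exact h.trans h.rel (h.symm hR)
    rcases ht with ht | ht
    · exact h.symm (h.cross ht h6 h7 (by linarith) hR h.rel)
    · exact h.trans (h.cross h6 h7 ht (by linarith) h.rel (h.symm hR)) (h.symm hR)
  have := h.class_in ht0 ht1 hat
  rcases ht with ht | ht <;> linarith

/-- The position of a leaf arc with respect to the longest one. -/
theorem position (h : Long R a b) {x y : ℝ} (hx : 0 < x) (hxy : x < y) (hy : y < 1) (hR : R x y) :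
    y < a ∨ b < x ∨ (a ≤ x ∧ y ≤ b) := by
  rcases lt_or_ge x a with h1 | h1
  · rcases h.out hx (by linarith) (Or.inl h1) hR with h2 | h2
    · exact Or.inl h2
    · linarith [h.long hx hxy hy hR]
  rcases lt_or_ge b x with h2 | h2
  · exact Or.inr (Or.inl h2)
  rcases lt_or_ge b y with h3 | h3
  · rcases h.out (by linarith) hy (Or.inr h3) (h.symm hR) with h4 | h4 <;> linarith
  · exact Or.inr (Or.inr ⟨h1, h3⟩)

theorem step (h : Long R a b) {x y : ℝ} (hx : 0 < x) (hxy : x < y) (hy : y < 1) (hR : R x y)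
    (ho : y < a ∨ b < x) : ∃ m : ℤ, 0 < 3 * x + m ∧ 3 * y + m < 1 := by
  have := h.half_lt
  have := h.lt_half
  rcases ho with h1 | h1
  · exact h.step_left hx hxy (by linarith) hR
  · exact h.step_right (by linarith) hxy hy hR

/-- An arc around [3 * a, 3 * b - 1] has preimages p < a and q ≥ b of its endpoints, and p is
related to q, q + 1/3 or q + 2/3. The first is too long. The second is too long or, after a
translation, becomes too long when tripled. The third leads from outside of [a, b] into it. -/
theorem not_around_left (h : Long R a b) {s u : ℝ} (hs : 0 < s) (hsu : s < u) (hu : u < 1)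
    (hR : R s u) {m : ℤ} (h1 : s + m < 3 * a) (h2 : 3 * b - 1 ≤ u + m) : False := by
  have i1 := h.half_lt
  have i2 := h.lt_half
  have i3 := h.lt_three
  have i4 := h.three_lt
  have i5 := h.third_le
  have i6 := h.len hs hsu hu hR
  set p := (s + m) / 3 with hp
  set q := (u + m + 1) / 3 with hq
  have hp0 : 0 < p := by linarith
  have hpa : p < a := by linarith
  have hqb : b ≤ q := by linarith
  have hq1 : q < 1 := by linarith
  rcases h.back3 (x := p) (y := q) (-1) (by
    have := h.shift hR m m
    convert this using 1
    · rw [hp]; ring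
    · rw [hq]; push_cast; ring) with h3 | h3 | h3
  · linarith [h.long hp0 (by linarith) hq1 h3]
  · rcases lt_trichotomy (q + 1 / 3) 1 with h4 | h4 | h4
    · linarith [h.long hp0 (by linarith) h4 h3]
    · refine h.no_int h3 0 (by push_cast; linarith) (by push_cast; linarith) 1 ?_
      push_cast; linarith
    · have h5 : R (q - 2 / 3) p := h.symm (by
        have := h.sub_one h3
        convert this using 1; ring)
      obtain ⟨n, n1, n2⟩ := h.step_left (by linarith) (by linarith) (by linarith) h5
      linarith [h.len n1 (by linarith) n2 (h.fwd_shift h5 n)]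
  · have h5 : R p (q - 1 / 3) := by
      have := h.sub_one h3
      convert this using 1; ring
    rcases h.out hp0 (by linarith) (Or.inl hpa) h5 with h6 | h6 <;>
      linarith

/-- No leaf arc properly contains the image of the longest one. -/
theorem not_around (h : Long R a b) {s u : ℝ} (hs : 0 < s) (hsu : s < u) (hu : u < 1)
    (hR : R s u) {m : ℤ} (h1 : s + m ≤ 3 * a) (h2 : 3 * b - 1 ≤ u + m) :
    s + m = 3 * a ∧ u + m = 3 * b - 1 := by
  have h3 : s + m = 3 * a := by
    by_contra hc
    exact h.not_around_left hs hsu hu hR (lt_of_le_of_ne h1 hc) h2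
  refine ⟨h3, ?_⟩
  by_contra hc
  have hR' : R (-(1 - u)) (-(1 - s)) := by
    have := h.shift (h.symm hR) (-1) (-1)
    convert this using 1 <;> push_cast <;> ring
  have h4 : 3 * b - 1 < u + m := lt_of_le_of_ne h2 (Ne.symm hc)
  refine h.reflect.not_around_left (s := 1 - u) (u := 1 - s) (m := 1 - m) (by linarith)
    (by linarith) (by linarith) hR' ?_ ?_ <;> push_cast <;> linarith

/-- Only n = 1 is possible. The image leaf would then bound the arc (3 * b - 2, 3 * a) in (0, 1),
whose length 2 - 3 * (b - a) exceeds 1/2. -/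
theorem image_no_int (h : Long R a b) (n : ℤ) (h1 : 3 * a < n) (h2 : n ≤ 3 * b - 1) : False := by
  have i1 := h.half_lt
  have i2 := h.lt_half
  have i3 := h.lt_three
  have i4 := h.three_lt
  have n1 : (0 : ℝ) < n := by linarith
  have n2 : (n : ℝ) < 2 := by linarith
  have n1' : 0 < n := by exact_mod_cast n1
  have n2' : n < 2 := by exact_mod_cast n2
  have n3 : n = 1 := by omega
  subst n3
  push_cast at h1 h2
  rcases eq_or_lt_of_le h2 with h4 | h4
  · refine h.no_int (h.fwd h.rel) 0 (by push_cast; linarith) (by push_cast; linarith) 2 ?_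
    push_cast; linarith
  · have := h.symm (h.shift (h.fwd h.rel) 0 (-2))
    push_cast at this
    linarith [h.long (by linarith) (by linarith) (by linarith) this]

end Long


/-! ### Pullbacks off the longest arc: the critical and the periodic case -/

namespace Long

variable {R : ℝ → ℝ → Prop} {a b : ℝ}

/-- If the right end of the lifted arc passed a, the arc would cross or surround the image of the
longest arc, against `not_around`. Of the three possible partners of the left end, the two others
violate the length bounds or the position relative to [a, b]. -/
theorem pull_left (h : Long R a b) {s u t : ℝ} (hs : 0 < s) (hsu : s < u) (hu : u < 1)
    (hR : R s u) (j : ℤ) (h1 : s + j < 3 * t) (h2 : 3 * t < u + j) (ht : 0 < t) (hta : t < a) :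
    R ((s + j) / 3) ((u + j) / 3) ∧ 0 < (s + j) / 3 ∧ (u + j) / 3 < a := by
  have i1 := h.half_lt
  have i2 := h.lt_half
  have i6 := h.len hs hsu hu hR
  set p := (s + j) / 3 with hp
  set q := (u + j) / 3 with hq
  have hj : (0 : ℝ) ≤ j := by
    have : (-1 : ℝ) < j := by linarith
    have h3 : -1 < j := by exact_mod_cast this
    have h4 : 0 ≤ j := by omega
    exact_mod_cast h4
  have hp0 : 0 < p := by linarith
  have hpq : p < q := by linarith
  have hqp : q < p + 1 / 6 := by linarith
  have hqa : q < a := by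
    by_contra hc
    rw [not_lt] at hc
    have h3 : 3 * b - 1 - j < 1 := by
      by_contra h4
      exact h.image_no_int (j + 1) (by push_cast; linarith) (by push_cast; linarith)
    have h5 : R (3 * a - j) (3 * b - 1 - j) := by
      have := h.shift (h.fwd h.rel) (-j) (-1 - j)
      convert this using 1 <;> push_cast <;> ring
    rcases le_or_gt (3 * b - 1) (u + j) with h6 | h6
    · linarith [(h.not_around hs hsu hu hR (by linarith) h6).1]
    · have h7 : R s (3 * b - 1 - j) := by
        rcases eq_or_lt_of_le hc with h8 | h8
        · have h9 : u = 3 * a - j := by linarith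
          rw [h9] at hR
          exact h.trans hR h5
        · exact h.trans (h.cross (s := s) (u := 3 * a - j) (t := u) (v := 3 * b - 1 - j) (by linarith)
            (by linarith) (by linarith) (by linarith) hR h5) h5
      linarith [(h.not_around hs (by linarith) h3 h7 (m := j) (by linarith) (by linarith)).1]
  refine ⟨?_, hp0, hqa⟩
  rcases h.back3 (x := p) (y := q) 0 (by
    have := h.shift hR j j
    convert this using 1
    · rw [hp]; ring
    · rw [hq]; push_cast; ring) with h3 | h3 | h3
  · exact h3
  · rcases h.out hp0 (by linarith) (Or.inl (by linarith)) h3 with h4 | h4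
    · linarith [h.bd_right hp0 (by linarith) (by linarith) h3]
    · linarith [h.long hp0 (by linarith) (by linarith) h3]
  · rcases lt_trichotomy (q + 2 / 3) 1 with h4 | h4 | h4
    · rcases h.out hp0 (by linarith) (Or.inl (by linarith)) h3 with h5 | h5
      · linarith
      · linarith [h.long hp0 (by linarith) (by linarith) h3]
    · refine (h.no_int h3 0 (by push_cast; linarith) (by push_cast; linarith) 1 ?_).elim
      push_cast; linarith
    · have h5 : R (q - 1 / 3) p := h.symm (by
        have := h.sub_one h3
        convert this using 1; ring)
      have hj1 : (1 : ℝ) ≤ j := by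
        have : (0 : ℝ) < j := by linarith
        have h3 : 0 < j := by exact_mod_cast this
        have h4 : 1 ≤ j := by omega
        exact_mod_cast h4
      rcases h.trip_left (by linarith) (by linarith) h5 with h6 | h6 <;> linarith

/-- Pulling back a leaf arc to a neighbourhood of a point outside of `[a, b]`. -/
theorem pull_out (h : Long R a b) {s u t : ℝ} (hs : 0 < s) (hsu : s < u) (hu : u < 1)
    (hR : R s u) (j : ℤ) (h1 : s + j < 3 * t) (h2 : 3 * t < u + j) (ht0 : 0 < t) (ht1 : t < 1)
    (ht : t < a ∨ b < t) :
    R ((s + j) / 3) ((u + j) / 3) ∧ 0 < (s + j) / 3 ∧ (u + j) / 3 < 1 := by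
  rcases ht with ht | ht
  · have := h.pull_left hs hsu hu hR j h1 h2 ht0 ht
    exact ⟨this.1, this.2.1, by linarith [this.2.2, h.lt_half]⟩
  · have hR' : R (-(1 - u)) (-(1 - s)) := by
      have := h.shift (h.symm hR) (-1) (-1)
      convert this using 1 <;> push_cast <;> ring
    have := h.reflect.pull_left (s := 1 - u) (u := 1 - s) (t := 1 - t) (by linarith) (by linarith)
      (by linarith) hR' (2 - j) (by push_cast; linarith) (by push_cast; linarith) (by linarith)
      (by linarith)
    have hb := h.half_lt
    push_cast at this
    refine ⟨?_, by linarith [this.2.2], by linarith [this.2.1]⟩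
    have h3 := h.shift (h.symm this.1) 1 1
    convert h3 using 1 <;> push_cast <;> ring

/-- Iterated pullback along an orbit outside of `[a, b]`. -/
theorem pull_iter (h : Long R a b) (n : ℕ) {s u t : ℝ} (hs : 0 < s) (hsu : s < u) (hu : u < 1)
    (hR : R s u) (m : ℤ) (h1 : s < 3 ^ n * t + m) (h2 : 3 ^ n * t + m < u) (ht0 : 0 < t) (ht1 : t < 1)
    (ho : ∀ i < n, ∀ m : ℤ, ¬ (a ≤ 3 ^ i * t + m ∧ 3 ^ i * t + m ≤ b)) :
    ∃ s' u', 0 < s' ∧ s' < t ∧ t < u' ∧ u' < 1 ∧ R s' u' ∧ 3 ^ n * s' + m = s ∧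
      3 ^ n * u' + m = u := by
  induction n generalizing s u m with
  | zero =>
    have hm : m = 0 := by
      simp only [pow_zero, one_mul] at h1 h2
      have m1 : (-1 : ℝ) < m := by linarith
      have m2 : (m : ℝ) < 1 := by linarith
      have m1' : -1 < m := by exact_mod_cast m1
      have m2' : m < 1 := by exact_mod_cast m2
      omega
    subst hm
    simp only [pow_zero, one_mul, Int.cast_zero, add_zero] at h1 h2 ⊢
    exact ⟨s, u, hs, h1, h2, hu, hR, rfl, rfl⟩
  | succ n ih =>
    set m' : ℤ := -⌊(3 : ℝ) ^ n * t⌋ with hm'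
    set t' := (3 : ℝ) ^ n * t + m' with ht'
    have t0 : 0 ≤ t' := by
      have := Int.floor_le ((3 : ℝ) ^ n * t)
      rw [ht', hm']; push_cast; linarith
    have t1 : t' < 1 := by
      have := Int.lt_floor_add_one ((3 : ℝ) ^ n * t)
      rw [ht', hm']; push_cast; linarith
    have h3 : (3 : ℝ) ^ (n + 1) * t + m = 3 * t' - (3 * m' - m : ℤ) := by
      rw [ht', pow_succ]; push_cast; ring
    rw [h3] at h1 h2
    have t0' : 0 < t' := by
      refine lt_of_le_of_ne t0 fun hc => ?_
      rw [← hc] at h1 h2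
      exact Int.cast_between_false (n := -(3 * m' - m)) 0 (by push_cast at h1 h2 ⊢; linarith)
        (by push_cast at h1 h2 ⊢; linarith)
    obtain ⟨c1, c2, c3⟩ := h.pull_out hs hsu hu hR (3 * m' - m) (t := t') (by linarith) (by linarith)
      t0' t1 (by
        have := ho n (by omega) m'
        by_contra hc
        simp only [not_or, not_lt] at hc
        exact this hc)
    obtain ⟨s', u', d1, d2, d3, d4, d5, d6, d7⟩ := ih c2 (by linarith) c3 c1 m'
      (by rw [← ht']; linarith) (by rw [← ht']; linarith) (fun i hi => ho i (by omega))
    refine ⟨s', u', d1, d2, d3, d4, d5, ?_, ?_⟩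
    · rw [pow_succ']; push_cast at d6; linarith
    · rw [pow_succ']; push_cast at d7; linarith

theorem exact_aux (h : Long R a b) {w : ℝ} (hw : R a w) : ∃ w' : ℝ, (∃ n : ℤ, w = w' + n) ∧
    a ≤ w' ∧ w' ≤ b ∧ R a w' := by
  refine ⟨Int.fract w, ⟨⌊w⌋, (Int.fract_add_floor w).symm⟩, ?_⟩
  have h1 : R a (Int.fract w) := by
    refine h.of_shift ⌊w⌋ ?_
    rwa [Int.fract_add_floor]
  have h2 : 0 < Int.fract w := by
    refine lt_of_le_of_ne (Int.fract_nonneg w) fun hc => ?_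
    exact h.no_int h1 0 (by push_cast; linarith [h.pos]) (by push_cast; linarith [h.lt, h.lt_one]) 0
      (by push_cast; linarith)
  have := h.class_in h2 (Int.fract_lt_one w) h1
  exact ⟨this.1, this.2, h1⟩

theorem hole_outside (h : Long R a b) (w : ℝ) (h1 : b < w) (h2 : w < a + 1) : ¬ R b w := by
  intro hR
  obtain ⟨w', ⟨n, hn⟩, h3, h4, -⟩ := h.exact_aux (h.trans h.rel hR)
  have := h.lt
  exact Int.cast_between_false (n := n) 0 (by push_cast; linarith) (by push_cast; linarith)

/-- If the orbit of a hits the class of a, then by `nopoly` both a and b equal that orbit point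
modulo one, though they differ by 1/3. If it enters (a, b) for the first time, then pulling (a, b)
back along the orbit gives a leaf arc properly around the point 3 * a, which is the image of the
longest arc. -/
theorem crit_orbit (h : Long R a b) (hc : b = a + 1 / 3) (n : ℕ) (hn : 0 < n) (m : ℤ) :
    ¬ (a ≤ 3 ^ n * a + m ∧ 3 ^ n * a + m ≤ b) := by
  induction n using Nat.strong_induction_on generalizing m with
  | _ n ih =>
  rintro ⟨h1, h2⟩
  have hfix : ∀ x y : ℝ, R x y → 3 ^ n * a + m = y →
      (∃ j : ℤ, 3 * x = 3 * a + j) → ∃ j : ℤ, x = 3 ^ n * a + j := by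
    intro x y hxy hy ⟨j, hj⟩
    obtain ⟨k, rfl⟩ : ∃ k, n = k + 1 := ⟨n - 1, by omega⟩
    have h3 : (3 : ℝ) ^ (k + 1) * x = 3 ^ (k + 1) * a + (3 ^ k * j : ℤ) := by
      rw [pow_succ, mul_assoc, hj]; push_cast; ring
    have h4 : R x (3 ^ (k + 1) * x) := by
      rw [h3]
      refine h.shift_right ?_ _
      refine h.of_shift m ?_
      rw [hy]; exact hxy
    obtain ⟨i, hi⟩ := h.nopoly x (k + 1) h4
    exact ⟨3 ^ k * j - i, by push_cast at h3 ⊢; linarith⟩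
  have hab : ∀ y, R a y → 3 ^ n * a + m = y → False := by
    intro y hy hy'
    obtain ⟨i, hi⟩ := hfix a y hy hy' ⟨0, by simp⟩
    obtain ⟨j, hj⟩ := hfix b y (h.trans (h.symm h.rel) hy) hy'
      ⟨1, by push_cast; linarith⟩
    exact Int.cast_between_false (n := j - i) 0 (by push_cast; linarith) (by push_cast; linarith)
  rcases eq_or_lt_of_le h1 with h3 | h3
  · exact hab a (h.refl a) h3.symm
  rcases eq_or_lt_of_le h2 with h4 | h4
  · exact hab b h.rel h4
  obtain ⟨k, rfl⟩ : ∃ k, n = k + 1 := ⟨n - 1, by omega⟩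
  have i1 := h.pos
  have i2 := h.lt_one
  set t := Int.fract (3 * a) with ht
  have ht' : 3 * a = t + ⌊3 * a⌋ := (Int.fract_add_floor _).symm
  have ht1 : t < 1 := Int.fract_lt_one _
  have e1 : (3 : ℝ) ^ (k + 1) * a + m = 3 ^ k * t + (3 ^ k * ⌊3 * a⌋ + m : ℤ) := by
    rw [pow_succ, mul_assoc, ht']
    push_cast
    have : ⌊t + (⌊3 * a⌋ : ℝ)⌋ = ⌊3 * a⌋ := by rw [← ht']
    rw [this]; ring
  have ht0 : 0 < t := by
    refine lt_of_le_of_ne (Int.fract_nonneg _) fun hc => ?_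
    rw [← hc, mul_zero, zero_add] at e1
    rw [e1] at h3 h4
    exact Int.cast_between_false (n := 3 ^ k * ⌊3 * a⌋ + m) 0 (by push_cast at h3 ⊢; linarith)
      (by push_cast at h4 ⊢; linarith)
  rw [e1] at h3 h4
  obtain ⟨s', u', d1, d2, d3, d4, d5, -, -⟩ := h.pull_iter k i1 h.lt i2 h.rel _ h3 h4 ht0 ht1 (by
    intro i hi m' hm'
    refine ih (i + 1) (by omega) (by omega) (m' - 3 ^ i * ⌊3 * a⌋) ?_
    have e2 : (3 : ℝ) ^ (i + 1) * a + (m' - 3 ^ i * ⌊3 * a⌋ : ℤ) = 3 ^ i * t + m' := by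
      have : (3 : ℝ) ^ (i + 1) * a = 3 ^ i * (t + ⌊3 * a⌋) := by
        rw [← ht', pow_succ, mul_assoc]
      rw [this]; push_cast; ring
    rwa [e2])
  have := (h.not_around d1 (by linarith) d4 d5 (m := ⌊3 * a⌋) (by linarith) (by linarith)).1
  linarith

/-- Leaf arcs outside of `[a, b]` are tripled until they are contained in `[a, b]`. -/
theorem exists_enter (h : Long R a b) (N : ℕ) {x y : ℝ} (hx : 0 < x) (hxy : x < y) (hy : y < 1)
    (hR : R x y) (hN : 1 ≤ 3 ^ N * (y - x)) : ∃ (n : ℕ) (m : ℤ), a ≤ 3 ^ n * x + m ∧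
      3 ^ n * y + m ≤ b ∧ ∀ i < n, ∃ m : ℤ, 0 < 3 ^ i * x + m ∧ 3 ^ i * y + m < 1 ∧
        (3 ^ i * y + m < a ∨ b < 3 ^ i * x + m) := by
  induction N generalizing x y with
  | zero => simp only [pow_zero, one_mul] at hN; linarith
  | succ N ih =>
    have key : (y < a ∨ b < x) → ∃ (n : ℕ) (m : ℤ), a ≤ 3 ^ n * x + m ∧
      3 ^ n * y + m ≤ b ∧ ∀ i < n, ∃ m : ℤ, 0 < 3 ^ i * x + m ∧ 3 ^ i * y + m < 1 ∧
        (3 ^ i * y + m < a ∨ b < 3 ^ i * x + m) := by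
      intro ho
      obtain ⟨j, j1, j2⟩ := h.step hx hxy hy hR ho
      obtain ⟨n, m, h1, h2, h3⟩ := ih j1 (by linarith) j2 (h.fwd_shift hR j) (by
        rw [pow_succ] at hN; linarith)
      refine ⟨n + 1, 3 ^ n * j + m, ?_, ?_, ?_⟩
      · push_cast; rw [pow_succ]; linarith
      · push_cast; rw [pow_succ]; linarith
      · intro i hi
        rcases Nat.eq_zero_or_pos i with h4 | h4
        · subst h4
          exact ⟨0, by simpa using hx, by simpa using hy, by simpa using ho⟩
        · obtain ⟨l, rfl⟩ : ∃ l, i = l + 1 := ⟨i - 1, by omega⟩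
          obtain ⟨m', g1, g2, g3⟩ := h3 l (by omega)
          refine ⟨3 ^ l * j + m', ?_⟩
          have e : ∀ z : ℝ, 3 ^ (l + 1) * z + (3 ^ l * j + m' : ℤ) = 3 ^ l * (3 * z + j) + m' := by
            intro z; rw [pow_succ]; push_cast; ring
          rw [e, e]
          exact ⟨g1, g2, g3⟩
    rcases h.position hx hxy hy hR with h1 | h1 | h1
    · exact key (Or.inl h1)
    · exact key (Or.inr h1)
    · exact ⟨0, 0, by simpa using h1.1, by simpa using h1.2, fun i hi => by omega⟩

end Long

/-- The data of a critical major `(a, b)`. -/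
def CritMajor (a b : ℝ) : Prop :=
  b = a + 1 / 3 ∧ ∀ n : ℕ, 0 < n → ∀ m : ℤ, ¬ (a ≤ 3 ^ n * a + m ∧ 3 ^ n * a + m ≤ b)

/-- The data of a major `(a, b)` of period `k`. -/
def PerMajor (a b : ℝ) (k : ℕ) : Prop :=
  -- The branch [a, b - 1/3] is mapped affinely onto a translate of [a, b] at time k, and stays off
  -- the translates of [a, b] at the times before.
  0 < k ∧ (∃ j : ℤ, 3 ^ k * a = a + j) ∧ 3 ^ k * (b - a - 1 / 3) = b - a ∧
    ∀ i, 0 < i → i < k → ∀ t, a ≤ t → t ≤ b - 1 / 3 → ∀ m : ℤ,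
      ¬ (a ≤ 3 ^ i * t + m ∧ 3 ^ i * t + m ≤ b)

namespace Long

variable {R : ℝ → ℝ → Prop} {a b : ℝ}

/-- The image (x, y) of the longest arc is tripled until it is contained in [a, b] modulo one.
Pulling (a, b) back along the same orbit gives a leaf arc around [x, y], which equals (x, y) by
`not_around`. So the image returns exactly onto the longest arc. -/
theorem exists_perMajor (h : Long R a b) (hab : 1 / 3 < b - a) : ∃ k, PerMajor a b k := by
  have i1 := h.half_lt
  have i2 := h.lt_half
  have i3 := h.lt_three
  have i4 := h.three_lt
  have i5 := h.length_lt
  have i6 := h.pos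
  set m₀ := ⌊3 * a⌋ with hm₀
  have f1 := Int.floor_le (3 * a)
  have f2 := Int.lt_floor_add_one (3 * a)
  set x := 3 * a - m₀ with hx
  set y := 3 * b - 1 - m₀ with hy
  have hy1 : y < 1 := by
    by_contra hc
    exact h.image_no_int (m₀ + 1) (by push_cast; linarith) (by push_cast; linarith)
  have hR : R x y := by
    have := h.shift (h.fwd h.rel) (-m₀) (-1 - m₀)
    convert this using 1
    · rw [hx]; push_cast; ring
    · rw [hy]; push_cast; ring
  have hx0 : 0 < x := by
    refine lt_of_le_of_ne (by linarith) fun hc => ?_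
    exact h.no_int (h.symm hR) 0 (by push_cast; linarith) (by push_cast; linarith) 0
      (by push_cast; linarith)
  have hxy : x < y := by linarith
  obtain ⟨N, hN⟩ := pow_unbounded_of_one_lt (1 / (y - x)) (by norm_num : (1 : ℝ) < 3)
  rw [div_lt_iff₀ (by linarith)] at hN
  obtain ⟨n, m, h1, h2, h3⟩ := h.exists_enter N hx0 hxy hy1 hR hN.le
  have hpow : (0 : ℝ) < 3 ^ n := by positivity
  have hout : ∀ i < n, ∀ t, x ≤ t → t ≤ y → ∀ m : ℤ, ¬ (a ≤ 3 ^ i * t + m ∧ 3 ^ i * t + m ≤ b) := by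
    intro i hi t ht1 ht2 m hm
    obtain ⟨m', g1, g2, g3⟩ := h3 i hi
    have hi : (0 : ℝ) < 3 ^ i := by positivity
    have e1 := mul_le_mul_of_nonneg_left ht1 hi.le
    have e2 := mul_le_mul_of_nonneg_left ht2 hi.le
    have : m = m' := by
      have m1 : (m : ℝ) < m' + 1 := by linarith
      have m2 : (m' : ℝ) < m + 1 := by linarith
      have m1' : m < m' + 1 := by exact_mod_cast m1
      have m2' : m' < m + 1 := by exact_mod_cast m2
      omega
    subst this
    rcases g3 with g3 | g3 <;> linarith
  have hmid1 : a < 3 ^ n * ((x + y) / 2) + m := by nlinarith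
  have hmid2 : 3 ^ n * ((x + y) / 2) + m < b := by nlinarith
  obtain ⟨s', u', d1, d2, d3, d4, d5, d6, d7⟩ := h.pull_iter n i6 h.lt h.lt_one h.rel m hmid1 hmid2
    (by linarith) (by linarith) (fun i hi => hout i hi _ (by linarith) (by linarith))
  have e1 : s' ≤ x := by
    by_contra hc
    have := mul_lt_mul_of_pos_left (not_le.1 hc) hpow
    linarith
  have e2 : y ≤ u' := by
    by_contra hc
    have := mul_lt_mul_of_pos_left (not_le.1 hc) hpow
    linarith
  obtain ⟨e3, e4⟩ := h.not_around d1 (by linarith) d4 d5 (m := m₀) (by linarith) (by linarith)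
  have e5 : s' = x := by linarith
  have e6 : u' = y := by linarith
  rw [e5] at d6
  rw [e6] at d7
  refine ⟨n + 1, by omega, ⟨3 ^ n * m₀ - m, ?_⟩, ?_, ?_⟩
  · rw [pow_succ]; push_cast; rw [hx] at d6; linarith
  · rw [pow_succ]; rw [hx] at d6; rw [hy] at d7; linarith
  · intro i hi1 hi2 t ht1 ht2 m hm
    rcases Nat.eq_zero_or_pos i with h4 | h4
    · omega
    · obtain ⟨l, rfl⟩ : ∃ l, i = l + 1 := ⟨i - 1, by omega⟩
      refine hout l (by omega) (3 * t - m₀) (by linarith) (by linarith) (3 ^ l * m₀ + m) ?_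
      have e : (3 : ℝ) ^ l * (3 * t - m₀) + (3 ^ l * m₀ + m : ℤ) = 3 ^ (l + 1) * t + m := by
        rw [pow_succ]; push_cast; ring
      rwa [e]

/-- The covering condition is applied to the outer hole (b, a + 1). If the image class is a point,
all points of the class differ by multiples of 1/3 and none fits strictly between a and b. Otherwise
the class is periodic, hence fixed by 3 ^ k modulo one. The two branches expand and have no other
fixed point than a and b, while the part between them is sent into the image of the outer hole. -/
theorem exact (h : Long R a b) {w : ℝ} (hw : R a w) : ∃ n : ℤ, w = a + n ∨ w = b + n := by
  obtain ⟨w', ⟨n, hn⟩, h1, h2, h3⟩ := h.exact_aux hw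
  have i1 := h.half_lt
  have i2 := h.lt_half
  have i5 := h.length_lt
  have i6 := h.third_le
  have i7 := h.lt
  suffices w' = a ∨ w' = b by
    rcases this with h4 | h4
    · exact ⟨n, Or.inl (by rw [hn, h4])⟩
    · exact ⟨n, Or.inr (by rw [hn, h4])⟩
  have hba : R b (a + 1) := h.add_one (h.symm h.rel)
  rcases h.cov (by linarith) (by linarith) hba h.hole_outside with h4 | ⟨j, j1, j2, j3⟩
  · obtain ⟨j, hj⟩ := h4 a (h.symm h.rel)
    obtain ⟨i, hi⟩ := h4 w' (h.trans (h.symm h.rel) h3)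
    have hj1 : j = -1 := by
      have m1 : (j : ℝ) < 0 := by linarith
      have m2 : (-2 : ℝ) < j := by linarith
      have m1' : j < 0 := by exact_mod_cast m1
      have m2' : -2 < j := by exact_mod_cast m2
      omega
    subst hj1
    push_cast at hj
    by_contra hc
    simp only [not_or] at hc
    have h5 : a < w' := lt_of_le_of_ne h1 (Ne.symm hc.1)
    have h6 : w' < b := lt_of_le_of_ne h2 hc.2
    exact Int.cast_between_false (n := i) (-1) (by push_cast; linarith) (by push_cast; linarith)
  · have hj : j = 1 := by
      have m1 : (j : ℝ) < 2 := by linarith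
      have m2 : (0 : ℝ) < j := by linarith
      have m1' : j < 2 := by exact_mod_cast m1
      have m2' : 0 < j := by exact_mod_cast m2
      omega
    subst hj
    push_cast at j1 j2 j3
    have hab : 1 / 3 < b - a := by linarith
    obtain ⟨k, hk, ⟨l, hl⟩, hk2, -⟩ := h.exists_perMajor hab
    have hpow : (1 : ℝ) < 3 ^ k := one_lt_pow₀ (by norm_num) hk.ne'
    have hfix : R w' (3 ^ k * w') := by
      have := h.fwd_pow h3 k
      rw [hl] at this
      exact h.trans (h.symm h3) (h.trans (h.per a l) this)
    obtain ⟨i, hi⟩ := h.nopoly w' k hfix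
    by_contra hc
    simp only [not_or] at hc
    have h5 : a < w' := lt_of_le_of_ne h1 (Ne.symm hc.1)
    have h6 : w' < b := lt_of_le_of_ne h2 hc.2
    rcases le_or_gt w' (b - 1 / 3) with h7 | h7
    · have e1 : (0 : ℝ) < (3 ^ k - 1) * (w' - a) := mul_pos (by linarith) (by linarith)
      have e2 : (3 : ℝ) ^ k * (w' - a) ≤ 3 ^ k * (b - a - 1 / 3) :=
        mul_le_mul_of_nonneg_left (by linarith) (by linarith)
      exact Int.cast_between_false (n := i - l) 0 (by push_cast; linarith) (by push_cast; linarith)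
    · rcases le_or_gt (a + 1 / 3) w' with h8 | h8
      · have e1 : (0 : ℝ) < (3 ^ k - 1) * (b - w') := mul_pos (by linarith) (by linarith)
        have e2 : (3 : ℝ) ^ k * (b - w') ≤ 3 ^ k * (b - a - 1 / 3) :=
          mul_le_mul_of_nonneg_left (by linarith) (by linarith)
        obtain ⟨k', rfl⟩ : ∃ k', k = k' + 1 := ⟨k - 1, by omega⟩
        have e3 : (3 : ℝ) ^ (k' + 1) * (1 / 3) = 3 ^ k' := by rw [pow_succ]; ring
        refine Int.cast_between_false (n := l + 3 ^ k' - i) 0 ?_ ?_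
        · push_cast; linarith
        · push_cast; linarith
      · refine j3 (3 * w' + 1) (by linarith) (by linarith) ?_
        exact h.add_one (h.fwd (h.trans (h.symm h.rel) h3))

end Long

/-! ### Majors -/

/-- The properties of the leaf under the quadratic gap that contains the fixed point. -/
structure Major (R : ℝ → ℝ → Prop) (a b : ℝ) : Prop where
  lam : Lam R
  nonneg : 0 ≤ a
  lt_half : a < 1 / 2
  half_le : 1 / 2 ≤ b
  third_le : 1 / 3 ≤ b - a
  le_half : b - a ≤ 1 / 2
  rel : R a b
  exact : ∀ {w}, R a w → ∃ n : ℤ, w = a + n ∨ w = b + n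
  trip : ∀ {x y}, b ≤ x → x < y → y ≤ a + 1 → R x y → ¬ (x = b ∧ y = a + 1) →
    ∃ n : ℤ, (b ≤ 3 * x + n ∧ 3 * y + n ≤ a + 1) ∨ (a ≤ 3 * x + n ∧ 3 * y + n ≤ b)
  pull : ∀ {c d}, b < c → c < d → d < a + 1 → 3 * (d - c) ≤ b - a → R (3 * c) (3 * d) → R c d

theorem Long.major {R : ℝ → ℝ → Prop} {a b : ℝ} (h : Long R a b) : Major R a b where
  lam := h.toLam
  nonneg := h.pos.le
  lt_half := h.lt_half
  half_le := h.half_lt.le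
  third_le := h.third_le
  le_half := h.length_lt.le
  rel := h.rel
  exact := h.exact
  trip {x y} hx hxy hy hR hne := by
    have i1 := h.half_lt
    have i2 := h.lt_half
    have i3 := h.lt_one
    have i4 := h.pos
    have key : ∀ {x y}, 0 < x → x < y → y < 1 → R x y → (y < a ∨ b < x) →
        ∃ n : ℤ, (b ≤ 3 * x + n ∧ 3 * y + n ≤ a + 1) ∨ (a ≤ 3 * x + n ∧ 3 * y + n ≤ b) := by
      intro x y hx hxy hy hR ho
      obtain ⟨m, m1, m2⟩ := h.step hx hxy hy hR ho
      rcases h.position m1 (by linarith) m2 (h.fwd_shift hR m) with h1 | h1 | h1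
      · exact ⟨m + 1, Or.inl ⟨by push_cast; linarith, by push_cast; linarith⟩⟩
      · exact ⟨m, Or.inl ⟨by linarith, by linarith⟩⟩
      · exact ⟨m, Or.inr h1⟩
    have hbx : b < x := by
      refine lt_of_le_of_ne hx fun hc => ?_
      rcases lt_or_eq_of_le hy with h1 | h1
      · exact h.hole_outside y (by linarith) h1 (hc ▸ hR)
      · exact hne ⟨hc.symm, h1⟩
    have hya : y < a + 1 := by
      refine lt_of_le_of_ne hy fun hc => ?_
      refine h.hole_outside x hbx (by linarith) ?_
      rw [hc] at hR
      have := h.sub_one (h.symm hR)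
      exact h.trans (h.symm h.rel) (h.symm (by
        have h2 := h.shift hR 0 (-1)
        simpa using h2))
    rcases lt_trichotomy y 1 with h1 | h1 | h1
    · exact key (by linarith) hxy h1 hR (Or.inr hbx)
    · exact (h.no_int hR 0 (by push_cast; linarith) (by push_cast; linarith) 1
        (by push_cast; linarith)).elim
    · rcases lt_trichotomy x 1 with h2 | h2 | h2
      · have := h.symm (h.sub_one hR)
        linarith [h.long (by linarith) (by linarith) h2 this]
      · exact (h.no_int (h.symm hR) 1 (by push_cast; linarith) (by push_cast; linarith) 1
          (by push_cast; linarith)).elim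
      · have h3 : R (x - 1) (y - 1) := by
          have := h.shift hR (-1) (-1)
          convert this using 1 <;> push_cast <;> ring
        obtain ⟨n, hn⟩ := key (by linarith) (by linarith) (by linarith) h3 (Or.inl (by linarith))
        refine ⟨n - 3, ?_⟩
        push_cast
        rcases hn with hn | hn
        · left; constructor <;> linarith
        · right; constructor <;> linarith
  pull {c d} hc hcd hd hl hR := by
    have i1 := h.half_lt
    have i2 := h.lt_half
    have i3 := h.lt_one
    have i5 := h.length_lt
    set j := ⌊3 * c⌋ with hj
    have f1 := Int.floor_le (3 * c)
    have f2 := Int.lt_floor_add_one (3 * c)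
    have hR' : R (3 * c - j) (3 * d - j) := by
      have := h.shift hR (-j) (-j)
      convert this using 1 <;> push_cast <;> ring
    have hs : 0 < 3 * c - j := by
      refine lt_of_le_of_ne (by linarith) fun hc => ?_
      exact h.no_int (h.symm hR') 0 (by push_cast; linarith) (by push_cast; linarith) 0
        (by push_cast; linarith)
    have hu : 3 * d - j < 1 := by
      rcases lt_trichotomy (3 * d - j) 1 with h1 | h1 | h1
      · exact h1
      · exact (h.no_int hR' 0 (by push_cast; linarith) (by push_cast; linarith) 1
          (by push_cast; linarith)).elim
      · have := h.symm (h.sub_one hR')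
        linarith [h.len (by linarith) (by linarith) (by linarith) this]
    -- Pulling back needs a point of (0, 1) off [a, b] between the ends: one below 1 if c < 1, and
    -- otherwise one translated by -1.
    rcases lt_or_ge c 1 with h1 | h1
    · have h2 := lt_min hcd h1
      have h3 := min_le_left d 1
      have h4 := min_le_right d 1
      have := (h.pull_out hs (by linarith) hu hR' j (t := (c + min d 1) / 2) (by linarith)
        (by linarith) (by linarith) (by linarith) (Or.inr (by linarith))).1
      convert this using 1 <;> ring
    · have := (h.pull_out hs (by linarith) hu hR' (j - 3) (t := (c + d) / 2 - 1)
        (by push_cast; linarith) (by push_cast; linarith) (by linarith) (by linarith)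
        (Or.inl (by linarith))).1
      have h2 := h.shift this 1 1
      convert h2 using 1 <;> push_cast <;> ring

/-- The case of a leaf that joins the two fixed points. -/
theorem GLam.major_half {R : ℝ → ℝ → Prop} (h : GLam R) (h0 : R 0 (1 / 2)) : Major R 0 (1 / 2) := by
  have hin : ∀ {x y : ℝ}, 0 < x → x < 1 → x ≠ 1 / 2 → R x y → y ∈ offHalf := by
    intro x y h1 h2 h3 hR
    by_contra hc
    exact h.half_class hc (h.symm hR) (mem_offHalf h1 h2 h3)
  have hside : ∀ {x y : ℝ}, 0 < x → x < 1 / 2 → 1 / 2 < y → y < 1 → ¬ R x y := by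
    intro x y h1 h2 h3 h4 hR
    have := h.cross h1 h2 h3 (by linarith) h0 hR
    exact h.half_class (not_mem_offHalf 0 (by norm_num)) this
      (mem_offHalf h1 (by linarith) (by linarith))
  refine
    { lam := h.toLam
      nonneg := le_rfl
      lt_half := by norm_num
      half_le := le_rfl
      third_le := by norm_num
      le_half := by norm_num
      rel := h0
      exact := ?_
      trip := ?_
      pull := ?_ }
  · intro w hw
    have h1 := h.half_class (not_mem_offHalf 0 (by norm_num)) hw
    simp only [offHalf, ne_eq, Set.mem_ofPred_eq, not_forall, not_not] at h1
    obtain ⟨m, hm⟩ := h1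
    obtain ⟨i, hi | hi⟩ : ∃ i : ℤ, m = 2 * i ∨ m = 2 * i + 1 := ⟨m / 2, by omega⟩
    · subst hi; push_cast at hm
      exact ⟨i, Or.inl (by linarith)⟩
    · subst hi; push_cast at hm
      exact ⟨i, Or.inr (by linarith)⟩
  · intro x y hx hxy hy hR hne
    have hx' : 1 / 2 < x ∧ y < 1 := by
      by_cases hx2 : x = 1 / 2
      · exfalso
        have hy1 : y < 1 := lt_of_le_of_ne (by linarith) fun hc => hne ⟨hx2, by linarith⟩
        exact hin (by linarith) hy1 (by linarith) (h.symm hR) 1 (by rw [hx2]; norm_num)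
      · have h1 : 1 / 2 < x := lt_of_le_of_ne hx (Ne.symm hx2)
        refine ⟨h1, lt_of_le_of_ne (by linarith) fun hc => ?_⟩
        exact hin (by linarith) (by linarith) hx2 hR 2 (by rw [hc]; norm_num)
    rcases h.trip_right hx'.1 hx'.2 hR with h1 | h1
    · exact ⟨-1, Or.inl ⟨by push_cast; linarith, by push_cast; linarith⟩⟩
    · refine ⟨-2, ?_⟩
      push_cast
      rcases le_or_gt (3 * y - 2) (1 / 2) with h2 | h2
      · right; constructor <;> linarith
      rcases le_or_gt (1 / 2) (3 * x - 2) with h3 | h3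
      · left; constructor <;> linarith
      exfalso
      have hR' : R (3 * x - 2) (3 * y - 2) := by
        have := h.shift (h.fwd hR) (-2) (-2)
        convert this using 1 <;> push_cast <;> ring
      rcases eq_or_lt_of_le h1 with h4 | h4
      · refine hin (by linarith) (by linarith) (by linarith) (h.symm hR') 0 ?_
        push_cast; linarith
      · exact hside (by linarith) h3 h2 (by linarith) hR'
  · intro c d hc hcd hd hl hR
    have hd1 : d < 1 := by linarith
    rcases h.back3 (x := c) (y := d) 0 (by simpa using hR) with h1 | h1 | h1
    · exact h1
    · exfalso
      rcases lt_trichotomy (d + 1 / 3) 1 with h2 | h2 | h2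
      · linarith [h.bd_right' (by linarith) (by linarith) h2 h1 (by linarith)]
      · exact hin (by linarith) (by linarith) (by linarith) h1 2 (by rw [h2]; norm_num)
      · exact hside (x := d + 1 / 3 - 1) (by linarith) (by linarith) hc (by linarith)
          (h.symm (h.sub_one h1))
    · exfalso
      have h2 : R (d - 1 / 3) c := h.symm (by
        have := h.sub_one h1
        convert this using 1; ring)
      rcases lt_trichotomy (d - 1 / 3) (1 / 2) with h3 | h3 | h3
      · exact hside (by linarith) h3 hc (by linarith) h2
      · exact hin (by linarith) (by linarith) (by linarith) (h.symm h2) 1 (by rw [h3]; norm_num)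
      · have h4 := h.bd_left' h3 (by linarith) (by linarith) h2
        rcases h.trip_right h3 (by linarith) h2 with h5 | h5 <;> linarith

/-- A nontrivial lamination has a critical or a periodic major. -/
theorem GLam.exists_major {R : ℝ → ℝ → Prop} (h : GLam R) (hne : ∃ s t, R s t ∧ ∀ n : ℤ, t ≠ s + n) :
    ∃ a b, Major R a b ∧ (CritMajor a b ∨ ∃ k, PerMajor a b k) := by
  by_cases h0 : R 0 (1 / 2)
  · refine ⟨0, 1 / 2, h.major_half h0, Or.inr ⟨1, one_pos, ⟨0, by simp⟩, by norm_num, ?_⟩⟩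
    intro i h1 h2
    omega
  have hcl : ∀ {x y : ℝ}, R x y → (∃ n : ℤ, x = n) → ∃ n : ℤ, y = n := by
    rintro x y hR ⟨n, rfl⟩
    have h1 := h.half_class (not_mem_offHalf (2 * n) (by push_cast; ring)) hR
    simp only [offHalf, ne_eq, Set.mem_ofPred_eq, not_forall, not_not] at h1
    obtain ⟨m, hm⟩ := h1
    obtain ⟨i, hi | hi⟩ : ∃ i : ℤ, m = 2 * i ∨ m = 2 * i + 1 := ⟨m / 2, by omega⟩
    · subst hi; push_cast at hm
      exact ⟨i, by linarith⟩
    · subst hi; push_cast at hm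
      refine (h0 ?_).elim
      have := h.shift hR (-n) (-i)
      convert this using 1
      · push_cast; ring
      · push_cast; linarith
  -- The bound 1/2, which holds by `len`, keeps the trivial pair (0, 1) out of this compact set.
  set K : Set (ℝ × ℝ) := {p | R p.1 p.2} ∩ (Set.Icc 0 1 ×ˢ Set.Icc 0 1 ∩ {p | p.1 ≤ p.2}) ∩
    {p | p.2 - p.1 ≤ 1 / 2} with hK
  have hKc : IsCompact K := by
    refine (isCompact_Icc.prod isCompact_Icc).of_isClosed_subset ?_ (s := Set.Icc (0 : ℝ) 1 ×ˢ
      Set.Icc (0 : ℝ) 1) (fun p hp => hp.1.2.1)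
    refine (h.closed.inter ((isClosed_Icc.prod isClosed_Icc).inter ?_)).inter ?_
    · exact isClosed_le continuous_fst continuous_snd
    · exact isClosed_le (by fun_prop) continuous_const
  have hleaf : ∃ s u, 0 < s ∧ s < u ∧ u < 1 ∧ R s u := by
    obtain ⟨s, t, hR, hn⟩ := hne
    have hfr : R (Int.fract s) (Int.fract t) := by
      have := h.shift hR (-⌊s⌋) (-⌊t⌋)
      convert this using 1 <;> rw [Int.fract] <;> push_cast <;> ring
    have hneq : Int.fract s ≠ Int.fract t := by
      intro hc
      rw [Int.fract, Int.fract] at hc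
      exact hn (⌊t⌋ - ⌊s⌋) (by push_cast; linarith)
    have hpos : ∀ {x y : ℝ}, R (Int.fract x) (Int.fract y) → Int.fract x ≠ Int.fract y →
        0 < Int.fract x := by
      intro x y hxy hne
      refine lt_of_le_of_ne (Int.fract_nonneg x) fun hc => ?_
      obtain ⟨n, hn⟩ := hcl hxy ⟨0, by rw [← hc]; simp⟩
      have n1 := Int.fract_nonneg y
      have n2 := Int.fract_lt_one y
      rcases eq_or_lt_of_le n1 with n3 | n3
      · exact hne (hc ▸ n3)
      · rw [hn] at n2 n3
        exact Int.cast_between_false 0 (by push_cast; linarith) (by push_cast; linarith)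
    rcases lt_or_gt_of_ne hneq with h1 | h1
    · exact ⟨_, _, hpos hfr hneq, h1, Int.fract_lt_one _, hfr⟩
    · exact ⟨_, _, hpos (h.symm hfr) hneq.symm, h1, Int.fract_lt_one _, h.symm hfr⟩
  have hmem : ∀ {s u}, 0 < s → s < u → u < 1 → R s u → (s, u) ∈ K := fun {s u} h1 h2 h3 h4 =>
    ⟨⟨h4, ⟨⟨h1.le, by linarith⟩, ⟨by linarith, h3.le⟩⟩, h2.le⟩, (h.len h1 h2 h3 h4).le⟩
  obtain ⟨s₀, u₀, l1, l2, l3, l4⟩ := hleaf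
  obtain ⟨⟨a, b⟩, hab, hmax⟩ := hKc.exists_isMaxOn ⟨_, hmem l1 l2 l3 l4⟩
    (f := fun p : ℝ × ℝ => p.2 - p.1) (by fun_prop)
  obtain ⟨⟨hR, ⟨⟨ha0, ha1⟩, hb0, hb1⟩, hab1⟩, hab2⟩ := hab
  simp only [Set.mem_ofPred_eq] at hR ha0 ha1 hb0 hb1 hab1 hab2
  have hmax' : ∀ {s u}, 0 < s → s < u → u < 1 → R s u → u - s ≤ b - a := fun h1 h2 h3 h4 =>
    hmax (hmem h1 h2 h3 h4)
  have hlt : a < b := by linarith [hmax' l1 l2 l3 l4]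
  have hint : ∀ n : ℤ, (n : ℝ) ≠ 0 → (n : ℝ) ≠ 1 → 0 ≤ (n : ℝ) → (n : ℝ) ≤ 1 → False := by
    intro n h1 h2 h3 h4
    exact Int.cast_between_false (n := n) 0 (by
      push_cast; exact lt_of_le_of_ne h3 (Ne.symm h1)) (by
      push_cast; rw [zero_add]; exact lt_of_le_of_ne h4 h2)
  have ha : 0 < a := by
    refine lt_of_le_of_ne ha0 fun hc => ?_
    obtain ⟨n, hn⟩ := hcl hR ⟨0, by rw [← hc]; simp⟩
    exact hint n (by rw [← hn]; linarith) (by rw [← hn]; linarith) (by linarith) (by linarith)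
  have hb : b < 1 := by
    refine lt_of_le_of_ne hb1 fun hc => ?_
    obtain ⟨n, hn⟩ := hcl (h.symm hR) ⟨1, by rw [hc]; simp⟩
    exact hint n (by rw [← hn]; linarith) (by rw [← hn]; linarith) (by linarith) (by linarith)
  have L : Long R a b :=
    { toGLam := h
      nohalf := h0
      pos := ha
      lt := hlt
      lt_one := hb
      rel := hR
      long := hmax' }
  refine ⟨a, b, L.major, ?_⟩
  rcases eq_or_lt_of_le L.third_le with h1 | h1
  · exact Or.inl ⟨by linarith, fun n hn m => L.crit_orbit (by linarith) n hn m⟩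
  · exact Or.inr (L.exists_perMajor h1)


/-! ### Two-point classes and the leaves that join the two branches of the return map -/

/-- The arc `(c, d)` is cut off by a leaf whose class consists of its endpoints. -/
def EdgeArc (R : ℝ → ℝ → Prop) (c d : ℝ) : Prop :=
  c < d ∧ d < c + 1 ∧ R c d ∧ ∀ w, R c w → ∃ n : ℤ, w = c + n ∨ w = d + n

namespace EdgeArc

variable {R : ℝ → ℝ → Prop} {c d : ℝ}

theorem shift (h : Lam R) (H : EdgeArc R c d) (n : ℤ) : EdgeArc R (c + n) (d + n) := by
  obtain ⟨h1, h2, h3, h4⟩ := H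
  refine ⟨by linarith, by linarith, h.shift h3 n n, fun w hw => ?_⟩
  obtain ⟨m, hm⟩ := h4 w (h.trans (h.per c n) hw)
  refine ⟨m - n, ?_⟩
  push_cast
  rcases hm with hm | hm
  · left; linarith
  · right; linarith

theorem other (h : Lam R) (H : EdgeArc R c d) : EdgeArc R d (c + 1) := by
  obtain ⟨h1, h2, h3, h4⟩ := H
  refine ⟨by linarith, by linarith, h.add_one (h.symm h3), fun w hw => ?_⟩
  obtain ⟨m, hm⟩ := h4 w (h.trans h3 hw)
  rcases hm with hm | hm
  · exact ⟨m - 1, Or.inr (by push_cast; linarith)⟩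
  · exact ⟨m, Or.inl hm⟩

theorem not_rel_inside (H : EdgeArc R c d) {t : ℝ} (h1 : c < t) (h2 : t < d) : ¬ R c t := by
  intro hR
  obtain ⟨n, hn | hn⟩ := H.2.2.2 t hR
  · exact Int.cast_between_false (n := n) 0 (by push_cast; linarith)
      (by push_cast; linarith [H.2.1])
  · exact Int.cast_between_false (n := n) (-1) (by push_cast; linarith [H.2.1])
      (by push_cast; linarith)

theorem not_rel (h : Lam R) (H : EdgeArc R c d) {t w : ℝ} (h1 : c < t) (h2 : t < d) (h3 : d ≤ w)
    (h4 : w ≤ c + 1) : ¬ R t w := by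
  intro hR
  refine H.not_rel_inside h1 h2 ?_
  obtain ⟨e1, e2, e3, e4⟩ := H
  rcases eq_or_lt_of_le h3 with h5 | h5
  · rw [← h5] at hR; exact h.trans e3 (h.symm hR)
  rcases eq_or_lt_of_le h4 with h6 | h6
  · rw [h6] at hR
    exact h.symm (by simpa using h.sub_one hR)
  · exact h.cross h1 h2 h5 h6 e3 hR

/-- A point whose image is in the class of the image of an edge is, modulo `1 / 3`, an endpoint. -/
theorem rel_mod (h : Lam R) (H : EdgeArc R (3 * c) (3 * d)) {w : ℝ} (hw : R c w) :
    ∃ n : ℤ, w = c + n / 3 ∨ w = d + n / 3 := by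
  obtain ⟨n, hn | hn⟩ := H.2.2.2 _ (h.fwd hw)
  · exact ⟨n, Or.inl (by linarith)⟩
  · exact ⟨n, Or.inr (by linarith)⟩

end EdgeArc

namespace Major

variable {R : ℝ → ℝ → Prop} {a b : ℝ} {k : ℕ}

theorem edge (H : Major R a b) : EdgeArc R a b :=
  ⟨by linarith [H.third_le], by linarith [H.le_half], H.rel, fun _ hw => H.exact hw⟩

end Major

namespace PerMajor

variable {R : ℝ → ℝ → Prop} {a b : ℝ} {k : ℕ}

theorem third_lt (P : PerMajor a b k) (h : a < b) : 1 / 3 < b - a := by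
  obtain ⟨-, -, h2, -⟩ := P
  by_contra hc
  have : (0 : ℝ) < 3 ^ k := by positivity
  nlinarith

theorem three_le (P : PerMajor a b k) : (3 : ℝ) ≤ 3 ^ k := by
  calc (3 : ℝ) = 3 ^ 1 := by norm_num
    _ ≤ 3 ^ k := pow_le_pow_right₀ (by norm_num) P.1

theorem pow_right (P : PerMajor a b k) : ∃ j : ℤ, 3 ^ k * b = b + j := by
  obtain ⟨h0, ⟨j, hj⟩, h2, -⟩ := P
  obtain ⟨l, rfl⟩ : ∃ l, k = l + 1 := ⟨k - 1, by omega⟩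
  refine ⟨j + 3 ^ l, ?_⟩
  have : (3 : ℝ) ^ (l + 1) * (1 / 3) = 3 ^ l := by rw [pow_succ]; ring
  push_cast
  linarith

/-- The first return branch at the left endpoint. -/
theorem branch_left (P : PerMajor a b k) (t : ℝ) : ∃ j : ℤ, a + 3 ^ k * (t - a) = 3 ^ k * t + j := by
  obtain ⟨-, ⟨j, hj⟩, -, -⟩ := P
  exact ⟨-j, by push_cast; linarith⟩

theorem branch_right (P : PerMajor a b k) (t : ℝ) :
    ∃ j : ℤ, b + 3 ^ k * (t - b) = 3 ^ k * t + j := by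
  obtain ⟨j, hj⟩ := P.pow_right
  exact ⟨-j, by push_cast; linarith⟩

theorem off_left (P : PerMajor a b k) {i : ℕ} (h0 : 0 < i) (hi : i < k) {t : ℝ} (h1 : a ≤ t)
    (h2 : t ≤ b - 1 / 3) (m : ℤ) : ¬ (a ≤ 3 ^ i * t + m ∧ 3 ^ i * t + m ≤ b) :=
  P.2.2.2 i h0 hi t h1 h2 m

/-- The right branch is the left one moved by 1/3, which becomes an integer after one tripling. -/
theorem off_right (P : PerMajor a b k) {i : ℕ} (h0 : 0 < i) (hi : i < k) {t : ℝ}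
    (h1 : a + 1 / 3 ≤ t) (h2 : t ≤ b) (m : ℤ) : ¬ (a ≤ 3 ^ i * t + m ∧ 3 ^ i * t + m ≤ b) := by
  obtain ⟨l, rfl⟩ : ∃ l, i = l + 1 := ⟨i - 1, by omega⟩
  have := P.off_left h0 hi (t := t - 1 / 3) (by linarith) (by linarith) (m + 3 ^ l)
  have e : (3 : ℝ) ^ (l + 1) * (t - 1 / 3) + (m + 3 ^ l : ℤ) = 3 ^ (l + 1) * t + m := by
    rw [pow_succ]; push_cast; ring
  rwa [e] at this

end PerMajor

/-- The lift of the first return map to `[a, b - 1 / 3] ∪ [a + 1 / 3, b]` with displacement in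
`(0, 1)`. -/
noncomputable def returnLift (a b : ℝ) (k : ℕ) (t : ℝ) : ℝ :=
  if t - ⌊t - a⌋ ≤ b - 1 / 3 then ⌊t - a⌋ + (a + 3 ^ k * (t - ⌊t - a⌋ - a))
  -- On the right branch the return map moves points to the left of b further left, so one full turn
  -- is added to make the displacement positive.
  else ⌊t - a⌋ + (b + 3 ^ k * (t - ⌊t - a⌋ - b)) + 1

section Return

variable {a b : ℝ} {k : ℕ}

theorem returnLift_add_int (t : ℝ) (n : ℤ) :
    returnLift a b k (t + n) = returnLift a b k t + n := by
  have h : ⌊t + n - a⌋ = ⌊t - a⌋ + n := by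
    rw [show t + n - a = t - a + n by ring, Int.floor_add_intCast]
  have h2 : t + n - ((⌊t - a⌋ + n : ℤ) : ℝ) = t - ⌊t - a⌋ := by push_cast; ring
  simp only [returnLift, h, h2]
  split_ifs <;> push_cast <;> ring

theorem returnLift_left {t : ℝ} (h1 : a ≤ t) (h2 : t ≤ b - 1 / 3) (hab : b < a + 1) :
    returnLift a b k t = a + 3 ^ k * (t - a) := by
  have : ⌊t - a⌋ = 0 := Int.floor_eq_zero_iff.2 ⟨by linarith, by linarith⟩
  simp only [returnLift, this, Int.cast_zero, sub_zero, if_pos h2]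
  ring

theorem returnLift_right {t : ℝ} (h1 : b - 1 / 3 < t) (h2 : t ≤ b) (hab : b < a + 1)
    (hab' : a ≤ b - 1 / 3) :
    returnLift a b k t = b + 3 ^ k * (t - b) + 1 := by
  have : ⌊t - a⌋ = 0 := Int.floor_eq_zero_iff.2 ⟨by linarith, by linarith⟩
  simp only [returnLift, this, Int.cast_zero, sub_zero, if_neg (not_le.2 h1)]
  ring

end Return

namespace Major

variable {R : ℝ → ℝ → Prop} {a b : ℝ} {k : ℕ}

/-- The class of b - 1/3 has a point over 3 * a. The candidates a and a + 2/3 are excluded because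
the class of a is {a, b} modulo one and leaves do not leave [a, b]. -/
theorem rel_middle (H : Major R a b) (P : PerMajor a b k) : R (b - 1 / 3) (a + 1 / 3) := by
  have h1 := P.third_lt H.edge.1
  have h2 := H.le_half
  rcases H.lam.back3 (x := b - 1 / 3) (y := a) (-1) (by
    have := H.lam.shift (H.lam.fwd (H.lam.symm H.rel)) (-1) (-1)
    convert this using 1; push_cast; ring) with h | h | h
  · exact (H.edge.not_rel_inside (by linarith) (by linarith) (H.lam.symm h)).elim
  · exact h
  · exact (H.edge.not_rel H.lam (by linarith) (by linarith) (by linarith) (by linarith) h).elim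

/-- The leaf with the same image as the major on the other side of the vassal gap. -/
theorem edge_middle (H : Major R a b) (P : PerMajor a b k) : EdgeArc R (b - 1 / 3) (a + 1 / 3) := by
  have h1 := P.third_lt H.edge.1
  have h2 := H.le_half
  refine ⟨by linarith, by linarith, H.rel_middle P, fun w hw => ?_⟩
  have hex : ∃ n : ℤ, w = a + n / 3 ∨ w = b + n / 3 := by
    have h3 : R (3 * b) (3 * w) := by
      have := H.lam.shift (H.lam.fwd hw) 1 0
      convert this using 1 <;> push_cast <;> ring
    obtain ⟨v, hv, n, hn⟩ := H.lam.back h3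
    obtain ⟨m, hm | hm⟩ := H.exact (H.lam.trans H.rel hv)
    · exact ⟨3 * m - n, Or.inl (by push_cast; linarith)⟩
    · exact ⟨3 * m - n, Or.inr (by push_cast; linarith)⟩
  have hno : ∀ x, b ≤ x → x ≤ a + 1 → ¬ R (b - 1 / 3) x := fun x hx1 hx2 =>
    H.edge.not_rel H.lam (by linarith) (by linarith) hx1 hx2
  have hred : ∀ (x : ℝ) (i : ℤ), w = x + i → R (b - 1 / 3) x := fun x i hx =>
    H.lam.of_shift i (hx ▸ hw)
  obtain ⟨n, hn⟩ := hex
  obtain ⟨i, hi⟩ : ∃ i : ℤ, n = 3 * i ∨ n = 3 * i + 1 ∨ n = 3 * i + 2 := ⟨n / 3, by omega⟩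
  rcases hn with hn | hn <;> rcases hi with hi | hi | hi <;> rw [hi] at hn <;> push_cast at hn
  · exact (hno (a + 1) (by linarith) (by linarith) (hred _ (i - 1) (by push_cast; linarith))).elim
  · exact ⟨i, Or.inr (by linarith)⟩
  · exact (hno (a + 2 / 3) (by linarith) (by linarith) (hred _ i (by linarith))).elim
  · exact (hno b (by linarith) (by linarith) (hred _ i (by linarith))).elim
  · exact (hno (b + 1 / 3) (by linarith) (by linarith) (hred _ i (by linarith))).elim
  · exact ⟨i + 1, Or.inl (by push_cast; linarith)⟩

/-- A straddling leaf that is mapped into its own arc gives a rotation system. -/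
theorem not_inward (H : Major R a b) (P : PerMajor a b k) (hS : NoSiegel R) {x y : ℝ}
    (hx1 : a < x) (hx2 : x ≤ b - 1 / 3) (hy1 : a + 1 / 3 ≤ y) (hy2 : y < b) (hR : R x y)
    (h1 : a + 3 ^ k * (x - a) < y) (h2 : x < b + 3 ^ k * (y - b)) : False := by
  have hab := P.third_lt H.edge.1
  have hab2 := H.le_half
  have hl := P.three_le
  have hl0 : (0 : ℝ) < 3 ^ k := by linarith
  have hlen : (3 : ℝ) ^ k * (b - 1 / 3 - a) = b - a := by have := P.2.2.1; linarith
  have hlen' : (3 : ℝ) ^ k * (b - (a + 1 / 3)) = b - a := by have := P.2.2.1; linarith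
  -- The domain is what remains of the two branches between x and y. Its complementary arcs are (b -
  -- 1/3, a + 1/3) and (y, x + 1), both bounded by leaves and moved off themselves.
  set E : Set ℝ := {t | ∃ n : ℤ, (x ≤ t + n ∧ t + n ≤ b - 1 / 3) ∨ (a + 1 / 3 ≤ t + n ∧ t + n ≤ y)}
    with hE
  set F := returnLift a b k with hF
  have hFl : ∀ {t}, x ≤ t → t ≤ b - 1 / 3 → F t = a + 3 ^ k * (t - a) := fun h3 h4 =>
    returnLift_left (by linarith) h4 (by linarith)
  have hFr : ∀ {t}, a + 1 / 3 ≤ t → t ≤ y → F t = b + 3 ^ k * (t - b) + 1 := fun h3 h4 =>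
    returnLift_right (by linarith) (by linarith) (by linarith) (by linarith)
  have hFa : ∀ t (n : ℤ), F (t + n) = F t + n := returnLift_add_int
  have hvl : ∀ {t}, x ≤ t → t ≤ b - 1 / 3 → t < a + 3 ^ k * (t - a) ∧ a + 3 ^ k * (t - a) ≤ b := by
    intro t h3 h4
    have e1 : (0 : ℝ) < (3 ^ k - 1) * (t - a) := mul_pos (by linarith) (by linarith)
    have e2 : (3 : ℝ) ^ k * (t - a) ≤ 3 ^ k * (b - 1 / 3 - a) :=
      mul_le_mul_of_nonneg_left (by linarith) hl0.le
    constructor <;> linarith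
  have hvr : ∀ {t}, a + 1 / 3 ≤ t → t ≤ y → b + 3 ^ k * (t - b) < t ∧ a ≤ b + 3 ^ k * (t - b) := by
    intro t h3 h4
    have e1 : (0 : ℝ) < (3 ^ k - 1) * (b - t) := mul_pos (by linarith) (by linarith)
    have e2 : (3 : ℝ) ^ k * (b - t) ≤ 3 ^ k * (b - (a + 1 / 3)) :=
      mul_le_mul_of_nonneg_left (by linarith) hl0.le
    constructor <;> linarith
  have hzero : ∀ (z : ℝ) (m : ℤ), a ≤ z → z < a + 1 → a ≤ z + m → z + m < a + 1 → m = 0 := by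
    intro z m h3 h4 h5 h6
    have m1 : (-1 : ℝ) < m := by linarith
    have m2 : (m : ℝ) < 1 := by linarith
    have m1' : -1 < m := by exact_mod_cast m1
    have m2' : m < 1 := by exact_mod_cast m2
    omega
  have hmem : ∀ z ∈ E, a ≤ z → z < a + 1 → (x ≤ z ∧ z ≤ b - 1 / 3) ∨ (a + 1 / 3 ≤ z ∧ z ≤ y) := by
    rintro z ⟨m, hm⟩ h3 h4
    have : m = 0 := hzero z m h3 h4 (by rcases hm with hm | hm <;> linarith)
      (by rcases hm with hm | hm <;> linarith)
    subst this
    simpa using hm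
  have hEper : ∀ {t} (n : ℤ), t ∈ E → t + n ∈ E := by
    rintro t n ⟨m, hm⟩
    refine ⟨m - n, ?_⟩
    have e : t + n + ((m - n : ℤ) : ℝ) = t + m := by push_cast; ring
    rwa [e]
  have PS : PreSys R k E F :=
    { lam := H.lam
      per := hEper
      map_add_int := hFa
      disp := by
        rintro t ⟨n, hn⟩
        have e := hFa t n
        rcases hn with hn | hn
        · rw [hFl hn.1 hn.2] at e
          have := hvl hn.1 hn.2
          constructor <;> linarith
        · rw [hFr hn.1 hn.2] at e
          have := hvr hn.1 hn.2
          constructor <;> linarith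
      cong := by
        rintro t ⟨n, hn⟩
        have e := hFa t n
        rcases hn with hn | hn
        · rw [hFl hn.1 hn.2] at e
          obtain ⟨j, hj⟩ := P.branch_left (t + n)
          exact ⟨3 ^ k * n + j - n, by push_cast; linarith⟩
        · rw [hFr hn.1 hn.2] at e
          obtain ⟨j, hj⟩ := P.branch_right (t + n)
          exact ⟨3 ^ k * n + j - n + 1, by push_cast; linarith⟩
      aff := by
        intro s t hst hD
        obtain ⟨n, hn⟩ := hD ⟨le_rfl, hst⟩
        have e1 := hFa s n
        have e2 := hFa t n
        have hsub : ∀ z, s + n ≤ z → z ≤ t + n → z ∈ E := fun z hz1 hz2 => by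
          have := hEper n (hD (show z - n ∈ Set.Icc s t from ⟨by linarith, by linarith⟩))
          simpa using this
        rcases hn with hn | hn
        · have ht : t + n ≤ b - 1 / 3 := by
            by_contra hc
            rw [not_le] at hc
            have g1 : b - 1 / 3 < min (t + n) ((a + b) / 2) := lt_min hc (by linarith)
            have g2 := min_le_right (t + n) ((a + b) / 2)
            rcases hmem _ (hsub (min (t + n) ((a + b) / 2)) (by linarith) (min_le_left _ _))
              (by linarith) (by linarith) with g | g <;> linarith
          rw [hFl hn.1 hn.2] at e1
          rw [hFl (by linarith) ht] at e2
          linarith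
        · have ht : t + n ≤ y := by
            by_contra hc
            rw [not_le] at hc
            have g1 : y < min (t + n) b := lt_min hc hy2
            have g2 := min_le_right (t + n) b
            rcases hmem _ (hsub (min (t + n) b) (by linarith) (min_le_left _ _))
              (by linarith) (by linarith) with g | g <;> linarith
          rw [hFr hn.1 hn.2] at e1
          rw [hFr (by linarith) ht] at e2
          linarith }
  have mem1 : x ∈ E := ⟨0, Or.inl ⟨by simp, by simpa using hx2⟩⟩
  have mem2 : y ∈ E := ⟨0, Or.inr ⟨by simpa using hy1, by simp⟩⟩
  have mem3 : b - 1 / 3 ∈ E := ⟨0, Or.inl ⟨by simpa using hx2, by simp⟩⟩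
  have mem4 : a + 1 / 3 ∈ E := ⟨0, Or.inr ⟨by simp, by simpa using hy1⟩⟩
  have hM₀ : Memb R E F y (x + 1) := by
    refine ⟨mem2, by simpa using hEper 1 mem1, by linarith, by linarith,
      H.lam.add_one (H.lam.symm hR), ?_, ?_⟩
    · rw [hFr hy1 le_rfl]; linarith
    · have := hFa x 1
      push_cast at this
      rw [this, hFl le_rfl hx2]; linarith
  have hM₁ : Memb R E F (b - 1 / 3) (a + 1 / 3) := by
    refine ⟨mem3, mem4, by linarith, by linarith, H.rel_middle P, ?_, ?_⟩
    · rw [hFl hx2 le_rfl]; linarith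
    · rw [hFr le_rfl hy1]; linarith
  have hcov : ∀ {t}, t ∉ E → ∃ e f, (∃ n : ℤ, (e = y + n ∧ f = x + 1 + n) ∨
      (e = b - 1 / 3 + n ∧ f = a + 1 / 3 + n)) ∧ e < t ∧ t < f := by
    intro t ht
    set n := ⌊t - a⌋
    have f1 := Int.floor_le (t - a)
    have f2 := Int.lt_floor_add_one (t - a)
    have ht' : ¬ ((x ≤ t - n ∧ t - n ≤ b - 1 / 3) ∨ (a + 1 / 3 ≤ t - n ∧ t - n ≤ y)) := fun hc =>
      ht ⟨-n, by push_cast; simpa [sub_eq_add_neg] using hc⟩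
    simp only [not_or, not_and, not_le] at ht'
    rcases lt_or_ge (t - n) x with g | g
    · exact ⟨_, _, ⟨n - 1, Or.inl ⟨rfl, rfl⟩⟩, by push_cast; linarith, by push_cast; linarith⟩
    have g2 := ht'.1 g
    rcases lt_or_ge (t - n) (a + 1 / 3) with g3 | g3
    · exact ⟨_, _, ⟨n, Or.inr ⟨rfl, rfl⟩⟩, by linarith, by linarith⟩
    have g4 := ht'.2 g3
    exact ⟨_, _, ⟨n, Or.inl ⟨rfl, rfl⟩⟩, by linarith, by linarith⟩
  -- a descent of the lift
  have hdesc : ∀ {s p}, s ∈ E → p ∈ E → s < p → F p ≤ F s →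
      ∃ n : ℤ, a + 1 / 3 ≤ s + n ∧ s + n ≤ y ∧ x + 1 ≤ p + n ∧ p + n ≤ b - 1 / 3 + 1 := by
    rintro s p ⟨n, hn⟩ ⟨m, hm⟩ hsp hle
    have e1 := hFa s n
    have e2 := hFa p m
    have hmul := mul_pos hl0 (sub_pos.2 hsp)
    rcases hn with hn | hn <;> rcases hm with hm | hm
    · rw [hFl hn.1 hn.2] at e1
      rw [hFl hm.1 hm.2] at e2
      have v1 := hvl hn.1 hn.2
      have v2 := hvl hm.1 hm.2
      have : m = n := by
        have m1 : (m : ℝ) < n + 1 := by linarith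
        have m2 : (n : ℝ) < m + 1 := by linarith
        have m1' : m < n + 1 := by exact_mod_cast m1
        have m2' : n < m + 1 := by exact_mod_cast m2
        omega
      subst this
      linarith
    · rw [hFl hn.1 hn.2] at e1
      rw [hFr hm.1 hm.2] at e2
      have v1 := hvl hn.1 hn.2
      have v2 := hvr hm.1 hm.2
      exfalso
      rcases le_or_gt m n with g | g
      · have : (m : ℝ) ≤ n := by exact_mod_cast g
        linarith
      · have : (n : ℝ) + 1 ≤ m := by exact_mod_cast g
        linarith
    · rw [hFr hn.1 hn.2] at e1
      rw [hFl hm.1 hm.2] at e2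
      have v1 := hvr hn.1 hn.2
      have v2 := hvl hm.1 hm.2
      have : n = m + 1 := by
        have m1 : (m : ℝ) < n := by linarith
        have m2 : (n : ℝ) < m + 2 := by linarith
        have m1' : m < n := by exact_mod_cast m1
        have m2' : n < m + 2 := by exact_mod_cast m2
        omega
      subst this
      push_cast at hn ⊢
      exact ⟨m + 1, by push_cast; linarith, by push_cast; linarith, by push_cast; linarith,
        by push_cast; linarith⟩
    · rw [hFr hn.1 hn.2] at e1
      rw [hFr hm.1 hm.2] at e2
      have v1 := hvr hn.1 hn.2
      have v2 := hvr hm.1 hm.2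
      have : m = n := by
        have m1 : (m : ℝ) < n + 1 := by linarith
        have m2 : (n : ℝ) < m + 1 := by linarith
        have m1' : m < n + 1 := by exact_mod_cast m1
        have m2' : n < m + 1 := by exact_mod_cast m2
        omega
      subst this
      linarith
  have S := PS.rotSys (G := fun e f => ∃ n : ℤ, (e = y + n ∧ f = x + 1 + n) ∨
      (e = b - 1 / 3 + n ∧ f = a + 1 / 3 + n)) ?_ ?_ ?_ hcov ?_ ?_ ?_ ⟨_, _, 0, Or.inl ⟨rfl, rfl⟩⟩
  · refine S.false hS fun m hm1 hm2 t ht ht' => ?_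
    have hDE : ∀ t, (∀ e f, (∃ n : ℤ, (e = y + n ∧ f = x + 1 + n) ∨
      (e = b - 1 / 3 + n ∧ f = a + 1 / 3 + n)) → ¬ (e < t ∧ t < f)) → t ∈ E := by
      intro t ht
      by_contra hc
      obtain ⟨e, f, g1, g2⟩ := hcov hc
      exact ht e f g1 g2
    obtain ⟨i, hi⟩ := hDE _ ht
    obtain ⟨j, hj⟩ := hDE _ ht'
    have e : (3 : ℝ) ^ m * (t + i) + (j - 3 ^ m * i : ℤ) = 3 ^ m * t + j := by push_cast; ring
    rcases hi with hi | hi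
    · refine P.off_left hm1 hm2 (t := t + i) (by linarith) (by linarith) (j - 3 ^ m * i) ?_
      rw [e]
      rcases hj with hj | hj <;> constructor <;> linarith
    · refine P.off_right hm1 hm2 (t := t + i) (by linarith) (by linarith) (j - 3 ^ m * i) ?_
      rw [e]
      rcases hj with hj | hj <;> constructor <;> linarith
  · rintro e f j ⟨n, ⟨rfl, rfl⟩ | ⟨rfl, rfl⟩⟩
    · exact ⟨n + j, Or.inl ⟨by push_cast; ring, by push_cast; ring⟩⟩
    · exact ⟨n + j, Or.inr ⟨by push_cast; ring, by push_cast; ring⟩⟩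
  · rintro e f ⟨n, ⟨rfl, rfl⟩ | ⟨rfl, rfl⟩⟩
    · exact PS.memb_shift n hM₀
    · exact PS.memb_shift n hM₁
  · have key : ∀ n n' : ℤ, (n : ℝ) < n' + 1 → (n' : ℝ) < n + 1 → n = n' := by
      intro n n' h5 h6
      have h5' : n < n' + 1 := by exact_mod_cast h5
      have h6' : n' < n + 1 := by exact_mod_cast h6
      omega
    rintro e f e' f' ⟨n, ⟨rfl, rfl⟩ | ⟨rfl, rfl⟩⟩ ⟨n', ⟨rfl, rfl⟩ | ⟨rfl, rfl⟩⟩ h3 h4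
    · have := key n n' (by linarith) (by linarith)
      subst this; exact ⟨rfl, rfl⟩
    · exfalso
      rcases le_or_gt n' n with hn | hn
      · have : (n' : ℝ) ≤ n := by exact_mod_cast hn
        linarith
      · have : (n : ℝ) + 1 ≤ n' := by exact_mod_cast hn
        linarith
    · exfalso
      rcases le_or_gt n n' with hn | hn
      · have : (n : ℝ) ≤ n' := by exact_mod_cast hn
        linarith
      · have : (n' : ℝ) + 1 ≤ n := by exact_mod_cast hn
        linarith
    · have := key n n' (by linarith) (by linarith)
      subst this; exact ⟨rfl, rfl⟩
  · refine ⟨min (x + 1 - y) (a + 1 / 3 - (b - 1 / 3)), lt_min (by linarith) (by linarith), ?_⟩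
    rintro e f ⟨n, ⟨rfl, rfl⟩ | ⟨rfl, rfl⟩⟩
    · have := min_le_left (x + 1 - y) (a + 1 / 3 - (b - 1 / 3)); linarith
    · have := min_le_right (x + 1 - y) (a + 1 / 3 - (b - 1 / 3)); linarith
  · have key : ∀ e f, (∃ n : ℤ, (e = y + n ∧ f = x + 1 + n) ∨
        (e = b - 1 / 3 + n ∧ f = a + 1 / 3 + n)) →
        ∃ i : ℤ, e < (a + b) / 2 + (i : ℝ) / 2 ∧ (a + b) / 2 + (i : ℝ) / 2 < f := by
      rintro e f ⟨n, ⟨rfl, rfl⟩ | ⟨rfl, rfl⟩⟩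
      · exact ⟨2 * n + 1, by push_cast; linarith, by push_cast; linarith⟩
      · exact ⟨2 * n, by push_cast; linarith, by push_cast; linarith⟩
    intro e₁ f₁ e₂ f₂ e₃ f₃ g1 g2 g3 h3 h4 h5
    obtain ⟨i, i1, i2⟩ := key _ _ g1
    obtain ⟨j, j1, j2⟩ := key _ _ g2
    obtain ⟨l, l1, l2⟩ := key _ _ g3
    have h6 : (i : ℝ) < j := by linarith
    have h7 : (j : ℝ) < l := by linarith
    have h8 : (l : ℝ) < i + 2 := by linarith
    have h6' : i < j := by exact_mod_cast h6
    have h7' : j < l := by exact_mod_cast h7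
    have h8' : l < i + 2 := by exact_mod_cast h8
    omega
  · intro s u p q _ h3 h4 h5 h6 h7
    have hp : p ∈ E := by simpa using hEper (-1) h4.2.1
    have e1 := h3.2.2.2.2.2
    have e2 := h4.2.2.2.2.2
    have e3 := hFa p 1
    push_cast at e3
    -- Arcs covering the circle force two descents, from s to p and from q to u. A descent occurs
    -- only from a right branch to the left branch of the next period, so the two are a period apart
    -- and u - s > 1.
    obtain ⟨n, n1, n2, n3, n4⟩ := hdesc h3.1 hp h5 (by linarith)
    obtain ⟨m, m1, m2, m3, m4⟩ := hdesc h4.1 h3.2.1 h7 (by linarith)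
    have hmn : (m : ℝ) < n := by linarith
    have hmn' : m + 1 ≤ n := by exact_mod_cast hmn
    have hmn2 : (m : ℝ) + 1 ≤ n := by exact_mod_cast hmn'
    linarith [h3.2.2.2.1]

/-- A straddling leaf other than the major is mapped into its own arc or off it. -/
theorem inward_or_outward (H : Major R a b) (P : PerMajor a b k) {x y : ℝ}
    (hx1 : a < x) (hx2 : x ≤ b - 1 / 3) (hy1 : a + 1 / 3 ≤ y) (hy2 : y < b) (hR : R x y) :
    (a + 3 ^ k * (x - a) < y ∧ x < b + 3 ^ k * (y - b)) ∨
      (y < a + 3 ^ k * (x - a) ∧ b + 3 ^ k * (y - b) < x) := by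
  have hab := P.third_lt H.edge.1
  have hab2 := H.le_half
  have hl := P.three_le
  have hl0 : (0 : ℝ) < 3 ^ k := by linarith
  have hlen := P.2.2.1
  obtain ⟨i, hi⟩ := P.branch_left x
  obtain ⟨j, hj⟩ := P.branch_right y
  set x' := a + 3 ^ k * (x - a) with hx'
  set y' := b + 3 ^ k * (y - b) with hy'
  have hR' : R x' y' := by
    rw [hi, hj]; exact H.lam.shift (H.lam.fwd_pow hR k) i j
  have e1 : (0 : ℝ) < (3 ^ k - 1) * (x - a) := mul_pos (by linarith) (by linarith)
  have e2 : (3 : ℝ) ^ k * (x - a) ≤ 3 ^ k * (b - a - 1 / 3) :=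
    mul_le_mul_of_nonneg_left (by linarith) hl0.le
  have e3 : (0 : ℝ) < (3 ^ k - 1) * (b - y) := mul_pos (by linarith) (by linarith)
  have e4 : (3 : ℝ) ^ k * (b - y) ≤ 3 ^ k * (b - a - 1 / 3) :=
    mul_le_mul_of_nonneg_left (by linarith) hl0.le
  have hxx : ¬ R x x' := by
    intro hc
    rw [hi] at hc
    obtain ⟨n, hn⟩ := H.lam.nopoly x k (H.lam.of_shift i hc)
    exact Int.cast_between_false (n := n + i) 0 (by push_cast; linarith) (by push_cast; linarith)
  rcases lt_trichotomy x' y with g1 | g1 | g1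
  · rcases lt_trichotomy x y' with g2 | g2 | g2
    · exact Or.inl ⟨g1, g2⟩
    · exact (hxx (g2 ▸ H.lam.symm hR')).elim
    · have := H.lam.cross g2 (by linarith) g1 (by linarith) (H.lam.symm hR') hR
      exact (hxx (H.lam.trans (H.lam.symm this) (H.lam.symm hR'))).elim
  · exact (hxx (g1 ▸ hR)).elim
  · rcases lt_trichotomy x y' with g2 | g2 | g2
    · have := H.lam.cross g2 (by linarith) g1 (by linarith) hR (H.lam.symm hR')
      exact (hxx (H.lam.trans this (H.lam.symm hR'))).elim
    · exact (hxx (g2 ▸ H.lam.symm hR')).elim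
    · exact Or.inr ⟨g1, g2⟩

/-- The only straddling leaves are the major and the middle leaf. -/
theorem straddle (H : Major R a b) (P : PerMajor a b k) (hS : NoSiegel R) {x y : ℝ}
    (hx1 : a ≤ x) (hx2 : x ≤ b - 1 / 3) (hy1 : a + 1 / 3 ≤ y) (hy2 : y ≤ b) (hR : R x y) :
    (x = a ∧ y = b) ∨ (x = b - 1 / 3 ∧ y = a + 1 / 3) := by
  have hab := P.third_lt H.edge.1
  have hab2 := H.le_half
  have hl := P.three_le
  have hl0 : (0 : ℝ) < 3 ^ k := by linarith
  have hlen := P.2.2.1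
  have hor : ∀ {x y}, a ≤ x → x ≤ b - 1 / 3 → a + 1 / 3 ≤ y → y ≤ b → R x y → (x = a ∧ y = b) ∨
      (y < a + 3 ^ k * (x - a) ∧ b + 3 ^ k * (y - b) < x) := by
    intro x y h1 h2 h3 h4 hR
    rcases eq_or_lt_of_le h1 with h5 | h5
    · rw [← h5] at hR
      rcases eq_or_lt_of_le h4 with h6 | h6
      · exact Or.inl ⟨h5.symm, h6⟩
      · exact (H.edge.not_rel_inside (by linarith) h6 hR).elim
    rcases eq_or_lt_of_le h4 with h6 | h6
    · rw [h6] at hR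
      exact (H.edge.not_rel_inside h5 (by linarith) (H.lam.trans H.rel (H.lam.symm hR))).elim
    rcases H.inward_or_outward P h5 h2 h3 h6 hR with h7 | h7
    · exact (H.not_inward P hS h5 h2 h3 h6 hR h7.1 h7.2).elim
    · exact Or.inr h7
  -- For a joining leaf other than the major, the image of x lies beyond y ≥ a + 1/3, so that 3 ^ k
  -- * (x - a) > 1/3. This separates these leaves from the major and makes their set compact.
  set c : ℝ := 1 / (3 * 3 ^ k) with hc
  have hc0 : 0 < c := by positivity
  have hc1 : 3 ^ k * c = 1 / 3 := by rw [hc]; field_simp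
  set K : Set (ℝ × ℝ) := {p | R p.1 p.2} ∩ (Set.Icc (a + c) (b - 1 / 3) ×ˢ Set.Icc (a + 1 / 3) b)
    with hK
  have hKc : IsCompact K :=
    (isCompact_Icc.prod isCompact_Icc).of_isClosed_subset
      (H.lam.closed.inter (isClosed_Icc.prod isClosed_Icc)) (fun p hp => hp.2)
  have hmem : ∀ {x y}, a ≤ x → x ≤ b - 1 / 3 → a + 1 / 3 ≤ y → y ≤ b → R x y → ¬ (x = a ∧ y = b) →
      (x, y) ∈ K := by
    intro x y h1 h2 h3 h4 hR hne
    refine ⟨hR, ⟨?_, h2⟩, h3, h4⟩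
    have h5 := ((hor h1 h2 h3 h4 hR).resolve_left hne).1
    by_contra hlt
    have := mul_lt_mul_of_pos_left (not_le.1 hlt) hl0
    change 3 ^ k * x < 3 ^ k * (a + c) at this
    linarith
  have hmid : (b - 1 / 3, a + 1 / 3) ∈ K :=
    hmem (by linarith) le_rfl le_rfl (by linarith) (H.rel_middle P) (by
      rintro ⟨h1, h2⟩; linarith)
  obtain ⟨⟨s, u⟩, hsu, hmax⟩ := hKc.exists_isMaxOn ⟨_, hmid⟩
    (f := fun p : ℝ × ℝ => p.2 - p.1) (by fun_prop)
  obtain ⟨hsuR, ⟨hs1, hs2⟩, hu1, hu2⟩ := hsu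
  simp only at hsuR hs1 hs2 hu1 hu2
  have hmax' : ∀ {x y}, a ≤ x → x ≤ b - 1 / 3 → a + 1 / 3 ≤ y → y ≤ b → R x y →
      ¬ (x = a ∧ y = b) → y - x ≤ u - s := fun h1 h2 h3 h4 h5 h6 => hmax (hmem h1 h2 h3 h4 h5 h6)
  obtain ⟨o1, o2⟩ := (hor (by linarith) hs2 hu1 hu2 hsuR).resolve_left (by
    rintro ⟨h1, -⟩; linarith)
  -- Adding the two outward inequalities gives (b - a) + (u - s) < 3 ^ k * (s - a + b - u), whose
  -- right side would be at most b - a if u - s ≥ 1/3.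
  have hshort : u - s < 1 / 3 := by
    have e1 : (0 : ℝ) ≤ (3 ^ k - 3) * (b - a - 1 / 3) := mul_nonneg (by linarith) (by linarith)
    by_contra hge
    rw [not_lt] at hge
    have e2 := mul_le_mul_of_nonneg_left (show s - a + (b - u) ≤ b - a - 1 / 3 by linarith) hl0.le
    linarith
  -- The leaf with the same image as s u, attached to u - 1/3, is longer than s u. By maximality it
  -- has to be the major, which makes s u the middle leaf.
  have hmain : s = b - 1 / 3 ∧ u = a + 1 / 3 := by
    by_contra hne
    rcases H.lam.back3 (x := u - 1 / 3) (y := s) (-1) (by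
      have := H.lam.shift (H.lam.fwd (H.lam.symm hsuR)) (-1) (-1)
      convert this using 1; push_cast; ring) with h | h | h
    · have := hmax' (x := u - 1 / 3) (y := u) (by linarith) (by linarith) hu1 hu2
        (H.lam.trans h hsuR) (by rintro ⟨h1, h2⟩; linarith)
      linarith
    · have := hmax' (x := u - 1 / 3) (y := s + 1 / 3) (by linarith) (by linarith) (by linarith)
        (by linarith) h (by rintro ⟨h1, h2⟩; exact hne ⟨by linarith, by linarith⟩)
      linarith
    · rcases eq_or_lt_of_le hu1 with h1 | h1
      · rw [← h1, add_sub_cancel_right] at h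
        refine H.edge.not_rel_inside (t := b - 1 / 3) (by linarith) (by linarith) ?_
        obtain ⟨n, hn | hn⟩ := H.exact h
        · exact (Int.cast_between_false (n := n) 0 (by push_cast; linarith)
            (by push_cast; linarith)).elim
        · exact (Int.cast_between_false (n := n) 0 (by push_cast; linarith)
            (by push_cast; linarith)).elim
      · exact H.edge.not_rel H.lam (t := u - 1 / 3) (by linarith) (by linarith) (by linarith)
          (by linarith) h
  by_cases hM : x = a ∧ y = b
  · exact Or.inl hM
  · right
    have := hmax' hx1 hx2 hy1 hy2 hR hM
    rw [hmain.1, hmain.2] at this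
    constructor <;> linarith

end Major


/-! ### The gap of points whose orbits avoid the major arc -/

/-- The points whose orbit under `t ↦ 3 ^ k t`, modulo one, avoids `U`. -/
def offOrbit (k : ℕ) (U : Set ℝ) : Set ℝ := {t | ∀ (n : ℕ) (m : ℤ), (3 ^ k) ^ n * t + m ∉ U}

section OffOrbit

variable {k : ℕ} {U : Set ℝ} {t : ℝ}

theorem isClosed_offOrbit (hU : IsOpen U) : IsClosed (offOrbit k U) := by
  have : offOrbit k U = ⋂ (n : ℕ) (m : ℤ), (fun t : ℝ => (3 ^ k) ^ n * t + m) ⁻¹' Uᶜ := by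
    ext t; simp [offOrbit]
  rw [this]
  exact isClosed_iInter fun n => isClosed_iInter fun m =>
    hU.isClosed_compl.preimage (by fun_prop)

theorem offOrbit_add_int (ht : t ∈ offOrbit k U) (m : ℤ) : t + m ∈ offOrbit k U := fun n i => by
  have := ht n ((3 ^ k) ^ n * m + i)
  convert this using 2
  push_cast; ring

theorem mem_offOrbit_iff :
    t ∈ offOrbit k U ↔ (∀ m : ℤ, t + m ∉ U) ∧ 3 ^ k * t ∈ offOrbit k U := by
  constructor
  · refine fun h => ⟨fun m => by simpa using h 0 m, fun n m => ?_⟩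
    have := h (n + 1) m
    rwa [pow_succ, mul_assoc] at this
  · rintro ⟨h1, h2⟩ n m
    rcases n with _ | n
    · simpa using h1 m
    · have := h2 n m
      rwa [← mul_assoc, ← pow_succ] at this

end OffOrbit

/-- The arc `(c, d)` is a complementary component of the periodic set `B`. -/
def RHole (B : Set ℝ) (c d : ℝ) : Prop :=
  c ∈ B ∧ d ∈ B ∧ c < d ∧ d < c + 1 ∧ ∀ t, c < t → t < d → t ∉ B

theorem RHole.shift {B : Set ℝ} (hB : ∀ t ∈ B, ∀ m : ℤ, t + m ∈ B) {c d : ℝ} (h : RHole B c d)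
    (m : ℤ) : RHole B (c + m) (d + m) := by
  obtain ⟨h1, h2, h3, h4, h5⟩ := h
  refine ⟨hB _ h1 m, hB _ h2 m, by linarith, by linarith, fun t ht1 ht2 ht => ?_⟩
  have := hB _ ht (-m)
  push_cast at this
  exact h5 _ (by linarith) (by linarith) this

/-- A point off a closed periodic set with two points lies in a complementary component. -/
theorem exists_rhole {B : Set ℝ} (hc : IsClosed B) (hB : ∀ t ∈ B, ∀ m : ℤ, t + m ∈ B) {u v : ℝ}
    (hu : u ∈ B) (hv : v ∈ B) (huv : ∀ m : ℤ, v ≠ u + m) {t : ℝ} (ht : t ∉ B) :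
    ∃ c d, RHole B c d ∧ c < t ∧ t < d := by
  have hin : ∀ w ∈ B, ∃ w' ∈ B, t < w' ∧ w' < t + 1 ∧ ∃ m : ℤ, w' = w + m := by
    intro w hw
    have h1 := Int.floor_le (t + 1 - w)
    have h2 := Int.lt_floor_add_one (t + 1 - w)
    have hm := hB w hw ⌊t + 1 - w⌋
    refine ⟨_, hm, by linarith, lt_of_le_of_ne (by linarith) fun he => ht ?_, _, rfl⟩
    have := hB _ hm (-1)
    rw [he] at this
    simpa using this
  obtain ⟨u', hu', u1, u2, i, rfl⟩ := hin u hu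
  obtain ⟨v', hv', v1, v2, j, rfl⟩ := hin v hv
  have hne : u + i ≠ v + j := fun he => huv (i - j) (by push_cast; linarith)
  set S := B ∩ Set.Icc t (t + 1) with hS
  have hSc : IsCompact S := isCompact_Icc.inter_left hc
  have mu : u + i ∈ S := ⟨hu', u1.le, u2.le⟩
  have mv : v + j ∈ S := ⟨hv', v1.le, v2.le⟩
  have hSn : S.Nonempty := ⟨_, mu⟩
  have l1 := hSc.isLeast_sInf hSn
  have l2 := hSc.isGreatest_sSup hSn
  set d := sInf S
  set c := sSup S
  have hd : t < d := lt_of_le_of_ne l1.1.2.1 fun he => ht (he ▸ l1.1.1)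
  have hct : c < t + 1 := lt_of_le_of_ne l2.1.2.2 fun he => ht (by
    have := hB _ l2.1.1 (-1)
    rw [he] at this
    simpa using this)
  have hdc : d < c := by
    rcases lt_or_gt_of_ne hne with h | h
    · linarith [l1.2 mu, l2.2 mv]
    · linarith [l1.2 mv, l2.2 mu]
  refine ⟨c - 1, d, ⟨?_, l1.1.1, by linarith [l1.1.2.2], by linarith, fun w h1 h2 hw => ?_⟩,
    by linarith, hd⟩
  · simpa [sub_eq_add_neg] using hB _ l2.1.1 (-1)
  · rcases lt_trichotomy w t with h | h | h
    · have := l2.2 (show w + 1 ∈ S from ⟨by simpa using hB w hw 1, by linarith [l1.1.2.2], by linarith⟩)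
      linarith
    · exact ht (h ▸ hw)
    · have := l1.2 (show w ∈ S from ⟨hw, h.le, by linarith [l1.1.2.2]⟩)
      linarith

/-- An arc `(a, b)` of length between `1 / 3` and `1 / 2` whose endpoints never enter the arc nor
change places under tripling. -/
structure OrbMajor (a b : ℝ) : Prop where
  third_le : 1 / 3 ≤ b - a
  le_half : b - a ≤ 1 / 2
  left_mem : a ∈ offOrbit 1 (Set.Ioo a b)
  right_mem : b ∈ offOrbit 1 (Set.Ioo a b)
  left_ne : ∀ (n : ℕ) (m : ℤ), 3 ^ n * a + m ≠ b
  right_ne : ∀ (n : ℕ) (m : ℤ), 3 ^ n * b + m ≠ a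

theorem CritMajor.orbMajor {a b : ℝ} (C : CritMajor a b) : OrbMajor a b := by
  obtain ⟨rfl, hC⟩ := C
  have hb : ∀ n : ℕ, 0 < n → ∀ m : ℤ, ∃ i : ℤ, 3 ^ n * (a + 1 / 3) + m = 3 ^ n * a + i := by
    intro n hn m
    obtain ⟨l, rfl⟩ : ∃ l, n = l + 1 := ⟨n - 1, by omega⟩
    exact ⟨3 ^ l + m, by push_cast; ring⟩
  refine ⟨by linarith, by linarith, fun n m h => ?_, fun n m h => ?_, fun n m h => ?_,
    fun n m h => ?_⟩
  · rw [pow_one] at h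
    rcases n.eq_zero_or_pos with rfl | hn
    · refine Int.cast_between_false (n := m) 0 ?_ ?_ <;> push_cast <;> linarith [h.1, h.2]
    · exact hC n hn m ⟨h.1.le, h.2.le⟩
  · rw [pow_one] at h
    rcases n.eq_zero_or_pos with rfl | hn
    · refine Int.cast_between_false (n := m) (-1) ?_ ?_ <;> push_cast <;> linarith [h.1, h.2]
    · obtain ⟨i, hi⟩ := hb n hn m
      rw [hi] at h
      exact hC n hn i ⟨h.1.le, h.2.le⟩
  · rcases n.eq_zero_or_pos with rfl | hn
    · refine Int.cast_between_false (n := m) 0 ?_ ?_ <;> push_cast <;> linarith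
    · exact hC n hn m ⟨by linarith, by linarith⟩
  · rcases n.eq_zero_or_pos with rfl | hn
    · refine Int.cast_between_false (n := m) (-1) ?_ ?_ <;> push_cast <;> linarith
    · obtain ⟨i, hi⟩ := hb n hn m
      rw [hi] at h
      exact hC n hn i ⟨by linarith, by linarith⟩

theorem pow_mod_period {k : ℕ} {x : ℝ} {j : ℤ} (h : 3 ^ k * x = x + j) (q i : ℕ) :
    ∃ m : ℤ, 3 ^ (k * q + i) * x = 3 ^ i * x + m := by
  induction q with
  | zero => exact ⟨0, by simp⟩
  | succ q ih =>
    obtain ⟨m, hm⟩ := ih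
    refine ⟨m + 3 ^ (k * q + i) * j, ?_⟩
    rw [show k * (q + 1) + i = (k * q + i) + k by ring, pow_add, mul_assoc, h, mul_add, hm]
    push_cast; ring

theorem PerMajor.orbMajor {a b : ℝ} {k : ℕ} (P : PerMajor a b k) (hab : a < b)
    (hab2 : b - a ≤ 1 / 2) : OrbMajor a b := by
  have h1 := P.third_lt hab
  obtain ⟨j, hj⟩ := P.2.1
  obtain ⟨j', hj'⟩ := P.pow_right
  have ha : ∀ (n : ℕ) (m : ℤ), ∃ i : ℕ, i < k ∧ ∃ l : ℤ, 3 ^ n * a + m = 3 ^ i * a + l := by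
    intro n m
    obtain ⟨l, hl⟩ := pow_mod_period hj (n / k) (n % k)
    rw [Nat.div_add_mod] at hl
    exact ⟨n % k, Nat.mod_lt _ P.1, l + m, by rw [hl]; push_cast; ring⟩
  have hb : ∀ (n : ℕ) (m : ℤ), ∃ i : ℕ, i < k ∧ ∃ l : ℤ, 3 ^ n * b + m = 3 ^ i * b + l := by
    intro n m
    obtain ⟨l, hl⟩ := pow_mod_period hj' (n / k) (n % k)
    rw [Nat.div_add_mod] at hl
    exact ⟨n % k, Nat.mod_lt _ P.1, l + m, by rw [hl]; push_cast; ring⟩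
  refine ⟨h1.le, hab2, fun n m h => ?_, fun n m h => ?_, fun n m h => ?_, fun n m h => ?_⟩
  · rw [pow_one] at h
    obtain ⟨i, hi, l, hl⟩ := ha n m
    rw [hl] at h
    rcases i.eq_zero_or_pos with rfl | hn
    · refine Int.cast_between_false (n := l) 0 ?_ ?_ <;> push_cast <;> linarith [h.1, h.2]
    · exact P.off_left hn hi le_rfl (by linarith) l ⟨h.1.le, h.2.le⟩
  · rw [pow_one] at h
    obtain ⟨i, hi, l, hl⟩ := hb n m
    rw [hl] at h
    rcases i.eq_zero_or_pos with rfl | hn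
    · refine Int.cast_between_false (n := l) (-1) ?_ ?_ <;> push_cast <;> linarith [h.1, h.2]
    · exact P.off_right hn hi (by linarith) le_rfl l ⟨h.1.le, h.2.le⟩
  · obtain ⟨i, hi, l, hl⟩ := ha n m
    rw [hl] at h
    rcases i.eq_zero_or_pos with rfl | hn
    · refine Int.cast_between_false (n := l) 0 ?_ ?_ <;> push_cast <;> linarith
    · exact P.off_left hn hi le_rfl (by linarith) l ⟨by linarith, by linarith⟩
  · obtain ⟨i, hi, l, hl⟩ := hb n m
    rw [hl] at h
    rcases i.eq_zero_or_pos with rfl | hn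
    · refine Int.cast_between_false (n := l) (-1) ?_ ?_ <;> push_cast <;> linarith
    · exact P.off_right hn hi (by linarith) le_rfl l ⟨by linarith, by linarith⟩

/-- The basis of the gap with major `(a, b)`. -/
abbrev gapSet (a b : ℝ) : Set ℝ := offOrbit 1 (Set.Ioo a b)

theorem gapSet_add_int {a b : ℝ} : ∀ t ∈ gapSet a b, ∀ m : ℤ, t + m ∈ gapSet a b :=
  fun _ ht m => offOrbit_add_int ht m

theorem mem_gapSet_iff {a b t : ℝ} :
    t ∈ gapSet a b ↔ (∀ m : ℤ, ¬ (a < t + m ∧ t + m < b)) ∧ 3 * t ∈ gapSet a b := by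
  rw [gapSet, mem_offOrbit_iff, pow_one]; rfl

namespace OrbMajor

variable {a b c d : ℝ}

theorem three_mem {t : ℝ} (h : t ∈ gapSet a b) : 3 * t ∈ gapSet a b := (mem_gapSet_iff.1 h).2

theorem isClosed_gapSet : IsClosed (gapSet a b) := isClosed_offOrbit isOpen_Ioo

theorem ne_shift (O : OrbMajor a b) (m : ℤ) : b ≠ a + m := by
  have := O.left_ne 0 m
  simpa using this.symm

theorem mem_of_three {t : ℝ} (h1 : b ≤ t) (h2 : t ≤ a + 1)
    (h : 3 * t ∈ gapSet a b) : t ∈ gapSet a b := by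
  refine mem_gapSet_iff.2 ⟨fun m hm => ?_, h⟩
  exact Int.cast_between_false (n := m) (-1) (by push_cast; linarith [hm.1])
    (by push_cast; linarith [hm.2])

/-- Every real number is, up to an integer, in `(a, b)` or in `[b, a + 1]`. -/
theorem position (a b t : ℝ) : ∃ m : ℤ, (a < t + m ∧ t + m < b) ∨ (b ≤ t + m ∧ t + m ≤ a + 1) := by
  have h1 := Int.floor_le (a + 1 - t)
  have h2 := Int.lt_floor_add_one (a + 1 - t)
  refine ⟨⌊a + 1 - t⌋, ?_⟩
  rcases lt_or_ge (t + ⌊a + 1 - t⌋) b with h | h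
  · exact Or.inl ⟨by linarith, h⟩
  · exact Or.inr ⟨h, by linarith⟩

theorem position_mem {t : ℝ} (h : t ∈ gapSet a b) : ∃ m : ℤ, b ≤ t + m ∧ t + m ≤ a + 1 := by
  obtain ⟨m, hm | hm⟩ := position a b t
  · exact ((mem_gapSet_iff.1 h).1 m hm).elim
  · exact ⟨m, hm⟩

theorem major_hole (O : OrbMajor a b) : RHole (gapSet a b) a b :=
  ⟨O.left_mem, O.right_mem, by linarith [O.third_le], by linarith [O.le_half],
    fun t h1 h2 ht => (mem_gapSet_iff.1 ht).1 0 ⟨by simpa using h1, by simpa using h2⟩⟩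

/-- A hole is a translate of the major hole, or lies on the other side of the major. -/
theorem hole_position (O : OrbMajor a b) (h : RHole (gapSet a b) c d) :
    ∃ m : ℤ, (c + m = a ∧ d + m = b) ∨ (b ≤ c + m ∧ d + m ≤ a + 1) := by
  obtain ⟨m, h1, h2⟩ := position_mem h.1
  obtain ⟨e1, e2, e3, e4, e5⟩ := h.shift gapSet_add_int m
  have i1 := O.third_le
  have i2 := O.le_half
  rcases eq_or_lt_of_le h2 with h3 | h3
  · refine ⟨m - 1, Or.inl ⟨by push_cast; linarith, ?_⟩⟩
    rcases lt_trichotomy (d + m) (b + 1) with g | g | g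
    · refine ((mem_gapSet_iff.1 e2).1 (-1) ⟨?_, ?_⟩).elim <;> push_cast <;> linarith
    · push_cast; linarith
    · exact (e5 (b + 1) (by linarith) g (by simpa using gapSet_add_int _ O.right_mem 1)).elim
  · refine ⟨m, Or.inr ⟨h1, ?_⟩⟩
    by_contra g
    exact e5 (a + 1) h3 (not_le.1 g) (by simpa using gapSet_add_int _ O.left_mem 1)

/-- An arc of length at least `1 / 3` on the other side of the major is no hole. -/
theorem hole_lt (O : OrbMajor a b) (h : RHole (gapSet a b) c d) (h1 : b ≤ c) (h2 : d ≤ a + 1) :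
    d - c < 1 / 3 := by
  by_contra hlen
  rw [not_lt] at hlen
  -- The tripled hole has length at least one and so contains a translate of a or of b. Its preimage
  -- in (c, d) would belong to the gap.
  have key : ∀ x ∈ gapSet a b, 3 * c < x → x < 3 * c + 1 → False := by
    intro x hx g1 g2
    refine h.2.2.2.2 (x / 3) (by linarith) (by linarith) (OrbMajor.mem_of_three (by linarith) (by linarith) ?_)
    rwa [mul_div_cancel₀ x (by norm_num : (3 : ℝ) ≠ 0)]
  have f1 := Int.floor_le (3 * c + 1 - a)
  have f2 := Int.lt_floor_add_one (3 * c + 1 - a)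
  set m := ⌊3 * c + 1 - a⌋
  have i1 := O.third_le
  have i2 := O.le_half
  rcases eq_or_lt_of_le (show a + m ≤ 3 * c + 1 by linarith) with g | g
  · have := gapSet_add_int _ O.right_mem (m - 1)
    push_cast at this
    exact key _ this (by linarith) (by linarith)
  · exact key _ (gapSet_add_int _ O.left_mem m) (by linarith) g

/-- A hole shorter than 1/3 is mapped injectively, and by `mem_of_three` a point of the gap inside
the image would pull back into the hole. -/
theorem hole_three (O : OrbMajor a b) (h : RHole (gapSet a b) c d) (h1 : b ≤ c) (h2 : d ≤ a + 1) :
    RHole (gapSet a b) (3 * c) (3 * d) := by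
  have := O.hole_lt h h1 h2
  obtain ⟨e1, e2, e3, e4, e5⟩ := h
  refine ⟨three_mem e1, three_mem e2, by linarith, by linarith, fun t g1 g2 ht => ?_⟩
  refine e5 (t / 3) (by linarith) (by linarith) (OrbMajor.mem_of_three (by linarith) (by linarith) ?_)
  rwa [mul_div_cancel₀ t (by norm_num : (3 : ℝ) ≠ 0)]

/-- Holes become translates of the major hole under tripling. -/
theorem hole_induction (O : OrbMajor a b) {Q : ℝ → ℝ → Prop} (h0 : Q a b)
    (hs : ∀ c d (m : ℤ), Q (c + m) (d + m) → Q c d)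
    (ht : ∀ c d, RHole (gapSet a b) c d → b ≤ c → d ≤ a + 1 → Q (3 * c) (3 * d) → Q c d)
    (h : RHole (gapSet a b) c d) : Q c d := by
  have key : ∀ (N : ℕ) {c d}, RHole (gapSet a b) c d → 1 ≤ 3 ^ N * (d - c) → Q c d := by
    intro N
    induction N with
    | zero => intro c d h hN; linarith [h.2.2.2.1]
    | succ N ih =>
      intro c d h hN
      obtain ⟨m, hm | hm⟩ := O.hole_position h
      · exact hs c d m (by rw [hm.1, hm.2]; exact h0)
      · refine hs c d m (ht _ _ (h.shift gapSet_add_int m) hm.1 hm.2 (ih ?_ ?_))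
        · exact O.hole_three (h.shift gapSet_add_int m) hm.1 hm.2
        · rw [pow_succ] at hN; linarith
  have hd : 0 < d - c := by linarith [h.2.2.1]
  obtain ⟨N, hN⟩ := pow_unbounded_of_one_lt (1 / (d - c)) (by norm_num : (1 : ℝ) < 3)
  rw [div_lt_iff₀ hd] at hN
  exact key N h hN.le

theorem hole_orbit (O : OrbMajor a b) (h : RHole (gapSet a b) c d) :
    ∃ (n : ℕ) (m : ℤ), 3 ^ n * c + m = a ∧ 3 ^ n * d + m = b := by
  refine O.hole_induction (Q := fun c d => ∃ (n : ℕ) (m : ℤ), 3 ^ n * c + m = a ∧ 3 ^ n * d + m = b)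
    ⟨0, 0, by simp, by simp⟩ ?_ ?_ h
  · rintro c d m ⟨n, i, h1, h2⟩
    exact ⟨n, 3 ^ n * m + i, by push_cast; linarith, by push_cast; linarith⟩
  · rintro c d - - - ⟨n, i, h1, h2⟩
    exact ⟨n + 1, i, by rw [pow_succ]; linarith, by rw [pow_succ]; linarith⟩

/-- Holes reach the major with their endpoints in order. A hole attached to the major would
therefore send b to a or a to b, contrary to `left_ne` and `right_ne`. -/
theorem hole_strict (O : OrbMajor a b) (h : RHole (gapSet a b) c d) (h1 : b ≤ c) (h2 : d ≤ a + 1) :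
    b < c ∧ d < a + 1 := by
  obtain ⟨n, m, e1, e2⟩ := O.hole_orbit h
  constructor
  · exact lt_of_le_of_ne h1 fun he => O.right_ne n m (by rw [he]; exact e1)
  · refine lt_of_le_of_ne h2 fun he => O.left_ne n (3 ^ n + m) ?_
    rw [he] at e2
    push_cast; linarith

theorem exists_hole (O : OrbMajor a b) {t : ℝ} (ht : t ∉ gapSet a b) :
    ∃ c d, RHole (gapSet a b) c d ∧ c < t ∧ t < d :=
  exists_rhole isClosed_gapSet gapSet_add_int O.left_mem O.right_mem O.ne_shift ht

end OrbMajor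

/-- Of the three preimages that s may be related to, only t lies in the arc, which is no longer than
1/3 and is not left by its leaves. -/
theorem EdgeArc.pull {R : ℝ → ℝ → Prop} (h : Lam R) {p q s t : ℝ} (H : EdgeArc R p q)
    (hpq : q - p ≤ 1 / 3) (hs1 : p < s) (hs2 : s < q) (ht1 : p < t) (ht2 : t < q)
    (hR : R (3 * s) (3 * t)) : R s t := by
  rcases h.back3 (x := s) (y := t) 0 (by simpa using hR) with g | g | g
  · exact g
  · exact (H.not_rel h hs1 hs2 (by linarith) (by linarith) g).elim
  · exact (H.not_rel h hs1 hs2 (by linarith) (by linarith) g).elim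

namespace Major

variable {R : ℝ → ℝ → Prop} {a b c d : ℝ}

/-- The holes of the gap are cut off by leaves. -/
theorem hole_edge (H : Major R a b) (O : OrbMajor a b) (h : RHole (gapSet a b) c d) :
    EdgeArc R c d := by
  refine O.hole_induction (Q := EdgeArc R) H.edge ?_ ?_ h
  · intro c d m hm
    have := hm.shift H.lam (-m)
    push_cast at this
    simpa using this
  · intro c d h h1 h2 hE
    obtain ⟨h3, h4⟩ := O.hole_strict h h1 h2
    have hlt := O.hole_lt h h1 h2
    obtain ⟨e1, e2, e3, e4, e5⟩ := h
    have i1 := H.third_le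
    have i2 := H.le_half
    have hlen : 3 * (d - c) ≤ b - a := by
      obtain ⟨m, hm | hm⟩ := O.hole_position (O.hole_three ⟨e1, e2, e3, e4, e5⟩ h1 h2)
      · linarith
      · have := O.hole_lt ((O.hole_three ⟨e1, e2, e3, e4, e5⟩ h1 h2).shift gapSet_add_int m) hm.1 hm.2
        linarith
    have hcd := H.pull h3 e3 h4 hlen hE.2.2.1
    refine ⟨e3, e4, hcd, fun w hw => ?_⟩
    -- Related points at distance 1/3 or more would have images at distance one or more, which do
    -- not fit into either of the arcs offered by `trip`.
    have hno : ∀ x y, b < x → x < a + 1 → b < y → y < a + 1 → R x y → 1 / 3 ≤ y - x → False := by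
      intro x y g1 g2 g3 g4 g5 g6
      obtain ⟨n, hn | hn⟩ := H.trip g1.le (by linarith) g4.le g5 (by rintro ⟨rfl, -⟩; linarith) <;>
        linarith
    have hno2 : ∀ x, b < x → x < a + 1 → R c x → ∀ j : ℤ, (∃ z, (z = c ∨ z = d) ∧ x = z + j / 3) →
        ∃ n : ℤ, x = c + n ∨ x = d + n := by
      rintro x g1 g2 g3 j ⟨z, hz, hx⟩
      have hRz : R z x := by
        rcases hz with rfl | rfl
        · exact g3
        · exact H.lam.trans (H.lam.symm hcd) g3
      have hz1 : b < z ∧ z < a + 1 := by rcases hz with rfl | rfl <;> constructor <;> linarith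
      have hj : j = 0 := by
        by_contra hj
        rcases lt_or_gt_of_ne hj with g | g
        · have : (j : ℝ) ≤ -1 := by exact_mod_cast Int.le_sub_one_of_lt g
          exact hno x z g1 g2 hz1.1 hz1.2 (H.lam.symm hRz) (by linarith)
        · have : (1 : ℝ) ≤ j := by exact_mod_cast g
          exact hno z x hz1.1 hz1.2 g1 g2 hRz (by linarith)
      subst hj
      refine ⟨0, ?_⟩
      rcases hz with rfl | rfl
      · left; simpa using hx
      · right; simpa using hx
    obtain ⟨m, hm | hm⟩ := OrbMajor.position a b w
    · exact (H.edge.not_rel H.lam hm.1 hm.2 h3.le (by linarith)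
        (H.lam.symm (H.lam.shift_right hw m))).elim
    have hRm := H.lam.shift_right hw m
    have g1 : b < w + m := lt_of_le_of_ne hm.1 fun he => by
      rw [← he] at hRm
      obtain ⟨n, hn | hn⟩ := H.exact (H.lam.trans H.rel (H.lam.symm hRm))
      · exact Int.cast_between_false (n := n) 0 (by push_cast; linarith) (by push_cast; linarith)
      · exact Int.cast_between_false (n := n) 0 (by push_cast; linarith) (by push_cast; linarith)
    have g2 : w + m < a + 1 := lt_of_le_of_ne hm.2 fun he => by
      rw [he] at hRm
      obtain ⟨n, hn | hn⟩ := H.exact (H.lam.symm (by simpa using H.lam.sub_one hRm))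
      · exact Int.cast_between_false (n := n) 0 (by push_cast; linarith) (by push_cast; linarith)
      · exact Int.cast_between_false (n := n) 0 (by push_cast; linarith) (by push_cast; linarith)
    obtain ⟨j, hj⟩ := hE.rel_mod H.lam hRm
    obtain ⟨n, hn⟩ := hno2 _ g1 g2 hRm j (by
      rcases hj with hj | hj
      · exact ⟨c, Or.inl rfl, hj⟩
      · exact ⟨d, Or.inr rfl, hj⟩)
    refine ⟨n - m, ?_⟩
    push_cast
    rcases hn with hn | hn
    · left; linarith
    · right; linarith

/-- A leaf with both endpoints in the gap is an edge of it. -/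
theorem leaf_edge (H : Major R a b) (O : OrbMajor a b) {x y : ℝ} (hx : x ∈ gapSet a b)
    (hy : y ∈ gapSet a b) (h1 : b ≤ x) (h2 : x < y) (h3 : y ≤ a + 1) (hR : R x y) :
    RHole (gapSet a b) x y ∨ (x = b ∧ y = a + 1) := by
  have i1 := H.third_le
  have i2 := H.le_half
  have key : ∀ (N : ℕ) {x y}, x ∈ gapSet a b → y ∈ gapSet a b → b ≤ x → x < y → y ≤ a + 1 → R x y →
      1 ≤ 3 ^ N * (y - x) → RHole (gapSet a b) x y ∨ (x = b ∧ y = a + 1) := by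
    intro N
    induction N with
    | zero => intro x y hx hy h1 h2 h3 hR hN; linarith
    | succ N ih =>
      intro x y hx hy h1 h2 h3 hR hN
      by_cases hM : x = b ∧ y = a + 1
      · exact Or.inr hM
      left
      obtain ⟨n, hn⟩ := H.trip h1 h2 h3 hR hM
      have hxn : 3 * x + n ∈ gapSet a b := gapSet_add_int _ (OrbMajor.three_mem hx) n
      have hyn : 3 * y + n ∈ gapSet a b := gapSet_add_int _ (OrbMajor.three_mem hy) n
      suffices hh : RHole (gapSet a b) (3 * x + n) (3 * y + n) by
        refine ⟨hx, hy, h2, by linarith [hh.2.2.2.1], fun t g1 g2 ht => ?_⟩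
        exact hh.2.2.2.2 (3 * t + n) (by linarith) (by linarith)
          (gapSet_add_int _ (OrbMajor.three_mem ht) n)
      rcases hn with hn | hn
      · rcases ih hxn hyn hn.1 (by linarith) hn.2 (H.lam.shift (H.lam.fwd hR) n n) (by
          rw [pow_succ] at hN; linarith) with g | ⟨g1, g2⟩
        · exact g
        exfalso
        -- If the image of the leaf x y is the major seen from outside, then a preimage of the major
        -- hole is attached to x or to y. Its class consists of two points and has no room for the
        -- other end of the leaf.
        have hpre : ∀ {c d : ℝ}, b ≤ c → d ≤ a + 1 →
            ∀ m : ℤ, 3 * c + m = a → 3 * d + m = b → EdgeArc R c d := by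
          intro c d k1 k2 m k3 k4
          have hc : c ∈ gapSet a b := OrbMajor.mem_of_three k1 (by linarith) (by
            have := gapSet_add_int _ O.left_mem (-m)
            rwa [show a + ((-m : ℤ) : ℝ) = 3 * c by push_cast; linarith] at this)
          have hd : d ∈ gapSet a b := OrbMajor.mem_of_three (by linarith) k2 (by
            have := gapSet_add_int _ O.right_mem (-m)
            rwa [show b + ((-m : ℤ) : ℝ) = 3 * d by push_cast; linarith] at this)
          refine H.hole_edge O ⟨hc, hd, by linarith, by linarith, fun t l1 l2 ht => ?_⟩
          exact O.major_hole.2.2.2.2 (3 * t + m) (by linarith) (by linarith)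
            (gapSet_add_int _ (OrbMajor.three_mem ht) m)
        rcases le_or_gt b (x - (b - a) / 3) with l | l
        · have hE := hpre (c := x - (b - a) / 3) (d := x) l (by linarith) n (by linarith)
            (by linarith)
          exact (hE.other H.lam).not_rel_inside (t := y) h2 (by linarith) hR
        · have hE := hpre (c := y) (d := y + (b - a) / 3) (by linarith) (by linarith) (n - 1)
            (by push_cast; linarith) (by push_cast; linarith)
          have h4 := hE.shift H.lam (-1)
          push_cast at h4
          have := (h4.other H.lam).not_rel_inside (t := x) (by linarith) (by linarith)
          apply this
          refine H.lam.trans (H.lam.symm h4.2.2.1) ?_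
          exact H.lam.symm (by simpa [sub_eq_add_neg] using H.lam.sub_one hR)
      · have ex : 3 * x + n = a := by
          rcases eq_or_lt_of_le hn.1 with g | g
          · exact g.symm
          · exact (O.major_hole.2.2.2.2 _ g (by linarith) hxn).elim
        have ey : 3 * y + n = b := by
          rcases eq_or_lt_of_le hn.2 with g | g
          · exact g
          · exact (O.major_hole.2.2.2.2 _ (by linarith) g hyn).elim
        rw [ex, ey]
        exact O.major_hole
  have hd : 0 < y - x := by linarith
  obtain ⟨N, hN⟩ := pow_unbounded_of_one_lt (1 / (y - x)) (by norm_num : (1 : ℝ) < 3)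
  rw [div_lt_iff₀ hd] at hN
  exact key N hx hy h1 h2 h3 hR hN.le

end Major


/-! ### Generation of the relation in the critical case -/

/-- The pairs `s`, `t + n` that lie in one hole of `B`. -/
def SameHole (B : Set ℝ) (s t : ℝ) (n : ℤ) : Prop :=
  ∃ p q, RHole B p q ∧ p < s ∧ s < q ∧ p < t + n ∧ t + n < q

/-- The endpoints of a hole of `B`, in one of the two orders and modulo one. -/
def REdge (B : Set ℝ) (s t : ℝ) : Prop := ∃ n : ℤ, RHole B s (t + n) ∨ RHole B t (s + n)

theorem REdge.symm {B : Set ℝ} {s t : ℝ} (h : REdge B s t) : REdge B t s := by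
  obtain ⟨n, hn⟩ := h; exact ⟨n, hn.symm⟩

theorem REdge.of_shift {B : Set ℝ} (hB : ∀ t ∈ B, ∀ m : ℤ, t + m ∈ B) {s t : ℝ} (m n : ℤ)
    (h : REdge B (s + m) (t + n)) : REdge B s t := by
  obtain ⟨i, hi | hi⟩ := h
  · have := hi.shift hB (-m)
    refine ⟨n + i - m, Or.inl ?_⟩
    convert this using 1 <;> push_cast <;> ring
  · have := hi.shift hB (-n)
    refine ⟨m + i - n, Or.inr ?_⟩
    convert this using 1 <;> push_cast <;> ring

/-- If related points are joined by an edge or are close, and closeness is preserved by tripling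
without change of the lift, then orbits of related points reach an edge. -/
theorem exists_edge_of_growth {E : ℝ → ℝ → Prop} {S : ℝ → ℝ → ℤ → Prop} {R : ℝ → ℝ → Prop}
    (h : Lam R) (h1 : ∀ s t, R s t → (∀ n : ℤ, t ≠ s + n) → E s t ∨ ∃ n, S s t n)
    (h2 : ∀ s t n m, S s t n → S (3 * s) (3 * t) m → m = 3 * n)
    (h3 : ∀ s t n, S s t n → |s - (t + n)| < 1 / 3) {s t : ℝ} (hR : R s t)
    (hst : ∀ n : ℤ, t ≠ s + n) :
    ∃ N : ℕ, E (3 ^ N * s) (3 ^ N * t) ∧ ∀ i < N, ∃ n, S (3 ^ i * s) (3 ^ i * t) n := by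
  have key : ∀ (M : ℕ) {s t : ℝ} {n : ℤ}, R s t → (∀ n : ℤ, t ≠ s + n) → S s t n →
      1 ≤ 3 ^ M * |s - (t + n)| →
      ∃ N : ℕ, E (3 ^ N * s) (3 ^ N * t) ∧ ∀ i < N, ∃ n, S (3 ^ i * s) (3 ^ i * t) n := by
    intro M
    induction M with
    | zero => intro s t n _ _ hS hM; linarith [h3 _ _ _ hS]
    | succ M ih =>
      intro s t n hR hst hS hM
      have hlt := abs_lt.1 (h3 _ _ _ hS)
      have hst3 : ∀ m : ℤ, 3 * t ≠ 3 * s + m := by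
        intro m hm
        have hm0 : m = -3 * n := by
          have g1 : ((m + 3 * n : ℤ) : ℝ) < 1 := by push_cast; linarith
          have g2 : (-1 : ℝ) < ((m + 3 * n : ℤ) : ℝ) := by push_cast; linarith
          have g1' : m + 3 * n < 1 := by exact_mod_cast g1
          have g2' : -1 < m + 3 * n := by exact_mod_cast g2
          omega
        rw [hm0] at hm
        push_cast at hm
        exact hst (-n) (by push_cast; linarith)
      obtain ⟨N, hN, hi⟩ : ∃ N : ℕ, E (3 ^ N * (3 * s)) (3 ^ N * (3 * t)) ∧
          ∀ i < N, ∃ n, S (3 ^ i * (3 * s)) (3 ^ i * (3 * t)) n := by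
        rcases h1 _ _ (h.fwd hR) hst3 with g | ⟨m, g⟩
        · exact ⟨0, by simpa using g, fun i hi => by omega⟩
        · refine ih (h.fwd hR) hst3 g ?_
          rw [h2 _ _ _ _ hS g]
          have : |3 * s - (3 * t + ((3 * n : ℤ) : ℝ))| = 3 * |s - (t + n)| := by
            rw [show 3 * s - (3 * t + ((3 * n : ℤ) : ℝ)) = 3 * (s - (t + n)) by push_cast; ring,
              abs_mul]
            norm_num
          rw [this]
          rw [pow_succ] at hM
          linarith
      refine ⟨N + 1, by simpa only [pow_succ, mul_assoc] using hN, fun i hiN => ?_⟩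
      rcases i with _ | i
      · exact ⟨n, by simpa using hS⟩
      · simpa only [pow_succ, mul_assoc] using hi i (by omega)
  rcases h1 _ _ hR hst with g | ⟨n, g⟩
  · exact ⟨0, by simpa using g, fun i hi => by omega⟩
  · have hpos : 0 < |s - (t + n)| := abs_pos.2 fun he => hst (-n) (by push_cast; linarith)
    obtain ⟨M, hM⟩ := pow_unbounded_of_one_lt (1 / |s - (t + n)|) (by norm_num : (1 : ℝ) < 3)
    rw [div_lt_iff₀ hpos] at hM
    exact key M hR hst g hM.le

theorem pullback_induction {E : ℝ → ℝ → Prop} {S : ℝ → ℝ → ℤ → Prop} {R : ℝ → ℝ → Prop}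
    (h1 : ∀ s t, E s t → R s t) (h2 : ∀ s t n, S s t n → R (3 * s) (3 * t) → R s t) (N : ℕ) {s t : ℝ}
    (hE : E (3 ^ N * s) (3 ^ N * t)) (hS : ∀ i < N, ∃ n, S (3 ^ i * s) (3 ^ i * t) n) : R s t := by
  induction N generalizing s t with
  | zero => exact h1 _ _ (by simpa using hE)
  | succ N ih =>
    obtain ⟨n, hn⟩ := hS 0 (by omega)
    refine h2 s t n (by simpa using hn) (ih (by simpa only [pow_succ, mul_assoc] using hE) ?_)
    intro i hi
    simpa only [pow_succ, mul_assoc] using hS (i + 1) (by omega)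

namespace Major

variable {R : ℝ → ℝ → Prop} {a b c d : ℝ} {k : ℕ}

/-- A leaf is an edge of the gap or lies in a hole of it. -/
theorem edge_or_sameHole (H : Major R a b) (O : OrbMajor a b) {s t : ℝ} (hR : R s t)
    (hst : ∀ n : ℤ, t ≠ s + n) : REdge (gapSet a b) s t ∨ ∃ n, SameHole (gapSet a b) s t n := by
  have i1 := H.third_le
  have i2 := H.le_half
  have hoff : ∀ {s t}, R s t → s ∉ gapSet a b → ∃ n, SameHole (gapSet a b) s t n := by
    intro s t hR hs
    obtain ⟨c, d, hcd, h1, h2⟩ := O.exists_hole hs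
    obtain ⟨m, hm | hm⟩ := OrbMajor.position c d t
    · exact ⟨m, c, d, hcd, h1, h2, hm.1, hm.2⟩
    · exact ((H.hole_edge O hcd).not_rel H.lam h1 h2 hm.1 hm.2 (H.lam.shift_right hR m)).elim
  by_cases hs : s ∈ gapSet a b
  · by_cases ht : t ∈ gapSet a b
    · left
      obtain ⟨m, hm1, hm2⟩ := OrbMajor.position_mem hs
      obtain ⟨n, hn1, hn2⟩ := OrbMajor.position_mem ht
      have hs' := gapSet_add_int _ hs m
      have ht' := gapSet_add_int _ ht n
      have hRmn := H.lam.shift hR m n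
      have key : ∀ {x y}, x ∈ gapSet a b → y ∈ gapSet a b → b ≤ x → x < y → y ≤ a + 1 → R x y →
          REdge (gapSet a b) x y := by
        intro x y hx hy g1 g2 g3 g4
        rcases H.leaf_edge O hx hy g1 g2 g3 g4 with g | ⟨rfl, rfl⟩
        · exact ⟨0, Or.inl (by simpa using g)⟩
        · refine ⟨1, Or.inr ?_⟩
          simpa using O.major_hole.shift gapSet_add_int 1
      refine REdge.of_shift gapSet_add_int m n ?_
      rcases lt_trichotomy (s + m) (t + n) with g | g | g
      · exact key hs' ht' hm1 g hn2 hRmn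
      · exact (hst (m - n) (by push_cast; linarith)).elim
      · exact (key ht' hs' hn1 g hm2 (H.lam.symm hRmn)).symm
    · right
      obtain ⟨n, p, q, h1, h2, h3, h4, h5⟩ := hoff (H.lam.symm hR) ht
      refine ⟨-n, p + (-n : ℤ), q + (-n : ℤ), h1.shift gapSet_add_int (-n), ?_⟩
      push_cast
      exact ⟨by linarith, by linarith, by linarith, by linarith⟩
  · exact Or.inr (hoff hR hs)

theorem rel_of_edge (H : Major R a b) (O : OrbMajor a b) {s t : ℝ} (h : REdge (gapSet a b) s t) :
    R s t := by
  obtain ⟨n, h | h⟩ := h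
  · exact H.lam.of_shift n (H.hole_edge O h).2.2.1
  · exact H.lam.symm (H.lam.of_shift n (H.hole_edge O h).2.2.1)

end Major

namespace OrbMajor

variable {a b : ℝ}

/-- Two points in an arc of length `1 / 3` whose image starts in the gap stay in their order when
their images are in one hole. -/
theorem lift_eq {x s t : ℝ} {m : ℤ} (hx : 3 * x ∈ gapSet a b) (hs1 : x < s) (hs2 : s < x + 1 / 3)
    (ht1 : x < t) (ht2 : t < x + 1 / 3) (h : SameHole (gapSet a b) (3 * s) (3 * t) m) : m = 0 := by
  obtain ⟨p, q, ⟨-, -, -, -, h5⟩, h1, h2, h3, h4⟩ := h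
  have g1 : 3 * x ≤ p := by
    by_contra g
    exact h5 _ (not_le.1 g) (by linarith) hx
  have g2 : q ≤ 3 * x + 1 := by
    by_contra g
    exact h5 _ (by linarith) (not_le.1 g) (by simpa using gapSet_add_int _ hx 1)
  have k1 : (m : ℝ) < 1 := by linarith
  have k2 : (-1 : ℝ) < m := by linarith
  have k1' : m < 1 := by exact_mod_cast k1
  have k2' : -1 < m := by exact_mod_cast k2
  omega

theorem lift_eq' {x s t : ℝ} {n m : ℤ} (hx : 3 * x ∈ gapSet a b) (hs1 : x < s)
    (hs2 : s < x + 1 / 3) (ht1 : x < t + n) (ht2 : t + n < x + 1 / 3)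
    (h : SameHole (gapSet a b) (3 * s) (3 * t) m) : m = 3 * n := by
  have := lift_eq (m := m - 3 * n) hx hs1 hs2 ht1 ht2 (by
    convert h using 0
    simp only [SameHole]
    push_cast
    ring_nf)
  omega

end OrbMajor

namespace Major

variable {R : ℝ → ℝ → Prop} {a b c d : ℝ} {k : ℕ}

/-- A lamination with a critical major is generated by its gap. -/
theorem rel_iff_of_crit (H : Major R a b) (C : CritMajor a b) (s t : ℝ) :
    R s t ↔ (∃ n : ℤ, t = s + n) ∨ ∃ N : ℕ, REdge (gapSet a b) (3 ^ N * s) (3 ^ N * t) ∧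
      ∀ i < N, ∃ n, SameHole (gapSet a b) (3 ^ i * s) (3 ^ i * t) n := by
  have O := C.orbMajor
  have hb := C.1
  -- In the critical case no hole is longer than 1/3, so tripling is injective on each hole and
  -- pullbacks inside holes are unique.
  have hlen : ∀ {p q}, RHole (gapSet a b) p q → q - p ≤ 1 / 3 := by
    intro p q h
    obtain ⟨m, hm | hm⟩ := O.hole_position h
    · linarith
    · have := O.hole_lt (h.shift gapSet_add_int m) hm.1 hm.2
      linarith
  constructor
  · intro hR
    by_cases hst : ∃ n : ℤ, t = s + n
    · exact Or.inl hst
    right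
    push Not at hst
    refine exists_edge_of_growth H.lam (fun s t => H.edge_or_sameHole O) ?_ ?_ hR hst
    · rintro s t n m ⟨p, q, hpq, h1, h2, h3, h4⟩ hm
      have := hlen hpq
      exact OrbMajor.lift_eq' (OrbMajor.three_mem hpq.1) h1 (by linarith) h3 (by linarith) hm
    · rintro s t n ⟨p, q, hpq, h1, h2, h3, h4⟩
      have := hlen hpq
      rw [abs_lt]
      constructor <;> linarith
  · rintro (⟨n, rfl⟩ | ⟨N, hE, hS⟩)
    · exact H.lam.per s n
    · refine pullback_induction (R := R) (E := REdge (gapSet a b)) (S := SameHole (gapSet a b))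
        (fun s t => H.rel_of_edge O) ?_ N hE hS
      rintro s t n ⟨p, q, hpq, h1, h2, h3, h4⟩ hR
      refine H.lam.of_shift n ((H.hole_edge O hpq).pull H.lam (hlen hpq) h1 h2 h3 h4 ?_)
      have := H.lam.shift_right hR (3 * n)
      convert this using 1
      push_cast; ring

end Major

/-! ### The vassal gap and its holes -/

/-- The basis of the vassal gap of the major `(a, b)` of period `k`. -/
abbrev vasSet (a b : ℝ) (k : ℕ) : Set ℝ :=
  offOrbit k (Set.Ioo (b - 1 / 3) (a + 1 / 3) ∪ Set.Ioo b (a + 1))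

theorem vasSet_add_int {a b : ℝ} {k : ℕ} : ∀ t ∈ vasSet a b k, ∀ m : ℤ, t + m ∈ vasSet a b k :=
  fun _ ht m => offOrbit_add_int ht m

theorem isClosed_vasSet {a b : ℝ} {k : ℕ} : IsClosed (vasSet a b k) :=
  isClosed_offOrbit (isOpen_Ioo.union isOpen_Ioo)

namespace PerMajor

variable {a b c d t : ℝ} {k : ℕ}

/-- The points that are in one of the two branches modulo one. -/
theorem branch_iff (hab : 1 / 3 ≤ b - a) :
    (∀ m : ℤ, t + m ∉ Set.Ioo (b - 1 / 3) (a + 1 / 3) ∪ Set.Ioo b (a + 1)) ↔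
      ∃ m : ℤ, (a ≤ t + m ∧ t + m ≤ b - 1 / 3) ∨ (a + 1 / 3 ≤ t + m ∧ t + m ≤ b) := by
  constructor
  · intro h
    have h1 := Int.floor_le (t - a)
    have h2 := Int.lt_floor_add_one (t - a)
    refine ⟨-⌊t - a⌋, ?_⟩
    have h3 := h (-⌊t - a⌋)
    push_cast at h3 ⊢
    simp only [Set.mem_union, Set.mem_Ioo, not_or, not_and, not_lt] at h3
    rcases le_or_gt (t + -(⌊t - a⌋ : ℝ)) (b - 1 / 3) with g | g
    · exact Or.inl ⟨by linarith, g⟩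
    · right
      refine ⟨h3.1 g, ?_⟩
      by_contra g2
      linarith [h3.2 (not_le.1 g2)]
  · rintro ⟨m, hm⟩ n hn
    simp only [Set.mem_union, Set.mem_Ioo] at hn
    have : m = n ∨ m + 1 = n := by
      have g1 : ((m - n : ℤ) : ℝ) < 1 := by
        push_cast; rcases hn with hn | hn <;> rcases hm with hm | hm <;> linarith
      have g2 : (-2 : ℝ) < ((m - n : ℤ) : ℝ) := by
        push_cast; rcases hn with hn | hn <;> rcases hm with hm | hm <;> linarith
      have g1' : m - n < 1 := by exact_mod_cast g1
      have g2' : -2 < m - n := by exact_mod_cast g2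
      omega
    rcases this with rfl | rfl
    · rcases hn with hn | hn <;> rcases hm with hm | hm <;> linarith
    · push_cast at hn
      rcases hn with hn | hn <;> rcases hm with hm | hm <;> linarith

theorem mem_vasSet_iff (hab : 1 / 3 ≤ b - a) :
    t ∈ vasSet a b k ↔
      (∃ m : ℤ, (a ≤ t + m ∧ t + m ≤ b - 1 / 3) ∨ (a + 1 / 3 ≤ t + m ∧ t + m ≤ b)) ∧
        3 ^ k * t ∈ vasSet a b k := by
  rw [vasSet, mem_offOrbit_iff, branch_iff hab]

theorem vas_cases (h : t ∈ vasSet a b k) :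
    t ≤ b - 1 / 3 ∨ a + 1 / 3 ≤ t := by
  by_contra hc
  rw [not_or, not_le, not_le] at hc
  exact (mem_offOrbit_iff.1 h).1 0 (Or.inl ⟨by simpa using hc.1, by simpa using hc.2⟩)

theorem not_mem_outer (h1 : b < t) (h2 : t < a + 1) : t ∉ vasSet a b k := fun h =>
  (mem_offOrbit_iff.1 h).1 0 (Or.inr ⟨by simpa using h1, by simpa using h2⟩)

theorem not_mem_middle (h1 : b - 1 / 3 < t) (h2 : t < a + 1 / 3) : t ∉ vasSet a b k := fun h =>
  (mem_offOrbit_iff.1 h).1 0 (Or.inl ⟨by simpa using h1, by simpa using h2⟩)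

theorem left_mem (P : PerMajor a b k) (hab : a < b) : a ∈ vasSet a b k := by
  have h1 := P.third_lt hab
  obtain ⟨j, hj⟩ := P.2.1
  intro n
  refine (branch_iff h1.le).2 ?_
  induction n with
  | zero => exact ⟨0, Or.inl ⟨by simp, by simp; linarith⟩⟩
  | succ n ih =>
    obtain ⟨m, hm⟩ := ih
    refine ⟨m - (3 ^ k) ^ n * j, ?_⟩
    rw [pow_succ, mul_assoc, hj]
    push_cast
    rwa [show (3 ^ k) ^ n * (a + j) + (m - (3 ^ k) ^ n * j) = (3 ^ k) ^ n * a + m by ring]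

theorem right_mem (P : PerMajor a b k) (hab : a < b) : b ∈ vasSet a b k := by
  have h1 := P.third_lt hab
  obtain ⟨j, hj⟩ := P.pow_right
  intro n
  refine (branch_iff h1.le).2 ?_
  induction n with
  | zero => exact ⟨0, Or.inr ⟨by simp; linarith, by simp⟩⟩
  | succ n ih =>
    obtain ⟨m, hm⟩ := ih
    refine ⟨m - (3 ^ k) ^ n * j, ?_⟩
    rw [pow_succ, mul_assoc, hj]
    push_cast
    rwa [show (3 ^ k) ^ n * (b + j) + (m - (3 ^ k) ^ n * j) = (3 ^ k) ^ n * b + m by ring]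

theorem mem_of_left (P : PerMajor a b k) (hab : a < b) (h1 : a ≤ t)
    (h2 : t ≤ b - 1 / 3) : t ∈ vasSet a b k ↔ a + 3 ^ k * (t - a) ∈ vasSet a b k := by
  obtain ⟨j, hj⟩ := P.branch_left t
  rw [hj, mem_vasSet_iff (P.third_lt hab).le]
  constructor
  · exact fun h => vasSet_add_int _ h.2 j
  · refine fun h => ⟨⟨0, Or.inl ⟨by simpa using h1, by simpa using h2⟩⟩, ?_⟩
    simpa using vasSet_add_int _ h (-j)

theorem mem_of_right (P : PerMajor a b k) (hab : a < b) (h1 : a + 1 / 3 ≤ t)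
    (h2 : t ≤ b) : t ∈ vasSet a b k ↔ b + 3 ^ k * (t - b) ∈ vasSet a b k := by
  obtain ⟨j, hj⟩ := P.branch_right t
  rw [hj, mem_vasSet_iff (P.third_lt hab).le]
  constructor
  · exact fun h => vasSet_add_int _ h.2 j
  · refine fun h => ⟨⟨0, Or.inr ⟨by simpa using h1, by simpa using h2⟩⟩, ?_⟩
    simpa using vasSet_add_int _ h (-j)

theorem midleft_mem (P : PerMajor a b k) (hab : a < b) :
    b - 1 / 3 ∈ vasSet a b k := by
  have h1 := P.third_lt hab
  rw [P.mem_of_left hab (by linarith) le_rfl]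
  have := P.2.2.1
  rw [show a + 3 ^ k * (b - 1 / 3 - a) = b by linarith]
  exact P.right_mem hab

theorem midright_mem (P : PerMajor a b k) (hab : a < b) :
    a + 1 / 3 ∈ vasSet a b k := by
  have h1 := P.third_lt hab
  rw [P.mem_of_right hab le_rfl (by linarith)]
  have := P.2.2.1
  rw [show b + 3 ^ k * (a + 1 / 3 - b) = a by linarith]
  exact P.left_mem hab

theorem branch_bounds_left (P : PerMajor a b k) (h1 : a ≤ t) (h2 : t ≤ b - 1 / 3) :
    a ≤ a + 3 ^ k * (t - a) ∧ a + 3 ^ k * (t - a) ≤ b := by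
  have hl0 : (0 : ℝ) < 3 ^ k := by positivity
  have e1 := mul_nonneg hl0.le (sub_nonneg.2 h1)
  have e2 := mul_le_mul_of_nonneg_left (show t - a ≤ b - a - 1 / 3 by linarith) hl0.le
  have := P.2.2.1
  constructor <;> linarith

theorem branch_bounds_right (P : PerMajor a b k) (h1 : a + 1 / 3 ≤ t) (h2 : t ≤ b) :
    a ≤ b + 3 ^ k * (t - b) ∧ b + 3 ^ k * (t - b) ≤ b := by
  have hl0 : (0 : ℝ) < 3 ^ k := by positivity
  have e1 := mul_nonneg hl0.le (sub_nonneg.2 h2)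
  have e2 := mul_le_mul_of_nonneg_left (show b - t ≤ b - a - 1 / 3 by linarith) hl0.le
  have := P.2.2.1
  constructor <;> linarith

/-- A hole of the vassal gap behind the major lies in a branch or is the middle one. -/
theorem hole_cases (P : PerMajor a b k) (hab : a < b)
    (h : RHole (vasSet a b k) c d) :
    d ≤ b - 1 / 3 ∨ (c = b - 1 / 3 ∧ d = a + 1 / 3) ∨ a + 1 / 3 ≤ c := by
  have h3 := P.third_lt hab
  obtain ⟨e1, e2, e3, e4, e5⟩ := h
  rcases le_or_gt d (b - 1 / 3) with g | g
  · exact Or.inl g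
  rcases le_or_gt (a + 1 / 3) c with g2 | g2
  · exact Or.inr (Or.inr g2)
  right; left
  have hc := (vas_cases e1).resolve_right (not_le.2 g2)
  have hd := (vas_cases e2).resolve_left (not_le.2 g)
  constructor
  · by_contra hne
    exact e5 _ (lt_of_le_of_ne hc hne) g (P.midleft_mem hab)
  · by_contra hne
    exact e5 _ g2 (lt_of_le_of_ne hd (Ne.symm hne)) (P.midright_mem hab)

/-- The left branch is an affine bijection of [a, b - 1/3] onto [a, b] under which membership in the
vassal set is preserved in both directions, so holes correspond to holes. -/
theorem hole_left (P : PerMajor a b k) (hab : a < b) (hab2 : b - a ≤ 1 / 2) (h1 : a ≤ c)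
    (h2 : d ≤ b - 1 / 3) :
    RHole (vasSet a b k) c d ↔ RHole (vasSet a b k) (a + 3 ^ k * (c - a)) (a + 3 ^ k * (d - a)) := by
  have hl : (3 : ℝ) ≤ 3 ^ k := P.three_le
  have hl0 : (0 : ℝ) < 3 ^ k := by linarith
  constructor
  · rintro ⟨e1, e2, e3, e4, e5⟩
    have b1 := P.branch_bounds_left h1 (by linarith)
    have b2 := P.branch_bounds_left (t := d) (by linarith) h2
    have hpos := mul_pos hl0 (sub_pos.2 e3)
    refine ⟨(P.mem_of_left hab h1 (by linarith)).1 e1,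
      (P.mem_of_left hab (by linarith) h2).1 e2, by linarith, by linarith, fun t g1 g2 ht => ?_⟩
    have eq : a + 3 ^ k * (a + (t - a) / 3 ^ k - a) = t := by field_simp; ring
    have g3 : c < a + (t - a) / 3 ^ k := by
      have : c - a < (t - a) / 3 ^ k := by rw [lt_div_iff₀ hl0]; linarith
      linarith
    have g4 : a + (t - a) / 3 ^ k < d := by
      have : (t - a) / 3 ^ k < d - a := by rw [div_lt_iff₀ hl0]; linarith
      linarith
    refine e5 _ g3 g4 ((P.mem_of_left hab (by linarith) (by linarith)).2 ?_)
    rwa [eq]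
  · rintro ⟨e1, e2, e3, e4, e5⟩
    have hcd : c < d := by
      by_contra hc
      have := mul_nonneg hl0.le (sub_nonneg.2 (not_lt.1 hc))
      linarith
    refine ⟨(P.mem_of_left hab h1 (by linarith)).2 e1,
      (P.mem_of_left hab (by linarith) h2).2 e2, hcd, by linarith, fun t g1 g2 ht => ?_⟩
    have m1 := mul_pos hl0 (sub_pos.2 g1)
    have m2 := mul_pos hl0 (sub_pos.2 g2)
    exact e5 _ (by linarith) (by linarith) ((P.mem_of_left hab (by linarith) (by linarith)).1 ht)

theorem hole_right (P : PerMajor a b k) (hab : a < b) (hab2 : b - a ≤ 1 / 2) (h1 : a + 1 / 3 ≤ c)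
    (h2 : d ≤ b) :
    RHole (vasSet a b k) c d ↔ RHole (vasSet a b k) (b + 3 ^ k * (c - b)) (b + 3 ^ k * (d - b)) := by
  have hl : (3 : ℝ) ≤ 3 ^ k := P.three_le
  have hl0 : (0 : ℝ) < 3 ^ k := by linarith
  constructor
  · rintro ⟨e1, e2, e3, e4, e5⟩
    have b1 := P.branch_bounds_right h1 (by linarith)
    have b2 := P.branch_bounds_right (t := d) (by linarith) h2
    have hpos := mul_pos hl0 (sub_pos.2 e3)
    refine ⟨(P.mem_of_right hab h1 (by linarith)).1 e1,
      (P.mem_of_right hab (by linarith) h2).1 e2, by linarith, by linarith, fun t g1 g2 ht => ?_⟩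
    have eq : b + 3 ^ k * (b + (t - b) / 3 ^ k - b) = t := by field_simp; ring
    have g3 : c < b + (t - b) / 3 ^ k := by
      have : c - b < (t - b) / 3 ^ k := by rw [lt_div_iff₀ hl0]; linarith
      linarith
    have g4 : b + (t - b) / 3 ^ k < d := by
      have : (t - b) / 3 ^ k < d - b := by rw [div_lt_iff₀ hl0]; linarith
      linarith
    refine e5 _ g3 g4 ((P.mem_of_right hab (by linarith) (by linarith)).2 ?_)
    rwa [eq]
  · rintro ⟨e1, e2, e3, e4, e5⟩
    have hcd : c < d := by
      by_contra hc
      have := mul_nonneg hl0.le (sub_nonneg.2 (not_lt.1 hc))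
      linarith
    refine ⟨(P.mem_of_right hab h1 (by linarith)).2 e1,
      (P.mem_of_right hab (by linarith) h2).2 e2, hcd, by linarith, fun t g1 g2 ht => ?_⟩
    have m1 := mul_pos hl0 (sub_pos.2 g1)
    have m2 := mul_pos hl0 (sub_pos.2 g2)
    exact e5 _ (by linarith) (by linarith) ((P.mem_of_right hab (by linarith) (by linarith)).1 ht)

/-- The holes of the vassal gap behind the major are the iterated preimages of the middle one. -/
theorem vas_hole_induction (P : PerMajor a b k) (hab : a < b) (hab2 : b - a ≤ 1 / 2)
    {Q : ℝ → ℝ → Prop} (h0 : Q (b - 1 / 3) (a + 1 / 3))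
    (hl : ∀ c d, RHole (vasSet a b k) c d → a < c → d < b - 1 / 3 →
      Q (a + 3 ^ k * (c - a)) (a + 3 ^ k * (d - a)) → Q c d)
    (hr : ∀ c d, RHole (vasSet a b k) c d → a + 1 / 3 < c → d < b →
      Q (b + 3 ^ k * (c - b)) (b + 3 ^ k * (d - b)) → Q c d)
    (h : RHole (vasSet a b k) c d) (h1 : a ≤ c) (h2 : d ≤ b) : Q c d ∧ a < c ∧ d < b := by
  have hk3 : (3 : ℝ) ≤ 3 ^ k := P.three_le
  have hl0 : (0 : ℝ) < 3 ^ k := by linarith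
  have hth := P.third_lt hab
  have hlen := P.2.2.1
  have key : ∀ (N : ℕ) {c d}, RHole (vasSet a b k) c d → a ≤ c → d ≤ b → 1 ≤ 3 ^ N * (d - c) →
      Q c d ∧ a < c ∧ d < b := by
    intro N
    induction N with
    | zero => intro c d h h1 h2 hN; linarith
    | succ N ih =>
      intro c d h h1 h2 hN
      have hgrow : 1 ≤ 3 ^ N * (3 ^ k * (d - c)) := by
        have e1 : 0 < d - c := by linarith [h.2.2.1]
        have e2 : 3 * (d - c) ≤ 3 ^ k * (d - c) := mul_le_mul_of_nonneg_right hk3 e1.le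
        have e3 := mul_le_mul_of_nonneg_left e2 (show (0 : ℝ) ≤ 3 ^ N by positivity)
        rw [pow_succ] at hN
        linarith
      rcases P.hole_cases hab h with g | ⟨rfl, rfl⟩ | g
      · have b1 := P.branch_bounds_left h1 (by linarith [h.2.2.1])
        have b2 := P.branch_bounds_left (by linarith [h.2.2.1]) g
        obtain ⟨q1, q2, q3⟩ := ih ((P.hole_left hab hab2 h1 g).1 h) b1.1 b2.2 (by linarith)
        -- The endpoint a is fixed by the branch, so a hole starting at a would have an image hole
        -- starting at a, which the induction hypothesis excludes.
        have c1 : a < c := by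
          by_contra hc
          rw [le_antisymm (not_lt.1 hc) h1] at q2
          linarith
        have d1 : d < b - 1 / 3 := by
          by_contra hc
          have : d = b - 1 / 3 := le_antisymm g (not_lt.1 hc)
          rw [this] at q3
          linarith
        exact ⟨hl c d h c1 d1 q1, c1, by linarith⟩
      · exact ⟨h0, by linarith, by linarith⟩
      · have b1 := P.branch_bounds_right g (by linarith [h.2.2.1])
        have b2 := P.branch_bounds_right (by linarith [h.2.2.1]) h2
        obtain ⟨q1, q2, q3⟩ := ih ((P.hole_right hab hab2 g h2).1 h) b1.1 b2.2 (by linarith)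
        have c1 : a + 1 / 3 < c := by
          by_contra hc
          rw [le_antisymm (not_lt.1 hc) g] at q2
          linarith
        have d1 : d < b := by
          by_contra hc
          have : d = b := le_antisymm h2 (not_lt.1 hc)
          rw [this] at q3
          linarith
        exact ⟨hr c d h c1 d1 q1, by linarith, d1⟩
  have hd : 0 < d - c := by linarith [h.2.2.1]
  obtain ⟨N, hN⟩ := pow_unbounded_of_one_lt (1 / (d - c)) (by norm_num : (1 : ℝ) < 3)
  rw [div_lt_iff₀ hd] at hN
  exact key N h h1 h2 hN.le

end PerMajor


/-! ### Edges of the vassal gap are leaves -/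

namespace Major

variable {R : ℝ → ℝ → Prop} {a b c d : ℝ} {k : ℕ}

/-- A partner t + 1/3 would give a leaf joining the two branches, excluded by `straddle`, and t +
2/3 lies outside of [a, b]. -/
theorem pull_left (H : Major R a b) (P : PerMajor a b k) (hS : NoSiegel R) {s t : ℝ}
    (hs1 : a < s) (hs2 : s < b - 1 / 3) (ht1 : a < t) (ht2 : t < b - 1 / 3)
    (hR : R (3 * s) (3 * t)) : R s t := by
  have hab := P.third_lt H.edge.1
  have hab2 := H.le_half
  rcases H.lam.back3 (x := s) (y := t) 0 (by simpa using hR) with g | g | g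
  · exact g
  · rcases H.straddle P hS hs1.le hs2.le (by linarith) (by linarith) g with k1 | k1 <;> linarith
  · exact (H.edge.not_rel H.lam hs1 (by linarith) (by linarith) (by linarith) g).elim

theorem pull_right (H : Major R a b) (P : PerMajor a b k) (hS : NoSiegel R) {s t : ℝ}
    (hs1 : a + 1 / 3 < s) (hs2 : s < b) (ht1 : a + 1 / 3 < t) (ht2 : t < b)
    (hR : R (3 * s) (3 * t)) : R s t := by
  have hab := P.third_lt H.edge.1
  have hab2 := H.le_half
  rcases H.lam.back3 (x := s) (y := t) 0 (by simpa using hR) with g | g | g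
  · exact g
  · exact (H.edge.not_rel H.lam (by linarith) hs2 (by linarith) (by linarith) g).elim
  · have g' : R (t - 1 / 3) s := by
      have := H.lam.symm (H.lam.sub_one g)
      rwa [show t + 2 / 3 - 1 = t - 1 / 3 by ring] at this
    rcases H.straddle P hS (by linarith) (by linarith) hs1.le hs2.le g' with k1 | k1 <;> linarith

/-- The images of a branch before its return are holes of the gap. -/
theorem branch_hole (O : OrbMajor a b) (P : PerMajor a b k) {i : ℕ} (h0 : 0 < i) (hi : i < k) :
    RHole (gapSet a b) (3 ^ i * a) (3 ^ i * (b - 1 / 3)) ∧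
      3 ^ i * (b - 1 / 3) - 3 ^ i * a ≤ 1 / 3 := by
  have hab : a < b := by linarith [O.third_le]
  have hth := P.third_lt hab
  have hlen := P.2.2.1
  have hiter : ∀ (n : ℕ) {t}, t ∈ gapSet a b → 3 ^ n * t ∈ gapSet a b := by
    intro n
    induction n with
    | zero => intro t ht; simpa using ht
    | succ n ih => intro t ht; rw [pow_succ', mul_assoc]; exact OrbMajor.three_mem (ih ht)
  obtain ⟨l, rfl⟩ : ∃ l, i = l + 1 := ⟨i - 1, by omega⟩
  obtain ⟨e, rfl⟩ : ∃ e, k = l + 1 + (e + 1) := ⟨k - (l + 1) - 1, by omega⟩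
  have hp : (3 : ℝ) ^ (l + 1) * (b - 1 / 3) = 3 ^ (l + 1) * b + ((-3 ^ l : ℤ) : ℝ) := by
    push_cast; rw [pow_succ]; ring
  have hd0 : (0 : ℝ) < 3 ^ (l + 1) * (b - 1 / 3 - a) := mul_pos (by positivity) (by linarith)
  have hpow : (3 : ℝ) ^ (l + 1 + (e + 1)) = 3 ^ (e + 1) * 3 ^ (l + 1) := by rw [add_comm, pow_add]
  have he : (3 : ℝ) ≤ 3 ^ (e + 1) := by
    rw [pow_succ]
    have : (1 : ℝ) ≤ 3 ^ e := one_le_pow₀ (by norm_num)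
    linarith
  -- At least one more tripling is needed before the branch reaches its final length b - a ≤ 1/2.
  have hsm : 3 ^ (l + 1) * (b - 1 / 3 - a) ≤ 1 / 6 := by
    have := mul_le_mul_of_nonneg_right he hd0.le
    rw [hpow, mul_assoc] at hlen
    have h2 := O.le_half
    have : b - 1 / 3 - a = b - a - 1 / 3 := by ring
    rw [this] at hd0 ⊢
    have := mul_le_mul_of_nonneg_right he hd0.le
    linarith
  refine ⟨⟨hiter _ O.left_mem, ?_, by linarith, by linarith, fun t g1 g2 ht => ?_⟩, by linarith⟩
  · rw [hp]; exact gapSet_add_int _ (hiter _ O.right_mem) _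
  · obtain ⟨j, hj⟩ := P.2.1
    have e1 : (0 : ℝ) < 3 ^ (e + 1) := by positivity
    have m1 := mul_lt_mul_of_pos_left g1 e1
    have m2 := mul_lt_mul_of_pos_left g2 e1
    rw [← mul_assoc, ← hpow] at m1 m2
    refine O.major_hole.2.2.2.2 (3 ^ (e + 1) * t + (-j : ℤ)) ?_ ?_ (gapSet_add_int _ (hiter _ ht) _)
    · push_cast; linarith
    · push_cast; linarith

/-- The iterated pullback along a branch of the first return map. -/
theorem pull_branch (H : Major R a b) (O : OrbMajor a b) (P : PerMajor a b k) {s t : ℝ}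
    (hs1 : a < s) (hs2 : s < b - 1 / 3) (ht1 : a < t) (ht2 : t < b - 1 / 3)
    (hR : R (3 ^ k * s) (3 ^ k * t)) : R (3 * s) (3 * t) := by
  have key : ∀ e i : ℕ, 0 < i → i + e = k → R (3 ^ i * s) (3 ^ i * t) := by
    intro e
    induction e with
    | zero => rintro i - rfl; exact hR
    | succ e ih =>
      intro i h0 hi
      have h1 := ih (i + 1) (by omega) (by omega)
      obtain ⟨hh, hl⟩ := branch_hole O P h0 (show i < k by omega)
      have e1 : (0 : ℝ) < 3 ^ i := by positivity
      refine (H.hole_edge O hh).pull H.lam hl (mul_lt_mul_of_pos_left hs1 e1)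
        (mul_lt_mul_of_pos_left hs2 e1) (mul_lt_mul_of_pos_left ht1 e1)
        (mul_lt_mul_of_pos_left ht2 e1) ?_
      simpa only [pow_succ', mul_assoc] using h1
  have := key (k - 1) 1 one_pos (by have := P.1; omega)
  simpa using this

/-- The middle leaf is pulled back along the branches. No third point can join the class: the other
branch is excluded by `straddle`, the middle arc is closed off by its own leaf, and on the same
branch the return map is injective and the image class has only two points. -/
theorem vas_hole_edge (H : Major R a b) (O : OrbMajor a b) (P : PerMajor a b k) (hS : NoSiegel R)
    (h : RHole (vasSet a b k) c d) (h1 : a ≤ c) (h2 : d ≤ b) : EdgeArc R c d := by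
  have hab := H.edge.1
  have hth := P.third_lt hab
  have hab2 := H.le_half
  have hl0 : (0 : ℝ) < 3 ^ k := by positivity
  obtain ⟨j, hj⟩ := P.2.1
  obtain ⟨j', hj'⟩ := P.pow_right
  refine (P.vas_hole_induction hab hab2 (Q := EdgeArc R) (H.edge_middle P) ?_ ?_ h h1 h2).1
  · intro c d h c1 d1 hE
    have hcd := h.2.2.1
    have hR : R c d := by
      refine H.pull_left P hS c1 (by linarith) (by linarith) d1
        (H.pull_branch O P c1 (by linarith) (by linarith) d1 ?_)
      have := H.lam.shift hE.2.2.1 j j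
      convert this using 1 <;> linarith
    refine ⟨hcd, by linarith, hR, fun w hw => ?_⟩
    obtain ⟨m, hm | hm⟩ := OrbMajor.position a b w
    · have hRm := H.lam.shift_right hw m
      rcases lt_or_ge (a + 1 / 3) (w + m) with g | g
      · rcases H.straddle P hS c1.le (by linarith) g.le hm.2.le hRm with g | g <;> linarith
      rcases le_or_gt (b - 1 / 3) (w + m) with g2 | g2
      · rcases eq_or_lt_of_le g2 with g3 | g3
        · rw [← g3] at hRm
          rcases H.straddle P hS c1.le (by linarith) le_rfl (by linarith)
            (H.lam.trans hRm (H.rel_middle P)) with g | g <;> linarith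
        rcases eq_or_lt_of_le g with g4 | g4
        · rw [g4] at hRm
          rcases H.straddle P hS c1.le (by linarith) le_rfl (by linarith) hRm with g | g <;> linarith
        · exact ((H.edge_middle P).not_rel H.lam g3 g4 (w := c + 1) (by linarith) (by linarith)
            (H.lam.add_one (H.lam.symm hRm))).elim
      · have b1 := P.branch_bounds_left hm.1.le g2.le
        have b2 := P.branch_bounds_left c1.le (by linarith)
        have b3 := P.branch_bounds_left (t := d) (by linarith) d1.le
        have p1 := mul_pos hl0 (sub_pos.2 hm.1)
        have p2 := mul_pos hl0 (sub_pos.2 c1)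
        obtain ⟨n, hn | hn⟩ := hE.2.2.2 (a + 3 ^ k * (w + m - a)) (by
            have := H.lam.shift (H.lam.fwd_pow hRm k) (-j) (-j)
            convert this using 1 <;> push_cast <;> linarith)
        · have hn0 : n = 0 := by
            by_contra hne
            rcases lt_or_gt_of_ne hne with g | g
            · have : (n : ℝ) ≤ -1 := by exact_mod_cast Int.le_sub_one_of_lt g
              linarith
            · have : (1 : ℝ) ≤ n := by exact_mod_cast g
              linarith
          refine ⟨-m, Or.inl ?_⟩
          rw [hn0, Int.cast_zero, add_zero] at hn
          have : w + m - a = c - a := mul_left_cancel₀ hl0.ne' (by linarith)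
          push_cast; linarith
        · have hn0 : n = 0 := by
            by_contra hne
            rcases lt_or_gt_of_ne hne with g | g
            · have : (n : ℝ) ≤ -1 := by exact_mod_cast Int.le_sub_one_of_lt g
              linarith
            · have : (1 : ℝ) ≤ n := by exact_mod_cast g
              linarith
          refine ⟨-m, Or.inr ?_⟩
          rw [hn0, Int.cast_zero, add_zero] at hn
          have : w + m - a = d - a := mul_left_cancel₀ hl0.ne' (by linarith)
          push_cast; linarith
    · exact (H.edge.not_rel H.lam c1 (by linarith) hm.1 hm.2 (H.lam.shift_right hw m)).elim
  · intro c d h c1 d1 hE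
    have hcd := h.2.2.1
    have hR : R c d := by
      refine H.pull_right P hS c1 (by linarith) (by linarith) d1 ?_
      have := H.pull_branch O P (s := c - 1 / 3) (t := d - 1 / 3) (by linarith) (by linarith)
        (by linarith) (by linarith) (by
          obtain ⟨l, hl⟩ : ∃ l, k = l + 1 := ⟨k - 1, by have := P.1; omega⟩
          have := H.lam.shift hE.2.2.1 (j' - 3 ^ l) (j' - 3 ^ l)
          have h3 : (3 : ℝ) ^ k * (1 / 3) = 3 ^ l := by rw [hl, pow_succ]; ring
          convert this using 1 <;> push_cast <;> linarith)
      have := H.lam.shift this 1 1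
      convert this using 1 <;> push_cast <;> ring
    refine ⟨hcd, by linarith, hR, fun w hw => ?_⟩
    obtain ⟨m, hm | hm⟩ := OrbMajor.position a b w
    · have hRm := H.lam.shift_right hw m
      rcases lt_or_ge (w + m) (b - 1 / 3) with g | g
      · rcases H.straddle P hS hm.1.le g.le c1.le (by linarith) (H.lam.symm hRm) with g | g <;> linarith
      rcases le_or_gt (w + m) (a + 1 / 3) with g2 | g2
      · rcases eq_or_lt_of_le g2 with g3 | g3
        · rw [g3] at hRm
          rcases H.straddle P hS (by linarith) le_rfl c1.le (by linarith)
            (H.lam.trans (H.rel_middle P) (H.lam.symm hRm)) with g | g <;> linarith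
        rcases eq_or_lt_of_le g with g4 | g4
        · rw [← g4] at hRm
          rcases H.straddle P hS (by linarith) le_rfl c1.le (by linarith) (H.lam.symm hRm) with
            g | g <;> linarith
        · exact ((H.edge_middle P).not_rel H.lam g4 g3 (w := c) (by linarith) (by linarith)
            (H.lam.symm hRm)).elim
      · have b1 := P.branch_bounds_right g2.le hm.2.le
        have b2 := P.branch_bounds_right c1.le (by linarith)
        have b3 := P.branch_bounds_right (t := d) (by linarith) d1.le
        have p1 := mul_pos hl0 (sub_pos.2 hm.2)
        have p2 := mul_pos hl0 (sub_pos.2 d1)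
        obtain ⟨n, hn | hn⟩ := hE.2.2.2 (b + 3 ^ k * (w + m - b)) (by
            have := H.lam.shift (H.lam.fwd_pow hRm k) (-j') (-j')
            convert this using 1 <;> push_cast <;> linarith)
        · have hn0 : n = 0 := by
            by_contra hne
            rcases lt_or_gt_of_ne hne with g | g
            · have : (n : ℝ) ≤ -1 := by exact_mod_cast Int.le_sub_one_of_lt g
              linarith
            · have : (1 : ℝ) ≤ n := by exact_mod_cast g
              linarith
          refine ⟨-m, Or.inl ?_⟩
          rw [hn0, Int.cast_zero, add_zero] at hn
          have : w + m - b = c - b := mul_left_cancel₀ hl0.ne' (by linarith)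
          push_cast; linarith
        · have hn0 : n = 0 := by
            by_contra hne
            rcases lt_or_gt_of_ne hne with g | g
            · have : (n : ℝ) ≤ -1 := by exact_mod_cast Int.le_sub_one_of_lt g
              linarith
            · have : (1 : ℝ) ≤ n := by exact_mod_cast g
              linarith
          refine ⟨-m, Or.inr ?_⟩
          rw [hn0, Int.cast_zero, add_zero] at hn
          have : w + m - b = d - b := mul_left_cancel₀ hl0.ne' (by linarith)
          push_cast; linarith
    · exact (H.edge.not_rel H.lam (by linarith) (by linarith) hm.1 hm.2
        (H.lam.shift_right hw m)).elim

/-- A leaf with both endpoints in the vassal gap, other than the major, is an edge of it. -/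
theorem vas_leaf_edge (H : Major R a b) (P : PerMajor a b k) (hS : NoSiegel R) {x y : ℝ}
    (hx : x ∈ vasSet a b k) (hy : y ∈ vasSet a b k) (h1 : a ≤ x) (h2 : x < y) (h3 : y ≤ b)
    (hR : R x y) (hne : ¬ (x = a ∧ y = b)) : RHole (vasSet a b k) x y := by
  have hab := H.edge.1
  have hth := P.third_lt hab
  have hab2 := H.le_half
  have hk3 : (3 : ℝ) ≤ 3 ^ k := P.three_le
  have hl0 : (0 : ℝ) < 3 ^ k := by positivity
  have hlen := P.2.2.1
  obtain ⟨j, hj⟩ := P.2.1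
  obtain ⟨j', hj'⟩ := P.pow_right
  have key : ∀ (N : ℕ) {x y}, x ∈ vasSet a b k → y ∈ vasSet a b k → a ≤ x → x < y → y ≤ b → R x y →
      ¬ (x = a ∧ y = b) → 1 ≤ 3 ^ N * (y - x) → RHole (vasSet a b k) x y := by
    intro N
    induction N with
    | zero => intro x y _ _ h1 _ h2 _ _ hN; linarith
    | succ N ih =>
      intro x y hx hy h1 h2 h3 hR hne hN
      have hgrow : 1 ≤ 3 ^ N * (3 ^ k * (y - x)) := by
        have e2 : 3 * (y - x) ≤ 3 ^ k * (y - x) := mul_le_mul_of_nonneg_right hk3 (by linarith)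
        have e3 := mul_le_mul_of_nonneg_left e2 (show (0 : ℝ) ≤ 3 ^ N by positivity)
        rw [pow_succ] at hN
        linarith
      have hpos := mul_pos hl0 (sub_pos.2 h2)
      rcases PerMajor.vas_cases hy with gy | gy
      · have b1 := P.branch_bounds_left h1 (by linarith)
        have b2 := P.branch_bounds_left (t := y) (by linarith) gy
        refine (P.hole_left hab hab2 h1 gy).2 (ih ((P.mem_of_left hab h1 (by linarith)).1 hx)
          ((P.mem_of_left hab (by linarith) gy).1 hy) b1.1 (by linarith) b2.2 ?_ ?_ (by linarith))
        · have := H.lam.shift (H.lam.fwd_pow hR k) (-j) (-j)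
          convert this using 1 <;> push_cast <;> linarith
        -- If the image were the major, the leaf would be (a, b - 1/3), but b - 1/3 is not in the
        -- class of a.
        · rintro ⟨g1, g2⟩
          have e1 : x - a = 0 := by
            have : 3 ^ k * (x - a) = 0 := by linarith
            exact (mul_eq_zero.1 this).resolve_left hl0.ne'
          have e2 : y - a = b - a - 1 / 3 := mul_left_cancel₀ hl0.ne' (by linarith)
          rw [show x = a by linarith, show y = b - 1 / 3 by linarith] at hR
          exact H.edge.not_rel_inside (by linarith) (by linarith) hR
      rcases PerMajor.vas_cases hx with gx | gx
      · rcases H.straddle P hS h1 gx gy h3 hR with g | ⟨rfl, rfl⟩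
        · exact (hne g).elim
        · exact ⟨hx, hy, h2, by linarith, fun t g1 g2 => PerMajor.not_mem_middle g1 g2⟩
      · have b1 := P.branch_bounds_right gx (by linarith)
        have b2 := P.branch_bounds_right (t := y) (by linarith) h3
        refine (P.hole_right hab hab2 gx h3).2 (ih ((P.mem_of_right hab gx (by linarith)).1 hx)
          ((P.mem_of_right hab (by linarith) h3).1 hy) b1.1 (by linarith) b2.2 ?_ ?_ (by linarith))
        · have := H.lam.shift (H.lam.fwd_pow hR k) (-j') (-j')
          convert this using 1 <;> push_cast <;> linarith
        · rintro ⟨g1, g2⟩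
          have e1 : y - b = 0 := by
            have : 3 ^ k * (y - b) = 0 := by linarith
            exact (mul_eq_zero.1 this).resolve_left hl0.ne'
          have e2 : b - x = b - a - 1 / 3 := mul_left_cancel₀ hl0.ne' (by linarith)
          rw [show y = b by linarith, show x = a + 1 / 3 by linarith] at hR
          exact H.edge.not_rel_inside (t := a + 1 / 3) (by linarith) (by linarith)
            (H.lam.trans H.rel (H.lam.symm hR))
  have hd : 0 < y - x := by linarith
  obtain ⟨N, hN⟩ := pow_unbounded_of_one_lt (1 / (y - x)) (by norm_num : (1 : ℝ) < 3)
  rw [div_lt_iff₀ hd] at hN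
  exact key N hx hy h1 h2 h3 hR hne hN.le

end Major


/-! ### Generation of the relation in the periodic case -/

namespace PerMajor

variable {a b c d : ℝ} {k : ℕ}

theorem outer_hole (P : PerMajor a b k) (hab : a < b) (hab2 : b - a ≤ 1 / 2) :
    RHole (vasSet a b k) b (a + 1) :=
  ⟨P.right_mem hab, by simpa using vasSet_add_int _ (P.left_mem hab) 1, by linarith, by linarith,
    fun _ h1 h2 => not_mem_outer h1 h2⟩

theorem vas_hole_position (P : PerMajor a b k) (hab : a < b) (hab2 : b - a ≤ 1 / 2)
    (h : RHole (vasSet a b k) c d) :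
    ∃ m : ℤ, (c + m = b ∧ d + m = a + 1) ∨ (a ≤ c + m ∧ d + m ≤ b) := by
  have hth := P.third_lt hab
  obtain ⟨m, hm⟩ := ((mem_vasSet_iff hth.le).1 h.1).1
  have h1 : a ≤ c + m := by rcases hm with hm | hm <;> linarith
  have h2 : c + m ≤ b := by rcases hm with hm | hm <;> linarith
  obtain ⟨e1, e2, e3, e4, e5⟩ := h.shift vasSet_add_int m
  refine ⟨m, ?_⟩
  rcases eq_or_lt_of_le h2 with h3 | h3
  · refine Or.inl ⟨h3, ?_⟩
    rcases lt_trichotomy (d + m) (a + 1) with g | g | g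
    · exact (not_mem_outer (by linarith) g e2).elim
    · exact g
    · exact (e5 (a + 1) (by linarith) g (P.outer_hole hab hab2).2.1).elim
  · refine Or.inr ⟨h1, ?_⟩
    by_contra g
    exact e5 b h3 (not_le.1 g) (P.right_mem hab)

theorem exists_vas_hole (P : PerMajor a b k) (hab : a < b) (hab2 : b - a ≤ 1 / 2) {t : ℝ}
    (ht : t ∉ vasSet a b k) : ∃ c d, RHole (vasSet a b k) c d ∧ c < t ∧ t < d :=
  exists_rhole isClosed_vasSet vasSet_add_int (P.left_mem hab) (P.right_mem hab)
    (P.orbMajor hab hab2).ne_shift ht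

end PerMajor

namespace Major

variable {R : ℝ → ℝ → Prop} {a b c d : ℝ} {k : ℕ}

theorem rel_of_vas_edge (H : Major R a b) (P : PerMajor a b k) (hS : NoSiegel R) {s t : ℝ}
    (h : REdge (vasSet a b k) s t) : R s t := by
  have O := P.orbMajor H.edge.1 H.le_half
  have key : ∀ {c d}, RHole (vasSet a b k) c d → R c d := by
    intro c d h
    obtain ⟨m, hm | hm⟩ := P.vas_hole_position H.edge.1 H.le_half h
    · have := H.lam.shift (H.lam.add_one (H.lam.symm H.rel)) (-m) (-m)
      rw [← hm.1, ← hm.2] at this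
      simpa using this
    · have := H.lam.shift (H.vas_hole_edge O P hS (h.shift vasSet_add_int m) hm.1 hm.2).2.2.1 (-m) (-m)
      simpa using this
  obtain ⟨n, h | h⟩ := h
  · exact H.lam.of_shift n (key h)
  · exact H.lam.symm (H.lam.of_shift n (key h))

/-- Two points in a common hole of the gap and in a common hole of the vassal gap are in an arc
along which related images can be pulled back. -/
theorem exists_arc (H : Major R a b) (P : PerMajor a b k) (hS : NoSiegel R) {s t : ℝ} {n n' : ℤ}
    (hA : SameHole (gapSet a b) s t n) (hV : SameHole (vasSet a b k) s t n') :
    ∃ x, 3 * x ∈ gapSet a b ∧ x < s ∧ s < x + 1 / 3 ∧ x < t + n ∧ t + n < x + 1 / 3 ∧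
      (R (3 * s) (3 * t) → R s t) := by
  have hab := H.edge.1
  have hth := P.third_lt hab
  have hab2 := H.le_half
  have O := P.orbMajor hab hab2
  obtain ⟨p, q, hpq, h1, h2, h3, h4⟩ := hA
  obtain ⟨m, hm | hm⟩ := O.hole_position hpq
  · obtain ⟨c, d, hcd, g1, g2, g3, g4⟩ := hV
    have hcd' := hcd.shift vasSet_add_int m
    have hc : a ≤ c + m := by
      by_contra g
      exact hcd'.2.2.2.2 a (not_le.1 g) (by linarith) (P.left_mem hab)
    have hd : d + m ≤ b := by
      by_contra g
      exact hcd'.2.2.2.2 b (by linarith) (not_le.1 g) (P.right_mem hab)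
    have hnn : n' = n := by
      have k1 : ((n' - n : ℤ) : ℝ) < 1 := by push_cast; linarith
      have k2 : (-1 : ℝ) < ((n' - n : ℤ) : ℝ) := by push_cast; linarith
      have k1' : n' - n < 1 := by exact_mod_cast k1
      have k2' : -1 < n' - n := by exact_mod_cast k2
      omega
    subst hnn
    have hshift : R (3 * s) (3 * t) → R (3 * (s + m)) (3 * (t + n' + m)) := fun hR => by
      have := H.lam.shift hR (3 * m) (3 * (n' + m))
      convert this using 1 <;> push_cast <;> ring
    have hback : R (s + m) (t + n' + m) → R s t := fun hR => by
      have := H.lam.shift hR (-m) (-(n' + m))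
      convert this using 1 <;> push_cast <;> ring
    have hmem : ∀ x z : ℝ, z ∈ gapSet a b → (∃ i : ℤ, 3 * x = 3 * z + i) → 3 * x ∈ gapSet a b := by
      rintro x z hz ⟨i, hi⟩
      rw [hi]
      exact gapSet_add_int _ (OrbMajor.three_mem hz) i
    -- The arc of length 1/3 starts at a, at b - 1/3 or at a + 1/3, according to whether the vassal
    -- hole is in the left branch, in the middle or in the right branch.
    rcases P.hole_cases hab hcd' with g | ⟨e1, e2⟩ | g
    · refine ⟨a - m, hmem _ a O.left_mem ⟨-3 * m, by push_cast; ring⟩, by linarith, by linarith,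
        by linarith, by linarith, fun hR => hback (H.pull_left P hS (by linarith) (by linarith)
          (by linarith) (by linarith) (hshift hR))⟩
    · refine ⟨b - 1 / 3 - m, hmem _ b O.right_mem ⟨-3 * m - 1, by push_cast; ring⟩, by linarith,
        by linarith, by linarith, by linarith, fun hR => hback ((H.edge_middle P).pull H.lam
          (by linarith) (by linarith) (by linarith) (by linarith) (by linarith) (hshift hR))⟩
    · refine ⟨a + 1 / 3 - m, hmem _ a O.left_mem ⟨-3 * m + 1, by push_cast; ring⟩, by linarith,
        by linarith, by linarith, by linarith, fun hR => hback (H.pull_right P hS (by linarith)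
          (by linarith) (by linarith) (by linarith) (hshift hR))⟩
  · have hlt := O.hole_lt (hpq.shift gapSet_add_int m) hm.1 hm.2
    refine ⟨p, OrbMajor.three_mem hpq.1, h1, by linarith, h3, by linarith, fun hR => ?_⟩
    refine H.lam.of_shift n ((H.hole_edge O hpq).pull H.lam (by linarith) h1 h2 h3 h4 ?_)
    have := H.lam.shift_right hR (3 * n)
    convert this using 1
    push_cast; ring

/-- A leaf in a hole of the gap is an edge of the vassal gap or lies in a hole of it. -/
theorem vas_edge_or_sameHole (H : Major R a b) (P : PerMajor a b k) (hS : NoSiegel R) {s t : ℝ}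
    {n : ℤ} (hA : SameHole (gapSet a b) s t n) (hR : R s t) (hst : ∀ n : ℤ, t ≠ s + n) :
    REdge (vasSet a b k) s t ∨ ∃ n', SameHole (vasSet a b k) s t n' := by
  have hab := H.edge.1
  have hth := P.third_lt hab
  have hab2 := H.le_half
  have O := P.orbMajor hab hab2
  obtain ⟨p, q, hpq, h1, h2, h3, h4⟩ := hA
  obtain ⟨m, hm | hm⟩ := O.hole_position hpq
  · have hoff : ∀ {x y}, a < x → x < b → a < y → y < b → R x y → x ∉ vasSet a b k →
        ∃ c d, RHole (vasSet a b k) c d ∧ c < x ∧ x < d ∧ c < y ∧ y < d := by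
      intro x y x1 x2 y1 y2 hxy hx
      obtain ⟨c, d, hcd, g1, g2⟩ := P.exists_vas_hole hab hab2 hx
      have hc : a ≤ c := by
        by_contra g
        exact hcd.2.2.2.2 a (not_le.1 g) (by linarith) (P.left_mem hab)
      have hd : d ≤ b := by
        by_contra g
        exact hcd.2.2.2.2 b (by linarith) (not_le.1 g) (P.right_mem hab)
      have hE := H.vas_hole_edge O P hS hcd hc hd
      refine ⟨c, d, hcd, g1, g2, ?_, ?_⟩
      · by_contra g
        exact hE.not_rel H.lam g1 g2 (w := y + 1) (by linarith) (by linarith) (H.lam.add_one hxy)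
      · by_contra g
        exact hE.not_rel H.lam g1 g2 (w := y) (by linarith) (by linarith) hxy
    have hR' : R (s + m) (t + n + m) := by
      have := H.lam.shift hR m (n + m)
      convert this using 1
      push_cast; ring
    have hput : (∃ c d, RHole (vasSet a b k) c d ∧ c < s + m ∧ s + m < d ∧ c < t + n + m ∧
        t + n + m < d) → ∃ n', SameHole (vasSet a b k) s t n' := by
      rintro ⟨c, d, hcd, g1, g2, g3, g4⟩
      refine ⟨n, c + (-m : ℤ), d + (-m : ℤ), hcd.shift vasSet_add_int (-m), ?_⟩
      push_cast
      exact ⟨by linarith, by linarith, by linarith, by linarith⟩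
    have s1 : a < s + m := by linarith
    have s2 : s + m < b := by linarith
    have t1 : a < t + n + m := by linarith
    have t2 : t + n + m < b := by linarith
    by_cases hs : s + m ∈ vasSet a b k
    · by_cases ht : t + n + m ∈ vasSet a b k
      · left
        have hE : REdge (vasSet a b k) (s + m) (t + n + m) := by
          rcases lt_trichotomy (s + m) (t + n + m) with g | g | g
          · exact ⟨0, Or.inl (by
              simpa using H.vas_leaf_edge P hS hs ht s1.le g t2.le hR' (by rintro ⟨e, -⟩; linarith))⟩
          · exact (hst (-n) (by push_cast; linarith)).elim
          · exact ⟨0, Or.inr (by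
              simpa using H.vas_leaf_edge P hS ht hs t1.le g s2.le (H.lam.symm hR')
                (by rintro ⟨e, -⟩; linarith))⟩
        refine REdge.of_shift vasSet_add_int m (n + m) ?_
        convert hE using 1
        push_cast; ring
      · right
        obtain ⟨c, d, hcd, g1, g2, g3, g4⟩ := hoff t1 t2 s1 s2 (H.lam.symm hR') ht
        exact hput ⟨c, d, hcd, g3, g4, g1, g2⟩
    · exact Or.inr (hput (hoff s1 s2 t1 t2 hR' hs))
  · right
    -- Every hole of the gap other than the major lies in the outer hole (b, a + 1) of the vassal
    -- gap.
    refine ⟨n, b + (-m : ℤ), a + 1 + (-m : ℤ),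
      (P.outer_hole hab hab2).shift vasSet_add_int (-m), ?_⟩
    push_cast
    exact ⟨by linarith, by linarith, by linarith, by linarith⟩

/-- A lamination with a periodic major is generated by its gap and the vassal gap. -/
theorem rel_iff_of_per (H : Major R a b) (P : PerMajor a b k) (hS : NoSiegel R) (s t : ℝ) :
    R s t ↔ (∃ n : ℤ, t = s + n) ∨ ∃ N : ℕ,
      (REdge (gapSet a b) (3 ^ N * s) (3 ^ N * t) ∨ REdge (vasSet a b k) (3 ^ N * s) (3 ^ N * t)) ∧
      ∀ i < N, (∃ n, SameHole (gapSet a b) (3 ^ i * s) (3 ^ i * t) n) ∧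
        ∃ n, SameHole (vasSet a b k) (3 ^ i * s) (3 ^ i * t) n := by
  have O := P.orbMajor H.edge.1 H.le_half
  constructor
  · intro hR
    by_cases hst : ∃ n : ℤ, t = s + n
    · exact Or.inl hst
    right
    push Not at hst
    have h1 : ∀ s t, R s t → (∀ n : ℤ, t ≠ s + n) →
        (REdge (gapSet a b) s t ∨ REdge (vasSet a b k) s t) ∨
        ∃ n, SameHole (gapSet a b) s t n ∧ ∃ n', SameHole (vasSet a b k) s t n' := by
      intro s t hR hst
      rcases H.edge_or_sameHole O hR hst with h | ⟨n, h⟩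
      · exact Or.inl (Or.inl h)
      · rcases H.vas_edge_or_sameHole P hS h hR hst with h' | h'
        · exact Or.inl (Or.inr h')
        · exact Or.inr ⟨n, h, h'⟩
    obtain ⟨N, hN, hi⟩ := exists_edge_of_growth H.lam
      (E := fun s t => REdge (gapSet a b) s t ∨ REdge (vasSet a b k) s t)
      (S := fun s t n => SameHole (gapSet a b) s t n ∧ ∃ n', SameHole (vasSet a b k) s t n') h1 (by
        rintro s t n m ⟨h1, n', h2⟩ ⟨h3, -⟩
        obtain ⟨x, g1, g2, g3, g4, g5, -⟩ := H.exists_arc P hS h1 h2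
        exact OrbMajor.lift_eq' g1 g2 g3 g4 g5 h3) (by
        rintro s t n ⟨h1, n', h2⟩
        obtain ⟨x, g1, g2, g3, g4, g5, -⟩ := H.exists_arc P hS h1 h2
        rw [abs_lt]
        constructor <;> linarith) hR hst
    exact ⟨N, hN, fun i h => by
      obtain ⟨n, h1, h2⟩ := hi i h
      exact ⟨⟨n, h1⟩, h2⟩⟩
  · rintro (⟨n, rfl⟩ | ⟨N, hE, hi⟩)
    · exact H.lam.per s n
    · refine pullback_induction (R := R)
        (E := fun s t => REdge (gapSet a b) s t ∨ REdge (vasSet a b k) s t)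
        (S := fun s t n => SameHole (gapSet a b) s t n ∧ ∃ n', SameHole (vasSet a b k) s t n')
        ?_ ?_ N hE ?_
      · rintro s t (h | h)
        · exact H.rel_of_edge O h
        · exact H.rel_of_vas_edge P hS h
      · rintro s t n ⟨h1, n', h2⟩ hR
        obtain ⟨x, -, -, -, -, -, h⟩ := H.exists_arc P hS h1 h2
        exact h hR
      · intro i h
        obtain ⟨⟨n, h1⟩, h2⟩ := hi i h
        exact ⟨n, h1, h2⟩

end Major


/-! ### The semiconjugacy of the gap to angle doubling -/

/-- The monotone degree one function that is constant off the translates of `(0, l)` and affine on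
them. -/
noncomputable def stairs (l x : ℝ) : ℝ := ⌊x⌋ + min 1 (Int.fract x / l)

theorem continuous_stairs {l : ℝ} (h0 : 0 < l) (h1 : l ≤ 1) : Continuous (stairs l) := by
  have h : Continuous ((fun y : ℝ => min 1 (y / l) - y) ∘ Int.fract) := by
    refine ContinuousOn.comp_fract'' (by fun_prop) ?_
    have : 1 ≤ 1 / l := by rw [le_div_iff₀ h0]; linarith
    rw [min_eq_left this]; simp
  have e : stairs l = fun x => x + ((fun y : ℝ => min 1 (y / l) - y) ∘ Int.fract) x := by
    funext x
    simp only [stairs, Function.comp]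
    linarith [Int.floor_add_fract x]
  rw [e]
  exact continuous_id.add h

/-- The slope is at most 1 / l. For l ≥ 1/3 this makes `quadLift` monotone. -/
theorem stairs_sub_le {l : ℝ} (h0 : 0 < l) (h1 : l ≤ 1) {s t : ℝ} (hst : s ≤ t) :
    l * (stairs l t - stairs l s) ≤ t - s := by
  have e : ∀ x, l * stairs l x = l * ⌊x⌋ + min l (Int.fract x) := by
    intro x
    rw [stairs, mul_add, mul_min_of_nonneg _ _ h0.le, mul_one, mul_div_cancel₀ _ h0.ne']
  rw [mul_sub, e, e]
  have a1 := Int.floor_add_fract s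
  have a2 := Int.floor_add_fract t
  have b1 := Int.fract_lt_one s
  have b2 := Int.fract_nonneg t
  have c1 := min_le_left l (Int.fract t)
  have c2 := min_le_right l (Int.fract t)
  rcases eq_or_lt_of_le (Int.floor_le_floor hst) with g | g
  · rw [g] at a1 ⊢
    rcases min_choice l (Int.fract s) with m | m <;> rw [m]
    · linarith
    · linarith
  · have g' : (⌊s⌋ : ℝ) + 1 ≤ ⌊t⌋ := by exact_mod_cast g
    have m := mul_le_mul_of_nonneg_left g' (show 0 ≤ 1 - l by linarith)
    rcases min_choice l (Int.fract s) with m' | m' <;> rw [m'] <;> linarith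

theorem stairs_add_int (l x : ℝ) (n : ℤ) : stairs l (x + n) = stairs l x + n := by
  simp only [stairs, Int.floor_add_intCast, Int.fract_add_intCast]
  push_cast; ring

theorem stairs_of_mem {l x : ℝ} (h0 : 0 < l) (h1 : l ≤ x) (h2 : x ≤ 1) : stairs l x = 1 := by
  rcases eq_or_lt_of_le h2 with rfl | h
  · simp [stairs]
  · have f : ⌊x⌋ = 0 := Int.floor_eq_zero_iff.2 ⟨by linarith, h⟩
    have f' : Int.fract x = x := Int.fract_eq_self.2 ⟨by linarith, h⟩
    have : 1 ≤ x / l := by rw [le_div_iff₀ h0]; linarith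
    simp [stairs, f, f', min_eq_left this]

/-- The lift of degree two that agrees with the tripling on the gap with major `(a, b)`. -/
noncomputable def quadLift (a b t : ℝ) : ℝ := 3 * t - stairs (b - a) (t - a)

/-- The correction that turns the iterates of `quadLift` into a semiconjugacy to the doubling. -/
noncomputable def quadMap (a b t : ℝ) : ℝ :=
  t + ∑' n : ℕ, (quadLift a b ((quadLift a b)^[n] t) - 2 * (quadLift a b)^[n] t) / 2 ^ (n + 1)

namespace OrbMajor

variable {a b c d : ℝ}

theorem pos (O : OrbMajor a b) : 0 < b - a := by linarith [O.third_le]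

theorem continuous_quadLift (O : OrbMajor a b) : Continuous (quadLift a b) :=
  (continuous_const.mul continuous_id).sub
    ((continuous_stairs O.pos (by linarith [O.le_half])).comp (by fun_prop))

theorem monotone_quadLift (O : OrbMajor a b) : Monotone (quadLift a b) := by
  intro s t hst
  have h := stairs_sub_le O.pos (by linarith [O.le_half]) (show s - a ≤ t - a by linarith)
  have hl := O.third_le
  simp only [quadLift]
  rcases le_or_gt (stairs (b - a) (t - a) - stairs (b - a) (s - a)) 0 with g | g
  · linarith
  · have := mul_le_mul_of_nonneg_right hl g.le
    linarith

theorem quadLift_add_int (t : ℝ) (n : ℤ) : quadLift a b (t + n) = quadLift a b t + 2 * n := by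
  rw [quadLift, show t + n - a = t - a + n by ring, stairs_add_int, quadLift]; ring

theorem quadLift_outer (O : OrbMajor a b) {t : ℝ} (h1 : b ≤ t) (h2 : t ≤ a + 1) :
    quadLift a b t = 3 * t - 1 := by
  rw [quadLift, stairs_of_mem O.pos (by linarith) (by linarith)]

theorem quadLift_mem (O : OrbMajor a b) {t : ℝ} (ht : t ∈ gapSet a b) :
    ∃ n : ℤ, quadLift a b t = 3 * t + n := by
  obtain ⟨m, h1, h2⟩ := position_mem ht
  have := O.quadLift_outer h1 h2
  rw [quadLift_add_int] at this
  exact ⟨m - 1, by push_cast; linarith⟩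

theorem quadLift_left (O : OrbMajor a b) : quadLift a b a = 3 * a := by
  have h := O.quadLift_outer (t := a + 1) (by linarith [O.le_half]) le_rfl
  have := quadLift_add_int (a := a) (b := b) a 1
  push_cast at this
  linarith

theorem quadLift_right (O : OrbMajor a b) : quadLift a b b = 3 * b - 1 :=
  O.quadLift_outer le_rfl (by linarith [O.le_half])

theorem exists_bound (O : OrbMajor a b) : ∃ C, ∀ t, |quadLift a b t - 2 * t| ≤ C := by
  refine ⟨|a| + 1, fun t => ?_⟩
  have h1 := Int.floor_add_fract (t - a)
  have h2 := Int.fract_nonneg (t - a)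
  have h3 := Int.fract_lt_one (t - a)
  have h4 := min_le_left 1 (Int.fract (t - a) / (b - a))
  have h5 : 0 ≤ min 1 (Int.fract (t - a) / (b - a)) :=
    le_min zero_le_one (div_nonneg h2 O.pos.le)
  have h6 := le_abs_self a
  have h7 := neg_abs_le a
  rw [quadLift, stairs, abs_le]
  constructor <;> linarith

theorem summable_quad (O : OrbMajor a b) (t : ℝ) : Summable fun n : ℕ =>
    (quadLift a b ((quadLift a b)^[n] t) - 2 * (quadLift a b)^[n] t) / 2 ^ (n + 1) := by
  obtain ⟨C, hC⟩ := O.exists_bound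
  refine Summable.of_norm_bounded (g := fun n : ℕ => C / 2 * (1 / 2) ^ n)
    (summable_geometric_two.mul_left _) fun n => ?_
  rw [norm_div, Real.norm_eq_abs, norm_pow, Real.norm_eq_abs, abs_of_pos (by norm_num : (0 : ℝ) < 2)]
  calc _ ≤ C / 2 ^ (n + 1) := div_le_div_of_nonneg_right (hC _) (by positivity)
    _ = _ := by rw [pow_succ, div_pow, one_pow]; field_simp

theorem continuous_quadMap (O : OrbMajor a b) : Continuous (quadMap a b) := by
  obtain ⟨C, hC⟩ := O.exists_bound
  refine continuous_id.add (continuous_tsum (u := fun n : ℕ => C / 2 * (1 / 2) ^ n) ?_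
    (summable_geometric_two.mul_left _) fun n t => ?_)
  · intro n
    have := O.continuous_quadLift.iterate n
    have h2 := O.continuous_quadLift.comp this
    exact (h2.sub (continuous_const.mul this)).div_const _
  · rw [norm_div, Real.norm_eq_abs, norm_pow, Real.norm_eq_abs, abs_of_pos (by norm_num : (0 : ℝ) < 2)]
    calc _ ≤ C / 2 ^ (n + 1) := div_le_div_of_nonneg_right (hC _) (by positivity)
      _ = _ := by rw [pow_succ, div_pow, one_pow]; field_simp

/-- The defining series telescopes to the normalised iterates. Monotonicity, periodicity and the
conjugation to doubling are then read off from the limit. -/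
theorem tendsto_quadMap (O : OrbMajor a b) (t : ℝ) :
    Filter.Tendsto (fun n : ℕ => (quadLift a b)^[n] t / 2 ^ n) Filter.atTop (nhds (quadMap a b t)) := by
  have h := ((O.summable_quad t).hasSum.tendsto_sum_nat).const_add t
  refine h.congr fun n => ?_
  induction n with
  | zero => simp
  | succ n ih =>
    rw [Finset.sum_range_succ, ← add_assoc, ih, Function.iterate_succ_apply', pow_succ]
    field_simp
    ring

theorem monotone_quadMap (O : OrbMajor a b) : Monotone (quadMap a b) := fun s t hst =>
  le_of_tendsto_of_tendsto' (O.tendsto_quadMap s) (O.tendsto_quadMap t) fun n =>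
    div_le_div_of_nonneg_right (O.monotone_quadLift.iterate n hst) (by positivity)

theorem iterate_quadLift_add_int (t : ℝ) (m : ℤ) (n : ℕ) :
    (quadLift a b)^[n] (t + m) = (quadLift a b)^[n] t + 2 ^ n * m := by
  induction n with
  | zero => simp
  | succ n ih =>
    rw [Function.iterate_succ_apply', ih, Function.iterate_succ_apply']
    have := quadLift_add_int (a := a) (b := b) ((quadLift a b)^[n] t) (2 ^ n * m)
    push_cast at this
    rw [this, pow_succ]; ring

theorem quadMap_add_int (O : OrbMajor a b) (t : ℝ) (m : ℤ) :
    quadMap a b (t + m) = quadMap a b t + m := by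
  refine tendsto_nhds_unique (O.tendsto_quadMap (t + m))
    (((O.tendsto_quadMap t).add_const (m : ℝ)).congr fun n => ?_)
  rw [iterate_quadLift_add_int]
  field_simp

theorem quadMap_quadLift (O : OrbMajor a b) (t : ℝ) :
    quadMap a b (quadLift a b t) = 2 * quadMap a b t := by
  have h := ((Filter.tendsto_add_atTop_iff_nat 1).2 (O.tendsto_quadMap t)).const_mul 2
  refine tendsto_nhds_unique (O.tendsto_quadMap _) (h.congr fun n => ?_)
  rw [Function.iterate_succ_apply, pow_succ]
  field_simp

theorem quadMap_three (O : OrbMajor a b) {t : ℝ} (ht : t ∈ gapSet a b) :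
    ∃ n : ℤ, quadMap a b (3 * t) = 2 * quadMap a b t + n := by
  obtain ⟨n, hn⟩ := O.quadLift_mem ht
  refine ⟨-n, ?_⟩
  have h := O.quadMap_quadLift t
  rw [hn, O.quadMap_add_int] at h
  push_cast; linarith

/-- The arc [b, a + 1] is longer than 1/3, so its triple covers a whole period, and preimages in it
stay in the gap. -/
theorem exists_preimage (O : OrbMajor a b) {t : ℝ} (ht : t ∈ gapSet a b) :
    ∃ s ∈ gapSet a b, ∃ n : ℤ, 3 * s = t + n := by
  have h1 := Int.le_ceil (3 * b - t)
  have h2 := Int.ceil_lt_add_one (3 * b - t)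
  have e : 3 * ((t + ⌈3 * b - t⌉) / 3) = t + ⌈3 * b - t⌉ := by ring
  refine ⟨(t + ⌈3 * b - t⌉) / 3, mem_of_three (by linarith) (by linarith [O.le_half]) ?_, _, e⟩
  rw [e]
  exact gapSet_add_int _ ht _

/-- The image of the major is a point or a hole. -/
structure ImageHole (a b : ℝ) : Prop extends OrbMajor a b where
  image : b = a + 1 / 3 ∨ RHole (gapSet a b) (3 * a) (3 * b - 1)

/-- The major is sent to a point or a hole by assumption, and the other holes, which lie where
`quadLift` is 3 * t - 1 up to translation, are handled by `hole_three`. -/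
theorem ImageHole.map (O : ImageHole a b) (h : RHole (gapSet a b) c d) :
    quadLift a b c = quadLift a b d ∨ RHole (gapSet a b) (quadLift a b c) (quadLift a b d) := by
  obtain ⟨m, ⟨h1, h2⟩ | ⟨h1, h2⟩⟩ := O.hole_position h
  · have e1 := quadLift_add_int (a := a) (b := b) c m
    have e2 := quadLift_add_int (a := a) (b := b) d m
    rw [h1, O.quadLift_left] at e1
    rw [h2, O.quadLift_right] at e2
    rcases O.image with g | g
    · left; linarith
    · right
      have := g.shift gapSet_add_int (-2 * m)
      push_cast at this
      convert this using 1 <;> linarith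
  · right
    have h' := h.shift gapSet_add_int m
    have e1 := quadLift_add_int (a := a) (b := b) c m
    have e2 := quadLift_add_int (a := a) (b := b) d m
    have := h'.2.2.1
    rw [O.quadLift_outer h1 (by linarith)] at e1
    rw [O.quadLift_outer (by linarith) h2] at e2
    have := (O.hole_three h' h1 h2).shift gapSet_add_int (-1 - 2 * m)
    push_cast at this
    convert this using 1 <;> linarith

/-- All iterated images of a hole have length at most one, which becomes negligible after division
by 2 ^ n. -/
theorem ImageHole.quadMap_eq (O : ImageHole a b) (h : RHole (gapSet a b) c d) {t : ℝ} (h1 : c ≤ t)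
    (h2 : t ≤ d) : quadMap a b t = quadMap a b c := by
  have hn : ∀ n : ℕ, (quadLift a b)^[n] c = (quadLift a b)^[n] d ∨
      RHole (gapSet a b) ((quadLift a b)^[n] c) ((quadLift a b)^[n] d) := by
    intro n
    induction n with
    | zero => exact Or.inr h
    | succ n ih =>
      rw [Function.iterate_succ_apply', Function.iterate_succ_apply']
      rcases ih with g | g
      · left; rw [g]
      · exact O.map g
  have hd : quadMap a b d ≤ quadMap a b c := by
    have h0 : Filter.Tendsto (fun n : ℕ => (quadLift a b)^[n] c / 2 ^ n + (1 / 2) ^ n) Filter.atTop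
        (nhds (quadMap a b c + 0)) :=
      (O.tendsto_quadMap c).add (tendsto_pow_atTop_nhds_zero_of_lt_one (by norm_num) (by norm_num))
    rw [add_zero] at h0
    refine le_of_tendsto_of_tendsto' (O.tendsto_quadMap d) h0 fun n => ?_
    have : (quadLift a b)^[n] d ≤ (quadLift a b)^[n] c + 1 := by
      rcases hn n with g | g
      · rw [g]; linarith
      · linarith [g.2.2.2.1]
    rw [div_pow, one_pow, ← add_div]
    exact div_le_div_of_nonneg_right this (by positivity)
  exact le_antisymm ((O.monotone_quadMap h2).trans hd) (O.monotone_quadMap h1)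

theorem ImageHole.three (O : ImageHole a b) (h : RHole (gapSet a b) c d) :
    ∃ n : ℤ, 3 * d + n = 3 * c ∨ RHole (gapSet a b) (3 * c) (3 * d + n) := by
  obtain ⟨i, hi⟩ := O.quadLift_mem h.1
  obtain ⟨j, hj⟩ := O.quadLift_mem h.2.1
  refine ⟨j - i, ?_⟩
  rcases O.map h with g | g
  · left; push_cast; linarith
  · right
    rw [hi, hj] at g
    have := g.shift gapSet_add_int (-i)
    convert this using 1 <;> push_cast <;> ring

end OrbMajor

theorem CritMajor.imageHole {a b : ℝ} (C : CritMajor a b) : OrbMajor.ImageHole a b :=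
  ⟨C.orbMajor, Or.inl C.1⟩

/-- For k = 1 the image of the major is a translate of the major; otherwise it is the first image of
a branch, a hole by `branch_hole`. -/
theorem PerMajor.imageHole {a b : ℝ} {k : ℕ} (P : PerMajor a b k) (hab : a < b)
    (hab2 : b - a ≤ 1 / 2) : OrbMajor.ImageHole a b := by
  have O := P.orbMajor hab hab2
  refine ⟨O, Or.inr ?_⟩
  have hk := P.1
  rcases eq_or_lt_of_le (show 1 ≤ k from hk) with rfl | hk
  · obtain ⟨j, hj⟩ := P.2.1
    have hl := P.2.2.1
    rw [pow_one] at hj hl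
    have := O.major_hole.shift gapSet_add_int j
    convert this using 1; linarith
  · have := (Major.branch_hole O P one_pos hk).1
    rw [pow_one] at this
    convert this using 1
    ring


/-! ### The dictionary between the circle and the line -/

/-- The point of the circle with angle `t + p`. -/
noncomputable def ang (p t : ℝ) : UnitAddCircle := ((t + p : ℝ) : UnitAddCircle)

/-- The real numbers that represent the points of `A`. -/
def liftSet (p : ℝ) (A : Set UnitAddCircle) : Set ℝ := {t | ang p t ∈ A}

section Angles

variable {p c d s t : ℝ} {A : Set UnitAddCircle}

theorem ang_surj (p : ℝ) (x : UnitAddCircle) : ∃ t, ang p t = x := by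
  obtain ⟨t, rfl⟩ := QuotientAddGroup.mk_surjective x
  exact ⟨t - p, by simp only [ang, sub_add_cancel]⟩

theorem ang_eq_iff : ang p s = ang p t ↔ ∃ n : ℤ, t = s + n := by
  have h : ang p t - ang p s = ((t - s : ℝ) : UnitAddCircle) := by
    rw [ang, ang, ← AddCircle.coe_sub]; congr 1; ring
  rw [eq_comm, ← sub_eq_zero, h, AddCircle.coe_eq_zero_iff]
  constructor
  · rintro ⟨n, hn⟩; exact ⟨n, by simp at hn; linarith⟩
  · rintro ⟨n, hn⟩; exact ⟨n, by simp; linarith⟩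

theorem ang_add_int (p t : ℝ) (n : ℤ) : ang p (t + n) = ang p t := (ang_eq_iff.2 ⟨n, rfl⟩).symm

theorem continuous_ang : Continuous (ang p) :=
  (AddCircle.continuous_mk' 1).comp (by fun_prop)

theorem liftSet_add_int : ∀ t ∈ liftSet p A, ∀ m : ℤ, t + m ∈ liftSet p A := fun t ht m => by
  simpa only [liftSet, Set.mem_ofPred_eq, ang_add_int] using ht

theorem liftSet_image {B : Set ℝ} (hB : ∀ t ∈ B, ∀ m : ℤ, t + m ∈ B) :
    liftSet p (ang p '' B) = B := by
  ext t
  constructor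
  · rintro ⟨s, hs, h⟩
    obtain ⟨n, rfl⟩ := ang_eq_iff.1 h
    exact hB s hs n
  · exact fun ht => ⟨t, ht, rfl⟩

theorem image_liftSet : ang p '' liftSet p A = A := by
  ext x
  constructor
  · rintro ⟨t, ht, rfl⟩; exact ht
  · intro hx
    obtain ⟨t, rfl⟩ := ang_surj p x
    exact ⟨t, hx, rfl⟩

theorem isClosed_image {B : Set ℝ} (hc : IsClosed B) (hB : ∀ t ∈ B, ∀ m : ℤ, t + m ∈ B) :
    IsClosed (ang p '' B) := by
  have hq : Topology.IsQuotientMap (ang p) :=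
    (QuotientAddGroup.isOpenQuotientMap_mk.isQuotientMap).comp (Homeomorph.addRight p).isQuotientMap
  rw [← hq.isClosed_preimage]
  convert hc using 1
  exact liftSet_image hB

theorem mem_cIcc_ang (h1 : c < d) (h2 : d ≤ c + 1) :
    ang p t ∈ Set.cIcc (ang p c) (ang p d) ↔ ∃ m : ℤ, c ≤ t + m ∧ t + m ≤ d := by
  rw [Set.mem_cIcc]
  simp only [ang]
  have hbtw := @QuotientAddGroup.btw_coe_iff ℝ _ _ _ _ (1 : ℝ) _ (c + p) (t + p) (d + p)
  refine hbtw.trans ?_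
  have e1 : toIocMod (one_pos : (0 : ℝ) < 1) (c + p) (d + p) = d + p :=
    (toIocMod_eq_iff _).2 ⟨⟨by linarith, by linarith⟩, 0, by simp⟩
  obtain ⟨e2, z, e3⟩ := (toIcoMod_eq_iff (one_pos : (0 : ℝ) < 1) (a := c + p) (b := t + p)).1 rfl
  rw [e1]
  set y := toIcoMod (one_pos : (0 : ℝ) < 1) (c + p) (t + p)
  simp only [mul_one, zsmul_eq_mul] at e3
  constructor
  · intro h
    exact ⟨-z, by push_cast; linarith [e2.1], by push_cast; linarith⟩
  · rintro ⟨m, g1, g2⟩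
    by_contra h
    rw [not_le] at h
    have k1 : ((m + z : ℤ) : ℝ) < 0 := by push_cast; linarith
    have k2 : (-1 : ℝ) < ((m + z : ℤ) : ℝ) := by push_cast; linarith [e2.2]
    have k1' : m + z < 0 := by exact_mod_cast k1
    have k2' : -1 < m + z := by exact_mod_cast k2
    omega

/-- The open arc is the complement of the closed arc from d to c + 1. -/
theorem mem_cIoo_ang (h1 : c < d) (h2 : d < c + 1) :
    ang p t ∈ Set.cIoo (ang p c) (ang p d) ↔ ∃ m : ℤ, c < t + m ∧ t + m < d := by
  rw [Set.mem_cIoo, sbtw_iff_not_btw, ← Set.mem_cIcc, ← ang_add_int p c 1, mem_cIcc_ang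
    (by push_cast; linarith) (by push_cast; linarith)]
  push_cast
  constructor
  · intro h
    obtain ⟨m, hm | hm⟩ := OrbMajor.position c d t
    · exact ⟨m, hm⟩
    · exact (h ⟨m, hm⟩).elim
  · rintro ⟨m, g1, g2⟩ ⟨n, g3, g4⟩
    exact Int.cast_between_false (n := n - m) 0 (by push_cast; linarith) (by push_cast; linarith)

theorem isHole_ang : IsHole A (ang p s) (ang p t) ↔ ∃ n : ℤ, RHole (liftSet p A) s (t + n) := by
  constructor
  · rintro ⟨h1, h2, h3, h4⟩
    have f1 := Int.floor_le (t - s)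
    have f2 := Int.lt_floor_add_one (t - s)
    set n := ⌊t - s⌋
    have hne : s ≠ t - n := fun he => h3 (ang_eq_iff.2 ⟨n, by linarith⟩)
    have hlt : s < t + (-n : ℤ) := by
      push_cast; exact lt_of_le_of_ne (by linarith) (by rw [← sub_eq_add_neg]; exact hne)
    have hlt2 : t + (-n : ℤ) < s + 1 := by push_cast; linarith
    refine ⟨-n, h1, liftSet_add_int t h2 (-n), hlt, hlt2, fun x g1 g2 hx => ?_⟩
    have hm := (mem_cIoo_ang (p := p) hlt hlt2).2 ⟨0, (by simpa using g1 : s < x + _), by simpa using g2⟩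
    rw [ang_add_int p t (-n)] at hm
    exact Set.disjoint_left.1 h4 hm hx
  · rintro ⟨n, h1, h2, h3, h4, h5⟩
    rw [← ang_add_int p t n]
    refine ⟨h1, h2, fun he => ?_, Set.disjoint_left.2 fun x hx hxA => ?_⟩
    · obtain ⟨m, hm⟩ := ang_eq_iff.1 he
      exact Int.cast_between_false (n := m) 0 (by push_cast; linarith) (by push_cast; linarith)
    · obtain ⟨y, rfl⟩ := ang_surj p x
      obtain ⟨m, g1, g2⟩ := (mem_cIoo_ang h3 h4).1 hx
      exact h5 _ g1 g2 (liftSet_add_int y hxA m)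

theorem isEdge_ang : IsEdge A (ang p s) (ang p t) ↔ REdge (liftSet p A) s t := by
  rw [IsEdge, isHole_ang, isHole_ang, ← exists_or]; rfl

/-- The hypothesis says that p is fixed by tripling modulo one, so angles measured from p are still
tripled. -/
theorem sig_ang {i : ℤ} (hp : 2 * p = i) (t : ℝ) : sig (ang p t) = ang p (3 * t) := by
  have : sig (ang p t) = ang p (3 * t + i) := by
    rw [sig, ang, ang, ← AddCircle.coe_nsmul]
    congr 1
    rw [← hp, nsmul_eq_mul]; push_cast; ring
  rw [this, ang_add_int]

theorem iterate_sig_ang {i : ℤ} (hp : 2 * p = i) (n : ℕ) (t : ℝ) :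
    sig^[n] (ang p t) = ang p (3 ^ n * t) := by
  induction n with
  | zero => simp
  | succ n ih => rw [Function.iterate_succ_apply', ih, sig_ang hp, pow_succ', mul_assoc]

end Angles

/-! ### Chords and half-planes in the disk -/

section Plane

variable {p c d s t : ℝ}

/-- The affine function that vanishes on the chord with endpoints of angles `c + p` and `d + p`, and
is positive on the side of the arc `(c, d)`. -/
noncomputable def sideFn (p c d : ℝ) (z : ℂ) : ℝ :=
  z.re * Real.cos (Real.pi * (c + d) + 2 * Real.pi * p) +
    z.im * Real.sin (Real.pi * (c + d) + 2 * Real.pi * p) - Real.cos (Real.pi * (d - c))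

theorem pt_re (p t : ℝ) : (pt (ang p t)).re = Real.cos (2 * Real.pi * (t + p)) := by
  rw [pt, ang, AddCircle.toCircle_apply_mk, div_one, Circle.coe_exp, Complex.exp_ofReal_mul_I_re]

theorem pt_im (p t : ℝ) : (pt (ang p t)).im = Real.sin (2 * Real.pi * (t + p)) := by
  rw [pt, ang, AddCircle.toCircle_apply_mk, div_one, Circle.coe_exp, Complex.exp_ofReal_mul_I_im]

theorem norm_pt (x : UnitAddCircle) : ‖pt x‖ = 1 := Circle.norm_coe _

theorem pt_injective : Function.Injective pt := fun _ _ h =>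
  AddCircle.injective_toCircle one_ne_zero (Circle.coe_injective h)

/-- This form shows that the sign depends only on how the distance of t to the midpoint of the arc
compares with half its length. -/
theorem sideFn_pt (p c d t : ℝ) : sideFn p c d (pt (ang p t)) =
    Real.cos (Real.pi * (2 * t - c - d)) - Real.cos (Real.pi * (d - c)) := by
  rw [sideFn, pt_re, pt_im, ← Real.cos_sub]
  congr 2
  ring

theorem continuous_sideFn : Continuous (sideFn p c d) := by
  unfold sideFn; fun_prop

theorem sideFn_combo {x y : ℝ} (hxy : x + y = 1) (z w : ℂ) :
    sideFn p c d (x • z + y • w) = x * sideFn p c d z + y * sideFn p c d w := by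
  obtain rfl : y = 1 - x := by linarith
  simp only [sideFn, Complex.add_re, Complex.add_im, Complex.real_smul, Complex.mul_re,
    Complex.mul_im, Complex.ofReal_re, Complex.ofReal_im]
  ring

theorem sideFn_left : sideFn p c d (pt (ang p c)) = 0 := by
  rw [sideFn_pt, show Real.pi * (2 * c - c - d) = -(Real.pi * (d - c)) by ring, Real.cos_neg, sub_self]

theorem sideFn_right : sideFn p c d (pt (ang p d)) = 0 := by
  rw [sideFn_pt, show Real.pi * (2 * d - c - d) = Real.pi * (d - c) by ring, sub_self]

theorem sideFn_pos (h2 : d ≤ c + 1) (g1 : c < t) (g2 : t < d) :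
    0 < sideFn p c d (pt (ang p t)) := by
  rw [sideFn_pt, sub_pos, ← Real.cos_abs (Real.pi * (2 * t - c - d))]
  have hpi := Real.pi_pos
  refine Real.cos_lt_cos_of_nonneg_of_le_pi (abs_nonneg _) (by nlinarith) ?_
  rw [abs_lt]
  constructor <;> nlinarith

theorem sideFn_neg (h1 : c ≤ d) (g1 : d < t) (g2 : t < c + 1) :
    sideFn p c d (pt (ang p t)) < 0 := by
  rw [sideFn_pt, sub_neg]
  have hpi := Real.pi_pos
  have e : Real.cos (Real.pi * (2 * t - c - d)) = Real.cos |Real.pi * (2 * t - c - d) - Real.pi * 1| * -1 := by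
    rw [Real.cos_abs, mul_one, Real.cos_sub_pi]; ring
  have e2 : Real.cos (Real.pi * (d - c)) = Real.cos (Real.pi * (1 - (d - c))) * -1 := by
    rw [show Real.pi * (1 - (d - c)) = Real.pi - Real.pi * (d - c) by ring, Real.cos_pi_sub]; ring
  rw [e, e2]
  have : Real.cos (Real.pi * (1 - (d - c))) < Real.cos |Real.pi * (2 * t - c - d) - Real.pi * 1| := by
    refine Real.cos_lt_cos_of_nonneg_of_le_pi (abs_nonneg _) (by nlinarith) ?_
    rw [abs_lt]
    constructor <;> nlinarith
  linarith

theorem sideFn_nonpos (h1 : c < d) (g1 : d ≤ t) (g2 : t ≤ c + 1) :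
    sideFn p c d (pt (ang p t)) ≤ 0 := by
  rcases eq_or_lt_of_le g1 with rfl | g1
  · rw [sideFn_right]
  rcases eq_or_lt_of_le g2 with rfl | g2
  · have := ang_add_int p c 1
    push_cast at this
    rw [this, sideFn_left]
  exact (sideFn_neg h1.le g1 g2).le

theorem sideFn_nonneg (h2 : d ≤ c + 1) (g1 : c ≤ t) (g2 : t ≤ d) :
    0 ≤ sideFn p c d (pt (ang p t)) := by
  rcases eq_or_lt_of_le g1 with rfl | g1
  · rw [sideFn_left]
  rcases eq_or_lt_of_le g2 with rfl | g2
  · rw [sideFn_right]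
  exact (sideFn_pos h2 g1 g2).le

theorem convex_sideFn_nonpos : Convex ℝ {z | sideFn p c d z ≤ 0} := by
  intro z hz w hw x y hx hy hxy
  simp only [Set.mem_ofPred_eq] at *
  rw [sideFn_combo hxy]
  nlinarith

theorem convex_sideFn_nonneg : Convex ℝ {z | 0 ≤ sideFn p c d z} := by
  intro z hz w hw x y hx hy hxy
  simp only [Set.mem_ofPred_eq] at *
  rw [sideFn_combo hxy]
  nlinarith [mul_nonneg hx hz, mul_nonneg hy hw]

theorem convex_sideFn_pos : Convex ℝ {z | 0 < sideFn p c d z} := by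
  intro z hz w hw x y hx hy hxy
  simp only [Set.mem_ofPred_eq] at *
  rw [sideFn_combo hxy]
  rcases eq_or_lt_of_le hx with rfl | hx
  · obtain rfl : y = 1 := by linarith
    simpa using hw
  · nlinarith [mul_pos hx hz, mul_nonneg hy hw.le]

/-- Linked chords meet. -/
theorem chords_meet {u v : ℝ} (h1 : s < u) (h2 : u < t) (h3 : t < v) (h4 : v < s + 1) :
    ∃ z, z ∈ openSegment ℝ (pt (ang p s)) (pt (ang p t)) ∧
      z ∈ openSegment ℝ (pt (ang p u)) (pt (ang p v)) := by
  have p1 : 0 < sideFn p s t (pt (ang p u)) := sideFn_pos (by linarith) h1 h2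
  have p2 : sideFn p s t (pt (ang p v)) < 0 := sideFn_neg (by linarith) h3 h4
  have p3 : 0 < sideFn p u v (pt (ang p t)) := sideFn_pos (by linarith) h2 h3
  have p4 : sideFn p u v (pt (ang p s)) < 0 := by
    have := ang_add_int p s 1
    push_cast at this
    rw [← this]
    exact sideFn_neg (by linarith) h4 (by linarith)
  set α := sideFn p s t (pt (ang p u))
  set β := sideFn p s t (pt (ang p v))
  set γ := sideFn p u v (pt (ang p t))
  set δ := sideFn p u v (pt (ang p s))
  have q1 : 0 < α - β := by linarith
  have q2 : 0 < γ - δ := by linarith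
  have w1 : -β / (α - β) + α / (α - β) = 1 := by field_simp; ring
  have w2 : γ / (γ - δ) + -δ / (γ - δ) = 1 := by field_simp; ring
  set z := (-β / (α - β)) • pt (ang p u) + (α / (α - β)) • pt (ang p v) with hz
  set w := (γ / (γ - δ)) • pt (ang p s) + (-δ / (γ - δ)) • pt (ang p t) with hw
  have z1 : sideFn p s t z = 0 := by
    rw [hz, sideFn_combo w1]
    change -β / (α - β) * α + α / (α - β) * β = 0
    ring
  have z2 : sideFn p u v z = 0 := by rw [hz, sideFn_combo w1, sideFn_left, sideFn_right]; ring
  have y1 : sideFn p u v w = 0 := by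
    rw [hw, sideFn_combo w2]
    change γ / (γ - δ) * δ + -δ / (γ - δ) * γ = 0
    ring
  have y2 : sideFn p s t w = 0 := by rw [hw, sideFn_combo w2, sideFn_left, sideFn_right]; ring
  -- Each chord has a point on the line of the other, with weights given by the opposite signs at
  -- its ends. The two lines are not parallel, so both points are their unique intersection.
  have hdet : 0 < Real.sin (Real.pi * (u + v) + 2 * Real.pi * p - (Real.pi * (s + t) + 2 * Real.pi * p)) := by
    have hpi := Real.pi_pos
    refine Real.sin_pos_of_pos_of_lt_pi ?_ ?_ <;> nlinarith
  rw [Real.sin_sub] at hdet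
  have hzw : z = w := by
    simp only [sideFn] at z1 z2 y1 y2
    set A := Real.cos (Real.pi * (s + t) + 2 * Real.pi * p)
    set B := Real.sin (Real.pi * (s + t) + 2 * Real.pi * p)
    set C := Real.cos (Real.pi * (u + v) + 2 * Real.pi * p)
    set D := Real.sin (Real.pi * (u + v) + 2 * Real.pi * p)
    have e1 : (z.re - w.re) * A + (z.im - w.im) * B = 0 := by linarith
    have e2 : (z.re - w.re) * C + (z.im - w.im) * D = 0 := by linarith
    apply Complex.ext
    · have : (z.re - w.re) * (D * A - C * B) = 0 := by linear_combination D * e1 - B * e2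
      rcases mul_eq_zero.1 this with h | h
      · linarith
      · exact (hdet.ne' h).elim
    · have : (z.im - w.im) * (D * A - C * B) = 0 := by linear_combination A * e2 - C * e1
      rcases mul_eq_zero.1 this with h | h
      · linarith
      · exact (hdet.ne' h).elim
  refine ⟨z, hzw ▸ ⟨_, _, div_pos p3 q2, div_pos (by linarith) q2, w2, rfl⟩,
    ⟨_, _, div_pos (by linarith) q1, div_pos p1 q1, w1, rfl⟩⟩

end Plane


section Plane

variable {p c d : ℝ}

/-- A point of the disk on the line through two points of the circle is on their chord. -/
theorem mem_chord_of_sideFn_eq_zero (h1 : c < d) (h2 : d < c + 1) {z : ℂ} (hz : ‖z‖ ≤ 1)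
    (h : sideFn p c d z = 0) : z ∈ chord (ang p c) (ang p d) := by
  have hpi := Real.pi_pos
  set α := Real.pi * (c + d) + 2 * Real.pi * p with hα
  set β := Real.pi * (d - c) with hβ
  have hs : 0 < Real.sin β := Real.sin_pos_of_pos_of_lt_pi (by nlinarith) (by nlinarith)
  have e1 : z.re * Real.cos α + z.im * Real.sin α = Real.cos β := by
    simp only [sideFn] at h; linarith
  -- The coordinate along the line of the chord. In the disk it is bounded by sin β, half the length
  -- of the chord.
  set y := z.im * Real.cos α - z.re * Real.sin α with hy
  have t1 := Real.sin_sq_add_cos_sq α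
  have t2 := Real.sin_sq_add_cos_sq β
  have hn : z.re ^ 2 + z.im ^ 2 ≤ 1 := by
    have := Complex.sq_norm z
    rw [Complex.normSq_apply] at this
    nlinarith [norm_nonneg z]
  have hid : z.re ^ 2 + z.im ^ 2 = Real.cos β ^ 2 + y ^ 2 := by
    rw [← e1, hy]
    linear_combination (-z.re ^ 2 - z.im ^ 2) * t1
  have hyb : |y| ≤ Real.sin β := abs_le_of_sq_le_sq (by linarith) hs.le
  obtain ⟨y1, y2⟩ := abs_le.1 hyb
  have r1 : z.re = Real.cos β * Real.cos α - y * Real.sin α := by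
    rw [← e1, hy]; linear_combination (-z.re) * t1
  have r2 : z.im = Real.cos β * Real.sin α + y * Real.cos α := by
    rw [← e1, hy]; linear_combination (-z.im) * t1
  refine ⟨(Real.sin β - y) / (2 * Real.sin β), (Real.sin β + y) / (2 * Real.sin β),
    div_nonneg (by linarith) (by linarith), div_nonneg (by linarith) (by linarith),
    by field_simp; ring, ?_⟩
  apply Complex.ext
  · simp only [Complex.add_re, Complex.real_smul, Complex.mul_re, Complex.ofReal_re,
      Complex.ofReal_im, zero_mul, sub_zero, pt_re]
    rw [show 2 * Real.pi * (c + p) = α - β by rw [hα, hβ]; ring,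
      show 2 * Real.pi * (d + p) = α + β by rw [hα, hβ]; ring, Real.cos_sub α β, Real.cos_add α β, r1]
    field_simp
    ring
  · simp only [Complex.add_im, Complex.real_smul, Complex.mul_im, Complex.ofReal_re,
      Complex.ofReal_im, zero_mul, add_zero, pt_im]
    rw [show 2 * Real.pi * (c + p) = α - β by rw [hα, hβ]; ring,
      show 2 * Real.pi * (d + p) = α + β by rw [hα, hβ]; ring, Real.sin_sub α β, Real.sin_add α β, r2]
    field_simp
    ring

/-- Every line through a point of the open disk is the line of a chord. -/
theorem exists_sideFn (p : ℝ) (f : ℂ →L[ℝ] ℝ) (hf : f ≠ 0) {w : ℂ} (hw : ‖w‖ < 1) :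
    ∃ c d ρ, 0 < ρ ∧ c < d ∧ d < c + 1 ∧ ∀ z, f z - f w = ρ * sideFn p c d z := by
  have hpi := Real.pi_pos
  have hfz : ∀ z : ℂ, f z = z.re * f 1 + z.im * f Complex.I := by
    intro z
    conv_lhs => rw [← Complex.re_add_im z]
    rw [map_add, show (z.re : ℂ) = z.re • (1 : ℂ) by simp,
      show (z.im : ℂ) * Complex.I = z.im • Complex.I by simp, map_smul, map_smul, smul_eq_mul,
      smul_eq_mul]
  set v : ℂ := ⟨f 1, f Complex.I⟩ with hv
  have hv0 : v ≠ 0 := by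
    intro h
    have h1 : f 1 = 0 := by simpa using congrArg Complex.re h
    have h2 : f Complex.I = 0 := by simpa using congrArg Complex.im h
    exact hf (ContinuousLinearMap.ext fun z => by rw [hfz, h1, h2]; simp)
  have hρ : 0 < ‖v‖ := norm_pos_iff.2 hv0
  have hfw : |f w| < ‖v‖ := by
    have e : f w = (w * (starRingEnd ℂ) v).re := by rw [hfz]; simp [hv]
    rw [e]
    refine (Complex.abs_re_le_norm _).trans_lt ?_
    rw [norm_mul, Complex.norm_conj]
    nlinarith
  obtain ⟨m1, m2⟩ := abs_lt.1 hfw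
  set x := f w / ‖v‖
  have x1 : -1 < x := by rw [lt_div_iff₀ hρ]; linarith
  have x2 : x < 1 := by rw [div_lt_iff₀ hρ]; linarith
  -- The line is at signed distance x = cos β from the origin with normal direction v, so it cuts
  -- the circle at the angles arg v ± β.
  set β := Real.arccos x
  have b1 : 0 < β := Real.arccos_pos.2 x2
  have b2 : β < Real.pi := lt_of_le_of_ne (Real.arccos_le_pi x) fun he => by
    have := Real.arccos_eq_pi.1 he
    linarith
  have hcos : Real.cos β = x := Real.cos_arccos x1.le x2.le
  have l1 : 0 < β / Real.pi := div_pos b1 hpi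
  have l2 : β / Real.pi < 1 := by rw [div_lt_iff₀ hpi]; linarith
  refine ⟨(v.arg / Real.pi - 2 * p - β / Real.pi) / 2, (v.arg / Real.pi - 2 * p + β / Real.pi) / 2,
    ‖v‖, hρ, by linarith, by linarith, fun z => ?_⟩
  have e1 : Real.pi * ((v.arg / Real.pi - 2 * p - β / Real.pi) / 2 +
      (v.arg / Real.pi - 2 * p + β / Real.pi) / 2) + 2 * Real.pi * p = v.arg := by
    field_simp; ring
  have e2 : Real.pi * ((v.arg / Real.pi - 2 * p + β / Real.pi) / 2 -
      (v.arg / Real.pi - 2 * p - β / Real.pi) / 2) = β := by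
    field_simp; ring
  rw [sideFn, e1, e2, hcos, hfz z]
  have c1 : ‖v‖ * Real.cos v.arg = f 1 := Complex.norm_mul_cos_arg v
  have c2 : ‖v‖ * Real.sin v.arg = f Complex.I := Complex.norm_mul_sin_arg v
  have c3 : ‖v‖ * x = f w := mul_div_cancel₀ _ hρ.ne'
  linear_combination (-z.re) * c1 - z.im * c2 + c3

/-- From a zero one could move inside K along the unit normal, in which direction the function grows
at unit rate. -/
theorem sideFn_neg_of_mem_interior {K : Set ℂ} (hK : ∀ z ∈ K, sideFn p c d z ≤ 0) {z : ℂ}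
    (hz : z ∈ interior K) : sideFn p c d z < 0 := by
  refine lt_of_le_of_ne (hK z (interior_subset hz)) fun h0 => ?_
  set α := Real.pi * (c + d) + 2 * Real.pi * p with hα
  set v : ℂ := ⟨Real.cos α, Real.sin α⟩ with hv
  have hcont : Continuous fun e : ℝ => z + e • v := by fun_prop
  have hev : ∀ᶠ e in nhds (0 : ℝ), z + e • v ∈ interior K :=
    hcont.continuousAt.eventually_mem (by simpa using isOpen_interior.mem_nhds hz)
  obtain ⟨ε, hε, h⟩ := Metric.eventually_nhds_iff.1 hev
  have h1 := hK _ (interior_subset (h (y := ε / 2) (by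
    rw [Real.dist_eq, sub_zero, abs_of_pos (by linarith)]; linarith)))
  have h2 : sideFn p c d (z + (ε / 2) • v) = sideFn p c d z + ε / 2 := by
    have := Real.sin_sq_add_cos_sq α
    simp only [sideFn, hv, Complex.add_re, Complex.add_im, Complex.real_smul, Complex.mul_re,
      Complex.mul_im, Complex.ofReal_re, Complex.ofReal_im, ← hα]
    linear_combination (ε / 2) * this
  linarith

end Plane

/-! ### Convex hulls and gaps -/

theorem hull_subset_closedBall (A : Set UnitAddCircle) : hull A ⊆ Metric.closedBall 0 1 :=
  convexHull_min (by
    rintro _ ⟨x, -, rfl⟩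
    simp [norm_pt]) (convex_closedBall _ _)

theorem interior_hull_subset_ball (A : Set UnitAddCircle) : interior (hull A) ⊆ Metric.ball 0 1 := by
  have := interior_mono (hull_subset_closedBall A)
  rwa [interior_closedBall _ one_ne_zero] at this

/-- Three distinct points of a circle are affinely independent. -/
theorem interior_hull_nonempty {A : Set UnitAddCircle} {x y z : UnitAddCircle} (hx : x ∈ A)
    (hy : y ∈ A) (hz : z ∈ A) (hxy : x ≠ y) (hxz : x ≠ z) (hyz : y ≠ z) :
    (interior (hull A)).Nonempty := by
  have hcos : EuclideanGeometry.Cospherical ({pt x, pt y, pt z} : Set ℂ) :=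
    ⟨0, 1, by
      rintro q (rfl | rfl | rfl) <;> simp [norm_pt]⟩
  have hind := hcos.affineIndependent_of_ne (pt_injective.ne hxy) (pt_injective.ne hxz)
    (pt_injective.ne hyz)
  have htop := hind.affineSpan_eq_top_iff_card_eq_finrank_add_one.2 (by
    simp [Complex.finrank_real_complex])
  refine (interior_convexHull_nonempty_iff_affineSpan_eq_top.2 htop).mono (interior_mono
    (convexHull_mono ?_))
  rintro _ ⟨i, rfl⟩
  fin_cases i
  · exact ⟨x, hx, rfl⟩
  · exact ⟨y, hy, rfl⟩
  · exact ⟨z, hz, rfl⟩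

section Hull

variable {p : ℝ} {B : Set ℝ}

theorem sideFn_nonpos_of_mem_hull (hB : ∀ t ∈ B, ∀ m : ℤ, t + m ∈ B) {c d : ℝ} (h : RHole B c d) :
    ∀ z ∈ hull (ang p '' B), sideFn p c d z ≤ 0 := by
  have : hull (ang p '' B) ⊆ {z | sideFn p c d z ≤ 0} := by
    refine convexHull_min ?_ convex_sideFn_nonpos
    rintro _ ⟨_, ⟨t, ht, rfl⟩, rfl⟩
    obtain ⟨m, hm | hm⟩ := OrbMajor.position c d t
    · exact (h.2.2.2.2 _ hm.1 hm.2 (hB t ht m)).elim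
    · rw [← ang_add_int p t m]
      exact sideFn_nonpos h.2.2.1 hm.1 hm.2
  exact this

theorem sideFn_nonpos_of_mem_closure (hB : ∀ t ∈ B, ∀ m : ℤ, t + m ∈ B) {c d : ℝ} (h : RHole B c d) :
    ∀ z ∈ closure (hull (ang p '' B)), sideFn p c d z ≤ 0 :=
  closure_minimal (sideFn_nonpos_of_mem_hull hB h) (isClosed_le continuous_sideFn continuous_const)

theorem pt_mem_hull {A : Set UnitAddCircle} {x : UnitAddCircle} (hx : x ∈ A) : pt x ∈ hull A :=
  subset_convexHull ℝ _ ⟨x, hx, rfl⟩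

theorem basis_closure_hull (hB : ∀ t ∈ B, ∀ m : ℤ, t + m ∈ B)
    (hh : ∀ t ∉ B, ∃ c d, RHole B c d ∧ c < t ∧ t < d) :
    basis (closure (hull (ang p '' B))) = ang p '' B := by
  ext x
  constructor
  · intro hx
    obtain ⟨t, rfl⟩ := ang_surj p x
    by_contra ht
    obtain ⟨c, d, hcd, h1, h2⟩ := hh t fun h => ht ⟨t, h, rfl⟩
    have := sideFn_nonpos_of_mem_closure (p := p) hB hcd _ hx
    linarith [sideFn_pos (p := p) hcd.2.2.2.1.le h1 h2]
  · exact fun hx => subset_closure (pt_mem_hull hx)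

/-- A chord with ends in one hole is separated from the hull by the line of its edge. If only one
end is in a given hole, the chord is linked with the edge of that hole or ends at a point of B, and
meets the hull. -/
theorem disjoint_chord_hull (hB : ∀ t ∈ B, ∀ m : ℤ, t + m ∈ B)
    (hh : ∀ t ∉ B, ∃ c d, RHole B c d ∧ c < t ∧ t < d) (s t : ℝ) :
    Disjoint (chord (ang p s) (ang p t)) (hull (ang p '' B)) ↔ ∃ n, SameHole B s t n := by
  constructor
  · intro hd
    have hs : s ∉ B := fun h => Set.disjoint_left.1 hd (left_mem_segment ℝ _ _)
      (pt_mem_hull ⟨s, h, rfl⟩)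
    have ht : t ∉ B := fun h => Set.disjoint_left.1 hd (right_mem_segment ℝ _ _)
      (pt_mem_hull ⟨t, h, rfl⟩)
    obtain ⟨c, d, hcd, h1, h2⟩ := hh s hs
    obtain ⟨m, hm | hm⟩ := OrbMajor.position c d t
    · exact ⟨m, c, d, hcd, h1, h2, hm.1, hm.2⟩
    exfalso
    have ht' : t + m ∉ B := fun h => ht (by simpa using hB _ h (-m))
    have g1 : d < t + m := lt_of_le_of_ne hm.1 fun he => ht' (he ▸ hcd.2.1)
    have g2 : t + m < c + 1 := lt_of_le_of_ne hm.2 fun he => ht' (he ▸ by simpa using hB _ hcd.1 1)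
    obtain ⟨z, z1, z2⟩ := chords_meet (p := p) h1 h2 g1 g2
    rw [ang_add_int] at z2
    refine Set.disjoint_left.1 hd (openSegment_subset_segment ℝ _ _ z2) ?_
    exact (convex_convexHull ℝ _).segment_subset (pt_mem_hull (Set.mem_image_of_mem _ hcd.1))
      (pt_mem_hull (Set.mem_image_of_mem _ hcd.2.1)) (openSegment_subset_segment ℝ _ _ z1)
  · rintro ⟨n, c, d, hcd, h1, h2, h3, h4⟩
    refine Set.disjoint_left.2 fun z hz hz' => ?_
    have g1 := sideFn_nonpos_of_mem_hull (p := p) hB hcd z hz'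
    have g2 : 0 < sideFn p c d z := convex_sideFn_pos.segment_subset
      (sideFn_pos hcd.2.2.2.1.le h1 h2) (by
        have := sideFn_pos (p := p) hcd.2.2.2.1.le h3 h4
        rwa [ang_add_int] at this) hz
    linarith

/-- A set whose holes are leaves, with every leaf in a closed hole, is the basis of a gap. -/
theorem isGap_closure_hull {r : Setoid UnitAddCircle} (hB : ∀ t ∈ B, ∀ m : ℤ, t + m ∈ B)
    (hh : ∀ t ∉ B, ∃ c d, RHole B c d ∧ c < t ∧ t < d)
    (h3 : (interior (hull (ang p '' B))).Nonempty)
    (hleaf : ∀ c d, RHole B c d → IsLeaf r (ang p c) (ang p d))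
    (hin : ∀ s t, ang p s ≠ ang p t → IsLeaf r (ang p s) (ang p t) → ∃ c d, RHole B c d ∧
      ∃ m n : ℤ, c ≤ s + m ∧ s + m ≤ d ∧ c ≤ t + n ∧ t + n ≤ d) :
    IsGap r (closure (hull (ang p '' B))) := by
  set K := hull (ang p '' B) with hK
  have hKc : Convex ℝ K := convex_convexHull ℝ _
  have hsub : interior K ⊆ Metric.ball 0 1 \ leafUnion r := by
    intro z hz
    refine ⟨interior_hull_subset_ball _ hz, ?_⟩
    rintro ⟨x, y, hxy, hzc⟩
    obtain ⟨s, rfl⟩ := ang_surj p x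
    obtain ⟨t, rfl⟩ := ang_surj p y
    by_cases he : ang p s = ang p t
    · rw [he, chord, segment_same] at hzc
      have := interior_hull_subset_ball _ hz
      rw [hzc, mem_ball_zero_iff, norm_pt] at this
      exact lt_irrefl _ this
    obtain ⟨c, d, hcd, m, n, g1, g2, g3, g4⟩ := hin s t he hxy
    have h1 := sideFn_neg_of_mem_interior (sideFn_nonpos_of_mem_hull (p := p) hB hcd) hz
    have k1 := sideFn_nonneg (p := p) hcd.2.2.2.1.le g1 g2
    have k2 := sideFn_nonneg (p := p) hcd.2.2.2.1.le g3 g4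
    rw [ang_add_int] at k1 k2
    have h2 : 0 ≤ sideFn p c d z := convex_sideFn_nonneg.segment_subset k1 k2 hzc
    linarith
  obtain ⟨z₀, hz₀⟩ := h3
  refine ⟨z₀, hsub hz₀, ?_⟩
  set C := connectedComponentIn (Metric.ball 0 1 \ leafUnion r) z₀ with hC
  have hCsub : C ⊆ Metric.ball 0 1 \ leafUnion r := connectedComponentIn_subset _ _
  have hpre : IsPreconnected C := isPreconnected_connectedComponentIn
  have hz₀C : z₀ ∈ C := mem_connectedComponentIn (hsub hz₀)
  apply le_antisymm
  -- The interior of the hull is connected and meets no leaf, because every leaf stays on the far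
  -- side of some edge.
  · rw [← hKc.closure_interior_eq_closure_of_nonempty_interior ⟨z₀, hz₀⟩]
    exact closure_mono (hKc.interior.isPreconnected.subset_connectedComponentIn hz₀ hsub)
  · refine closure_minimal (fun w hw => ?_) isClosed_closure
    by_contra hwK
    -- A point w of the component outside of the closed hull is separated from it by a line through
    -- w. The arc cut off by that line has no point of B, so it lies in a single hole and w is
    -- strictly beyond the edge of this hole.
    obtain ⟨f, u, hu1, hu2⟩ := geometric_hahn_banach_closed_point hKc.closure isClosed_closure hwK
    have hw1 : ‖w‖ < 1 := by simpa using (hCsub hw).1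
    have hz₀K : z₀ ∈ closure K := subset_closure (interior_subset hz₀)
    obtain ⟨c, d, ρ, hρ, hcd, hcd1, hf⟩ := exists_sideFn p f (by
      rintro rfl
      have := hu1 z₀ hz₀K
      simp at this hu2
      linarith) hw1
    have hB0 : ∀ t ∈ B, sideFn p c d (pt (ang p t)) < 0 := by
      intro t ht
      have h1 := hu1 _ (subset_closure (pt_mem_hull ⟨t, ht, rfl⟩ : pt (ang p t) ∈ K))
      have h2 := hf (pt (ang p t))
      by_contra hc
      have := mul_nonneg hρ.le (not_lt.1 hc)
      linarith
    have hcdB : ∀ t, c ≤ t → t ≤ d → t ∉ B := fun t h1 h2 ht =>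
      absurd (hB0 t ht) (not_lt.2 (sideFn_nonneg hcd1.le h1 h2))
    obtain ⟨c', d', hole, g1, g2⟩ := hh c (hcdB c le_rfl hcd.le)
    have g3 : d < d' := by
      by_contra hc
      exact hcdB d' g2.le (not_lt.1 hc) hole.2.1
    have hwc : w ∈ chord (ang p c) (ang p d) :=
      mem_chord_of_sideFn_eq_zero hcd hcd1 hw1.le (by
        have := hf w
        rw [sub_self] at this
        exact (mul_eq_zero.1 this.symm).resolve_left hρ.ne')
    have hpos : 0 < sideFn p c' d' w := convex_sideFn_pos.segment_subset
      (sideFn_pos hole.2.2.2.1.le g1 g2) (sideFn_pos hole.2.2.2.1.le (g1.trans hcd) g3) hwc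
    have hneg := sideFn_neg_of_mem_interior (sideFn_nonpos_of_mem_hull (p := p) hB hole) hz₀
    -- The component is connected and lies on both sides of the edge, so it meets the edge, which is
    -- a leaf.
    obtain ⟨v, hv, hv0⟩ := hpre.intermediate_value hz₀C hw
      (continuous_sideFn (p := p) (c := c') (d := d')).continuousOn ⟨hneg.le, hpos.le⟩
    refine (hCsub hv).2 ⟨_, _, hleaf _ _ hole, ?_⟩
    exact mem_chord_of_sideFn_eq_zero hole.2.2.1 hole.2.2.2.1 (by
      have := (hCsub hv).1
      rw [mem_ball_zero_iff] at this
      exact this.le) hv0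

end Hull


/-! ### Collapsing maps, classes and leaves -/

theorem exists_collapse {p : ℝ} {B : Set ℝ} (hB : ∀ t ∈ B, ∀ m : ℤ, t + m ∈ B) {Ψ : ℝ → ℝ}
    (h1 : Continuous Ψ) (h2 : Monotone Ψ) (h3 : ∀ t, Ψ (t + 1) = Ψ t + 1)
    (h4 : ∀ c d, RHole B c d → Ψ c = Ψ d) :
    ∃ ψ, IsCollapse (ang p '' B) ψ ∧ ∀ t, ψ (ang p t) = (Ψ t : UnitAddCircle) := by
  have hper : Function.Periodic (fun y : ℝ => ((Ψ (y - p) : ℝ) : UnitAddCircle)) 1 := by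
    intro y
    change ((Ψ (y + 1 - p) : ℝ) : UnitAddCircle) = _
    rw [show y + 1 - p = y - p + 1 by ring, h3, AddCircle.coe_add, AddCircle.coe_period, add_zero]
  have hψ : ∀ t, hper.lift (ang p t) = (Ψ t : UnitAddCircle) := by
    intro t
    rw [ang, hper.lift_coe, add_sub_cancel_right]
  refine ⟨hper.lift, ⟨⟨fun t => Ψ (t - p), h1.comp (by fun_prop), fun s t hst => h2 (by linarith),
    fun t => ?_, fun t => hper.lift_coe t⟩, fun a b hab x hx => ?_⟩, hψ⟩
  · change Ψ (t + 1 - p) = Ψ (t - p) + 1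
    rw [show t + 1 - p = t - p + 1 by ring, h3]
  · obtain ⟨c, rfl⟩ := ang_surj p a
    obtain ⟨d, rfl⟩ := ang_surj p b
    obtain ⟨t, rfl⟩ := ang_surj p x
    obtain ⟨n, hn⟩ := isHole_ang.1 hab
    rw [liftSet_image hB] at hn
    rw [← ang_add_int p d n] at hx
    obtain ⟨m, m1, m2⟩ := (mem_cIcc_ang hn.2.2.1 hn.2.2.2.1.le).1 hx
    rw [← ang_add_int p t m, hψ, hψ]
    congr 1
    exact le_antisymm ((h2 m2).trans (h4 _ _ hn).ge) (h2 m1)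

theorem rhole_unique {B : Set ℝ} {c d d' : ℝ} (h : RHole B c d) (h' : RHole B c d') : d = d' := by
  rcases lt_trichotomy d d' with g | g | g
  · exact (h'.2.2.2.2 d h.2.2.1 g h.2.1).elim
  · exact g
  · exact (h.2.2.2.2 d' h'.2.2.1 g h'.2.1).elim

/-- The relation on the line induced by a relation on the circle. -/
def angRel (r : Setoid UnitAddCircle) (p s t : ℝ) : Prop := r (ang p s) (ang p t)

section Classes

variable {r : Setoid UnitAddCircle} {g : Set UnitAddCircle}

theorem mem_class_iff (hg : g ∈ r.classes) {x y : UnitAddCircle} (hx : x ∈ g) : y ∈ g ↔ r x y := by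
  obtain ⟨z, rfl⟩ := hg
  exact ⟨fun hy => r.trans' hx (r.symm' hy), fun h => r.trans' (r.symm' h) hx⟩

theorem exists_class (r : Setoid UnitAddCircle) (x : UnitAddCircle) : ∃ g ∈ r.classes, x ∈ g :=
  ⟨_, r.mem_classes x, r.refl' x⟩

theorem IsLeaf.symm {x y : UnitAddCircle} (h : IsLeaf r x y) : IsLeaf r y x := by
  rcases h with rfl | ⟨g, hg, h⟩
  · exact Or.inl rfl
  · exact Or.inr ⟨g, hg, h.symm⟩

theorem IsLamination.cross (hr : IsLamination r) {p s u t v : ℝ} (h1 : s < u) (h2 : u < t)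
    (h3 : t < v) (h4 : v < s + 1) (hst : angRel r p s t) (huv : angRel r p u v) : angRel r p s u := by
  by_contra hc
  obtain ⟨z, z1, z2⟩ := chords_meet (p := p) h1 h2 h3 h4
  exact Set.disjoint_left.1 (hr.unlinked _ _ _ _ hst huv fun h => hc (r.trans' hst h)) z1 z2

/-- A leaf with an endpoint in a hole whose endpoints are related stays in the closed hole. -/
theorem IsLamination.leaf_in_hole (hr : IsLamination r) {p c d s t : ℝ} (h1 : c < s) (h2 : s < d)
    (hcd : angRel r p c d) (hst : ang p s ≠ ang p t)
    (hl : IsLeaf r (ang p s) (ang p t)) : ∃ n : ℤ, c ≤ t + n ∧ t + n ≤ d := by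
  obtain ⟨m, hm | hm⟩ := OrbMajor.position c d t
  · exact ⟨m, hm.1.le, hm.2.le⟩
  rcases eq_or_lt_of_le hm.1 with g1 | g1
  · exact ⟨m, by linarith, g1.ge⟩
  rcases eq_or_lt_of_le hm.2 with g2 | g2
  · exact ⟨m - 1, by push_cast; linarith, by push_cast; linarith⟩
  exfalso
  obtain ⟨g, hg, he⟩ := hl.resolve_left hst
  have hsg : ang p s ∈ g := by rcases he with he | he; exacts [he.1, he.2.1]
  have htg : ang p t ∈ g := by rcases he with he | he; exacts [he.2.1, he.1]
  have hrel : angRel r p s (t + m) := by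
    rw [angRel, ang_add_int]; exact (mem_class_iff hg hsg).1 htg
  have hcs := hr.cross h1 h2 g1 g2 hcd hrel
  have hcg : ang p c ∈ g := (mem_class_iff hg hsg).2 (r.symm' hcs)
  have hdg : ang p d ∈ g := (mem_class_iff hg hcg).2 hcd
  obtain ⟨n, hn | hn⟩ := isEdge_ang.1 he
  · have hnm : n = m := by
      have k1 : ((n - m : ℤ) : ℝ) < 1 := by push_cast; linarith [hn.2.2.2.1]
      have k2 : (-1 : ℝ) < ((n - m : ℤ) : ℝ) := by push_cast; linarith [hn.2.2.1]
      have k1' : n - m < 1 := by exact_mod_cast k1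
      have k2' : -1 < n - m := by exact_mod_cast k2
      omega
    subst hnm
    exact hn.2.2.2.2 d h2 g1 hdg
  · have hnm : n = 1 - m := by
      have k1 : ((n + m - 1 : ℤ) : ℝ) < 1 := by push_cast; linarith [hn.2.2.2.1]
      have k2 : (-1 : ℝ) < ((n + m - 1 : ℤ) : ℝ) := by push_cast; linarith [hn.2.2.1]
      have k1' : n + m - 1 < 1 := by exact_mod_cast k1
      have k2' : -1 < n + m - 1 := by exact_mod_cast k2
      omega
    subst hnm
    push_cast at hn
    refine hn.2.2.2.2 (c + (1 - m : ℤ)) (by push_cast; linarith) (by push_cast; linarith) ?_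
    exact liftSet_add_int c hcg _

/-- A periodic set whose holes are leaves and which has no other related pairs than the endpoints of
its holes is the basis of a gap. -/
theorem IsLamination.isGap_of_holes (hr : IsLamination r) {p : ℝ} {B : Set ℝ}
    (hB : ∀ t ∈ B, ∀ m : ℤ, t + m ∈ B) (hh : ∀ t ∉ B, ∃ c d, RHole B c d ∧ c < t ∧ t < d)
    (h3 : (interior (hull (ang p '' B))).Nonempty)
    (hrel : ∀ c d, RHole B c d → angRel r p c d)
    (hleaf : ∀ c d, RHole B c d → IsLeaf r (ang p c) (ang p d))
    (hcls : ∀ s t, s ∈ B → t ∈ B → ang p s ≠ ang p t → IsLeaf r (ang p s) (ang p t) → REdge B s t) :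
    IsGap r (closure (hull (ang p '' B))) ∧ basis (closure (hull (ang p '' B))) = ang p '' B := by
  refine ⟨isGap_closure_hull hB hh h3 hleaf fun s t hst hl => ?_, basis_closure_hull hB hh⟩
  by_cases hs : s ∈ B
  · by_cases ht : t ∈ B
    · obtain ⟨n, hn | hn⟩ := hcls s t hs ht hst hl
      · exact ⟨_, _, hn, 0, n, by simp, by simpa using hn.2.2.1.le, hn.2.2.1.le, le_rfl⟩
      · exact ⟨_, _, hn, n, 0, hn.2.2.1.le, le_rfl, by simp, by simpa using hn.2.2.1.le⟩
    · obtain ⟨c, d, hcd, g1, g2⟩ := hh t ht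
      obtain ⟨n, n1, n2⟩ := hr.leaf_in_hole g1 g2 (hrel c d hcd) hst.symm hl.symm
      exact ⟨c, d, hcd, n, 0, n1, n2, by simpa using g1.le, by simpa using g2.le⟩
  · obtain ⟨c, d, hcd, g1, g2⟩ := hh s hs
    obtain ⟨n, n1, n2⟩ := hr.leaf_in_hole g1 g2 (hrel c d hcd) hst hl
    exact ⟨c, d, hcd, 0, n, by simpa using g1.le, by simpa using g2.le, n1, n2⟩

end Classes

/-! ### From cubic invariant laminations to the lifted axioms -/

namespace IsCubicInvariantLamination

variable {r : Setoid UnitAddCircle} {g : Set UnitAddCircle}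

theorem image_iterate (hr : IsCubicInvariantLamination r) (hg : g ∈ r.classes) (n : ℕ) :
    sig^[n] '' g ∈ r.classes := by
  induction n with
  | zero => simpa using hg
  | succ n ih =>
    rw [Function.iterate_succ', Set.image_comp]
    exact hr.forward _ ih

theorem hole_iterate (hr : IsCubicInvariantLamination r) (hg : g ∈ r.classes) (n : ℕ) :
    (sig^[n] '' g).Subsingleton ∨
      ∀ a b, IsHole g a b → IsHole (sig^[n] '' g) (sig^[n] a) (sig^[n] b) := by
  induction n with
  | zero => right; simp
  | succ n ih =>
    rw [Function.iterate_succ', Set.image_comp]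
    rcases ih with h | h
    · exact Or.inl (h.image _)
    · rcases hr.covering _ (hr.image_iterate hg n) with h' | h'
      · exact Or.inl h'
      · exact Or.inr fun a b hab => h' _ _ (h a b hab)

/-- If a class is mapped to itself with a fixed point, then all of its points are fixed. -/
theorem fixed_of_fixed (hr : IsCubicInvariantLamination r) (hg : g ∈ r.classes) {n : ℕ}
    (hn : sig^[n] '' g = g) {x : UnitAddCircle} (hx : x ∈ g) (hfix : sig^[n] x = x) :
    ∀ y ∈ g, sig^[n] y = y := by
  rcases hr.hole_iterate hg n with h | h
  · rw [hn] at h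
    intro y hy
    rw [h hy hx, hfix]
  rw [hn] at h
  obtain ⟨s, rfl⟩ := ang_surj 0 x
  set G := liftSet 0 g with hG
  have hfin : ∀ S : Set ℝ, S ⊆ G ∩ Set.Ico s (s + 1) → S.Finite := by
    intro S hS
    refine Set.Finite.of_finite_image (f := ang 0) ((hr.finite_classes g hg).subset ?_) ?_
    · rintro _ ⟨t, ht, rfl⟩; exact (hS ht).1
    · intro t ht u hu he
      obtain ⟨m, hm⟩ := ang_eq_iff.1 he
      have h1 := (hS ht).2
      have h2 := (hS hu).2
      have hm0 : m = 0 := by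
        have k1 : (m : ℝ) < 1 := by linarith [h1.1, h2.2]
        have k2 : (-1 : ℝ) < m := by linarith [h1.2, h2.1]
        have k1' : m < 1 := by exact_mod_cast k1
        have k2' : -1 < m := by exact_mod_cast k2
        omega
      rw [hm, hm0]; simp
  suffices hall : {t | t ∈ G ∩ Set.Ico s (s + 1) ∧ sig^[n] (ang 0 t) ≠ ang 0 t} = ∅ by
    intro y hy
    obtain ⟨t, rfl⟩ := ang_surj 0 y
    by_contra hne
    have h1 := Int.floor_le (t - s)
    have h2 := Int.lt_floor_add_one (t - s)
    have : t + (-⌊t - s⌋ : ℤ) ∈ {t | t ∈ G ∩ Set.Ico s (s + 1) ∧ sig^[n] (ang 0 t) ≠ ang 0 t} := by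
      refine ⟨⟨liftSet_add_int t hy _, by push_cast; linarith, by push_cast; linarith⟩, ?_⟩
      rwa [ang_add_int]
    rw [hall] at this
    exact this
  by_contra hne
  -- Take the first point y of the class after s that is not fixed, and its predecessor z, which is
  -- fixed. The hole (z, y) is sent to a hole starting at z, hence to itself, and y is fixed after
  -- all.
  obtain ⟨y, ⟨⟨hyG, hy⟩, hyf⟩, hmin⟩ := Set.exists_min_image _ id
    (hfin {t | t ∈ G ∩ Set.Ico s (s + 1) ∧ sig^[n] (ang 0 t) ≠ ang 0 t} fun t ht => ht.1)
    (Set.nonempty_iff_ne_empty.2 hne)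
  have hsy : s < y := lt_of_le_of_ne hy.1 fun he => hyf (he ▸ hfix)
  obtain ⟨z, ⟨⟨hzG, hz⟩, hzy⟩, hmax⟩ := Set.exists_max_image {t | t ∈ G ∩ Set.Ico s (s + 1) ∧ t < y} id
    (hfin _ fun t ht => ht.1) ⟨s, ⟨hx, le_rfl, by linarith⟩, hsy⟩
  have hzf : sig^[n] (ang 0 z) = ang 0 z := by
    by_contra hc
    have := hmin z ⟨⟨hzG, hz⟩, hc⟩
    exact absurd hzy (not_lt.2 this)
  have hole : RHole G z y := ⟨hzG, hyG, hzy, by linarith [hy.2, hz.1], fun t t1 t2 ht => by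
    have := hmax t ⟨⟨ht, by linarith [hz.1], by linarith [hy.2]⟩, t2⟩
    exact absurd t1 (not_lt.2 this)⟩
  have h1 := h _ _ (isHole_ang.2 ⟨0, by simpa using hole⟩)
  rw [hzf] at h1
  obtain ⟨w, hw⟩ := ang_surj 0 (sig^[n] (ang 0 y))
  rw [← hw] at h1
  obtain ⟨m, hm⟩ := isHole_ang.1 h1
  apply hyf
  rw [← hw, rhole_unique hole hm, ang_add_int]

/-- Without rotational gaps and leaves a class that returns to itself is fixed pointwise. -/
theorem fixed_of_return (hr : IsCubicInvariantLamination r)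
    (hrot : ¬ HasPeriodicRotationalGapOrLeaf r) {x : UnitAddCircle} {k : ℕ} (hk : 0 < k)
    (hx : r x (sig^[k] x)) : sig^[k] x = x := by
  obtain ⟨g, hg, hxg⟩ := exists_class r x
  have hkg : sig^[k] '' g = g := by
    have h1 := hr.image_iterate hg k
    have h2 : sig^[k] x ∈ g := (mem_class_iff hg hxg).2 hx
    ext y
    rw [mem_class_iff h1 ⟨x, hxg, rfl⟩, mem_class_iff hg h2]
  have hex : ∃ n, 0 < n ∧ sig^[n] '' g = g := ⟨k, hk, hkg⟩
  classical
  set n := Nat.find hex with hn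
  obtain ⟨hn0, hng⟩ := Nat.find_spec hex
  have hmin : ∀ m, 0 < m → m < n → sig^[m] '' g ≠ g := fun m h1 h2 h3 =>
    Nat.find_min hex h2 ⟨h1, h3⟩
  -- One fixed point of the return makes all of them fixed, and then minimality of n forces n to
  -- divide k.
  by_cases hfix : ∃ y ∈ g, sig^[n] y = y
  · obtain ⟨y, hy, hyf⟩ := hfix
    have hall := hr.fixed_of_fixed hg hng hy hyf
    have hmod : ∀ y ∈ g, sig^[k % n] y = sig^[k] y := fun y hy =>
      Function.IsPeriodicPt.iterate_mod_apply (hall y hy) k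
    have h0 : k % n = 0 := by
      by_contra hne
      refine hmin (k % n) (Nat.pos_of_ne_zero hne) (Nat.mod_lt _ hn0) ?_
      rw [Set.image_congr hmod, hkg]
    rw [← hmod x hxg, h0]; rfl
  -- Without fixed points the class is itself rotational: its hull is a gap if it has at least three
  -- points, and a leaf if it has two.
  · push Not at hfix
    exfalso
    have hfin := hr.finite_classes g hg
    have hper : IsPeriodicRotational g :=
      ⟨⟨x, hxg⟩, n, ⟨hn0, hng, hmin⟩, Or.inl ⟨hfin, hfix⟩⟩
    set y := sig^[n] x with hy
    have hyg : y ∈ g := by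
      have : y ∈ sig^[n] '' g := ⟨x, hxg, rfl⟩
      rwa [hng] at this
    have hxy : x ≠ y := (hfix x hxg).symm
    by_cases hz : ∃ z ∈ g, z ≠ x ∧ z ≠ y
    · obtain ⟨z, hzg, hzx, hzy⟩ := hz
      refine hrot (Or.inl ?_)
      have himg : ang 0 '' liftSet 0 g = g := image_liftSet
      obtain ⟨s, hs⟩ := ang_surj 0 x
      obtain ⟨t, ht⟩ := ang_surj 0 y
      have hh : ∀ t ∉ liftSet 0 g, ∃ c d, RHole (liftSet 0 g) c d ∧ c < t ∧ t < d := by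
        intro q hq
        refine exists_rhole (hfin.isClosed.preimage continuous_ang) liftSet_add_int (u := s) (v := t)
          (hs ▸ hxg : ang 0 s ∈ g) (ht ▸ hyg : ang 0 t ∈ g) (fun m hm => hxy ?_) hq
        rw [← hs, ← ht]
        exact ang_eq_iff.2 ⟨m, hm⟩
      obtain ⟨g1, g2⟩ := hr.toIsLamination.isGap_of_holes (p := 0) (B := liftSet 0 g)
        liftSet_add_int hh (by
          rw [himg]; exact interior_hull_nonempty hxg hyg hzg hxy hzx.symm hzy.symm)
        (fun c d h => (mem_class_iff hg h.1).1 h.2.1)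
        (fun c d h => Or.inr ⟨g, hg, Or.inl (isHole_ang.2 ⟨0, by simpa using h⟩)⟩)
        (fun s t hsB htB hne hl => by
          obtain ⟨g', hg', he⟩ := hl.resolve_left hne
          have hsg : ang 0 s ∈ g' := by rcases he with he | he; exacts [he.1, he.2.1]
          have : g' = g := by
            ext q
            rw [mem_class_iff hg' hsg, mem_class_iff hg hsB]
          rw [this] at he
          exact isEdge_ang.1 he)
      refine ⟨_, g1, ?_⟩
      rw [g2, himg]
      exact hper
    · push Not at hz
      have hgxy : g = {x, y} := by
        ext z
        constructor
        · intro h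
          by_cases hzx : z = x
          · exact Or.inl hzx
          · exact Or.inr (hz z h hzx)
        · rintro (rfl | rfl)
          · exact hxg
          · exact hyg
      refine hrot (Or.inr ⟨x, y, Or.inr ⟨g, hg, Or.inl ⟨hxg, hyg, hxy, ?_⟩⟩, hgxy ▸ hper⟩)
      rw [Set.disjoint_left, hgxy]
      rintro z hz' (rfl | rfl)
      · exact (Set.mem_cIoo.1 hz').2 (btw_refl_right _ _)
      · exact (Set.mem_cIoo.1 hz').2 (btw_refl_left _ _)

/-- The hypothesis on rotational gaps and leaves enters only through `nopoly`; the other axioms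
restate the definition on the line. -/
theorem lam (hr : IsCubicInvariantLamination r) (hrot : ¬ HasPeriodicRotationalGapOrLeaf r) {p : ℝ}
    {i : ℤ} (hp : 2 * p = i) : Lam (angRel r p) where
  refl t := r.refl' _
  symm h := r.symm' h
  trans h h' := r.trans' h h'
  per t n := by rw [angRel, ang_add_int]
  cross h1 h2 h3 h4 h5 h6 := hr.toIsLamination.cross h1 h2 h3 h4 h5 h6
  closed := hr.closed_graph.preimage
    ((continuous_ang.comp continuous_fst).prodMk (continuous_ang.comp continuous_snd) :
      Continuous fun q : ℝ × ℝ => (ang p q.1, ang p q.2))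
  fwd {s t} h := by
    obtain ⟨g, hg, hs⟩ := exists_class r (ang p s)
    rw [angRel, ← sig_ang hp, ← sig_ang hp]
    exact (mem_class_iff (hr.forward g hg) ⟨_, hs, rfl⟩).1 ⟨_, (mem_class_iff hg hs).2 h, rfl⟩
  back {s t} h := by
    obtain ⟨g, hg, hs⟩ := exists_class r (ang p s)
    rw [angRel, ← sig_ang hp] at h
    obtain ⟨x, hx, he⟩ := (mem_class_iff (hr.forward g hg) ⟨_, hs, rfl⟩).2 h
    obtain ⟨w, rfl⟩ := ang_surj p x
    rw [sig_ang hp, eq_comm] at he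
    obtain ⟨n, hn⟩ := ang_eq_iff.1 he
    exact ⟨w, (mem_class_iff hg hs).1 hx, n, hn⟩
  nopoly s k h := by
    rcases k.eq_zero_or_pos with rfl | hk
    · exact ⟨0, by simp⟩
    · rw [angRel, ← iterate_sig_ang hp] at h
      have := hr.fixed_of_return hrot hk h
      rw [iterate_sig_ang hp, eq_comm] at this
      exact ang_eq_iff.1 this
  cov {s u} h1 h2 hR hole := by
    obtain ⟨g, hg, hs⟩ := exists_class r (ang p s)
    have hH : IsHole g (ang p s) (ang p u) := isHole_ang.2 ⟨0, by
      simp only [Int.cast_zero, add_zero]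
      exact ⟨hs, (mem_class_iff hg hs).2 hR, h1, h2, fun t t1 t2 ht =>
        hole t t1 t2 ((mem_class_iff hg hs).1 ht)⟩⟩
    rcases hr.covering g hg with h | h
    · left
      intro w hw
      have := h ⟨_, hs, rfl⟩ ⟨_, (mem_class_iff hg hs).2 hw, rfl⟩
      rw [sig_ang hp, sig_ang hp] at this
      exact ang_eq_iff.1 this
    · right
      have h3 := h _ _ hH
      rw [sig_ang hp, sig_ang hp] at h3
      obtain ⟨n, e1, e2, e3, e4, e5⟩ := isHole_ang.1 h3
      refine ⟨-n, by push_cast; linarith, by push_cast; linarith, fun w w1 w2 hw => ?_⟩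
      exact e5 w w1 (by push_cast at w2; linarith) ((mem_class_iff (hr.forward g hg) e1).2 hw)

end IsCubicInvariantLamination


/-! ### Realising Siegel data as a Siegel gap -/

namespace SiegelData

variable {R : ℝ → ℝ → Prop} {k : ℕ} {O : Set ℝ} {Ψ : ℝ → ℝ} {θ : ℝ}

theorem exists_hole (S : SiegelData R k O Ψ θ) {t : ℝ} (ht : t ∉ O) :
    ∃ c d, RHole O c d ∧ c < t ∧ t < d := by
  obtain ⟨s, u, h1, h2, h3, h4, h5, -, -, h8⟩ := S.hole ht
  exact ⟨s, u, ⟨h1, h2, by linarith, h5, h8⟩, h3, h4⟩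

theorem rel_and_eq (S : SiegelData R k O Ψ θ) {c d : ℝ} (h : RHole O c d) : R c d ∧ Ψ c = Ψ d := by
  have hcd := h.2.2.1
  have hm : (c + d) / 2 ∉ O := h.2.2.2.2 _ (by linarith) (by linarith)
  obtain ⟨s, u, h1, h2, h3, h4, h5, h6, h7, h8⟩ := S.hole hm
  have e1 : s = c := by
    rcases lt_trichotomy s c with g | g | g
    · exact (h8 c g (by linarith) h.1).elim
    · exact g
    · exact (h.2.2.2.2 s g (by linarith) h1).elim
  have e2 : u = d := by
    rcases lt_trichotomy u d with g | g | g
    · exact (h.2.2.2.2 u (by linarith) g h2).elim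
    · exact g
    · exact (h8 d (by linarith) g h.2.1).elim
  exact ⟨e1 ▸ e2 ▸ h6, e1 ▸ e2 ▸ h7⟩

theorem map_iterate (S : SiegelData R k O Ψ θ) {t : ℝ} (ht : t ∈ O) (n : ℕ) :
    (3 ^ k) ^ n * t ∈ O ∧ ∃ m : ℤ, Ψ ((3 ^ k) ^ n * t) = Ψ t + n * θ + m := by
  induction n with
  | zero => exact ⟨by simpa using ht, 0, by simp⟩
  | succ n ih =>
    obtain ⟨h1, m, hm⟩ := ih
    obtain ⟨h2, j, hj⟩ := S.map h1
    rw [← mul_assoc, ← pow_succ'] at h2 hj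
    exact ⟨h2, m + j, by rw [hj, hm]; push_cast; ring⟩

theorem map_add_int (S : SiegelData R k O Ψ θ) (t : ℝ) (n : ℤ) : Ψ (t + n) = Ψ t + n :=
  (⟨⟨Ψ, S.monotone⟩, S.deg⟩ : CircleDeg1Lift).map_add_int t n

theorem infinite (S : SiegelData R k O Ψ θ) (p : ℝ) : (ang p '' O).Infinite := by
  obtain ⟨t, ht⟩ := S.nonempty
  refine Set.infinite_of_injective_forall_mem (f := fun n : ℕ => ang p ((3 ^ k) ^ n * t)) ?_
    fun n => ⟨_, (S.map_iterate ht n).1, rfl⟩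
  intro n n' he
  obtain ⟨j, hj⟩ := ang_eq_iff.1 he
  obtain ⟨-, m, hm⟩ := S.map_iterate ht n
  obtain ⟨-, m', hm'⟩ := S.map_iterate ht n'
  rw [hj, S.map_add_int, hm] at hm'
  by_contra hne
  have hne' : ((n' : ℤ) - n : ℤ) ≠ 0 := by omega
  refine (S.irrational.intCast_mul hne').ne_int (m + j - m') ?_
  push_cast
  linarith

/-- No other point of the class of the endpoints of a hole lies on the other side of the hole. -/
theorem not_rel_outside (S : SiegelData R k O Ψ θ) (h : Lam R) {c d w : ℝ} (hcd : RHole O c d)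
    (h1 : d < w) (h2 : w < c + 1) : ¬ R c w := by
  -- A period of O cannot consist of three points, since the irrational rotation makes O infinite
  -- modulo one.
  have hfin : ∀ y, (∀ t, c < t → t < c + 1 → t ∈ O → t = d ∨ t = y) → False := by
    intro y hy
    refine S.infinite 0 (Set.Finite.subset (s := {ang 0 c, ang 0 d, ang 0 y}) (by simp) ?_)
    rintro _ ⟨t, ht, rfl⟩
    have f1 := Int.floor_le (t - c)
    have f2 := Int.lt_floor_add_one (t - c)
    have hm := S.per (-⌊t - c⌋) ht
    rw [← ang_add_int 0 t (-⌊t - c⌋)]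
    push_cast at hm ⊢
    rcases eq_or_lt_of_le (show c ≤ t + -(⌊t - c⌋ : ℝ) by linarith) with g | g
    · rw [← g]; simp
    · rcases hy _ g (by linarith) hm with g | g <;> rw [g] <;> simp
  have hR := (S.rel_and_eq hcd).1
  have hc1 : c + 1 ∈ O := by simpa using S.per 1 hcd.1
  have hd1 : d + 1 ∈ O := by simpa using S.per 1 hcd.2.1
  have key : ∀ w ∈ O, d < w → w < c + 1 → ¬ R c w := by
    intro w hw h1 h2 hcw
    have a1 : ∀ t, d < t → t < w → t ∉ O :=
      (S.cls hcd.2.1 hw h1 (by linarith [hcd.2.2.1]) (h.trans (h.symm hR) hcw)).resolve_right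
        fun hc => hc (c + 1) h2 (by linarith [hcd.2.2.1]) hc1
    have a2 : ∀ t, w < t → t < c + 1 → t ∉ O :=
      (S.cls hw hc1 h2 (by linarith [hcd.2.2.1]) (h.add_one (h.symm hcw))).resolve_right
        fun hc => hc (d + 1) (by linarith [hcd.2.2.1]) (by linarith) hd1
    refine hfin w fun t t1 t2 ht => ?_
    rcases lt_trichotomy t d with g | g | g
    · exact (hcd.2.2.2.2 t t1 g ht).elim
    · exact Or.inl g
    rcases lt_trichotomy t w with g' | g' | g'
    · exact (a1 t g g' ht).elim
    · exact Or.inr g'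
    · exact (a2 t g' t2 ht).elim
  by_cases hw : w ∈ O
  · exact key w hw h1 h2
  intro hcw
  obtain ⟨s, u, hsu, g1, g2⟩ := S.exists_hole hw
  have e1 : d ≤ s := by
    by_contra hc
    exact hsu.2.2.2.2 d (not_le.1 hc) (by linarith) hcd.2.1
  have e2 : u ≤ c + 1 := by
    by_contra hc
    exact hsu.2.2.2.2 (c + 1) (by linarith) (not_le.1 hc) hc1
  have hRsu := (S.rel_and_eq hsu).1
  have hcs : R c s := by
    rcases eq_or_lt_of_le e2 with g | g
    · rw [g] at hRsu
      exact h.symm (by simpa using h.sub_one hRsu)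
    · exact h.cross (by linarith [hcd.2.2.1]) g1 g2 g hcw hRsu
  rcases eq_or_lt_of_le e1 with g | g
  · rcases eq_or_lt_of_le e2 with g' | g'
    · refine hfin d fun t t1 t2 ht => ?_
      rcases lt_trichotomy t d with k1 | k1 | k1
      · exact (hcd.2.2.2.2 t t1 k1 ht).elim
      · exact Or.inl k1
      · exact (hsu.2.2.2.2 t (by linarith) (by linarith) ht).elim
    · exact key u hsu.2.1 (by linarith) g' (h.trans hcs hRsu)
  · exact key s hsu.1 g (by linarith) hcs

end SiegelData

/-- The holes of O are leaves and no other leaves join points of O, so the closed hull of O is a gap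
with basis O. The collapse Ψ exhibits it as a Siegel gap of minimal period k. -/
theorem IsCubicInvariantLamination.noSiegel {r : Setoid UnitAddCircle}
    (hr : IsCubicInvariantLamination r) (hrot : ¬ HasPeriodicRotationalGapOrLeaf r) {p : ℝ}
    {i : ℤ} (hp : 2 * p = i) : NoSiegel (angRel r p) := by
  intro k O Ψ θ hk S hmin
  have h := hr.lam hrot hp
  have hB : ∀ t ∈ O, ∀ m : ℤ, t + m ∈ O := fun t ht m => S.per m ht
  obtain ⟨x, hx, y, hy, z, hz, hxy, hxz, hyz⟩ : ∃ x ∈ ang p '' O, ∃ y ∈ ang p '' O,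
      ∃ z ∈ ang p '' O, x ≠ y ∧ x ≠ z ∧ y ≠ z := by
    obtain ⟨T, hT, hcard⟩ := (S.infinite p).exists_subset_card_eq 3
    obtain ⟨x, y, z, hxy, hxz, hyz, rfl⟩ := Finset.card_eq_three.1 hcard
    exact ⟨x, hT (by simp), y, hT (by simp), z, hT (by simp), hxy, hxz, hyz⟩
  obtain ⟨g1, g2⟩ := hr.toIsLamination.isGap_of_holes (p := p) hB (fun t ht => S.exists_hole ht)
    (interior_hull_nonempty hx hy hz hxy hxz hyz) (fun c d hcd => (S.rel_and_eq hcd).1)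
    (fun c d hcd => by
      obtain ⟨g, hg, hc⟩ := exists_class r (ang p c)
      -- The class may have further points inside the hole (c, d), so the chord is recognised as an
      -- edge of the class from its other side, with the hole (d, c + 1).
      refine Or.inr ⟨g, hg, Or.inr (isHole_ang.2 ⟨1, ?_⟩)⟩
      push_cast
      refine ⟨(mem_class_iff hg hc).2 (S.rel_and_eq hcd).1, by simpa using liftSet_add_int c hc 1,
        hcd.2.2.2.1, by linarith [hcd.2.2.1], fun w w1 w2 hw => ?_⟩
      exact S.not_rel_outside h hcd w1 w2 ((mem_class_iff hg hc).1 hw))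
    (fun s t hs ht hne hl => by
      obtain ⟨g, hg, he⟩ := hl.resolve_left hne
      have hsg : ang p s ∈ g := by rcases he with he | he; exacts [he.1, he.2.1]
      have htg : ang p t ∈ g := by rcases he with he | he; exacts [he.2.1, he.1]
      have hst : angRel r p s t := (mem_class_iff hg hsg).1 htg
      have f1 := Int.floor_le (t - s)
      have f2 := Int.lt_floor_add_one (t - s)
      have hlt : s < t + (-⌊t - s⌋ : ℤ) := by
        push_cast
        refine lt_of_le_of_ne (by linarith) fun e => hne (ang_eq_iff.2 ⟨⌊t - s⌋, by linarith⟩)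
      have hlt2 : t + (-⌊t - s⌋ : ℤ) < s + 1 := by push_cast; linarith
      have ht' := S.per (-⌊t - s⌋) ht
      rcases S.cls hs ht' hlt hlt2 (h.shift_right hst _) with e | e
      · exact ⟨_, Or.inl ⟨hs, ht', hlt, hlt2, e⟩⟩
      · have : RHole O (t + (-⌊t - s⌋ : ℤ)) (s + 1) :=
          ⟨ht', by simpa using S.per 1 hs, hlt2, by linarith, e⟩
        have := this.shift hB ⌊t - s⌋
        refine ⟨1 + ⌊t - s⌋, Or.inr ?_⟩
        convert this using 1 <;> push_cast <;> ring)
  have himg : ∀ m : ℕ, sig^[m] '' (ang p '' O) = ang p '' ((fun t => 3 ^ m * t) '' O) := by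
    intro m
    rw [Set.image_image, Set.image_image]
    exact Set.image_congr fun t _ => iterate_sig_ang hp m t
  obtain ⟨ψ, hψ1, hψ2⟩ := exists_collapse (p := p) hB S.continuous S.monotone S.deg
    fun c d hcd => (S.rel_and_eq hcd).2
  refine hrot (Or.inl ⟨_, g1, ?_⟩)
  rw [g2]
  refine ⟨⟨x, hx⟩, k, ⟨hk, ?_, fun m m1 m2 he => ?_⟩, Or.inr ⟨S.infinite p, ψ, θ, hψ1,
    S.irrational, ?_⟩⟩
  · rw [himg]
    apply le_antisymm
    · rintro _ ⟨_, ⟨t, ht, rfl⟩, rfl⟩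
      exact ⟨_, (S.map ht).1, rfl⟩
    · rintro _ ⟨t, ht, rfl⟩
      obtain ⟨s, hs, n, hn⟩ := S.surj ht
      exact ⟨_, ⟨s, hs, rfl⟩, by simp only [hn, ang_add_int]⟩
  · obtain ⟨t, ht, ht'⟩ := hmin m m1 m2
    apply ht'
    rw [himg] at he
    have : ang p (3 ^ m * t) ∈ ang p '' O := he ▸ ⟨_, ⟨t, ht, rfl⟩, rfl⟩
    rw [← liftSet_image (p := p) hB]
    exact this
  · rintro _ ⟨t, ht, rfl⟩
    rw [iterate_sig_ang hp, hψ2, hψ2]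
    obtain ⟨-, n, hn⟩ := S.map ht
    rw [hn, ← AddCircle.coe_add]
    simp


/-! ### The gap on the circle and the conclusion -/

section Final

variable {a b p : ℝ} {i : ℤ} {k : ℕ}

theorem isInvariantQuadraticGap_gapSet (O : OrbMajor.ImageHole a b) (hp : 2 * p = i) :
    IsInvariantQuadraticGap (ang p '' gapSet a b) := by
  have h1 := O.third_le
  have h2 := O.le_half
  -- A third point of the gap, needed for a nonempty interior: it has the same image as a modulo one
  -- and lies in [b, a + 1].
  have hc : a + 2 / 3 ∈ gapSet a b := by
    refine OrbMajor.mem_of_three (by linarith) (by linarith) ?_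
    have := gapSet_add_int _ (OrbMajor.three_mem O.left_mem) 2
    convert this using 1
    push_cast; ring
  have hne : ∀ s t : ℝ, s < t → t < s + 1 → ang p s ≠ ang p t := by
    intro s t g1 g2 he
    obtain ⟨n, hn⟩ := ang_eq_iff.1 he
    exact Int.cast_between_false (n := n) 0 (by push_cast; linarith) (by push_cast; linarith)
  refine ⟨⟨isClosed_image OrbMajor.isClosed_gapSet gapSet_add_int, ?_, ?_, ?_⟩, ?_⟩
  · exact interior_hull_nonempty ⟨a, O.left_mem, rfl⟩ ⟨b, O.right_mem, rfl⟩ ⟨_, hc, rfl⟩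
      (hne _ _ (by linarith) (by linarith)) (hne _ _ (by linarith) (by linarith))
      (hne _ _ (by linarith) (by linarith))
  · apply le_antisymm
    · rintro _ ⟨_, ⟨t, ht, rfl⟩, rfl⟩
      exact ⟨_, OrbMajor.three_mem ht, (sig_ang hp t).symm⟩
    · rintro _ ⟨t, ht, rfl⟩
      obtain ⟨s, hs, n, hn⟩ := O.exists_preimage ht
      exact ⟨_, ⟨s, hs, rfl⟩, by rw [sig_ang hp, hn, ang_add_int]⟩
  · intro x y hxy
    obtain ⟨c, rfl⟩ := ang_surj p x
    obtain ⟨d, rfl⟩ := ang_surj p y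
    obtain ⟨n, hn⟩ := isHole_ang.1 hxy
    rw [liftSet_image gapSet_add_int] at hn
    obtain ⟨m, hm | hm⟩ := O.three hn
    · left
      rw [sig_ang hp, sig_ang hp, ← hm]
      rw [ang_add_int, mul_add, show (3 : ℝ) * n = ((3 * n : ℤ) : ℝ) by push_cast; ring, ang_add_int]
    · right
      rw [sig_ang hp, sig_ang hp, isHole_ang, liftSet_image gapSet_add_int]
      refine ⟨3 * n + m, ?_⟩
      convert hm using 1
      push_cast; ring
  · obtain ⟨ψ, h3, h4⟩ := exists_collapse (p := p) gapSet_add_int O.continuous_quadMap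
      O.monotone_quadMap (fun t => by simpa using O.quadMap_add_int t 1)
      fun c d h => (O.quadMap_eq h h.2.2.1.le le_rfl).symm
    refine ⟨ψ, h3, ?_⟩
    rintro _ ⟨t, ht, rfl⟩
    obtain ⟨n, hn⟩ := O.quadMap_three ht
    rw [sig_ang hp, h4, h4, hn, ← AddCircle.coe_nsmul, nsmul_eq_mul]
    simp

theorem isMajor_gapSet (O : OrbMajor a b) : IsMajor (ang p '' gapSet a b) (ang p a) (ang p b) := by
  refine ⟨isHole_ang.2 ⟨0, ?_⟩, ?_⟩
  · rw [liftSet_image gapSet_add_int]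
    simpa using O.major_hole
  · have e : ang p b - ang p a = ((b - a : ℝ) : UnitAddCircle) := by
      rw [ang, ang, ← AddCircle.coe_sub]; congr 1; ring
    have h1 := O.third_le
    have h2 := O.le_half
    rw [arcLen, e, AddCircle.coe_equivIco_mk_apply, div_one, mul_one,
      Int.fract_eq_self.2 ⟨by linarith, by linarith⟩]
    exact h1

theorem isRegularCriticalMajor_gapSet (C : CritMajor a b) (hp : 2 * p = i) :
    IsRegularCriticalMajor (ang p '' gapSet a b) (ang p a) (ang p b) := by
  refine ⟨isMajor_gapSet C.orbMajor, ?_, fun n hn => ?_⟩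
  · rw [sig_ang hp, sig_ang hp, ang_eq_iff]
    exact ⟨1, by rw [C.1]; push_cast; ring⟩
  · rw [iterate_sig_ang hp, ← ang_add_int p a 1]
    have hb := C.1
    refine (mem_cIoo_ang (by push_cast; linarith) (by push_cast; linarith)).2 ?_
    obtain ⟨m, hm | hm⟩ := OrbMajor.position a b (3 ^ n * a)
    · exact (C.2 n hn m ⟨hm.1.le, hm.2.le⟩).elim
    · refine ⟨m, lt_of_le_of_ne hm.1 fun e => ?_, ?_⟩
      · exact C.2 n hn m ⟨by linarith, e.ge⟩
      · push_cast
        refine lt_of_le_of_ne hm.2 fun e => ?_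
        exact C.2 n hn (m - 1) ⟨by push_cast; linarith, by push_cast; linarith⟩

theorem isPeriodicMajor_gapSet (P : PerMajor a b k) (O : OrbMajor a b) (hp : 2 * p = i) :
    IsPeriodicMajor (ang p '' gapSet a b) (ang p a) (ang p b) k := by
  have h1 := O.third_le
  refine ⟨isMajor_gapSet O, P.1, ?_, fun m m1 m2 he => ?_⟩
  · obtain ⟨j, hj⟩ := P.2.1
    obtain ⟨j', hj'⟩ := P.pow_right
    rw [Set.image_pair, iterate_sig_ang hp, iterate_sig_ang hp, hj, hj', ang_add_int, ang_add_int]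
  · have : sig^[m] (ang p a) ∈ ({ang p a, ang p b} : Set UnitAddCircle) := by
      rw [← he]; exact ⟨_, Or.inl rfl, rfl⟩
    rw [iterate_sig_ang hp] at this
    rcases this with e | e
    · obtain ⟨n, hn⟩ := ang_eq_iff.1 e
      exact P.off_left m1 m2 le_rfl (by linarith) n ⟨by linarith, by linarith⟩
    · obtain ⟨n, hn⟩ := ang_eq_iff.1 e
      exact P.off_left m1 m2 le_rfl (by linarith) n ⟨by linarith, by linarith⟩

theorem vassalBasis_ang (P : PerMajor a b k) (O : OrbMajor a b) (hp : 2 * p = i) :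
    vassalBasis (ang p a) (ang p b) k = ang p '' vasSet a b k := by
  have h1 := P.third_lt (by linarith [O.third_le])
  have h2 := O.le_half
  have e1 : ang p b - ((1 / 3 : ℝ) : UnitAddCircle) = ang p (b - 1 / 3) := by
    rw [ang, ang, ← AddCircle.coe_sub]; congr 1; ring
  have e2 : ang p a + ((1 / 3 : ℝ) : UnitAddCircle) = ang p (a + 1 / 3) := by
    rw [ang, ang, ← AddCircle.coe_add]; congr 1; ring
  have key : ∀ t, ang p t ∈ vassalBasis (ang p a) (ang p b) k ↔ t ∈ vasSet a b k := by
    intro t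
    simp only [vassalBasis, vasSet, offOrbit, Set.mem_ofPred_eq]
    refine forall_congr' fun j => ?_
    rw [PerMajor.branch_iff h1.le, ← Function.iterate_mul, iterate_sig_ang hp, Set.mem_union, e1, e2,
      mem_cIcc_ang (by linarith) (by linarith), mem_cIcc_ang (by linarith) (by linarith), pow_mul,
      ← exists_or]
  ext x
  obtain ⟨t, rfl⟩ := ang_surj p x
  rw [key]
  exact ⟨fun h => ⟨t, h, rfl⟩, fun h => by
    have : t ∈ liftSet p (ang p '' vasSet a b k) := h
    rwa [liftSet_image vasSet_add_int] at this⟩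

theorem Major.isCanonicalLamination {r : Setoid UnitAddCircle} (H : Major (angRel r p) a b)
    (hS : NoSiegel (angRel r p)) (hp : 2 * p = i)
    (hM : CritMajor a b ∨ ∃ k, PerMajor a b k) :
    IsCanonicalLamination (ang p '' gapSet a b) r := by
  rcases hM with C | ⟨k, P⟩
  · refine Or.inl ⟨_, _, isRegularCriticalMajor_gapSet C hp, fun x y => ?_⟩
    obtain ⟨s, rfl⟩ := ang_surj p x
    obtain ⟨t, rfl⟩ := ang_surj p y
    refine (H.rel_iff_of_crit C s t).trans ?_
    have hh : ∀ t ∉ gapSet a b, ∃ c d, RHole (gapSet a b) c d ∧ c < t ∧ t < d := fun t ht =>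
      C.orbMajor.exists_hole ht
    simp only [pullbackRel, ang_eq_iff, Set.mem_singleton_iff, exists_eq_left, forall_eq,
      iterate_sig_ang hp, isEdge_ang, liftSet_image (p := p) gapSet_add_int,
      disjoint_chord_hull gapSet_add_int hh]
  · have O := P.orbMajor H.edge.1 H.le_half
    refine Or.inr ⟨_, _, k, isPeriodicMajor_gapSet P O hp, fun x y => ?_⟩
    obtain ⟨s, rfl⟩ := ang_surj p x
    obtain ⟨t, rfl⟩ := ang_surj p y
    refine (H.rel_iff_of_per P hS s t).trans ?_
    have hh : ∀ t ∉ gapSet a b, ∃ c d, RHole (gapSet a b) c d ∧ c < t ∧ t < d := fun t ht =>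
      O.exists_hole ht
    have hh' : ∀ t ∉ vasSet a b k, ∃ c d, RHole (vasSet a b k) c d ∧ c < t ∧ t < d := fun t ht =>
      P.exists_vas_hole H.edge.1 H.le_half ht
    simp only [pullbackRel, ang_eq_iff, vassalBasis_ang P O hp, Set.mem_insert_iff,
      Set.mem_singleton_iff, exists_eq_or_imp, exists_eq_left, forall_eq_or_imp, forall_eq,
      iterate_sig_ang hp, isEdge_ang, liftSet_image (p := p) gapSet_add_int,
      liftSet_image (p := p) vasSet_add_int, disjoint_chord_hull gapSet_add_int hh,
      disjoint_chord_hull vasSet_add_int hh']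

end Final

theorem lemma4p15 (r : Setoid UnitAddCircle) (hr : IsCubicInvariantLamination r)
    (hrot : ¬ HasPeriodicRotationalGapOrLeaf r) :
    (∀ x y, r x y ↔ x = y) ∨
      ∃ A : Set UnitAddCircle, IsInvariantQuadraticGap A ∧ IsCanonicalLamination A r := by
  -- The base point p is the fixed point, 0 or 1/2, from which all leaf arcs are moved off
  -- themselves.
  obtain ⟨p, i, hp, hG⟩ : ∃ (p : ℝ) (i : ℤ), 2 * p = i ∧ GLam (angRel r p) := by
    have h0 : (2 : ℝ) * 0 = ((0 : ℤ) : ℝ) := by simp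
    rcases (hr.lam hrot h0).glam_or (hr.noSiegel hrot h0) with h | h
    · exact ⟨0, 0, h0, h⟩
    · refine ⟨1 / 2, 1, by norm_num, ?_⟩
      have e : angRel r (1 / 2) = fun s t => angRel r 0 (s + 1 / 2) (t + 1 / 2) := by
        funext s t
        simp only [angRel, ang, add_zero]
      rw [e]
      exact h
  by_cases hne : ∃ s t, angRel r p s t ∧ ∀ n : ℤ, t ≠ s + n
  · right
    obtain ⟨a, b, H, hM⟩ := hG.exists_major hne
    refine ⟨ang p '' gapSet a b, isInvariantQuadraticGap_gapSet ?_ hp,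
      H.isCanonicalLamination (hr.noSiegel hrot hp) hp hM⟩
    rcases hM with C | ⟨k, P⟩
    · exact C.imageHole
    · exact P.imageHole H.edge.1 H.le_half
  · left
    push Not at hne
    intro x y
    obtain ⟨s, rfl⟩ := ang_surj p x
    obtain ⟨t, rfl⟩ := ang_surj p y
    exact ⟨fun h => ang_eq_iff.2 (hne s t h), fun h => h ▸ r.refl' _⟩
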